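/- **Setting.** Let $\mathfrak g=\mathfrak{sl}(3,\mathbb R)$ with its contact grading $\mathfrak g=\bigoplus_{p=-2}^{2}\mathfrak g_p$ ($E_{ij}$ has degree $j-i$), $\mathfrak g_-=\mathfrak g_{-2}\oplus\mathfrak g_{-1}$, and let $V=\mathfrak{sl}(3,\mathbb R)$ be the adjoint representation, graded by $V_q=\mathfrak g_{q-2}$, with the filtration $\phi^qV=\bigoplus_{i\ge q}V_i$ and the Killing form $\kappa$. Put $L=O(V,\kappa)$, $\mathfrak l=\mathfrak{so}(V,\kappa)=\mathfrak{so}(5,3)=\mathfrak g\oplus\mathfrak g^\perp$ ($\mathfrak g$ embedded by $\mathrm{ad}$), $G=SL(3,\mathbb R)$ acting by $\mathrm{Ad}$, and let $G^{0}\subset G$ be the upper triangular subgroup with Lie algebra $\mathfrak g^0$. Write $e_0=E_{31}$, $e_1=E_{21}$, $e_2=E_{32}$, $\check e_0=E_{13}$, $\check e_1=E_{12}$, $\check e_2=E_{23}$, $H_1=E_{11}-E_{22}$, $H_2=E_{22}-E_{33}$. With $(A_1,\dots,A_8)=(E_{13},E_{12},E_{23},H_1,H_2,E_{32},E_{21},E_{31})$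 and its dual basis $(A_i^*)$ put $$R_{-1,1}=[e_1,[e_1,[e_1,A_1\otimes A_7^*-A_2\otimes A_8^*]]],\qquad S_{1,-1}=[e_2,[e_2,[e_2,A_1\otimes A_6^*-A_3\otimes A_8^*]]],$$ both in $\mathfrak g^\perp$, and $\xi^R_1=R_{-1,1}\otimes e_2^*$, $\xi^S_1=S_{1,-1}\otimes e_1^*$ in $\mathrm{Hom}(\mathfrak g_-,\mathfrak g^\perp)$. Let $(M,\mathfrak f)$ be a connected smooth $3$-manifold with a tangential filtration $\mathfrak f^{-1}=D\subset\mathfrak f^{-2}=TM$, and let $\varphi\colon(M,\mathfrak f)\to L/\phi^0L\subset\mathrm{Flag}(V,\phi)$ be an osculating map of type $\mathfrak{sl}_3$: $\varphi$ is smooth, differentiating sections of $\varphi^q$ along $\mathfrak f^{p}$ gives sections of $\varphi^{p+q}$, and at each point the symbol $(\mathrm{gr}\,\mathfrak f_x,\mathrm{gr}\,\varphi_x)$ is isomorphic, through an element of $L$, to $(\mathfrak g_-,V)$. Let $P\to M$ be its Cartan bundle: a principal $G^0$-bundle of frames $a\in L$ carrying the filtration $\phi$ to $\varphi(x)$, on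 which the Maurer–Cartan form $\omega=a^{-1}da=\omega_I+\omega_{II}$ (decomposed along $\mathfrak g\oplus\mathfrak g^\perp$) is such that $\omega_I$ is an isomorphism of each tangent space onto $\mathfrak g$ and $\omega_{II}=\chi\,\omega_I$, where the structure function $\chi\colon P\to\mathrm{Hom}(\mathfrak g_-,\mathfrak g^\perp)$ has only components of positive degree and satisfies $\partial^*\chi=\sum_i[\check e_i,\chi(e_i)]=0$. The embedding is flat if $\chi\equiv0$. The symmetry algebra consists of the $B\in\mathfrak l$ whose action by left translations is tangent to $P$; $\mathfrak H=\mathfrak H_z\subset\mathfrak l$ denotes the set of values of $\omega$ at $z\in P$ on it, that is, its image under $B\mapsto a^{-1}Ba$ if $z$ is the frame $a$. It is assumed to be transitive on $M$. **Proposition (contact Cayley surface).** Assume that $\varphi$ is not flat and that $\dim\mathfrak H\ge4$. 1. Up to the action of $G^{0}$ and the symmetry exchanging the roles of $(e_1,R)$ and $(e_2,S)$, we have $\chi=\xi_1^R$ and $\mathfrak H=\langle e_0,\ e_1,\ e_2+R_{-1,1},\ 5H_1+4H_2\rangle$. More precisely, either for every $z\in P$ there is $b\in G^{0}$ with $$\chi(zb)=\xi^R_1,\qquad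 \mathfrak H_{zb}=\langle e_0,\ e_1,\ e_2+R_{-1,1},\ 5H_1+4H_2\rangle,$$ or for every $z\in P$ there is $b\in G^{0}$ with $$\chi(zb)=\xi^S_1,\qquad \mathfrak H_{zb}=\langle e_0,\ e_2,\ e_1+S_{1,-1},\ 4H_1+5H_2\rangle .$$ 2. This object is unique: any two embeddings $\varphi\colon M\to L/\phi^0L$, $\varphi'\colon M'\to L/\phi^0L$ satisfying the assumptions are locally equivalent at any two points $x\in M$, $x'\in M'$, that is, there are an isomorphism $h$ of filtered manifolds from a neighbourhood of $x$ to a neighbourhood of $x'$ with $h(x)=x'$, and $a\in L$, such that $a\circ\varphi=\varphi'\circ h$. 3. It exists, with $\dim\mathfrak H=4$, and is given by the system of PDEs $$Z_1^2u=0,\qquad Z_2^2u=a\,Z_1u,\qquad Z_1=\partial_x+\tfrac12y\,\partial_z,\quad Z_2=\partial_y-\tfrac12x\,\partial_z,$$ for any constant $a\neq0$: there is such a $\varphi$ on $M=\mathbb R^3$ with $D=\langle Z_1,Z_2\rangle$ and a map $F\colon\mathbb R^3\to V$ spanning the lines $\varphi^4$ such that the smooth solutions $u$ on $\mathbb R^3$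 are exactly the functions $\lambda\circ F$, $\lambda\in V^*$, each for a unique $\lambda$. -/

import Mathlib

open scoped Manifold ContDiff Matrix

noncomputable section

namespace ContactSl3

/-! ### The Lie algebra `sl(3,ℝ)`, its adjoint representation, and `so(5,3)` -/

/-- Real `3 × 3` matrices. -/
abbrev M3 := Matrix (Fin 3) (Fin 3) ℝ

/-- Real `8 × 8` matrices, that is, endomorphisms of `V = sl(3,ℝ)` written in the basis `A`. -/
abbrev M8 := Matrix (Fin 8) (Fin 8) ℝ

/-- The matrix unit `E_{ij}` (indices start at `0`). -/
def E (i j : Fin 3) : M3 := Matrix.single i j 1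

/-- `H₁ = E₁₁ - E₂₂`. -/
def H1 : M3 := E 0 0 - E 1 1

/-- `H₂ = E₂₂ - E₃₃`. -/
def H2 : M3 := E 1 1 - E 2 2

/-- The basis `A₁, …, A₈` of `sl(3,ℝ)`:
`E₁₃, E₁₂, E₂₃, H₁, H₂, E₃₂, E₂₁, E₃₁`. -/
def A : Fin 8 → M3 := ![E 0 2, E 0 1, E 1 2, H1, H2, E 2 1, E 1 0, E 2 0]

/-- Coordinates of a traceless matrix in the basis `A`. -/
def coord (X : M3) : Fin 8 → ℝ :=
  ![X 0 2, X 0 1, X 1 2, X 0 0, -X 2 2, X 2 1, X 1 0, X 2 0]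

/-- `sl(3,ℝ)`. -/
def sl3 : Submodule ℝ M3 where
  carrier := {X | X.trace = 0}
  add_mem' := by
    intro X Y hX hY
    simp only [Set.mem_ofPred_eq] at *
    rw [Matrix.trace_add, hX, hY, add_zero]
  zero_mem' := by simp
  smul_mem' := by
    intro c X hX
    simp only [Set.mem_ofPred_eq] at *
    rw [Matrix.trace_smul, hX, smul_zero]

/-- `ad X` as an `8 × 8` matrix in the basis `A`. -/
def ad (X : M3) : M8 := Matrix.of fun i j => coord (X * A j - A j * X) i

/-- `Ad b : X ↦ b X b⁻¹` as an `8 × 8` matrix in the basis `A`. -/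
def Ad (b : M3) : M8 := Matrix.of fun i j => coord (b * A j * b⁻¹) i

/-- The Gram matrix of the Killing form of `sl(3,ℝ)` in the basis `A`. -/
def K : M8 := Matrix.of fun i j => (ad (A i) * ad (A j)).trace

/-- The group `L = O(V, κ)`. -/
def L : Set M8 := {a | aᵀ * K * a = K}

/-- The Lie algebra `𝔩 = 𝔬(V, κ) = so(5,3)` of `L`. -/
def lAlg : Submodule ℝ M8 where
  carrier := {B | Bᵀ * K + K * B = 0}
  add_mem' := by
    intro B C hB hC
    simp only [Set.mem_ofPred_eq] at *
    rw [Matrix.transpose_add, add_mul, mul_add, add_add_add_comm, hB, hC, add_zero]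
  zero_mem' := by simp
  smul_mem' := by
    intro c B hB
    simp only [Set.mem_ofPred_eq] at *
    rw [Matrix.transpose_smul, smul_mul_assoc, mul_smul_comm, ← smul_add, hB, smul_zero]

/-- The invariant complement `𝔤^⊥` of `𝔤 = ad sl(3,ℝ)` in `𝔩`: the orthogonal complement for the
trace form. -/
def gPerp : Submodule ℝ M8 where
  carrier := {B | B ∈ lAlg ∧ ∀ X ∈ sl3, (B * ad X).trace = 0}
  add_mem' := by
    rintro B C ⟨hB, hB'⟩ ⟨hC, hC'⟩
    refine ⟨lAlg.add_mem hB hC, fun X hX => ?_⟩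
    rw [add_mul, Matrix.trace_add, hB' X hX, hC' X hX, add_zero]
  zero_mem' := ⟨lAlg.zero_mem, by simp⟩
  smul_mem' := by
    rintro c B ⟨hB, hB'⟩
    refine ⟨lAlg.smul_mem c hB, fun X hX => ?_⟩
    rw [smul_mul_assoc, Matrix.trace_smul, hB' X hX, smul_zero]

/-! ### Gradings and filtrations -/

/-- The graded piece `𝔤_p` of the contact grading of `sl(3,ℝ)`. -/
def gr (p : ℤ) : Submodule ℝ M3 where
  carrier := {X | X ∈ sl3 ∧ ∀ i j : Fin 3, ((j : ℕ) : ℤ) - ((i : ℕ) : ℤ) ≠ p → X i j = 0}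
  add_mem' := by
    rintro X Y ⟨hX, hX'⟩ ⟨hY, hY'⟩
    refine ⟨sl3.add_mem hX hY, fun i j h => ?_⟩
    rw [Matrix.add_apply, hX' i j h, hY' i j h, add_zero]
  zero_mem' := ⟨sl3.zero_mem, fun _ _ _ => rfl⟩
  smul_mem' := by
    rintro c X ⟨hX, hX'⟩
    refine ⟨sl3.smul_mem c hX, fun i j h => ?_⟩
    rw [Matrix.smul_apply, hX' i j h, smul_zero]

/-- `𝔤_- = 𝔤_{-2} ⊕ 𝔤_{-1}`: the strictly lower triangular matrices. -/
def gMinus : Submodule ℝ M3 where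
  carrier := {X | ∀ i j : Fin 3, i ≤ j → X i j = 0}
  add_mem' := by
    intro X Y hX hY i j h
    rw [Matrix.add_apply, hX i j h, hY i j h, add_zero]
  zero_mem' := fun _ _ _ => rfl
  smul_mem' := by
    intro c X hX i j h
    rw [Matrix.smul_apply, hX i j h, smul_zero]

/-- `𝔤⁰ = φ⁰𝔤`: the upper triangular matrices of trace zero. -/
def gZero : Submodule ℝ M3 where
  carrier := {X | X ∈ sl3 ∧ ∀ i j : Fin 3, j < i → X i j = 0}
  add_mem' := by
    rintro X Y ⟨hX, hX'⟩ ⟨hY, hY'⟩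
    refine ⟨sl3.add_mem hX hY, fun i j h => ?_⟩
    rw [Matrix.add_apply, hX' i j h, hY' i j h, add_zero]
  zero_mem' := ⟨sl3.zero_mem, fun _ _ _ => rfl⟩
  smul_mem' := by
    rintro c X ⟨hX, hX'⟩
    refine ⟨sl3.smul_mem c hX, fun i j h => ?_⟩
    rw [Matrix.smul_apply, hX' i j h, smul_zero]

/-- `G⁰ = φ⁰G`: the upper triangular matrices in `G = SL(3,ℝ)`. -/
def GZero : Set M3 := {b | b.det = 1 ∧ ∀ i j : Fin 3, j < i → b i j = 0}

/-- The projection of `𝔤 = 𝔤_- ⊕ 𝔤⁰` to `𝔤_-`. -/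
def lowerPart : M3 →ₗ[ℝ] gMinus where
  toFun X := ⟨Matrix.of fun i j => if j < i then X i j else 0, by
    intro i j h
    simp [not_lt.mpr h]⟩
  map_add' := by
    intro X Y
    ext i j
    by_cases h : j < i <;> simp [h]
  map_smul' := by
    intro c X
    ext i j
    by_cases h : j < i <;> simp [h]

/-- The degrees of `A₁, …, A₈` in `V = V₀ ⊕ ⋯ ⊕ V₄`, where `V_q = 𝔤_{q-2}`. -/
def vdeg : Fin 8 → ℤ := ![4, 3, 3, 2, 2, 1, 1, 0]

/-- The standard filtration `φ^q V = ⊕_{i ≥ q} V_i`. -/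
def stdFlag (q : ℤ) : Submodule ℝ (Fin 8 → ℝ) where
  carrier := {v | ∀ i, vdeg i < q → v i = 0}
  add_mem' := by
    intro v w hv hw i h
    rw [Pi.add_apply, hv i h, hw i h, add_zero]
  zero_mem' := fun _ _ => rfl
  smul_mem' := by
    intro c v hv i h
    rw [Pi.smul_apply, hv i h, smul_zero]

/-- The induced filtration of `gl(V)`: `B ∈ φ^p gl(V)` if and only if `B (φ^q V) ⊆ φ^{p+q} V` for
all `q`. -/
def glFil (p : ℤ) : Submodule ℝ M8 where
  carrier := {B | ∀ i j, vdeg i - vdeg j < p → B i j = 0}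
  add_mem' := by
    intro B C hB hC i j h
    rw [Matrix.add_apply, hB i j h, hC i j h, add_zero]
  zero_mem' := fun _ _ _ => rfl
  smul_mem' := by
    intro c B hB i j h
    rw [Matrix.smul_apply, hB i j h, smul_zero]

/-! ### The distinguished elements -/

/-- `e₀ = E₃₁`, `e₁ = E₂₁`, `e₂ = E₃₂`. -/
def e : Fin 3 → M3 := ![E 2 0, E 1 0, E 2 1]

/-- `ě₀ = E₁₃`, `ě₁ = E₁₂`, `ě₂ = E₂₃`; the basis of `𝔤_+` dual to `e` for the trace form. -/
def eCheck : Fin 3 → M3 := ![E 0 2, E 0 1, E 1 2]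

/-- `R_{2,1} = A₁ ⊗ A₇* - A₂ ⊗ A₈*`, a highest weight vector of `Γ_{3,0} ⊆ 𝔩`. -/
def R21 : M8 := Matrix.single 0 6 1 - Matrix.single 1 7 1

/-- `R_{-1,1} = [e₁, [e₁, [e₁, R_{2,1}]]]`. -/
def Rm11 : M8 := ⁅ad (e 1), ⁅ad (e 1), ⁅ad (e 1), R21⁆⁆⁆

/-- `S_{1,2} = A₁ ⊗ A₆* - A₃ ⊗ A₈*`, a highest weight vector of `Γ_{0,3} ⊆ 𝔩`. -/
def S12 : M8 := Matrix.single 0 5 1 - Matrix.single 2 7 1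

/-- `S_{1,-1} = [e₂, [e₂, [e₂, S_{1,2}]]]`. -/
def S1m1 : M8 := ⁅ad (e 2), ⁅ad (e 2), ⁅ad (e 2), S12⁆⁆⁆

/-- `ξ₁^R = R_{-1,1} ⊗ e₂*`. -/
def xiR : gMinus →ₗ[ℝ] M8 where
  toFun X := X.1 2 1 • Rm11
  map_add' := by intro X Y; simp [add_smul]
  map_smul' := by intro c X; simp [mul_smul]

/-- `ξ₁^S = S_{1,-1} ⊗ e₁*`. -/
def xiS : gMinus →ₗ[ℝ] M8 where
  toFun X := X.1 1 0 • S1m1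
  map_add' := by intro X Y; simp [add_smul]
  map_smul' := by intro c X; simp [mul_smul]

/-- `⟨e₀, e₁, e₂ + R_{-1,1}, 5H₁ + 4H₂⟩ ⊆ so(5,3)`. -/
def cayleyR : Submodule ℝ M8 :=
  Submodule.span ℝ {ad (e 0), ad (e 1), ad (e 2) + Rm11, ad ((5 : ℝ) • H1 + (4 : ℝ) • H2)}

/-- The mirror image `⟨e₀, e₂, e₁ + S_{1,-1}, 4H₁ + 5H₂⟩ ⊆ so(5,3)`. -/
def cayleyS : Submodule ℝ M8 :=
  Submodule.span ℝ {ad (e 0), ad (e 2), ad (e 1) + S1m1, ad ((4 : ℝ) • H1 + (5 : ℝ) • H2)}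

/-- The codifferential `∂* : Hom(𝔤_-, 𝔤^⊥) → 𝔤^⊥`, `∂*χ = ∑ᵢ [ěᵢ, χ(eᵢ)]`. -/
def codiff (χ : gMinus →ₗ[ℝ] M8) : M8 :=
  ∑ i : Fin 3, ⁅ad (eCheck i), χ (lowerPart (e i))⁆

/-- The normalization of a structure function `χ ∈ Hom(𝔤_-, 𝔤^⊥)`: it is a sum of components of
degree at least `1`, and `∂*χ = 0`. -/
def IsNormal (χ : gMinus →ₗ[ℝ] M8) : Prop :=
  (∀ p : ℤ, p < 0 → ∀ X ∈ gr p, χ (lowerPart X) ∈ glFil (p + 1)) ∧ codiff χ = 0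

/-! ### Osculating maps of `sl₃`-type -/

/-- Three-dimensional Euclidean space. -/
abbrev E3 := EuclideanSpace ℝ (Fin 3)

section Manifold

variable {M : Type*} [TopologicalSpace M] [ChartedSpace E3 M]

/-- Smoothness on `U` of a vector valued map. -/
def SmoothVec (v : M → Fin 8 → ℝ) (U : Set M) : Prop :=
  ∀ i, ContMDiffOn (𝓡 3) 𝓘(ℝ, ℝ) ∞ (fun y => v y i) U

/-- Smoothness on `U` of a matrix valued map. -/
def SmoothMat (s : M → M8) (U : Set M) : Prop :=
  ∀ i j, ContMDiffOn (𝓡 3) 𝓘(ℝ, ℝ) ∞ (fun y => s y i j) U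

/-- The derivative at `x` of a vector valued map in the direction of the tangent vector `X`. -/
def dVec (v : M → Fin 8 → ℝ) (x : M) (X : TangentSpace (𝓡 3) x) : Fin 8 → ℝ :=
  fun i => (mfderiv (𝓡 3) 𝓘(ℝ, ℝ) (fun y => v y i) x X : ℝ)

/-- The derivative at `x` of a matrix valued map in the direction of the tangent vector `X`. -/
def dMat (s : M → M8) (x : M) (X : TangentSpace (𝓡 3) x) : M8 :=
  Matrix.of fun i j => (mfderiv (𝓡 3) 𝓘(ℝ, ℝ) (fun y => s y i j) x X : ℝ)

/-- The matrix `a` carries the standard filtration of `V` to the filtration `F`. -/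
def IsFrameOf (a : M8) (F : ℤ → Submodule ℝ (Fin 8 → ℝ)) : Prop :=
  a ∈ L ∧ ∀ q, F q = (stdFlag q).map a.mulVecLin

/-- `v` is a smooth section, over the open set `U`, of the subbundle `φ^q` of `M × V`. -/
def IsSection (φ : M → ℤ → Submodule ℝ (Fin 8 → ℝ)) (U : Set M) (q : ℤ)
    (v : M → Fin 8 → ℝ) : Prop :=
  IsOpen U ∧ SmoothVec v U ∧ ∀ x ∈ U, v x ∈ φ x q

/-- `φ : (M, 𝔣) → L/φ⁰L ⊆ Flag(V, φ)` is an osculating map of type `sl₃`. A point of the flag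
variety is a filtration of `V`; the tangential filtration is `𝔣⁰ = 0`, `𝔣⁻¹ = D`, `𝔣⁻² = TM`. -/
structure IsOsculatingMap (D : ∀ x : M, Submodule ℝ (TangentSpace (𝓡 3) x))
    (φ : M → ℤ → Submodule ℝ (Fin 8 → ℝ)) : Prop where
  /-- `φ` is a smooth map to `L/φ⁰L`: locally it lifts to a smooth map to `L`. -/
  smooth : ∀ x₀ : M, ∃ (U : Set M) (F : M → M8), IsOpen U ∧ x₀ ∈ U ∧ SmoothMat F U ∧
    ∀ x ∈ U, IsFrameOf (F x) (φ x)
  /-- `𝔣^p φ^q ⊆ φ^{p+q}`. -/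
  osculating : ∀ (U : Set M) (q : ℤ) (v : M → Fin 8 → ℝ), IsSection φ U q v → ∀ x ∈ U,
    (∀ X ∈ D x, dVec v x X ∈ φ x (q - 1)) ∧ (∀ X, dVec v x X ∈ φ x (q - 2))
  /-- The symbol `(gr 𝔣_x, gr φ_x)` is isomorphic to `(𝔤_-, V)`: there are an element `a` of `L`
  (giving the isomorphism `gr V → gr φ_x`) and isomorphisms `σ₁ : 𝔣⁻¹_x → 𝔤_{-1}` and
  `σ₂ : T_xM / 𝔣⁻¹_x → 𝔤_{-2}` that intertwine the actions. (As `𝔤_-` acts faithfully on `V`,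
  they form an isomorphism of Lie algebras.) -/
  symbol : ∀ x : M, ∃ a : M8, IsFrameOf a (φ x) ∧
    ∃ (σ₁ : D x →ₗ[ℝ] gr (-1)) (σ₂ : TangentSpace (𝓡 3) x →ₗ[ℝ] gr (-2)),
      Function.Bijective σ₁ ∧ Function.Surjective σ₂ ∧ LinearMap.ker σ₂ = D x ∧
      ∀ (U : Set M) (q : ℤ) (v : M → Fin 8 → ℝ), x ∈ U → IsSection φ U q v →
        (∀ X : D x, dVec v x X.1 - (a * ad (σ₁ X).1 * a⁻¹) *ᵥ v x ∈ φ x q) ∧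
        (∀ X, dVec v x X - (a * ad (σ₂ X).1 * a⁻¹) *ᵥ v x ∈ φ x (q - 1))

/-! ### The Cartan bundle and its structure function -/

/-- `s` is a smooth section over the open set `U` of the set `P ⊆ M × L` of frames. -/
def IsLocalFrame (P : Set (M × M8)) (U : Set M) (s : M → M8) : Prop :=
  IsOpen U ∧ SmoothMat s U ∧ ∀ x ∈ U, (x, s x) ∈ P

/-- The image `ω(T_zP) ⊆ 𝔩` of the tangent space of `P` at `z = (x, a)`, where `ω = a⁻¹ da` is the
pull-back of the Maurer–Cartan form of `L` along `P → L`. It is spanned by the images of the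
tangent vectors to local sections of `P` through `z`, and by `𝔤⁰`, the image of the vertical
vectors. -/
def omegaImage (P : Set (M × M8)) (x : M) (a : M8) : Submodule ℝ M8 :=
  Submodule.span ℝ
    ({w | ∃ (U : Set M) (s : M → M8) (X : TangentSpace (𝓡 3) x),
        IsLocalFrame P U s ∧ x ∈ U ∧ s x = a ∧ w = a⁻¹ * dMat s x X} ∪ ad '' gZero)

/-- `χ ∈ Hom(𝔤_-, 𝔤^⊥)` is the value of the structure function at `z = (x, a)`: writing
`ω = ω_I + ω_II` for the decomposition `𝔩 = 𝔤 ⊕ 𝔤^⊥`, the map `ω_I : T_zP → 𝔤` is onto (hence an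
isomorphism, both spaces being of dimension 8) and `ω_II = χ ω_I`. -/
def IsStructureFunctionAt (P : Set (M × M8)) (x : M) (a : M8) (χ : gMinus →ₗ[ℝ] M8) : Prop :=
  (∀ X, χ X ∈ gPerp) ∧
    ∀ w, w ∈ omegaImage P x a ↔ ∃ Y ∈ sl3, w = ad Y + χ (lowerPart Y)

/-- `P` is the extrinsic Cartan bundle of `φ`: a principal `G⁰`-bundle of frames in `L` adapted to
`φ`, such that `ω_I` is an isomorphism on each tangent space and the structure function `χ` is
normal. The form `ω` is the restriction of the Maurer–Cartan form of `L`, so it satisfies the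
structure equation and is equivariant. -/
structure IsCartanBundle (φ : M → ℤ → Submodule ℝ (Fin 8 → ℝ)) (P : Set (M × M8)) : Prop where
  frame : ∀ x a, (x, a) ∈ P → IsFrameOf a (φ x)
  nonempty_fibre : ∀ x, ∃ a, (x, a) ∈ P
  torsor : ∀ x a, (x, a) ∈ P → ∀ a', (x, a') ∈ P ↔ ∃ b ∈ GZero, a' = a * Ad b
  local_section : ∀ x a, (x, a) ∈ P → ∃ U s, IsLocalFrame P U s ∧ x ∈ U ∧ s x = a
  normal : ∀ x a, (x, a) ∈ P → ∃ χ, IsStructureFunctionAt P x a χ ∧ IsNormal χ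

/-- The embedding is flat if its structure function vanishes identically. -/
def IsFlat (P : Set (M × M8)) : Prop :=
  ∀ x a, (x, a) ∈ P → IsStructureFunctionAt P x a 0

/-- The symmetry algebra as a subspace of `𝔩`: an element `B` of `𝔩` is an infinitesimal symmetry
if the vector field generated on `L` by left translations with `exp(tB)` is tangent to `P`. -/
def symAlg (P : Set (M × M8)) : Submodule ℝ M8 where
  carrier := {B | B ∈ lAlg ∧ ∀ x a, (x, a) ∈ P → a⁻¹ * B * a ∈ omegaImage P x a}
  add_mem' := by
    rintro B C ⟨hB, hB'⟩ ⟨hC, hC'⟩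
    refine ⟨lAlg.add_mem hB hC, fun x a h => ?_⟩
    rw [mul_add, add_mul]
    exact Submodule.add_mem _ (hB' x a h) (hC' x a h)
  zero_mem' := ⟨lAlg.zero_mem, fun x a _ => by simp⟩
  smul_mem' := by
    rintro c B ⟨hB, hB'⟩
    refine ⟨lAlg.smul_mem c hB, fun x a h => ?_⟩
    rw [mul_smul_comm, smul_mul_assoc]
    exact Submodule.smul_mem _ c (hB' x a h)

/-- The map `B ↦ a⁻¹ B a`. -/
def conjInv (a : M8) : M8 →ₗ[ℝ] M8 where
  toFun B := a⁻¹ * B * a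
  map_add' := by intro B C; rw [mul_add, add_mul]
  map_smul' := by intro c B; rw [mul_smul_comm, smul_mul_assoc, RingHom.id_apply]

/-- The symmetry algebra `ℌ ⊆ 𝔩` read in the frame `a`: the values of `ω` at `z = (x, a)` on the
infinitesimal symmetries. (Equivalently, the frame `a` is moved to the identity of `L`.) -/
def symAlgAt (P : Set (M × M8)) (a : M8) : Submodule ℝ M8 := (symAlg P).map (conjInv a)

/-- The symmetry algebra is (locally) transitive on `M`: together with the vertical vectors it
spans each tangent space of `P`. -/
def IsTransitive (P : Set (M × M8)) : Prop :=
  ∀ x a, (x, a) ∈ P → ∀ w ∈ omegaImage P x a, ∃ B ∈ symAlgAt P a, ∃ Y ∈ gZero, w = B + ad Y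

/-- `φ` is a transitive osculating embedding of type `sl₃` with Cartan bundle `P`, it is not flat,
and its symmetry algebra has dimension at least `4`. -/
structure IsSubmaximal (D : ∀ x : M, Submodule ℝ (TangentSpace (𝓡 3) x))
    (φ : M → ℤ → Submodule ℝ (Fin 8 → ℝ)) (P : Set (M × M8)) : Prop where
  osculating : IsOsculatingMap D φ
  cartan : IsCartanBundle φ P
  transitive : IsTransitive P
  not_flat : ¬ IsFlat P
  four_le : 4 ≤ Module.finrank ℝ (symAlg P)

end Manifold

/-- Local equivalence of `φ` at `x` with `φ'` at `x'`: a local isomorphism `h` of filtered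
manifolds and an element `a` of `L` with `h x = x'` and `a ∘ φ = φ' ∘ h`. -/
def LocallyEquivalent {M M' : Type*} [TopologicalSpace M] [ChartedSpace E3 M]
    [TopologicalSpace M'] [ChartedSpace E3 M']
    (D : ∀ x : M, Submodule ℝ (TangentSpace (𝓡 3) x))
    (φ : M → ℤ → Submodule ℝ (Fin 8 → ℝ)) (x : M)
    (D' : ∀ x : M', Submodule ℝ (TangentSpace (𝓡 3) x))
    (φ' : M' → ℤ → Submodule ℝ (Fin 8 → ℝ)) (x' : M') : Prop :=
  ∃ h : OpenPartialHomeomorph M M', x ∈ h.source ∧ h x = x' ∧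
    ContMDiffOn (𝓡 3) (𝓡 3) ∞ h h.source ∧ ContMDiffOn (𝓡 3) (𝓡 3) ∞ h.symm h.target ∧
    (∀ y ∈ h.source, (D y).map (mfderiv (𝓡 3) (𝓡 3) h y).toLinearMap = D' (h y)) ∧
    ∃ a ∈ L, ∀ y ∈ h.source, ∀ q, φ' (h y) q = (φ y q).map a.mulVecLin

/-! ### The system of differential equations -/

/-- `Z₁ = ∂/∂x + (y/2) ∂/∂z`. -/
def Z1 (p : E3) : E3 := !₂[1, 0, p 1 / 2]

/-- `Z₂ = ∂/∂y - (x/2) ∂/∂z`. -/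
def Z2 (p : E3) : E3 := !₂[0, 1, -(p 0 / 2)]

/-- The derivative of the function `u` along the vector field `Z`. -/
def along (Z : E3 → E3) (u : E3 → ℝ) : E3 → ℝ := fun p => fderiv ℝ u p (Z p)

/-- `u` is a smooth solution on `ℝ³` of `Z₁²u = 0`, `Z₂²u = a Z₁u`. -/
def IsSolution (a : ℝ) (u : E3 → ℝ) : Prop :=
  ContDiff ℝ ∞ u ∧ along Z1 (along Z1 u) = 0 ∧ along Z2 (along Z2 u) = a • along Z1 u

/-- The osculating map `φ` on `ℝ³` corresponds to the system `Z₁²u = 0`, `Z₂²u = a Z₁u`: the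
distribution is spanned by `Z₁, Z₂`, and the line `φ⁴` is spanned by a vector function `F` such
that the solutions are exactly the functions `λ ∘ F`, each for a unique linear form `λ` on `V`. -/
def CorrespondsToSystem (a : ℝ) (D : ∀ p : E3, Submodule ℝ (TangentSpace (𝓡 3) p))
    (φ : E3 → ℤ → Submodule ℝ (Fin 8 → ℝ)) : Prop :=
  (∀ p : E3, D p = Submodule.span ℝ ({Z1 p, Z2 p} : Set E3)) ∧
  ∃ F : E3 → Fin 8 → ℝ, (∀ p, φ p 4 = Submodule.span ℝ {F p}) ∧
    (∀ u, IsSolution a u ↔ ∃ c : Fin 8 → ℝ, u = fun p => c ⬝ᵥ F p) ∧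
    (∀ c c' : Fin 8 → ℝ, (∀ p, c ⬝ᵥ F p = c' ⬝ᵥ F p) → c = c')

end ContactSl3

end

open scoped Manifold ContDiff Matrix

noncomputable section

namespace ContactSl3

/-! ### Coordinates on `sl(3,ℝ)` -/

/-! Transitivity turns the geometry into algebra at a single frame. Let H be the symmetry algebra
read in a frame z. It is a Lie subalgebra of 𝔩, it lies in the graph of χ(z), and it projects onto
𝔤/𝔤⁰; `AlgData` records this together with the normalization of χ. Bracketing lifts of e₀, e₁, e₂
inside H shows that the lowest homogeneous part of χ is a cocycle of 𝔤₋ with values in 𝔤^⊥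
(`AlgData.closed`), and ∂*χ = 0 makes it harmonic. Explicit linear algebra in degrees 1 to 5 leaves
only the lines of ξ₁^R and ξ₁^S, both of degree 1, so χ vanishes as soon as its coefficients along
these two lines do (`AlgData.exists_leading`).

Since dim M = 3, the bound dim H ≥ 4 produces a nonzero element of 𝔤⁰ in H, and χ is invariant under
it. If the coefficient of ξ₁^R is nonzero, comparing weights forces the diagonal part of such an
element to be proportional to 5H₁ + 4H₂ and excludes nilpotent elements. Hence the isotropy is a
line, conjugate under G⁰ to that of 5H₁ + 4H₂. The weights of this element kill all of χ except a
multiple of R_{-1,1} on e₂, and a diagonal matrix normalizes the multiple (`AlgData.eq_span`,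
`exists_conj_cayleyR`). The outer automorphism X ↦ -J Xᵀ J is realized by `S8` in L, preserves the
filtration and exchanges R with S, which settles the other case.

Two global points remain for the normal form. Flat and non-flat frames cannot coexist: the symmetry
algebras in different frames are conjugate in L, but the nilpotency order of ad e₂ + R_{-1,1}
prevents a conjugate of the normal form from lying in ad 𝔤 (`not_flat_of_cayleyR`). And the type R
or S is constant on a connected M because each type is a closed condition (`typeR`). That the
infinitesimal symmetries form a Lie algebra at all is proved by differentiating the tangency
condition (`FrameField.bracket`).

For uniqueness, the normal form contains a Heisenberg algebra, whose one-parameter groups give a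
model frame. Suitable entries of the first column of a moving frame serve as coordinates; in them
the frame is the model times a deviation. The deviation solves a linear equation whose coefficients
preserve the filtration, so by Grönwall it preserves the filtration as well, and the flags are those
of the model (`FrameField.exists_normal_coordinates`). Embeddings of type S reduce to the same model
through `S8`. The distribution is recovered from the flags by `IsOsculatingMap.mem_D_iff`.

For existence, the model frame times Ad G⁰ is a Cartan bundle with the required symmetries. Eight
derivatives of a solution of the system close up under Z₁, Z₂ and their bracket, with exactly the
matrices of the Heisenberg algebra. Paired with the inverse frame they become constant, and this
writes every solution as a linear form on the curve that spans φ⁴. -/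

/-- The traceless matrix with prescribed coordinates in the basis `A`. -/
def toM (v : Fin 8 → ℝ) : M3 :=
  !![v 3, v 1, v 0; v 6, v 4 - v 3, v 2; v 7, v 5, -v 4]

lemma toM_mem (v : Fin 8 → ℝ) : toM v ∈ sl3 := by
  change (toM v).trace = 0
  simp [toM, Matrix.trace, Fin.sum_univ_succ]
  ring

lemma coord_toM (v : Fin 8 → ℝ) : coord (toM v) = v := by
  ext i; fin_cases i <;> simp [coord, toM]

lemma mem_sl3_iff {X : M3} : X ∈ sl3 ↔ X 0 0 + X 1 1 + X 2 2 = 0 := by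
  change X.trace = 0 ↔ _
  simp [Matrix.trace, Fin.sum_univ_succ, add_assoc]

lemma toM_coord {X : M3} (hX : X ∈ sl3) : toM (coord X) = X := by
  rw [mem_sl3_iff] at hX
  ext i j; fin_cases i <;> fin_cases j <;> simp [coord, toM]
  linarith

lemma coord_add (X Y : M3) : coord (X + Y) = coord X + coord Y := by
  ext i; fin_cases i <;> simp [coord]; ring

lemma coord_smul (c : ℝ) (X : M3) : coord (c • X) = c • coord X := by
  ext i; fin_cases i <;> simp [coord]

lemma toM_add (v w : Fin 8 → ℝ) : toM (v + w) = toM v + toM w := by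
  ext i j; fin_cases i <;> fin_cases j <;> simp [toM] <;> ring

lemma toM_smul (c : ℝ) (v : Fin 8 → ℝ) : toM (c • v) = c • toM v := by
  ext i j; fin_cases i <;> fin_cases j <;> simp [toM] <;> ring

/-- `coord` as a linear map. -/
def coordₗ : M3 →ₗ[ℝ] (Fin 8 → ℝ) where
  toFun := coord
  map_add' := coord_add
  map_smul' := coord_smul

lemma A_eq_toM (j : Fin 8) : A j = toM (Pi.single j 1) := by
  fin_cases j <;> ext a b <;> fin_cases a <;> fin_cases b <;> simp [A, toM, E, H1, H2]

lemma toM_eq_sum (v : Fin 8 → ℝ) : toM v = ∑ j, v j • A j := by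
  ext a b; fin_cases a <;> fin_cases b <;>
    simp [A, toM, E, H1, H2, Fin.sum_univ_eight] <;> ring

lemma bracket_mem_sl3 (X Y : M3) : X * Y - Y * X ∈ sl3 := by
  change (X * Y - Y * X).trace = 0
  rw [Matrix.trace_sub, Matrix.trace_mul_comm, sub_self]

lemma ad_mulVec (X : M3) (v : Fin 8 → ℝ) :
    ad X *ᵥ v = coord (X * toM v - toM v * X) := by
  have h : X * toM v - toM v * X = ∑ j, v j • (X * A j - A j * X) := by
    rw [toM_eq_sum, Finset.mul_sum, Finset.sum_mul, ← Finset.sum_sub_distrib]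
    exact Finset.sum_congr rfl fun j _ => by rw [mul_smul_comm, smul_mul_assoc, smul_sub]
  rw [h]
  change _ = coordₗ _
  rw [map_sum]
  ext i
  simp only [Matrix.mulVec, dotProduct, ad, Matrix.of_apply, Finset.sum_apply, map_smul,
    Pi.smul_apply, smul_eq_mul, coordₗ, LinearMap.coe_mk, AddHom.coe_mk]
  exact Finset.sum_congr rfl fun j _ => mul_comm _ _

lemma Ad_mulVec (b : M3) (v : Fin 8 → ℝ) : Ad b *ᵥ v = coord (b * toM v * b⁻¹) := by
  have h : b * toM v * b⁻¹ = ∑ j, v j • (b * A j * b⁻¹) := by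
    rw [toM_eq_sum, Finset.mul_sum, Finset.sum_mul]
    exact Finset.sum_congr rfl fun j _ => by rw [mul_smul_comm, smul_mul_assoc]
  rw [h]
  change _ = coordₗ _
  rw [map_sum]
  ext i
  simp only [Matrix.mulVec, dotProduct, Ad, Matrix.of_apply, Finset.sum_apply, map_smul,
    Pi.smul_apply, smul_eq_mul, coordₗ, LinearMap.coe_mk, AddHom.coe_mk]
  exact Finset.sum_congr rfl fun j _ => mul_comm _ _

/-- Serves as the standard reduction: an identity of 8 × 8 matrices is tested on a general vector,
where it becomes a computation with 3 × 3 matrices or with eight polynomials. -/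
lemma ext_mulVec {B C : M8} (h : ∀ v, B *ᵥ v = C *ᵥ v) : B = C :=
  Matrix.toLin'.injective (LinearMap.ext fun v => by simpa using h v)

lemma toM_ad_mulVec (X : M3) (v : Fin 8 → ℝ) :
    toM (ad X *ᵥ v) = X * toM v - toM v * X := by
  rw [ad_mulVec, toM_coord (bracket_mem_sl3 _ _)]

lemma conj_mem_sl3 {b : M3} (hb : IsUnit b.det) {X : M3} (hX : X ∈ sl3) :
    b * X * b⁻¹ ∈ sl3 := by
  change (b * X * b⁻¹).trace = 0
  rw [Matrix.trace_mul_comm, ← mul_assoc, Matrix.nonsing_inv_mul _ hb, one_mul]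
  exact hX

lemma toM_Ad_mulVec {b : M3} (hb : IsUnit b.det) (v : Fin 8 → ℝ) :
    toM (Ad b *ᵥ v) = b * toM v * b⁻¹ := by
  rw [Ad_mulVec, toM_coord (conj_mem_sl3 hb (toM_mem v))]

lemma toM_injective : Function.Injective toM := fun v w h => by
  rw [← coord_toM v, h, coord_toM]

/-! ### The adjoint representation -/

/-- The matrix of `ad (toM v)`, written out. -/
def adMat (v : Fin 8 → ℝ) : M8 :=
  !![v 3 + v 4, -v 2, v 1, -v 0, -v 0, 0, 0, 0;
    -v 5, 2 * v 3 - v 4, 0, -2 * v 1, v 1, v 0, 0, 0;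
    v 6, 0, -v 3 + 2 * v 4, v 2, -2 * v 2, 0, -v 0, 0;
    -v 7, -v 6, 0, 0, 0, 0, v 1, v 0;
    -v 7, 0, -v 5, 0, 0, v 2, 0, v 0;
    0, v 7, 0, -v 5, 2 * v 5, v 3 - 2 * v 4, 0, -v 1;
    0, 0, -v 7, 2 * v 6, -v 6, 0, -2 * v 3 + v 4, v 2;
    0, 0, 0, v 7, v 7, -v 6, v 5, -v 3 - v 4]

lemma mulVec_eight (B : M8) (v : Fin 8 → ℝ) (i : Fin 8) :
    (B *ᵥ v) i = B i 0 * v 0 + B i 1 * v 1 + B i 2 * v 2 + B i 3 * v 3 + B i 4 * v 4 + B i 5 * v 5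
      + B i 6 * v 6 + B i 7 * v 7 := by
  simp [Matrix.mulVec, dotProduct, Fin.sum_univ_eight]

lemma ad_toM (v : Fin 8 → ℝ) : ad (toM v) = adMat v := by
  refine ext_mulVec fun w => ?_
  rw [ad_mulVec]
  ext i
  rw [mulVec_eight]
  fin_cases i <;> simp [coord, toM, adMat] <;> ring

lemma ad_eq_adMat {X : M3} (hX : X ∈ sl3) : ad X = adMat (coord X) := by
  rw [← ad_toM, toM_coord hX]

lemma ad_add (X Y : M3) : ad (X + Y) = ad X + ad Y := by
  refine ext_mulVec fun w => ?_
  rw [Matrix.add_mulVec, ad_mulVec, ad_mulVec, ad_mulVec, ← coord_add]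
  congr 1; noncomm_ring

lemma ad_smul (c : ℝ) (X : M3) : ad (c • X) = c • ad X := by
  refine ext_mulVec fun w => ?_
  rw [Matrix.smul_mulVec, ad_mulVec, ad_mulVec, ← coord_smul, smul_sub, smul_mul_assoc,
    mul_smul_comm]

/-- The adjoint representation as a linear map. -/
def adₗ : M3 →ₗ[ℝ] M8 where
  toFun := ad
  map_add' := ad_add
  map_smul' := ad_smul

lemma ad_sub (X Y : M3) : ad (X - Y) = ad X - ad Y := adₗ.map_sub X Y
lemma ad_neg (X : M3) : ad (-X) = -ad X := adₗ.map_neg X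
@[simp] lemma ad_zero : ad 0 = 0 := adₗ.map_zero

lemma ad_bracket (X Y : M3) : ad (X * Y - Y * X) = ad X * ad Y - ad Y * ad X := by
  refine ext_mulVec fun w => toM_injective ?_
  rw [toM_ad_mulVec, Matrix.sub_mulVec, ← Matrix.mulVec_mulVec, ← Matrix.mulVec_mulVec,
    sub_eq_add_neg (ad X *ᵥ _), toM_add, ← neg_one_smul ℝ (ad Y *ᵥ _), toM_smul]
  simp only [toM_ad_mulVec]
  simp only [neg_smul, one_smul]
  noncomm_ring

/-- The factor is 2n for 𝔰𝔩(n), with n = 3. Invariance of the Killing form can therefore be tested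
with traces of 3 × 3 matrices. -/
lemma trace_adMat_mul (v w : Fin 8 → ℝ) :
    (adMat v * adMat w).trace = 6 * (toM v * toM w).trace := by
  simp only [Matrix.trace, Matrix.diag, Matrix.mul_apply, Fin.sum_univ_eight, Fin.sum_univ_three]
  simp [adMat, toM]
  ring

lemma trace_ad_mul_ad {X Y : M3} (hX : X ∈ sl3) (hY : Y ∈ sl3) :
    (ad X * ad Y).trace = 6 * (X * Y).trace := by
  rw [ad_eq_adMat hX, ad_eq_adMat hY, trace_adMat_mul, toM_coord hX, toM_coord hY]

lemma dotProduct_K (v w : Fin 8 → ℝ) : v ⬝ᵥ (K *ᵥ w) = 6 * (toM v * toM w).trace := by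
  have hK : ∀ i j, K i j = 6 * (A i * A j).trace := fun i j => by
    rw [K, Matrix.of_apply, trace_ad_mul_ad] <;> rw [A_eq_toM] <;> exact toM_mem _
  simp only [dotProduct, Matrix.mulVec, hK]
  rw [toM_eq_sum v, toM_eq_sum w, Finset.sum_mul]
  simp only [Finset.mul_sum, Matrix.trace_sum, smul_mul_assoc, mul_smul_comm, Matrix.trace_smul,
    smul_eq_mul]
  refine Finset.sum_congr rfl fun i _ => Finset.sum_congr rfl fun j _ => by ring

/-- The Killing form, written out. -/
lemma K_eq : K = !![0, 0, 0, 0, 0, 0, 0, 6; 0, 0, 0, 0, 0, 0, 6, 0; 0, 0, 0, 0, 0, 6, 0, 0;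
    0, 0, 0, 12, -6, 0, 0, 0; 0, 0, 0, -6, 12, 0, 0, 0; 0, 0, 6, 0, 0, 0, 0, 0;
    0, 6, 0, 0, 0, 0, 0, 0; 6, 0, 0, 0, 0, 0, 0, 0] := by
  refine ext_mulVec fun w => ?_
  ext i
  have h := dotProduct_K (Pi.single i 1) w
  rw [single_one_dotProduct] at h
  rw [h, mulVec_eight]
  fin_cases i <;> simp [toM, Matrix.trace, Fin.sum_univ_three] <;> ring

lemma ext_dotProduct {B C : M8} (h : ∀ v w, v ⬝ᵥ (B *ᵥ w) = v ⬝ᵥ (C *ᵥ w)) : B = C :=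
  ext_mulVec fun w => by
    ext i; simpa using h (Pi.single i 1) w

lemma mem_L_iff {a : M8} : a ∈ L ↔ ∀ v w, (toM (a *ᵥ v) * toM (a *ᵥ w)).trace =
    (toM v * toM w).trace := by
  have key : ∀ v w, v ⬝ᵥ ((aᵀ * K * a) *ᵥ w) = 6 * (toM (a *ᵥ v) * toM (a *ᵥ w)).trace := by
    intro v w
    rw [← dotProduct_K, mul_assoc, ← Matrix.mulVec_mulVec, ← Matrix.mulVec_mulVec,
      Matrix.dotProduct_mulVec, Matrix.vecMul_transpose]
  constructor
  · intro h v w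
    have h1 := key v w
    rw [show aᵀ * K * a = K from h, dotProduct_K] at h1
    linarith
  · intro h
    refine ext_dotProduct fun v w => ?_
    rw [key, h, dotProduct_K]

lemma mem_lAlg_iff {B : M8} : B ∈ lAlg ↔ ∀ v w, (toM (B *ᵥ v) * toM w).trace +
    (toM v * toM (B *ᵥ w)).trace = 0 := by
  have key : ∀ v w, v ⬝ᵥ ((Bᵀ * K + K * B) *ᵥ w) =
      6 * ((toM (B *ᵥ v) * toM w).trace + (toM v * toM (B *ᵥ w)).trace) := by
    intro v w
    rw [mul_add, ← dotProduct_K, ← dotProduct_K, Matrix.add_mulVec, dotProduct_add,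
      ← Matrix.mulVec_mulVec, ← Matrix.mulVec_mulVec, Matrix.dotProduct_mulVec v,
      Matrix.vecMul_transpose]
  constructor
  · intro h v w
    have h1 := key v w
    rw [show Bᵀ * K + K * B = 0 from h] at h1
    simp only [Matrix.zero_mulVec, dotProduct_zero] at h1
    linarith
  · intro h
    change Bᵀ * K + K * B = 0
    refine ext_dotProduct fun v w => ?_
    rw [key, h]; simp

lemma ad_mem_lAlg (X : M3) : ad X ∈ lAlg := by
  rw [mem_lAlg_iff]
  intro v w
  have h : (X * toM v - toM v * X) * toM w + toM v * (X * toM w - toM w * X) =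
      X * (toM v * toM w) - toM v * toM w * X := by noncomm_ring
  rw [toM_ad_mulVec, toM_ad_mulVec, ← Matrix.trace_add, h, Matrix.trace_sub,
    Matrix.trace_mul_comm, sub_self]

lemma lAlg_bracket {B C : M8} (hB : B ∈ lAlg) (hC : C ∈ lAlg) : B * C - C * B ∈ lAlg := by
  have hB' : Bᵀ * K = -(K * B) := eq_neg_of_add_eq_zero_left hB
  have hC' : Cᵀ * K = -(K * C) := eq_neg_of_add_eq_zero_left hC
  change (B * C - C * B)ᵀ * K + K * (B * C - C * B) = 0
  rw [Matrix.transpose_sub, Matrix.transpose_mul, Matrix.transpose_mul, sub_mul, mul_assoc,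
    mul_assoc, hB', hC', mul_neg, mul_neg, ← mul_assoc, ← mul_assoc, hB', hC']
  noncomm_ring

/-! ### The group `L` -/

lemma K_mul_inv : K * ((1 / 36 : ℝ) • !![0, 0, 0, 0, 0, 0, 0, 6; 0, 0, 0, 0, 0, 0, 6, 0;
    0, 0, 0, 0, 0, 6, 0, 0; 0, 0, 0, 4, 2, 0, 0, 0; 0, 0, 0, 2, 4, 0, 0, 0;
    0, 0, 6, 0, 0, 0, 0, 0; 0, 6, 0, 0, 0, 0, 0, 0; 6, 0, 0, 0, 0, 0, 0, 0]) = 1 := by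
  refine ext_mulVec fun w => ?_
  rw [← Matrix.mulVec_mulVec, Matrix.smul_mulVec, Matrix.mulVec_smul, Matrix.one_mulVec, K_eq]
  ext i
  rw [Pi.smul_apply, mulVec_eight]
  simp only [mulVec_eight]
  fin_cases i <;> simp <;> ring

lemma isUnit_K_det : IsUnit K.det := by
  have h := congrArg Matrix.det K_mul_inv
  rw [Matrix.det_mul, Matrix.det_one] at h
  exact IsUnit.of_mul_eq_one _ h

lemma det_sq_of_mem_L {a : M8} (ha : a ∈ L) : IsUnit a.det := by
  have h : (aᵀ * K * a).det = K.det := congrArg Matrix.det (ha : aᵀ * K * a = K)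
  rw [Matrix.det_mul, Matrix.det_mul, Matrix.det_transpose] at h
  have hK := isUnit_K_det.ne_zero
  refine isUnit_iff_ne_zero.mpr fun h0 => hK ?_
  rw [← h, h0]; ring

lemma L_inv_mul {a : M8} (ha : a ∈ L) : a⁻¹ * a = 1 := Matrix.nonsing_inv_mul _ (det_sq_of_mem_L ha)
lemma L_mul_inv {a : M8} (ha : a ∈ L) : a * a⁻¹ = 1 := Matrix.mul_nonsing_inv _ (det_sq_of_mem_L ha)

/-- Elements of `L` are inverted by the adjoint for the Killing form. -/
lemma L_inv_eq {a : M8} (ha : a ∈ L) : a⁻¹ = K⁻¹ * aᵀ * K := by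
  have h : K⁻¹ * aᵀ * K * a = 1 := by
    rw [mul_assoc, mul_assoc, ← mul_assoc aᵀ, show aᵀ * K * a = K from ha,
      Matrix.nonsing_inv_mul _ isUnit_K_det]
  exact Matrix.inv_eq_left_inv h

lemma L_mul {a c : M8} (ha : a ∈ L) (hc : c ∈ L) : a * c ∈ L := by
  change (a * c)ᵀ * K * (a * c) = K
  rw [Matrix.transpose_mul, show cᵀ * aᵀ * K * (a * c) = cᵀ * (aᵀ * K * a) * c by noncomm_ring,
    show aᵀ * K * a = K from ha]
  exact hc

lemma L_inv {a : M8} (ha : a ∈ L) : a⁻¹ ∈ L := by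
  have h1 : aᵀ * K * a = K := ha
  change a⁻¹ᵀ * K * a⁻¹ = K
  rw [← h1, show a⁻¹ᵀ * (aᵀ * K * a) * a⁻¹ = (a⁻¹ᵀ * aᵀ) * K * (a * a⁻¹) by noncomm_ring,
    ← Matrix.transpose_mul, L_mul_inv ha, Matrix.transpose_one, h1]
  simp

lemma one_mem_L : (1 : M8) ∈ L := by change (1 : M8)ᵀ * K * 1 = K; simp

lemma conj_mem_lAlg {a B : M8} (ha : a ∈ L) (hB : B ∈ lAlg) : a * B * a⁻¹ ∈ lAlg := by
  have h1 : aᵀ * K * a = K := ha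
  have h2 : Bᵀ * K + K * B = 0 := hB
  have h3 : a⁻¹ᵀ * K * a⁻¹ = K := L_inv ha
  have h4 : a⁻¹ᵀ * aᵀ = 1 := by rw [← Matrix.transpose_mul, L_mul_inv ha, Matrix.transpose_one]
  have h5 : aᵀ * K = K * a⁻¹ := by
    rw [← h1, mul_assoc _ a, L_mul_inv ha, mul_one, h1]
  have h6 : K * a = a⁻¹ᵀ * K := by
    conv_rhs => rw [← h1, ← mul_assoc, ← mul_assoc, h4, one_mul]
  change (a * B * a⁻¹)ᵀ * K + K * (a * B * a⁻¹) = 0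
  rw [Matrix.transpose_mul, Matrix.transpose_mul, mul_assoc, mul_assoc, h5,
    show K * (a * B * a⁻¹) = K * a * B * a⁻¹ by noncomm_ring, h6,
    show a⁻¹ᵀ * (Bᵀ * (K * a⁻¹)) + a⁻¹ᵀ * K * B * a⁻¹ = a⁻¹ᵀ * (Bᵀ * K + K * B) * a⁻¹ by
      noncomm_ring, h2]
  simp

/-! ### The adjoint action of the group -/

lemma Ad_mul {b c : M3} (hc : IsUnit c.det) : Ad (b * c) = Ad b * Ad c := by
  refine ext_mulVec fun w => ?_
  rw [← Matrix.mulVec_mulVec, Ad_mulVec, Ad_mulVec b, toM_Ad_mulVec hc, Matrix.mul_inv_rev]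
  congr 1; noncomm_ring

lemma Ad_one : Ad 1 = 1 := by
  refine ext_mulVec fun w => ?_
  rw [Ad_mulVec]; simp [coord_toM]

lemma isUnit_det_inv {b : M3} (hb : IsUnit b.det) : IsUnit b⁻¹.det := by
  rw [Matrix.det_nonsing_inv]; exact hb.ringInverse

lemma Ad_inv {b : M3} (hb : IsUnit b.det) : (Ad b)⁻¹ = Ad b⁻¹ := by
  refine Matrix.inv_eq_left_inv ?_
  rw [← Ad_mul hb, Matrix.nonsing_inv_mul _ hb, Ad_one]

lemma Ad_mem_L {b : M3} (hb : IsUnit b.det) : Ad b ∈ L := by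
  rw [mem_L_iff]
  intro v w
  rw [toM_Ad_mulVec hb, toM_Ad_mulVec hb,
    show b * toM v * b⁻¹ * (b * toM w * b⁻¹) = b * (toM v * (b⁻¹ * b) * toM w) * b⁻¹ by
      noncomm_ring, Matrix.nonsing_inv_mul _ hb, mul_one, Matrix.trace_mul_comm, ← mul_assoc,
    Matrix.nonsing_inv_mul _ hb, one_mul]

lemma Ad_ad {b : M3} (hb : IsUnit b.det) (X : M3) : Ad b * ad X * (Ad b)⁻¹ = ad (b * X * b⁻¹) := by
  rw [Ad_inv hb]
  refine ext_mulVec fun w => toM_injective ?_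
  have hb' := isUnit_det_inv hb
  rw [← Matrix.mulVec_mulVec, ← Matrix.mulVec_mulVec, toM_Ad_mulVec hb, toM_ad_mulVec,
    toM_ad_mulVec, toM_Ad_mulVec hb', Matrix.nonsing_inv_nonsing_inv _ hb]
  have h1 : b * b⁻¹ = 1 := Matrix.mul_nonsing_inv _ hb
  rw [mul_sub, sub_mul]
  congr 1
  · rw [show b * (X * (b⁻¹ * toM w * b)) * b⁻¹ = b * X * b⁻¹ * toM w * (b * b⁻¹) by noncomm_ring,
      h1, mul_one]
  · rw [show b * (b⁻¹ * toM w * b * X) * b⁻¹ = (b * b⁻¹) * (toM w * (b * X * b⁻¹)) by noncomm_ring,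
      h1, one_mul]


/-! ### Filtrations -/

/-- The filtration of `M₃(ℝ)` by the degree `j - i`. -/
def mFil (p : ℤ) : Submodule ℝ M3 where
  carrier := {X | ∀ i j : Fin 3, ((j : ℕ) : ℤ) - ((i : ℕ) : ℤ) < p → X i j = 0}
  add_mem' := by
    intro X Y hX hY i j h
    rw [Matrix.add_apply, hX i j h, hY i j h, add_zero]
  zero_mem' := fun _ _ _ => rfl
  smul_mem' := by
    intro c X hX i j h
    rw [Matrix.smul_apply, hX i j h, smul_zero]

lemma mFil_mul {p q : ℤ} {X Y : M3} (hX : X ∈ mFil p) (hY : Y ∈ mFil q) :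
    X * Y ∈ mFil (p + q) := by
  intro i j h
  rw [Matrix.mul_apply]
  refine Finset.sum_eq_zero fun k _ => ?_
  by_cases hk : ((k : ℕ) : ℤ) - ((i : ℕ) : ℤ) < p
  · rw [hX i k hk, zero_mul]
  · rw [hY k j (by omega), mul_zero]

lemma mFil_mono {p q : ℤ} (h : p ≤ q) : mFil q ≤ mFil p := fun _ hX i j hij =>
  hX i j (hij.trans_le h)

lemma mFil_bracket {p q : ℤ} {X Y : M3} (hX : X ∈ mFil p) (hY : Y ∈ mFil q) :
    X * Y - Y * X ∈ mFil (p + q) :=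
  sub_mem (mFil_mul hX hY) (add_comm q p ▸ mFil_mul hY hX)

lemma mem_gZero_iff {X : M3} : X ∈ gZero ↔ X ∈ sl3 ∧ X ∈ mFil 0 := by
  refine and_congr_right fun _ => ⟨fun h i j hij => h i j ?_, fun h i j hij => h i j ?_⟩
  · exact Fin.lt_def.mpr (by omega)
  · have := Fin.lt_def.mp hij; omega

lemma glFil_mul {p q : ℤ} {B C : M8} (hB : B ∈ glFil p) (hC : C ∈ glFil q) :
    B * C ∈ glFil (p + q) := by
  intro i j h
  rw [Matrix.mul_apply]
  refine Finset.sum_eq_zero fun k _ => ?_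
  by_cases hk : vdeg i - vdeg k < p
  · rw [hB i k hk, zero_mul]
  · rw [hC k j (by omega), mul_zero]

lemma glFil_mono {p q : ℤ} (h : p ≤ q) : glFil q ≤ glFil p := fun _ hX i j hij =>
  hX i j (hij.trans_le h)

lemma glFil_bracket {p q : ℤ} {X Y : M8} (hX : X ∈ glFil p) (hY : Y ∈ glFil q) :
    X * Y - Y * X ∈ glFil (p + q) :=
  sub_mem (glFil_mul hX hY) (add_comm q p ▸ glFil_mul hY hX)

lemma glFil_trace {p : ℤ} (hp : 0 < p) {B : M8} (hB : B ∈ glFil p) : B.trace = 0 :=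
  Finset.sum_eq_zero fun i _ => hB i i (by simpa using hp)

lemma glFil_mulVec {p q : ℤ} {B : M8} (hB : B ∈ glFil p) {v : Fin 8 → ℝ} (hv : v ∈ stdFlag q) :
    B *ᵥ v ∈ stdFlag (p + q) := by
  intro i h
  change ∑ k, B i k * v k = 0
  refine Finset.sum_eq_zero fun k _ => ?_
  by_cases hk : vdeg i - vdeg k < p
  · rw [hB i k hk, zero_mul]
  · rw [hv k (by omega), mul_zero]

lemma stdFlag_anti {p q : ℤ} (h : p ≤ q) : stdFlag q ≤ stdFlag p := fun _ hv i hi =>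
  hv i (hi.trans_le h)

lemma coord_of_mFil {p : ℤ} {X : M3} (hX : X ∈ mFil p) (i : Fin 8) (hi : vdeg i - 2 < p) :
    coord X i = 0 := by
  fin_cases i <;> simp [vdeg] at hi <;> simp [coord] <;> exact hX _ _ (by simp; omega)

lemma A_mem_mFil (j : Fin 8) : A j ∈ mFil (vdeg j - 2) := by
  intro a b h
  fin_cases j <;> fin_cases a <;> fin_cases b <;> simp [vdeg] at h <;> simp [A, E, H1, H2]

lemma ad_mem_glFil {p : ℤ} {X : M3} (hX : X ∈ mFil p) : ad X ∈ glFil p := by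
  intro i j h
  exact coord_of_mFil (mFil_bracket hX (A_mem_mFil j)) i (by omega)

/-! ### The decomposition of `𝔩` -/

lemma E_mem_mFil (i j : Fin 3) : E i j ∈ mFil (((j : ℕ) : ℤ) - ((i : ℕ) : ℤ)) := by
  intro a b h
  rw [E, Matrix.single_apply_of_ne]
  rintro ⟨rfl, rfl⟩
  exact lt_irrefl _ h

lemma E_mem_sl3 {i j : Fin 3} (h : i ≠ j) : E i j ∈ sl3 := by
  change (E i j).trace = 0
  rw [E, Matrix.trace_single_eq_of_ne _ _ _ h]

lemma H1_mem : H1 ∈ sl3 := by rw [mem_sl3_iff]; simp [H1, E]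
lemma H2_mem : H2 ∈ sl3 := by rw [mem_sl3_iff]; simp [H2, E]

lemma H1_mem_mFil : H1 ∈ mFil 0 := sub_mem (E_mem_mFil 0 0) (E_mem_mFil 1 1)
lemma H2_mem_mFil : H2 ∈ mFil 0 := sub_mem (E_mem_mFil 1 1) (E_mem_mFil 2 2)

lemma trace_mul_E (X : M3) (i j : Fin 3) : (X * E j i).trace = X i j := by
  simp [E, Matrix.trace_mul_single]

/-- The decomposition `𝔤 ⊕ 𝔤^⊥` is compatible with the filtrations. -/
lemma mFil_of_add_mem {Q : M8} (hQ : Q ∈ gPerp) {Z : M3} (hZ : Z ∈ sl3) {m : ℤ}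
    (h : Q + ad Z ∈ glFil m) : Z ∈ mFil m := by
  -- An operator of positive filtration degree is traceless and Q is trace-orthogonal to ad X, so
  -- the trace form pairs Z to zero with every X of sufficiently high degree.
  have key : ∀ X ∈ sl3, ∀ p, X ∈ mFil p → 0 < m + p → (Z * X).trace = 0 := by
    intro X hX p hXp hp
    have h1 := glFil_trace hp (glFil_mul h (ad_mem_glFil hXp))
    rw [add_mul, Matrix.trace_add, hQ.2 X hX, trace_ad_mul_ad hZ hX] at h1
    linarith
  intro i j hij
  -- A diagonal matrix unit is not traceless, so the diagonal of Z is tested against H₁ and H₂, and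
  -- tr Z = 0 supplies the third equation.
  by_cases hne : i = j
  · subst hne
    have hm : 0 < m + 0 := by omega
    have h1 := key H1 H1_mem 0 H1_mem_mFil hm
    have h2 := key H2 H2_mem 0 H2_mem_mFil hm
    rw [H1, mul_sub, Matrix.trace_sub, trace_mul_E, trace_mul_E] at h1
    rw [H2, mul_sub, Matrix.trace_sub, trace_mul_E, trace_mul_E] at h2
    rw [mem_sl3_iff] at hZ
    fin_cases i <;> simp <;> linarith
  · have h1 := key (E j i) (E_mem_sl3 (Ne.symm hne)) _ (E_mem_mFil j i) (by omega)
    rwa [trace_mul_E] at h1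

lemma eq_zero_of_mFil {X : M3} (hX : X ∈ mFil 5) : X = 0 := by
  ext i j
  exact hX i j (by have := i.2; have := j.2; omega)

/-- Zero lies in every step of the filtration, so compatibility of the decomposition with the
filtration puts Z in every step too. -/
lemma gPerp_inter {Q : M8} (hQ : Q ∈ gPerp) {Z : M3} (hZ : Z ∈ sl3) (h : Q + ad Z = 0) :
    Q = 0 ∧ Z = 0 := by
  have hZ0 : Z = 0 := eq_zero_of_mFil (mFil_of_add_mem hQ hZ (h ▸ zero_mem _))
  subst hZ0
  simpa using h

/-- Directness of 𝔤 ⊕ 𝔤^⊥ in the form used throughout: the two components of an identity in 𝔩 may be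
compared separately. -/
lemma graph_unique {Q Q' : M8} (hQ : Q ∈ gPerp) (hQ' : Q' ∈ gPerp) {Z Z' : M3} (hZ : Z ∈ sl3)
    (hZ' : Z' ∈ sl3) (h : ad Z + Q = ad Z' + Q') : Z = Z' ∧ Q = Q' := by
  have h1 := gPerp_inter (sub_mem hQ hQ') (sub_mem hZ hZ') (by
    rw [ad_sub, ← sub_eq_zero.mpr h]; abel)
  exact ⟨sub_eq_zero.mp h1.2, sub_eq_zero.mp h1.1⟩

/-- Invariance of the trace form: tr([ad X, Q] ad Y) = tr(Q ad [Y, X]). -/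
lemma gPerp_bracket {Q : M8} (hQ : Q ∈ gPerp) (X : M3) :
    ad X * Q - Q * ad X ∈ gPerp := by
  refine ⟨lAlg_bracket (ad_mem_lAlg X) hQ.1, fun Y hY => ?_⟩
  have h := hQ.2 (Y * X - X * Y) (bracket_mem_sl3 _ _)
  rw [ad_bracket, mul_sub, Matrix.trace_sub] at h
  rw [sub_mul, Matrix.trace_sub, mul_assoc, Matrix.trace_mul_comm, mul_assoc, mul_assoc]
  exact h

lemma gPerp_conj {b : M3} (hb : IsUnit b.det) {Q : M8} (hQ : Q ∈ gPerp) :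
    Ad b * Q * (Ad b)⁻¹ ∈ gPerp := by
  have hA := Ad_mem_L hb
  refine ⟨conj_mem_lAlg hA hQ.1, fun X hX => ?_⟩
  have h := hQ.2 (b⁻¹ * X * b) (by
    have := conj_mem_sl3 (isUnit_det_inv hb) hX
    rwa [Matrix.nonsing_inv_nonsing_inv _ hb] at this)
  have h2 := Ad_ad (isUnit_det_inv hb) X
  rw [Matrix.nonsing_inv_nonsing_inv _ hb, ← Ad_inv hb,
    Matrix.nonsing_inv_nonsing_inv _ (det_sq_of_mem_L hA)] at h2
  rw [← h2] at h
  rw [← h, mul_assoc, mul_assoc, Matrix.trace_mul_comm]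
  congr 1
  noncomm_ring

/-- The projection of `𝔩` to `𝔤`. -/
lemma exists_gPerp_add {C : M8} (hC : C ∈ lAlg) : ∃ Z ∈ sl3, C - ad Z ∈ gPerp := by
  set t : Fin 8 → ℝ := fun j => (C * ad (A j)).trace / 6 with ht
  -- In the basis A the trace form is antidiagonal except on ⟨H₁, H₂⟩, where it is the Cartan matrix
  -- with rows (2, -1) and (-1, 2). Inverting it reverses the other coordinates and produces the
  -- thirds.
  obtain ⟨Z, hZ⟩ : ∃ Z, Z = toM ![t 7, t 6, t 5, (2 * t 3 + t 4) / 3, (t 3 + 2 * t 4) / 3,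
    t 2, t 1, t 0] := ⟨_, rfl⟩
  have hZm : Z ∈ sl3 := hZ ▸ toM_mem _
  refine ⟨Z, hZm, sub_mem hC (ad_mem_lAlg _), fun X hX => ?_⟩
  have hj : ∀ j, ((C - ad Z) * ad (A j)).trace = 0 := by
    intro j
    rw [sub_mul, Matrix.trace_sub, trace_ad_mul_ad hZm (A_eq_toM j ▸ toM_mem _),
      show (C * ad (A j)).trace = 6 * t j by rw [ht]; ring]
    fin_cases j <;> simp [A, H1, H2, mul_sub, trace_mul_E] <;> simp [hZ, toM] <;> ring
  rw [← toM_coord hX, toM_eq_sum]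
  change (_ * adₗ _).trace = 0
  rw [map_sum, Finset.mul_sum, Matrix.trace_sum]
  refine Finset.sum_eq_zero fun j _ => ?_
  rw [map_smul, mul_smul_comm, Matrix.trace_smul]
  change _ • (_ * ad (A j)).trace = 0
  rw [hj, smul_zero]

/-! ### Coordinates on `𝔤^⊥` -/

/-- The element of `𝔤^⊥ ≅ S³ℝ³ ⊕ S³(ℝ³)*` with given coordinates. The coordinates belong to the
monomials `111, 112, 113, 122, 123, 133, 222, 223, 233, 333`. -/
def gpMat (x y : Fin 10 → ℝ) : M8 :=
  !![-x 4 + y 4, -x 3 - y 5, x 2 + y 7, -2 * x 1 + y 8, x 1 - 2 * y 8, -y 9, x 0, 0;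
    x 5 + y 3, x 4 - y 4, y 6, x 2 + y 7, x 2 - 2 * y 7, -x 1 - y 8, 0, -x 0;
    -x 7 - y 2, -x 6, x 4 - y 4, -2 * x 3 + y 5, x 3 + y 5, 0, x 1 + y 8, y 9;
    y 1, -y 2, -x 5 + y 3, x 4 + y 4, -2 * x 4 - 2 * y 4, x 3 - y 5, -x 2, x 1;
    x 8, x 7 - y 2, -x 5, 2 * x 4 + 2 * y 4, -x 4 - y 4, -y 5, -x 2 + y 7, y 8;
    x 9, x 8 + y 1, 0, x 5 - 2 * y 3, x 5 + y 3, -x 4 + y 4, -y 6, -x 2 - y 7;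
    -y 0, 0, -x 8 - y 1, x 7 + y 2, -2 * x 7 + y 2, x 6, -x 4 + y 4, x 3 + y 5;
    0, y 0, -x 9, x 8 - 2 * y 1, -2 * x 8 + y 1, x 7 + y 2, -x 5 - y 3, x 4 - y 4]

lemma lAlg_entry {B : M8} (hB : B ∈ lAlg) (i j : Fin 8) :
    (K * B) j i + (K * B) i j = 0 := by
  have h : Bᵀ * K + K * B = 0 := hB
  have hK : Kᵀ = K := by
    rw [K_eq]; ext i j; fin_cases i <;> fin_cases j <;> rfl
  have h2 := congrFun (congrFun h i) j
  rw [Matrix.add_apply, ← hK, ← Matrix.transpose_mul, Matrix.transpose_apply, hK] at h2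
  simpa using h2

-- Antisymmetry of K B gives 36 linear equations and orthogonality to the eight ad A_j gives 8 more,
-- so 64 - 44 = 20 parameters remain. They are read off from chosen entries, and each other entry is
-- an explicit combination of these equations.
set_option maxHeartbeats 2000000 in
lemma exists_gpMat {B : M8} (hB : B ∈ gPerp) : ∃ x y, B = gpMat x y := by
  refine ⟨![B 0 6, B 3 7, -B 3 6, B 4 5 - B 0 1, (B 3 3 - B 0 0) / 2, -B 4 2, -B 2 1,
    B 3 1 - B 2 0, B 4 0, B 5 0], ![-B 6 0, B 3 0, -B 3 1, B 4 2 + B 1 0, (B 0 0 + B 3 3) / 2,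
    -B 4 5, B 1 2, B 3 6 + B 0 2, B 4 7, -B 0 5], ?_⟩
  -- The rows of K B: K is antidiagonal apart from its Cartan block, so each row of the product
  -- involves at most two rows of B.
  set kb : Fin 8 → Fin 8 → ℝ := fun i j => ![6 * B 7 j, 6 * B 6 j, 6 * B 5 j,
    12 * B 3 j - 6 * B 4 j, 12 * B 4 j - 6 * B 3 j, 6 * B 2 j, 6 * B 1 j, 6 * B 0 j] i with hkb
  have hk : ∀ i j, (K * B) i j = kb i j := fun i j => by
    rw [Matrix.mul_apply, Fin.sum_univ_eight, K_eq]
    fin_cases i <;> simp [hkb] <;> ring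
  have h : ∀ i j, kb j i + kb i j = 0 := fun i j => by
    rw [← hk, ← hk]; exact lAlg_entry hB.1 i j
  have ht : ∀ j, (B * adMat (Pi.single j 1)).trace = 0 := fun j => by
    rw [← ad_toM]; exact hB.2 _ (toM_mem _)
  simp only [hkb] at h
  simp only [Matrix.trace, Matrix.diag, Matrix.mul_apply, Fin.sum_univ_eight] at ht
  have hL00 : 12 * B 7 0 = 0 := by
    have := h 0 0
    simp at this; linarith
  have hL01 : 6 * B 6 0 + 6 * B 7 1 = 0 := by
    have := h 0 1
    simp at this; linarith
  have hL02 : 6 * B 5 0 + 6 * B 7 2 = 0 := by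
    have := h 0 2
    simp at this; linarith
  have hL03 : 12 * B 3 0 - 6 * B 4 0 + 6 * B 7 3 = 0 := by
    have := h 0 3
    simp at this; linarith
  have hL04 : (-6) * B 3 0 + 12 * B 4 0 + 6 * B 7 4 = 0 := by
    have := h 0 4
    simp at this; linarith
  have hL05 : 6 * B 2 0 + 6 * B 7 5 = 0 := by
    have := h 0 5
    simp at this; linarith
  have hL06 : 6 * B 1 0 + 6 * B 7 6 = 0 := by
    have := h 0 6
    simp at this; linarith
  have hL07 : 6 * B 0 0 + 6 * B 7 7 = 0 := by
    have := h 0 7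
    simp at this; linarith
  have hL11 : 12 * B 6 1 = 0 := by
    have := h 1 1
    simp at this; linarith
  have hL12 : 6 * B 5 1 + 6 * B 6 2 = 0 := by
    have := h 1 2
    simp at this; linarith
  have hL13 : 12 * B 3 1 - 6 * B 4 1 + 6 * B 6 3 = 0 := by
    have := h 1 3
    simp at this; linarith
  have hL14 : (-6) * B 3 1 + 12 * B 4 1 + 6 * B 6 4 = 0 := by
    have := h 1 4
    simp at this; linarith
  have hL15 : 6 * B 2 1 + 6 * B 6 5 = 0 := by
    have := h 1 5
    simp at this; linarith
  have hL16 : 6 * B 1 1 + 6 * B 6 6 = 0 := by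
    have := h 1 6
    simp at this; linarith
  have hL17 : 6 * B 0 1 + 6 * B 6 7 = 0 := by
    have := h 1 7
    simp at this; linarith
  have hL22 : 12 * B 5 2 = 0 := by
    have := h 2 2
    simp at this; linarith
  have hL23 : 12 * B 3 2 - 6 * B 4 2 + 6 * B 5 3 = 0 := by
    have := h 2 3
    simp at this; linarith
  have hL24 : (-6) * B 3 2 + 12 * B 4 2 + 6 * B 5 4 = 0 := by
    have := h 2 4
    simp at this; linarith
  have hL25 : 6 * B 2 2 + 6 * B 5 5 = 0 := by
    have := h 2 5
    simp at this; linarith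
  have hL26 : 6 * B 1 2 + 6 * B 5 6 = 0 := by
    have := h 2 6
    simp at this; linarith
  have hL27 : 6 * B 0 2 + 6 * B 5 7 = 0 := by
    have := h 2 7
    simp at this; linarith
  have hL33 : 24 * B 3 3 - 12 * B 4 3 = 0 := by
    have := h 3 3
    simp at this; linarith
  have hL34 : (-6) * B 3 3 + 12 * B 3 4 + 12 * B 4 3 - 6 * B 4 4 = 0 := by
    have := h 3 4
    simp at this; linarith
  have hL35 : 6 * B 2 3 + 12 * B 3 5 - 6 * B 4 5 = 0 := by
    have := h 3 5
    simp at this; linarith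
  have hL36 : 6 * B 1 3 + 12 * B 3 6 - 6 * B 4 6 = 0 := by
    have := h 3 6
    simp at this; linarith
  have hL37 : 6 * B 0 3 + 12 * B 3 7 - 6 * B 4 7 = 0 := by
    have := h 3 7
    simp at this; linarith
  have hL44 : (-12) * B 3 4 + 24 * B 4 4 = 0 := by
    have := h 4 4
    simp at this; linarith
  have hL45 : 6 * B 2 4 - 6 * B 3 5 + 12 * B 4 5 = 0 := by
    have := h 4 5
    simp at this; linarith
  have hL46 : 6 * B 1 4 - 6 * B 3 6 + 12 * B 4 6 = 0 := by
    have := h 4 6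
    simp at this; linarith
  have hL47 : 6 * B 0 4 - 6 * B 3 7 + 12 * B 4 7 = 0 := by
    have := h 4 7
    simp at this; linarith
  have hL55 : 12 * B 2 5 = 0 := by
    have := h 5 5
    simp at this; linarith
  have hL56 : 6 * B 1 5 + 6 * B 2 6 = 0 := by
    have := h 5 6
    simp at this; linarith
  have hL57 : 6 * B 0 5 + 6 * B 2 7 = 0 := by
    have := h 5 7
    simp at this; linarith
  have hL66 : 12 * B 1 6 = 0 := by
    have := h 6 6
    simp at this; linarith
  have hL67 : 6 * B 0 6 + 6 * B 1 7 = 0 := by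
    have := h 6 7
    simp at this; linarith
  have hL77 : 12 * B 0 7 = 0 := by
    have := h 7 7
    simp at this; linarith
  have hT0 : -B 3 0 - B 4 0 + B 5 1 - B 6 2 + B 7 3 + B 7 4 = 0 := by
    have := ht 0
    simp [adMat] at this; linarith
  have hT1 : B 2 0 - 2 * B 3 1 + B 4 1 + B 6 3 - B 7 5 = 0 := by
    have := ht 1
    simp [adMat] at this; linarith
  have hT2 : -B 1 0 + B 3 2 - 2 * B 4 2 + B 5 4 + B 7 6 = 0 := by
    have := ht 2
    simp [adMat] at this; linarith
  have hT3 : B 0 0 + 2 * B 1 1 - B 2 2 + B 5 5 - 2 * B 6 6 - B 7 7 = 0 := by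
    have := ht 3
    simp [adMat] at this; linarith
  have hT4 : B 0 0 - B 1 1 + 2 * B 2 2 - 2 * B 5 5 + B 6 6 - B 7 7 = 0 := by
    have := ht 4
    simp [adMat] at this; linarith
  have hT5 : -B 0 1 - B 2 4 - B 3 5 + 2 * B 4 5 + B 6 7 = 0 := by
    have := ht 5
    simp [adMat] at this; linarith
  have hT6 : B 0 2 - B 1 3 + 2 * B 3 6 - B 4 6 - B 5 7 = 0 := by
    have := ht 6
    simp [adMat] at this; linarith
  have hT7 : -B 0 3 - B 0 4 + B 1 5 - B 2 6 + B 3 7 + B 4 7 = 0 := by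
    have := ht 7
    simp [adMat] at this; linarith
  ext i j; fin_cases i <;> fin_cases j
  · simp [gpMat]; ring
  · simp [gpMat]
  · simp [gpMat]
  · simp [gpMat]; linear_combination (1 / 6) * hL37
  · simp [gpMat]; linear_combination (1 / 6) * hL47
  · simp [gpMat]
  · simp [gpMat]
  · simp [gpMat]; linear_combination (1 / 12) * hL77
  · simp [gpMat]
  · simp [gpMat]; linear_combination (1 / 12) * hL07 + (1 / 12) * hL16 + (1 / 3) * hT3 + (1 / 6) * hT4
  · simp [gpMat]
  · simp [gpMat]; linear_combination (-1 / 12) * hL27 + (1 / 12) * hL36 - (1 / 2) * hT6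
  · simp [gpMat]; linear_combination (1 / 6) * hL27 + (1 / 6) * hL36 + (1 / 6) * hL46 + hT6
  · simp [gpMat]; linear_combination (1 / 12) * hL37 + (1 / 12) * hL47 + (1 / 12) * hL56 + (1 / 2) * hT7
  · simp [gpMat]; linear_combination (1 / 12) * hL66
  · simp [gpMat]; linear_combination (1 / 6) * hL67
  · simp [gpMat]
  · simp [gpMat]
  · simp [gpMat]; linear_combination (1 / 12) * hL07 + (1 / 12) * hL25 + (1 / 6) * hT3 + (1 / 3) * hT4
  · simp [gpMat]; linear_combination (-1 / 6) * hL17 + (1 / 6) * hL35 + (1 / 6) * hL45 + hT5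
  · simp [gpMat]; linear_combination (1 / 12) * hL17 + (1 / 12) * hL45 - (1 / 2) * hT5
  · simp [gpMat]; linear_combination (1 / 12) * hL55
  · simp [gpMat]; linear_combination (-1 / 12) * hL37 - (1 / 12) * hL47 + (1 / 12) * hL56 - (1 / 2) * hT7
  · simp [gpMat]; linear_combination (1 / 6) * hL57
  · simp [gpMat]
  · simp [gpMat]
  · simp [gpMat]; linear_combination (-1 / 12) * hL06 - (1 / 12) * hL24 + (1 / 2) * hT2
  · simp [gpMat]; ring
  · simp [gpMat]; linear_combination (1 / 9) * hL33 + (1 / 9) * hL34 + (1 / 36) * hL44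
  · simp [gpMat]; linear_combination (1 / 12) * hL17 - (1 / 12) * hL45 - (1 / 2) * hT5
  · simp [gpMat]
  · simp [gpMat]
  · simp [gpMat]
  · simp [gpMat]; linear_combination (1 / 12) * hL05 - (1 / 12) * hL13 + (1 / 2) * hT1
  · simp [gpMat]
  · simp [gpMat]; linear_combination (-1 / 12) * hL33
  · simp [gpMat]; linear_combination (1 / 18) * hL33 + (1 / 18) * hL34 + (1 / 18) * hL44
  · simp [gpMat]
  · simp [gpMat]; linear_combination (-1 / 12) * hL27 - (1 / 12) * hL36 - (1 / 2) * hT6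
  · simp [gpMat]
  · simp [gpMat]
  · simp [gpMat]; linear_combination (-1 / 12) * hL03 - (1 / 12) * hL04 + (1 / 12) * hL12 + (1 / 2) * hT0
  · simp [gpMat]; linear_combination (1 / 12) * hL22
  · simp [gpMat]; linear_combination (1 / 6) * hL06 + (1 / 6) * hL23 + (1 / 6) * hL24 - hT2
  · simp [gpMat]; linear_combination (-1 / 12) * hL06 + (1 / 12) * hL24 + (1 / 2) * hT2
  · simp [gpMat]; linear_combination (-1 / 12) * hL07 + (1 / 12) * hL25 - (1 / 6) * hT3 - (1 / 3) * hT4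
  · simp [gpMat]; linear_combination (1 / 6) * hL26
  · simp [gpMat]; linear_combination (1 / 6) * hL27
  · simp [gpMat]
  · simp [gpMat]; linear_combination (1 / 12) * hL11
  · simp [gpMat]; linear_combination (1 / 12) * hL03 + (1 / 12) * hL04 + (1 / 12) * hL12 - (1 / 2) * hT0
  · simp [gpMat]; linear_combination (1 / 12) * hL05 + (1 / 12) * hL13 + (1 / 2) * hT1
  · simp [gpMat]; linear_combination (-1 / 6) * hL05 + (1 / 6) * hL13 + (1 / 6) * hL14 - hT1
  · simp [gpMat]; linear_combination (1 / 6) * hL15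
  · simp [gpMat]; linear_combination (-1 / 12) * hL07 + (1 / 12) * hL16 - (1 / 3) * hT3 - (1 / 6) * hT4
  · simp [gpMat]; linear_combination (1 / 6) * hL17
  · simp [gpMat]; linear_combination (1 / 12) * hL00
  · simp [gpMat]; linear_combination (1 / 6) * hL01
  · simp [gpMat]; linear_combination (1 / 6) * hL02
  · simp [gpMat]; linear_combination (1 / 6) * hL03
  · simp [gpMat]; linear_combination (1 / 6) * hL04
  · simp [gpMat]; linear_combination (1 / 6) * hL05
  · simp [gpMat]; linear_combination (1 / 6) * hL06
  · simp [gpMat]; linear_combination (1 / 6) * hL07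


/-! ### Harmonic elements of `Hom(𝔤_-, 𝔤^⊥)` -/

lemma adMat_mul (v : Fin 8 → ℝ) (B : M8) (i j : Fin 8) : (adMat v * B) i j =
    ![(v 3 + v 4) * B 0 j + (-v 2) * B 1 j + (v 1) * B 2 j + (-v 0) * B 3 j + (-v 0) * B 4 j,
      (-v 5) * B 0 j + (2 * v 3 - v 4) * B 1 j + (-2 * v 1) * B 3 j + (v 1) * B 4 j + (v 0) * B 5 j,
      (v 6) * B 0 j + (-v 3 + 2 * v 4) * B 2 j + (v 2) * B 3 j + (-2 * v 2) * B 4 j + (-v 0) * B 6 j,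
      (-v 7) * B 0 j + (-v 6) * B 1 j + (v 1) * B 6 j + (v 0) * B 7 j,
      (-v 7) * B 0 j + (-v 5) * B 2 j + (v 2) * B 5 j + (v 0) * B 7 j,
      (v 7) * B 1 j + (-v 5) * B 3 j + (2 * v 5) * B 4 j + (v 3 - 2 * v 4) * B 5 j + (-v 1) * B 7 j,
      (-v 7) * B 2 j + (2 * v 6) * B 3 j + (-v 6) * B 4 j + (-2 * v 3 + v 4) * B 6 j + (v 2) * B 7 j,
      (v 7) * B 3 j + (v 7) * B 4 j + (-v 6) * B 5 j + (v 5) * B 6 j + (-v 3 - v 4) * B 7 j] i := by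
  rw [Matrix.mul_apply, Fin.sum_univ_eight]
  fin_cases i <;> simp [adMat]

lemma mul_adMat (v : Fin 8 → ℝ) (B : M8) (i j : Fin 8) : (B * adMat v) i j =
    ![B i 0 * (v 3 + v 4) + B i 1 * (-v 5) + B i 2 * (v 6) + B i 3 * (-v 7) + B i 4 * (-v 7),
      B i 0 * (-v 2) + B i 1 * (2 * v 3 - v 4) + B i 3 * (-v 6) + B i 5 * (v 7),
      B i 0 * (v 1) + B i 2 * (-v 3 + 2 * v 4) + B i 4 * (-v 5) + B i 6 * (-v 7),
      B i 0 * (-v 0) + B i 1 * (-2 * v 1) + B i 2 * (v 2) + B i 5 * (-v 5) + B i 6 * (2 * v 6) + B i 7 * (v 7),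
      B i 0 * (-v 0) + B i 1 * (v 1) + B i 2 * (-2 * v 2) + B i 5 * (2 * v 5) + B i 6 * (-v 6) + B i 7 * (v 7),
      B i 1 * (v 0) + B i 4 * (v 2) + B i 5 * (v 3 - 2 * v 4) + B i 7 * (-v 6),
      B i 2 * (-v 0) + B i 3 * (v 1) + B i 6 * (-2 * v 3 + v 4) + B i 7 * (v 5),
      B i 3 * (v 0) + B i 4 * (v 0) + B i 5 * (-v 1) + B i 6 * (v 2) + B i 7 * (-v 3 - v 4)] j := by
  rw [Matrix.mul_apply, Fin.sum_univ_eight]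
  fin_cases j <;> simp [adMat]

lemma ad_eq_adMat_of {X : M3} {v : Fin 8 → ℝ} (h : X = toM v) : ad X = adMat v := by
  rw [h, ad_toM]

lemma e_zero : e 0 = toM ![0, 0, 0, 0, 0, 0, 0, 1] := by
  ext a b; fin_cases a <;> fin_cases b <;> simp [e, E, toM]
lemma e_one : e 1 = toM ![0, 0, 0, 0, 0, 0, 1, 0] := by
  ext a b; fin_cases a <;> fin_cases b <;> simp [e, E, toM]
lemma e_two : e 2 = toM ![0, 0, 0, 0, 0, 1, 0, 0] := by
  ext a b; fin_cases a <;> fin_cases b <;> simp [e, E, toM]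
lemma eCheck_zero : eCheck 0 = toM ![1, 0, 0, 0, 0, 0, 0, 0] := by
  ext a b; fin_cases a <;> fin_cases b <;> simp [eCheck, E, toM]
lemma eCheck_one : eCheck 1 = toM ![0, 1, 0, 0, 0, 0, 0, 0] := by
  ext a b; fin_cases a <;> fin_cases b <;> simp [eCheck, E, toM]
lemma eCheck_two : eCheck 2 = toM ![0, 0, 1, 0, 0, 0, 0, 0] := by
  ext a b; fin_cases a <;> fin_cases b <;> simp [eCheck, E, toM]

lemma ad_e_zero : ad (e 0) = adMat ![0, 0, 0, 0, 0, 0, 0, 1] := ad_eq_adMat_of e_zero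
lemma ad_e_one : ad (e 1) = adMat ![0, 0, 0, 0, 0, 0, 1, 0] := ad_eq_adMat_of e_one
lemma ad_e_two : ad (e 2) = adMat ![0, 0, 0, 0, 0, 1, 0, 0] := ad_eq_adMat_of e_two
lemma ad_eCheck_zero : ad (eCheck 0) = adMat ![1, 0, 0, 0, 0, 0, 0, 0] := ad_eq_adMat_of eCheck_zero
lemma ad_eCheck_one : ad (eCheck 1) = adMat ![0, 1, 0, 0, 0, 0, 0, 0] := ad_eq_adMat_of eCheck_one
lemma ad_eCheck_two : ad (eCheck 2) = adMat ![0, 0, 1, 0, 0, 0, 0, 0] := ad_eq_adMat_of eCheck_two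

/-- The component of degree `k` of the cochain `eᵢ ↦ cᵢ` is closed, and the cochain is coclosed. -/
structure IsHarmonic (c0 c1 c2 : M8) (k : ℤ) : Prop where
  closed12 : ∀ i j, vdeg i - vdeg j = k - 2 →
    (-c0 - (ad (e 1) * c2 - c2 * ad (e 1)) + (ad (e 2) * c1 - c1 * ad (e 2))) i j = 0
  closed01 : ∀ i j, vdeg i - vdeg j = k - 3 →
    (-(ad (e 0) * c1 - c1 * ad (e 0)) + (ad (e 1) * c0 - c0 * ad (e 1))) i j = 0
  closed02 : ∀ i j, vdeg i - vdeg j = k - 3 →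
    (-(ad (e 0) * c2 - c2 * ad (e 0)) + (ad (e 2) * c0 - c0 * ad (e 2))) i j = 0
  coclosed : ∀ i j, ((ad (eCheck 0) * c0 - c0 * ad (eCheck 0)) +
    (ad (eCheck 1) * c1 - c1 * ad (eCheck 1)) + (ad (eCheck 2) * c2 - c2 * ad (eCheck 2))) i j = 0

/-- Twelve coordinates have degree 1: those of degree -1 in c₀ and those of degree 0 in c₁ and c₂.
The chosen entries of the closedness and coclosedness equations give ten conditions, and the two
coordinates left free, x₂ at 222 and y₁ at 222, are the coefficients of ξ₁^R and ξ₁^S. Since each ad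
eᵢ and ad ěᵢ is homogeneous, an entry of fixed degree sees only the component of that degree, so no
truncation is needed. -/
lemma harmonic_1 {x0 y0 x1 y1 x2 y2 : Fin 10 → ℝ}
    (h : IsHarmonic (gpMat x0 y0) (gpMat x1 y1) (gpMat x2 y2) 1) :
        x0 5 = 0 ∧ x0 7 = 0 ∧ y0 2 = 0 ∧ y0 3 = 0 ∧ x1 4 = 0 ∧ x1 6 = 0 ∧ y1 4 = 0 ∧ x2 4 = 0 ∧
      y2 4 = 0 ∧ y2 6 = 0 := by
  obtain ⟨h12, h01, h02, hd⟩ := h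
  have q0 := h12 3 1 (by simp [vdeg])
  have q1 := h12 4 2 (by simp [vdeg])
  have q2 := h01 3 0 (by simp [vdeg])
  have q3 := h02 4 0 (by simp [vdeg])
  have q4 := hd 3 6
  have q5 := hd 4 5
  have q6 := h12 1 0 (by simp [vdeg])
  have q7 := h12 2 0 (by simp [vdeg])
  have q8 := hd 0 1
  have q9 := hd 0 2
  simp only [Matrix.add_apply, Matrix.sub_apply, Matrix.neg_apply, ad_e_zero, ad_e_one, ad_e_two,
    ad_eCheck_zero, ad_eCheck_one, ad_eCheck_two, adMat_mul, mul_adMat] at q0 q1 q2 q3 q4 q5 q6 q7 q8 q9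
  simp [gpMat] at q0 q1 q2 q3 q4 q5 q6 q7 q8 q9
  refine ⟨?_, ?_, ?_, ?_, ?_, ?_, ?_, ?_, ?_, ?_⟩ <;> linarith

/-- In degrees 2, 3, 4 and 5 there are 12, 8, 6 and 2 coordinates, and here and in the next three
lemmas the equations kill all of them: there is no harmonic cochain of degree above 1. Degree 5 is
the last one, since 𝔤^⊥ ends in degree 3 and 𝔤₋ starts in degree -2. -/
lemma harmonic_2 {x0 y0 x1 y1 x2 y2 : Fin 10 → ℝ}
    (h : IsHarmonic (gpMat x0 y0) (gpMat x1 y1) (gpMat x2 y2) 2) :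
        x0 4 = 0 ∧ x0 6 = 0 ∧ y0 4 = 0 ∧ y0 6 = 0 ∧ x1 2 = 0 ∧ x1 3 = 0 ∧ y1 5 = 0 ∧ y1 7 = 0 ∧
      x2 2 = 0 ∧ x2 3 = 0 ∧ y2 5 = 0 ∧ y2 7 = 0 := by
  obtain ⟨h12, h01, h02, hd⟩ := h
  have q0 := h01 4 2 (by simp [vdeg])
  have q1 := h02 3 1 (by simp [vdeg])
  have q2 := h12 1 2 (by simp [vdeg])
  have q3 := h12 2 1 (by simp [vdeg])
  have q4 := h01 3 1 (by simp [vdeg])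
  have q5 := h02 4 2 (by simp [vdeg])
  have q6 := h01 1 0 (by simp [vdeg])
  have q7 := h02 2 0 (by simp [vdeg])
  have q8 := hd 3 7
  have q9 := hd 4 7
  have q10 := h01 2 0 (by simp [vdeg])
  have q11 := h02 1 0 (by simp [vdeg])
  simp only [Matrix.add_apply, Matrix.sub_apply, Matrix.neg_apply, ad_e_zero, ad_e_one, ad_e_two,
    ad_eCheck_zero, ad_eCheck_one, ad_eCheck_two, adMat_mul, mul_adMat] at q0 q1 q2 q3 q4 q5 q6 q7 q8 q9 q10 q11
  simp [gpMat] at q0 q1 q2 q3 q4 q5 q6 q7 q8 q9 q10 q11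
  refine ⟨?_, ?_, ?_, ?_, ?_, ?_, ?_, ?_, ?_, ?_, ?_, ?_⟩ <;> linarith

lemma harmonic_3 {x0 y0 x1 y1 x2 y2 : Fin 10 → ℝ}
    (h : IsHarmonic (gpMat x0 y0) (gpMat x1 y1) (gpMat x2 y2) 3) :
    x0 2 = 0 ∧ x0 3 = 0 ∧ y0 5 = 0 ∧ y0 7 = 0 ∧ x1 1 = 0 ∧ y1 8 = 0 ∧ x2 1 = 0 ∧ y2 8 = 0 := by
  obtain ⟨h12, h01, h02, hd⟩ := h
  have q0 := h01 2 1 (by simp [vdeg])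
  have q1 := h02 1 2 (by simp [vdeg])
  have q2 := h12 3 6 (by simp [vdeg])
  have q3 := h12 4 5 (by simp [vdeg])
  have q4 := hd 0 5
  have q5 := hd 0 6
  have q6 := h12 0 1 (by simp [vdeg])
  have q7 := h12 0 2 (by simp [vdeg])
  simp only [Matrix.add_apply, Matrix.sub_apply, Matrix.neg_apply, ad_e_zero, ad_e_one, ad_e_two,
    ad_eCheck_zero, ad_eCheck_one, ad_eCheck_two, adMat_mul, mul_adMat] at q0 q1 q2 q3 q4 q5 q6 q7
  simp [gpMat] at q0 q1 q2 q3 q4 q5 q6 q7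
  refine ⟨?_, ?_, ?_, ?_, ?_, ?_, ?_, ?_⟩ <;> linarith

lemma harmonic_4 {x0 y0 x1 y1 x2 y2 : Fin 10 → ℝ}
    (h : IsHarmonic (gpMat x0 y0) (gpMat x1 y1) (gpMat x2 y2) 4) :
    x0 1 = 0 ∧ y0 8 = 0 ∧ x1 0 = 0 ∧ y1 9 = 0 ∧ x2 0 = 0 ∧ y2 9 = 0 := by
  obtain ⟨h12, h01, h02, hd⟩ := h
  have q0 := h01 0 2 (by simp [vdeg])
  have q1 := h02 0 1 (by simp [vdeg])
  have q2 := h12 3 7 (by simp [vdeg])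
  have q3 := h12 4 7 (by simp [vdeg])
  have q4 := h01 4 5 (by simp [vdeg])
  have q5 := h02 3 6 (by simp [vdeg])
  simp only [Matrix.add_apply, Matrix.sub_apply, Matrix.neg_apply, ad_e_zero, ad_e_one, ad_e_two,
    ad_eCheck_zero, ad_eCheck_one, ad_eCheck_two, adMat_mul, mul_adMat] at q0 q1 q2 q3 q4 q5
  simp [gpMat] at q0 q1 q2 q3 q4 q5
  refine ⟨?_, ?_, ?_, ?_, ?_, ?_⟩ <;> linarith

lemma harmonic_5 {x0 y0 x1 y1 x2 y2 : Fin 10 → ℝ}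
    (h : IsHarmonic (gpMat x0 y0) (gpMat x1 y1) (gpMat x2 y2) 5) :
    x0 0 = 0 ∧ y0 9 = 0 := by
  obtain ⟨h12, h01, h02, hd⟩ := h
  have q0 := h12 0 5 (by simp [vdeg])
  have q1 := h12 0 6 (by simp [vdeg])
  simp only [Matrix.add_apply, Matrix.sub_apply, Matrix.neg_apply, ad_e_zero, ad_e_one, ad_e_two,
    ad_eCheck_zero, ad_eCheck_one, ad_eCheck_two, adMat_mul, mul_adMat] at q0 q1
  simp [gpMat] at q0 q1
  refine ⟨?_, ?_⟩ <;> linarith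

/-- The coordinates of an element of `φ^p𝔤^⊥` of degree less than `p` vanish. -/
lemma gpMat_coord_eq_zero {x y : Fin 10 → ℝ} {p : ℤ} (h : gpMat x y ∈ glFil p) :
    (-3 < p → x 9 = 0 ∧ y 0 = 0) ∧ (-2 < p → x 8 = 0 ∧ y 1 = 0) ∧
    (-1 < p → x 5 = 0 ∧ x 7 = 0 ∧ y 2 = 0 ∧ y 3 = 0) ∧
    (0 < p → x 4 = 0 ∧ x 6 = 0 ∧ y 4 = 0 ∧ y 6 = 0) ∧
    (1 < p → x 2 = 0 ∧ x 3 = 0 ∧ y 5 = 0 ∧ y 7 = 0) ∧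
    (2 < p → x 1 = 0 ∧ y 8 = 0) ∧ (3 < p → x 0 = 0 ∧ y 9 = 0) := by
  have key : ∀ i j, vdeg i - vdeg j < p → gpMat x y i j = 0 := h
  refine ⟨fun hp => ?_, fun hp => ?_, fun hp => ?_, fun hp => ?_, fun hp => ?_, fun hp => ?_,
    fun hp => ?_⟩
  · have h1 := key 5 0 (by simpa [vdeg] using hp)
    have h2 := key 6 0 (by simpa [vdeg] using hp)
    simp [gpMat] at h1 h2
    exact ⟨h1, h2⟩
  · have h1 := key 4 0 (by simpa [vdeg] using hp)
    have h2 := key 3 0 (by simpa [vdeg] using hp)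
    simp [gpMat] at h1 h2
    exact ⟨h1, h2⟩
  · have h1 := key 4 2 (by simpa [vdeg] using hp)
    have h2 := key 3 1 (by simpa [vdeg] using hp)
    have h3 := key 1 0 (by simpa [vdeg] using hp)
    have h4 := key 2 0 (by simpa [vdeg] using hp)
    simp [gpMat] at h1 h2 h3 h4
    refine ⟨h1, ?_, h2, ?_⟩ <;> linarith
  · have h1 := key 0 0 (by simpa [vdeg] using hp)
    have h2 := key 2 1 (by simpa [vdeg] using hp)
    have h3 := key 3 3 (by simpa [vdeg] using hp)
    have h4 := key 1 2 (by simpa [vdeg] using hp)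
    simp [gpMat] at h1 h2 h3 h4
    refine ⟨?_, h2, ?_, h4⟩ <;> linarith
  · have h1 := key 3 6 (by simpa [vdeg] using hp)
    have h2 := key 4 5 (by simpa [vdeg] using hp)
    have h3 := key 0 1 (by simpa [vdeg] using hp)
    have h4 := key 0 2 (by simpa [vdeg] using hp)
    simp [gpMat] at h1 h2 h3 h4
    refine ⟨h1, ?_, h2, ?_⟩ <;> linarith
  · have h1 := key 3 7 (by simpa [vdeg] using hp)
    have h2 := key 4 7 (by simpa [vdeg] using hp)
    simp [gpMat] at h1 h2
    exact ⟨h1, h2⟩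
  · have h1 := key 0 6 (by simpa [vdeg] using hp)
    have h2 := key 0 5 (by simpa [vdeg] using hp)
    simp [gpMat] at h1 h2
    exact ⟨h1, h2⟩

lemma gpMat_mem_glFil {x y : Fin 10 → ℝ} {p : ℤ} (h3 : -3 < p → x 9 = 0 ∧ y 0 = 0)
    (h2 : -2 < p → x 8 = 0 ∧ y 1 = 0) (h1 : -1 < p → x 5 = 0 ∧ x 7 = 0 ∧ y 2 = 0 ∧ y 3 = 0)
    (h0 : 0 < p → x 4 = 0 ∧ x 6 = 0 ∧ y 4 = 0 ∧ y 6 = 0)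
    (k1 : 1 < p → x 2 = 0 ∧ x 3 = 0 ∧ y 5 = 0 ∧ y 7 = 0)
    (k2 : 2 < p → x 1 = 0 ∧ y 8 = 0) (k3 : 3 < p → x 0 = 0 ∧ y 9 = 0) :
    gpMat x y ∈ glFil p := by
  intro i j h
  fin_cases i <;> fin_cases j <;> simp [vdeg] at h <;> simp [gpMat] <;> grind


/-! ### Symmetry algebras at a point -/

/-- `H ⊆ 𝔩` is a Lie algebra, contained in the graph of the normal cochain `χ`, which projects
onto `𝔤/𝔤⁰`. -/
structure AlgData (H : Submodule ℝ M8) (χ : gMinus →ₗ[ℝ] M8) : Prop where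
  perp : ∀ X, χ X ∈ gPerp
  normal : IsNormal χ
  graph : ∀ w ∈ H, ∃ Y ∈ sl3, w = ad Y + χ (lowerPart Y)
  trans : ∀ Y ∈ sl3, ∃ Z ∈ gZero, ad (Y - Z) + χ (lowerPart Y) ∈ H
  lie : ∀ B ∈ H, ∀ C ∈ H, B * C - C * B ∈ H

lemma lowerPart_eq (X : M3) : lowerPart X =
    X 2 0 • lowerPart (e 0) + X 1 0 • lowerPart (e 1) + X 2 1 • lowerPart (e 2) := by
  ext i j
  fin_cases i <;> fin_cases j <;> simp [lowerPart, e, E]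

lemma map_lowerPart (χ : gMinus →ₗ[ℝ] M8) (X : M3) : χ (lowerPart X) =
    X 2 0 • χ (lowerPart (e 0)) + X 1 0 • χ (lowerPart (e 1)) + X 2 1 • χ (lowerPart (e 2)) := by
  rw [lowerPart_eq, map_add, map_add, map_smul, map_smul, map_smul]

lemma lowerPart_coe (X : gMinus) : lowerPart X.1 = X := by
  ext i j
  by_cases h : j < i
  · simp [lowerPart, h]
  · simp [lowerPart, h, X.2 i j (not_lt.mp h)]

lemma lowerPart_of_mem {X : M3} (hX : X ∈ mFil 0) : lowerPart X = 0 := by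
  rw [lowerPart_eq, hX 2 0 (by simp), hX 1 0 (by simp), hX 2 1 (by simp)]
  simp

/-- The degrees of `e₀, e₁, e₂`. -/
def edeg : Fin 3 → ℤ := ![-2, -1, -1]

lemma e_mem_sl3 (i : Fin 3) : e i ∈ sl3 := by
  fin_cases i <;> exact E_mem_sl3 (by decide)

lemma e_mem_gr (i : Fin 3) : e i ∈ gr (edeg i) := by
  refine ⟨e_mem_sl3 i, fun a b h => ?_⟩
  fin_cases i <;> fin_cases a <;> fin_cases b <;> simp [edeg] at h <;> simp [e, E]

lemma gr_le_mFil {p : ℤ} {X : M3} (hX : X ∈ gr p) : X ∈ mFil p := fun i j h => hX.2 i j h.ne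

lemma e_mem_mFil (i : Fin 3) : e i ∈ mFil (edeg i) := gr_le_mFil (e_mem_gr i)

lemma edeg_neg (i : Fin 3) : edeg i ≤ -1 := by fin_cases i <;> simp [edeg]

lemma gPerp_add_mem_glFil {Q : M8} (hQ : Q ∈ gPerp) {Z : M3} (hZ : Z ∈ sl3) {m : ℤ}
    (h : Q + ad Z ∈ glFil m) : Z ∈ mFil m ∧ Q ∈ glFil m := by
  have h1 := mFil_of_add_mem hQ hZ h
  refine ⟨h1, ?_⟩
  simpa using sub_mem h (ad_mem_glFil h1)

namespace AlgData

variable {H : Submodule ℝ M8} {χ : gMinus →ₗ[ℝ] M8}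

/-- A lift of `eᵢ`. -/
lemma exists_lift (h : AlgData H χ) (i : Fin 3) :
    ∃ Z ∈ gZero, ad (e i - Z) + χ (lowerPart (e i)) ∈ H := h.trans _ (e_mem_sl3 i)

lemma map_mem_glFil {k : ℤ} (hk : ∀ i, χ (lowerPart (e i)) ∈ glFil (edeg i + k)) {p : ℤ}
    {X : M3} (hX : X ∈ mFil p) : χ (lowerPart X) ∈ glFil (p + k) := by
  rw [map_lowerPart]
  refine add_mem (add_mem ?_ ?_) ?_
  · by_cases hp : p ≤ -2
    · exact Submodule.smul_mem _ _ (glFil_mono (by simp [edeg]; omega) (hk 0))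
    · rw [hX 2 0 (by simp; omega), zero_smul]; exact zero_mem _
  · by_cases hp : p ≤ -1
    · exact Submodule.smul_mem _ _ (glFil_mono (by simp [edeg]; omega) (hk 1))
    · rw [hX 1 0 (by simp; omega), zero_smul]; exact zero_mem _
  · by_cases hp : p ≤ -1
    · exact Submodule.smul_mem _ _ (glFil_mono (by simp [edeg]; omega) (hk 2))
    · rw [hX 2 1 (by simp; omega), zero_smul]; exact zero_mem _

/-- The leading part of the structure function is closed. -/
lemma closed (h : AlgData H χ) {k : ℤ} (h1 : 1 ≤ k)
    (hk : ∀ i, χ (lowerPart (e i)) ∈ glFil (edeg i + k)) (i j : Fin 3) :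
    χ (lowerPart (e i * e j - e j * e i)) -
      (ad (e i) * χ (lowerPart (e j)) - χ (lowerPart (e j)) * ad (e i)) +
      (ad (e j) * χ (lowerPart (e i)) - χ (lowerPart (e i)) * ad (e j)) ∈
    glFil (edeg i + edeg j + k + 1) := by
  obtain ⟨Zi, hZi, hHi⟩ := h.exists_lift i
  obtain ⟨Zj, hZj, hHj⟩ := h.exists_lift j
  rw [mem_gZero_iff] at hZi hZj
  obtain ⟨W, hW, hWe⟩ := h.graph _ (h.lie _ hHi _ hHj)
  set ci := χ (lowerPart (e i)) with hci
  set cj := χ (lowerPart (e j)) with hcj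
  set ai := e i - Zi with hai
  set aj := e j - Zj with haj
  have hi := edeg_neg i
  have hj := edeg_neg j
  have hQ : χ (lowerPart W) - (ad ai * cj - cj * ad ai) + (ad aj * ci - ci * ad aj) ∈ gPerp :=
    add_mem (sub_mem (h.perp _) (gPerp_bracket (h.perp _) _)) (gPerp_bracket (h.perp _) _)
  have hV : W - (ai * aj - aj * ai) ∈ sl3 := sub_mem hW (bracket_mem_sl3 _ _)
  -- Separating in the bracket of two lifts the part linear in χ, the right side is quadratic in χ.
  -- It has degree at least 2k relative to eᵢ, eⱼ, hence at least k + 1, and since the filtration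
  -- respects 𝔤 ⊕ 𝔤^⊥ the 𝔤- and 𝔤^⊥-parts on the left are separately negligible.
  have hsum : (χ (lowerPart W) - (ad ai * cj - cj * ad ai) + (ad aj * ci - ci * ad aj)) +
      ad (W - (ai * aj - aj * ai)) = ci * cj - cj * ci := by
    rw [ad_sub W, ad_bracket ai aj]
    have : χ (lowerPart W) = (ad ai + ci) * (ad aj + cj) - (ad aj + cj) * (ad ai + ci) - ad W := by
      rw [hWe]; abel
    rw [this]
    noncomm_ring
  have hCC : ci * cj - cj * ci ∈ glFil (edeg i + edeg j + k + 1) :=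
    glFil_mono (by omega) (glFil_bracket (hk i) (hk j))
  obtain ⟨hV2, hQ2⟩ := gPerp_add_mem_glFil hQ hV (by rw [hsum]; exact hCC)
  -- The corrections Zᵢ, Zⱼ have degree at least 0, so replacing the lifts by eᵢ, eⱼ changes the
  -- bracket only from one degree higher on.
  have haim : ai * aj - aj * ai - (e i * e j - e j * e i) ∈ mFil (edeg i + edeg j + 1) := by
    have h2 := mFil_bracket (e_mem_mFil i) hZj.2
    have h3 := mFil_bracket hZi.2 (e_mem_mFil j)
    have h4 := mFil_bracket hZi.2 hZj.2
    have h5 := sub_mem (sub_mem (mFil_mono (by omega : edeg i + edeg j + 1 ≤ 0 + 0) h4)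
      (mFil_mono (by omega : edeg i + edeg j + 1 ≤ edeg i + 0) h2))
      (mFil_mono (by omega : edeg i + edeg j + 1 ≤ 0 + edeg j) h3)
    convert h5 using 1
    rw [hai, haj]; noncomm_ring
  have hχ : χ (lowerPart W) - χ (lowerPart (e i * e j - e j * e i)) ∈
      glFil (edeg i + edeg j + k + 1) := by
    rw [← map_sub, ← map_sub]
    have h6 : W - (e i * e j - e j * e i) ∈ mFil (edeg i + edeg j + 1) := by
      have := add_mem (mFil_mono (by omega : edeg i + edeg j + 1 ≤ edeg i + edeg j + k + 1) hV2)
        haim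
      convert this using 1; abel
    have := map_mem_glFil hk h6
    convert this using 2; ring
  have hbi : ad Zi * cj - cj * ad Zi ∈ glFil (edeg i + edeg j + k + 1) :=
    glFil_mono (by omega) (glFil_bracket (ad_mem_glFil hZi.2) (hk j))
  have hbj : ad Zj * ci - ci * ad Zj ∈ glFil (edeg i + edeg j + k + 1) :=
    glFil_mono (by omega) (glFil_bracket (ad_mem_glFil hZj.2) (hk i))
  have := add_mem (sub_mem (sub_mem hQ2 hχ) hbi) hbj
  convert this using 1
  rw [hai, haj, ad_sub, ad_sub]
  noncomm_ring

lemma isHarmonic (h : AlgData H χ) {k : ℤ} (h1 : 1 ≤ k)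
    (hk : ∀ i, χ (lowerPart (e i)) ∈ glFil (edeg i + k)) :
    IsHarmonic (χ (lowerPart (e 0))) (χ (lowerPart (e 1))) (χ (lowerPart (e 2))) k := by
  have e12 : e 1 * e 2 - e 2 * e 1 = -e 0 := by
    ext a b; fin_cases a <;> fin_cases b <;> simp [e, E]
  have e01 : e 0 * e 1 - e 1 * e 0 = 0 := by
    ext a b; fin_cases a <;> fin_cases b <;> simp [e, E]
  have e02 : e 0 * e 2 - e 2 * e 0 = 0 := by
    ext a b; fin_cases a <;> fin_cases b <;> simp [e, E]
  refine ⟨fun i j hij => ?_, fun i j hij => ?_, fun i j hij => ?_, fun i j => ?_⟩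
  · have := h.closed h1 hk 1 2
    rw [e12, map_neg, map_neg] at this
    exact this i j (by simp [edeg]; omega)
  · have := h.closed h1 hk 0 1
    rw [e01, map_zero, map_zero, zero_sub] at this
    exact this i j (by simp [edeg]; omega)
  · have := h.closed h1 hk 0 2
    rw [e02, map_zero, map_zero, zero_sub] at this
    exact this i j (by simp [edeg]; omega)
  · have := h.normal.2
    rw [codiff, Fin.sum_univ_three] at this
    simp only [Ring.lie_def] at this
    rw [this]; rfl

end AlgData

/-- The coordinates of a cochain all of whose components of degree `1` vanish, except for the
coefficients of `ξ₁^R` and `ξ₁^S`. -/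
structure Leading (x0 y0 x1 y1 x2 y2 : Fin 10 → ℝ) : Prop where
  neg0 : x0 9 = 0 ∧ y0 0 = 0 ∧ x0 8 = 0 ∧ y0 1 = 0 ∧ x0 5 = 0 ∧ x0 7 = 0 ∧ y0 2 = 0 ∧ y0 3 = 0
  neg1 : x1 9 = 0 ∧ y1 0 = 0 ∧ x1 8 = 0 ∧ y1 1 = 0 ∧ x1 5 = 0 ∧ x1 7 = 0 ∧ y1 2 = 0 ∧ y1 3 = 0
  neg2 : x2 9 = 0 ∧ y2 0 = 0 ∧ x2 8 = 0 ∧ y2 1 = 0 ∧ x2 5 = 0 ∧ x2 7 = 0 ∧ y2 2 = 0 ∧ y2 3 = 0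
  zero1 : x1 4 = 0 ∧ x1 6 = 0 ∧ y1 4 = 0
  zero2 : x2 4 = 0 ∧ y2 4 = 0 ∧ y2 6 = 0

lemma gpMat_eq_zero {x y : Fin 10 → ℝ} (hx : ∀ i, x i = 0) (hy : ∀ i, y i = 0) :
    gpMat x y = 0 := by
  ext i j; fin_cases i <;> fin_cases j <;> simp [gpMat, hx, hy]

lemma mem_glFil_edeg {χ : gMinus →ₗ[ℝ] M8} {k : ℤ} (h0 : χ (lowerPart (e 0)) ∈ glFil (k - 2))
    (h1 : χ (lowerPart (e 1)) ∈ glFil (k - 1)) (h2 : χ (lowerPart (e 2)) ∈ glFil (k - 1)) (i : Fin 3) :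
    χ (lowerPart (e i)) ∈ glFil (edeg i + k) := by
  fin_cases i
  · exact glFil_mono (by simp [edeg]) h0
  · exact glFil_mono (by simp [edeg]) h1
  · exact glFil_mono (by simp [edeg]) h2

-- Descent through the degrees: once all components below degree k vanish, the one of degree k is
-- harmonic by `AlgData.isHarmonic`. If the two free coefficients in degree 1 vanish, the absence of
-- harmonic cochains in degrees 2 to 5 exhausts χ.
set_option maxHeartbeats 1000000 in
lemma AlgData.exists_leading {H : Submodule ℝ M8} {χ : gMinus →ₗ[ℝ] M8} (h : AlgData H χ) :
    ∃ x0 y0 x1 y1 x2 y2 : Fin 10 → ℝ, χ (lowerPart (e 0)) = gpMat x0 y0 ∧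
      χ (lowerPart (e 1)) = gpMat x1 y1 ∧ χ (lowerPart (e 2)) = gpMat x2 y2 ∧
      Leading x0 y0 x1 y1 x2 y2 ∧ (x2 6 = 0 → y1 6 = 0 → χ = 0) := by
  obtain ⟨x0, y0, h0⟩ := exists_gpMat (h.perp (lowerPart (e 0)))
  obtain ⟨x1, y1, h1⟩ := exists_gpMat (h.perp (lowerPart (e 1)))
  obtain ⟨x2, y2, h2⟩ := exists_gpMat (h.perp (lowerPart (e 2)))
  have hk1 : ∀ i, χ (lowerPart (e i)) ∈ glFil (edeg i + 1) := fun i =>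
    h.normal.1 _ (by have := edeg_neg i; omega) _ (e_mem_gr i)
  have H1 := h.isHarmonic le_rfl hk1
  rw [h0, h1, h2] at H1
  obtain ⟨a1, a2, a3, a4, a5, a6, a7, a8, a9, a10⟩ := harmonic_1 H1
  have g0 := hk1 0
  have g1 := hk1 1
  have g2 := hk1 2
  rw [h0] at g0; rw [h1] at g1; rw [h2] at g2
  simp only [edeg, Matrix.cons_val] at g0 g1 g2
  norm_num at g0 g1 g2
  obtain ⟨m03, m02, -⟩ := gpMat_coord_eq_zero g0
  obtain ⟨m13, m12, m11, -⟩ := gpMat_coord_eq_zero g1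
  obtain ⟨m23, m22, m21, -⟩ := gpMat_coord_eq_zero g2
  norm_num at m03 m02 m13 m12 m11 m23 m22 m21
  obtain ⟨m11, m11', m11'', m11'''⟩ := m11
  obtain ⟨m21, m21', m21'', m21'''⟩ := m21
  refine ⟨x0, y0, x1, y1, x2, y2, h0, h1, h2, ⟨?_, ?_, ?_, ?_, ?_⟩, fun hα hβ => ?_⟩
  · exact ⟨m03.1, m03.2, m02.1, m02.2, a1, a2, a3, a4⟩
  · exact ⟨m13.1, m13.2, m12.1, m12.2, m11, m11', m11'', m11'''⟩
  · exact ⟨m23.1, m23.2, m22.1, m22.2, m21, m21', m21'', m21'''⟩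
  · exact ⟨a5, a6, a7⟩
  · exact ⟨a8, a9, a10⟩
  have hk2 : ∀ i, χ (lowerPart (e i)) ∈ glFil (edeg i + 2) :=
    mem_glFil_edeg (by rw [h0]; apply gpMat_mem_glFil <;> simp [*])
      (by rw [h1]; apply gpMat_mem_glFil <;> simp [*]) (by rw [h2]; apply gpMat_mem_glFil <;> simp [*])
  have H2 := h.isHarmonic (by norm_num) hk2
  rw [h0, h1, h2] at H2
  have b := harmonic_2 H2
  have hk3 : ∀ i, χ (lowerPart (e i)) ∈ glFil (edeg i + 3) :=
    mem_glFil_edeg (by rw [h0]; apply gpMat_mem_glFil <;> simp [*])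
      (by rw [h1]; apply gpMat_mem_glFil <;> simp [*]) (by rw [h2]; apply gpMat_mem_glFil <;> simp [*])
  have H3 := h.isHarmonic (by norm_num) hk3
  rw [h0, h1, h2] at H3
  have c := harmonic_3 H3
  have hk4 : ∀ i, χ (lowerPart (e i)) ∈ glFil (edeg i + 4) :=
    mem_glFil_edeg (by rw [h0]; apply gpMat_mem_glFil <;> simp [*])
      (by rw [h1]; apply gpMat_mem_glFil <;> simp [*]) (by rw [h2]; apply gpMat_mem_glFil <;> simp [*])
  have H4 := h.isHarmonic (by norm_num) hk4
  rw [h0, h1, h2] at H4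
  have d := harmonic_4 H4
  have hk5 : ∀ i, χ (lowerPart (e i)) ∈ glFil (edeg i + 5) :=
    mem_glFil_edeg (by rw [h0]; apply gpMat_mem_glFil <;> simp [*])
      (by rw [h1]; apply gpMat_mem_glFil <;> simp [*]) (by rw [h2]; apply gpMat_mem_glFil <;> simp [*])
  have H5 := h.isHarmonic (by norm_num) hk5
  rw [h0, h1, h2] at H5
  have f := harmonic_5 H5
  have z0 : χ (lowerPart (e 0)) = 0 := by
    rw [h0]; apply gpMat_eq_zero <;> intro i <;> fin_cases i <;> simp [*]
  have z1 : χ (lowerPart (e 1)) = 0 := by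
    rw [h1]; apply gpMat_eq_zero <;> intro i <;> fin_cases i <;> simp [*]
  have z2 : χ (lowerPart (e 2)) = 0 := by
    rw [h2]; apply gpMat_eq_zero <;> intro i <;> fin_cases i <;> simp [*]
  ext X : 1
  rw [← lowerPart_coe X, map_lowerPart, z0, z1, z2]
  simp


/-! ### Isotropy -/

/-- The upper triangular traceless matrix with given coordinates. -/
def upper (c p q s t : ℝ) : M3 := toM ![c, p, q, s, t, 0, 0, 0]

lemma upper_mem (c p q s t : ℝ) : upper c p q s t ∈ gZero := by
  refine ⟨toM_mem _, fun i j h => ?_⟩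
  fin_cases i <;> fin_cases j <;> simp at h <;> simp [upper, toM]

lemma eq_upper {Y : M3} (h : Y ∈ gZero) :
    Y = upper (Y 0 2) (Y 0 1) (Y 1 2) (Y 0 0) (-Y 2 2) := by
  have h3 := h.1
  rw [mem_sl3_iff] at h3
  have h1 := h.2
  ext i j
  fin_cases i <;> fin_cases j <;> simp [upper, toM] <;>
    first | exact h1 _ _ (by simp) | linarith

lemma bracket_toM (v w : Fin 8 → ℝ) :
    toM v * toM w - toM w * toM v = toM (adMat v *ᵥ w) := by
  rw [← ad_toM, toM_ad_mulVec]

lemma smul_e_two (c : ℝ) : c • e 2 = toM ![0, 0, 0, 0, 0, c, 0, 0] := by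
  rw [e_two, ← toM_smul]; simp

lemma smul_e_one (c : ℝ) : c • e 1 = toM ![0, 0, 0, 0, 0, 0, c, 0] := by
  rw [e_one, ← toM_smul]; simp

namespace AlgData

variable {H : Submodule ℝ M8} {χ : gMinus →ₗ[ℝ] M8}

/-- The structure function is invariant under the isotropy algebra. -/
lemma invariant (h : AlgData H χ) {Y : M3} (hY : Y ∈ gZero) (hYH : ad Y ∈ H) {i : Fin 3} {Z : M3}
    (hZ : Z ∈ gZero) (hZH : ad (e i - Z) + χ (lowerPart (e i)) ∈ H) :
    ad Y * χ (lowerPart (e i)) - χ (lowerPart (e i)) * ad Y =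
      χ (lowerPart (Y * e i - e i * Y)) ∧
    ad (Y * (e i - Z) - (e i - Z) * Y) + χ (lowerPart (Y * e i - e i * Y)) ∈ H := by
  have h1 := h.lie _ hYH _ hZH
  have e1 : ad Y * (ad (e i - Z) + χ (lowerPart (e i))) -
      (ad (e i - Z) + χ (lowerPart (e i))) * ad Y = ad (Y * (e i - Z) - (e i - Z) * Y) +
      (ad Y * χ (lowerPart (e i)) - χ (lowerPart (e i)) * ad Y) := by
    rw [ad_bracket]; noncomm_ring
  obtain ⟨W, hW, hWe⟩ := h.graph _ h1
  have h2 := graph_unique (gPerp_bracket (h.perp _) Y) (h.perp _) (bracket_mem_sl3 _ _) hW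
    (e1.symm.trans hWe)
  -- The correction Z contributes only [Y, Z], which lies in 𝔤⁰ and is not seen by χ.
  have h3 : lowerPart W = lowerPart (Y * e i - e i * Y) := by
    rw [mem_gZero_iff] at hY hZ
    rw [← h2.1, ← sub_eq_zero, ← map_sub]
    refine lowerPart_of_mem ?_
    have := neg_mem (mFil_bracket hY.2 hZ.2)
    rw [add_zero] at this
    convert this using 1
    noncomm_ring
  have h4 := h2.2
  rw [h3] at h4
  refine ⟨h4, ?_⟩
  rw [← h4, ← e1]
  exact h1

lemma bracket_upper_e_two (c p q s t : ℝ) :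
    upper c p q s t * e 2 - e 2 * upper c p q s t = upper 0 c 0 0 q + (s - 2 * t) • e 2 := by
  rw [smul_e_two, e_two, upper, upper, bracket_toM, ← toM_add]
  congr 1; ext i; rw [mulVec_eight]
  fin_cases i <;> simp [adMat]

lemma bracket_upper_e_one (c p q s t : ℝ) :
    upper c p q s t * e 1 - e 1 * upper c p q s t = upper 0 0 (-c) p 0 + (t - 2 * s) • e 1 := by
  rw [smul_e_one, e_one, upper, upper, bracket_toM, ← toM_add]
  congr 1; ext i; rw [mulVec_eight]
  fin_cases i <;> simp [adMat]
  ring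

lemma upper_mem_mFil (c p q s t : ℝ) : upper c p q s t ∈ mFil 0 :=
  (mem_gZero_iff.mp (upper_mem c p q s t)).2

lemma map_bracket_upper_e_two (c p q s t : ℝ) :
    χ (lowerPart (upper c p q s t * e 2 - e 2 * upper c p q s t)) =
      (s - 2 * t) • χ (lowerPart (e 2)) := by
  rw [bracket_upper_e_two, map_add, lowerPart_of_mem (upper_mem_mFil _ _ _ _ _), zero_add, map_smul,
    map_smul]

lemma map_bracket_upper_e_one (c p q s t : ℝ) :
    χ (lowerPart (upper c p q s t * e 1 - e 1 * upper c p q s t)) =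
      (t - 2 * s) • χ (lowerPart (e 1)) := by
  rw [bracket_upper_e_one, map_add, lowerPart_of_mem (upper_mem_mFil _ _ _ _ _), zero_add, map_smul,
    map_smul]

/-- The weights of `ξ₁^R` and `ξ₁^S` vanish on the isotropy algebra. -/
lemma isotropy_weight (h : AlgData H χ) {c p q s t : ℝ} (hH : ad (upper c p q s t) ∈ H) :
    (5 * t - 4 * s) * χ (lowerPart (e 2)) 2 1 = 0 ∧
    (5 * s - 4 * t) * χ (lowerPart (e 1)) 1 2 = 0 ∧
    (s = 0 → t = 0 → p * χ (lowerPart (e 2)) 2 1 = 0) := by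
  obtain ⟨x0, y0, x1, y1, x2, y2, h0, h1, h2, hl, -⟩ := h.exists_leading
  obtain ⟨Z1, hZ1, hZH1⟩ := h.exists_lift 1
  obtain ⟨Z2, hZ2, hZH2⟩ := h.exists_lift 2
  have i1 := (h.invariant (upper_mem _ _ _ _ _) hH hZ1 hZH1).1
  have i2 := (h.invariant (upper_mem _ _ _ _ _) hH hZ2 hZH2).1
  rw [map_bracket_upper_e_one, h1] at i1
  rw [map_bracket_upper_e_two, h2] at i2
  rw [h1, h2]
  rw [upper, ad_toM] at i1 i2
  obtain ⟨a1, a2, a3, a4, a5, a6, a7, a8⟩ := hl.neg1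
  obtain ⟨b1, b2, b3, b4, b5, b6, b7, b8⟩ := hl.neg2
  -- Entries (1,2) and (2,1) carry the coefficients of ξ₁^S and ξ₁^R, so they compare weights.
  -- Entries (3,5) and (0,1) lie one degree higher, where the E₁₂-component p enters.
  have j1 := congrFun (congrFun i1 1) 2
  have j2 := congrFun (congrFun i2 2) 1
  have j3 := congrFun (congrFun i2 3) 5
  have j4 := congrFun (congrFun i2 0) 1
  rw [Matrix.sub_apply, adMat_mul, mul_adMat, Matrix.smul_apply] at j1 j2 j3 j4
  simp [gpMat] at j1 j2 j3 j4 ⊢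
  obtain ⟨d1, d2, d3⟩ := hl.zero1
  obtain ⟨c1, c2, c3⟩ := hl.zero2
  simp only [a1, a2, a3, a4, a5, a6, a7, a8, b1, b2, b3, b4, b5, b6, b7, b8, d1, d2, d3, c1, c2,
    c3] at j1 j2 j3 j4
  refine ⟨?_, ?_, ?_⟩
  · by_contra hne
    push Not at hne
    apply hne.1
    have : (5 * t - 4 * s) * x2 6 = 0 := by linarith
    exact (mul_eq_zero.mp this).resolve_right hne.2
  · by_contra hne
    push Not at hne
    apply hne.1
    have : (5 * s - 4 * t) * y1 6 = 0 := by linarith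
    exact (mul_eq_zero.mp this).resolve_right hne.2
  · intro hs ht
    subst hs ht
    have : p * x2 6 = 0 := by linarith
    exact mul_eq_zero.mp this

/-- If the coefficient of `ξ₁^R` does not vanish, no nilpotent element lies in the isotropy
algebra. -/
lemma isotropy_nilpotent (h : AlgData H χ) (hα : χ (lowerPart (e 2)) 2 1 ≠ 0) {c p q s t : ℝ}
    (hH : ad (upper c p q s t) ∈ H) (hs : s = 0) : c = 0 ∧ p = 0 ∧ q = 0 ∧ t = 0 := by
  subst hs
  obtain ⟨Z2, hZ2, hZH2⟩ := h.exists_lift 2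
  have ht : t = 0 := by
    have := (mul_eq_zero.mp (h.isotropy_weight hH).1).resolve_right hα; linarith
  subst ht
  have hp : p = 0 := (mul_eq_zero.mp ((h.isotropy_weight hH).2.2 rfl rfl)).resolve_right hα
  subst hp
  have i2 := (h.invariant (upper_mem _ _ _ _ _) hH hZ2 hZH2).2
  rw [map_bracket_upper_e_two, mul_zero, sub_zero, zero_smul, add_zero] at i2
  have key : upper c 0 q 0 0 * (e 2 - Z2) - (e 2 - Z2) * upper c 0 q 0 0 =
      upper (q * Z2 0 1 + c * Z2 0 0 - c * Z2 2 2) c (-(q * Z2 0 0) - 2 * q * Z2 2 2) 0 q := by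
    have h1 : e 2 - Z2 = toM ![-Z2 0 2, -Z2 0 1, -Z2 1 2, -Z2 0 0, Z2 2 2, 1, 0, 0] := by
      conv_lhs => rw [eq_upper hZ2, upper, e_two, sub_eq_add_neg, ← neg_one_smul ℝ (toM _),
        ← toM_smul, ← toM_add]
      simp
    rw [h1, upper, upper, bracket_toM]
    congr 1; ext i; rw [mulVec_eight]
    fin_cases i <;> simp [adMat] <;> ring
  rw [key] at i2
  have hq : q = 0 := by
    have := (mul_eq_zero.mp (h.isotropy_weight i2).1).resolve_right hα; linarith
  subst hq
  exact ⟨(mul_eq_zero.mp ((h.isotropy_weight i2).2.2 rfl rfl)).resolve_right hα, rfl, rfl, rfl⟩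

end AlgData

/-! ### The normal form -/

lemma ad_e_one_mulVec (v : Fin 8 → ℝ) :
    ad (e 1) *ᵥ v = ![0, 0, v 0, -v 1, 0, 0, 2 * v 3 - v 4, -v 5] := by
  rw [e_one, ad_toM]
  ext i; rw [mulVec_eight]; fin_cases i <;> simp [adMat]
  ring

lemma R21_mulVec (v : Fin 8 → ℝ) : R21 *ᵥ v = ![v 6, -v 7, 0, 0, 0, 0, 0, 0] := by
  rw [R21, Matrix.sub_mulVec, Matrix.single_mulVec, Matrix.single_mulVec]
  ext i; fin_cases i <;> simp

lemma Rm11_mulVec (v : Fin 8 → ℝ) : Rm11 *ᵥ v = ![0, 0, -6 * v 1, 0, 0, 0, 6 * v 5, 0] := by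
  simp only [Rm11, Ring.lie_def, Matrix.sub_mulVec, ← Matrix.mulVec_mulVec, ad_e_one_mulVec,
    R21_mulVec]
  ext i; simp only [Pi.sub_apply]
  fin_cases i <;> simp <;> ring

lemma Rm11_eq : Rm11 = gpMat ![0, 0, 0, 0, 0, 0, 6, 0, 0, 0] 0 := by
  refine ext_mulVec fun v => ?_
  rw [Rm11_mulVec]
  ext i; rw [mulVec_eight]; fin_cases i <;> simp [gpMat]

lemma torus_eq : (5 : ℝ) • H1 + (4 : ℝ) • H2 = upper 0 0 0 5 4 := by
  ext i j; fin_cases i <;> fin_cases j <;> simp [H1, H2, E, upper, toM]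
  norm_num

lemma adMat_torus : adMat ![0, 0, 0, 5, 4, 0, 0, 0] =
    Matrix.diagonal ![9, 6, 3, 0, 0, -3, -6, -9] := by
  ext i j
  fin_cases i <;> fin_cases j <;> simp [adMat] <;> norm_num

lemma adMat_torus_bracket (B : M8) (i j : Fin 8) :
    (adMat ![0, 0, 0, 5, 4, 0, 0, 0] * B - B * adMat ![0, 0, 0, 5, 4, 0, 0, 0]) i j =
      (![9, 6, 3, 0, 0, -3, -6, -9] i - ![9, 6, 3, 0, 0, -3, -6, -9] j) * B i j := by
  rw [adMat_torus, Matrix.sub_apply, Matrix.diagonal_mul, Matrix.mul_diagonal]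
  ring

lemma conjInv_ad {b : M3} (hb : IsUnit b.det) (X : M3) :
    conjInv (Ad b) (ad X) = ad (b⁻¹ * X * b) := by
  have h := Ad_ad (isUnit_det_inv hb) X
  rw [← Ad_inv hb, Matrix.nonsing_inv_nonsing_inv _ (det_sq_of_mem_L (Ad_mem_L hb)),
    Matrix.nonsing_inv_nonsing_inv _ hb] at h
  exact h

lemma conjInv_mul {a c B : M8} : conjInv (a * c) B = conjInv c (conjInv a B) := by
  simp only [conjInv, LinearMap.coe_mk, AddHom.coe_mk, Matrix.mul_inv_rev]
  noncomm_ring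

lemma map_conjInv_mul (a c : M8) (H : Submodule ℝ M8) :
    H.map (conjInv (a * c)) = (H.map (conjInv a)).map (conjInv c) := by
  rw [← Submodule.map_comp]
  congr 1
  exact LinearMap.ext fun B => conjInv_mul

lemma conjInv_one : conjInv 1 = LinearMap.id := by
  ext1 B; simp [conjInv]

lemma isUnit_of_GZero {b : M3} (hb : b ∈ GZero) : IsUnit b.det := by rw [hb.1]; exact isUnit_one

/-- The coordinates of a weight vector for the grading element `5H₁ + 4H₂` of negative weight. -/
lemma gpMat_coord_of_weight {x y : Fin 10 → ℝ} {w : ℝ} (hw : w < 0)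
    (k : ∀ a b, ![9, 6, 3, 0, 0, -3, -6, -9] a - ![9, 6, 3, 0, 0, -3, -6, -9] b ≠ w →
      gpMat x y a b = 0) :
    (x 0 = 0 ∧ x 1 = 0 ∧ x 2 = 0 ∧ x 3 = 0 ∧ x 4 = 0 ∧ y 4 = 0 ∧ y 5 = 0 ∧ y 6 = 0 ∧ y 7 = 0 ∧
      y 8 = 0 ∧ y 9 = 0) ∧ (w ≠ -3 → x 6 = 0) := by
  have k' : ∀ a b, 0 ≤ ![(9 : ℝ), 6, 3, 0, 0, -3, -6, -9] a - ![9, 6, 3, 0, 0, -3, -6, -9] b →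
      gpMat x y a b = 0 := fun a b hab => k a b (by linarith)
  have g1 := k' 0 0 (by simp)
  have g2 := k' 3 3 (by simp)
  have g3 := k' 1 2 (by simp; norm_num)
  have g4 := k' 3 6 (by simp)
  have g5 := k' 4 5 (by simp)
  have g6 := k' 0 1 (by simp; norm_num)
  have g7 := k' 0 2 (by simp; norm_num)
  have g8 := k' 3 7 (by simp)
  have g9 := k' 4 7 (by simp)
  have g10 := k' 0 6 (by simp; norm_num)
  have g11 := k' 0 5 (by simp; norm_num)
  simp [gpMat] at g1 g2 g3 g4 g5 g6 g7 g8 g9 g10 g11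
  refine ⟨by grind, fun hw3 => ?_⟩
  have g12 := k 2 1 (by simp; intro h; apply hw3; linarith)
  simpa [gpMat] using g12

namespace AlgData

variable {H : Submodule ℝ M8} {χ : gMinus →ₗ[ℝ] M8}

/-- The structure function is an eigenvector of the isotropy. -/
lemma weight_eq_zero (h : AlgData H χ) (hT : ad (upper 0 0 0 5 4) ∈ H) {i : Fin 3} {w : ℝ}
    (hw : upper 0 0 0 5 4 * e i - e i * upper 0 0 0 5 4 = w • e i) (a b : Fin 8)
    (hne : ![9, 6, 3, 0, 0, -3, -6, -9] a - ![9, 6, 3, 0, 0, -3, -6, -9] b ≠ w) :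
    χ (lowerPart (e i)) a b = 0 := by
  obtain ⟨Z, hZ, hZH⟩ := h.exists_lift i
  have h1 := (h.invariant (upper_mem _ _ _ _ _) hT hZ hZH).1
  rw [hw, map_smul, map_smul, upper, ad_toM] at h1
  have h2 := congrFun (congrFun h1 a) b
  rw [adMat_torus_bracket, Matrix.smul_apply, smul_eq_mul] at h2
  have h3 : (![9, 6, 3, 0, 0, -3, -6, -9] a - ![9, 6, 3, 0, 0, -3, -6, -9] b - w) *
      χ (lowerPart (e i)) a b = 0 := by linarith
  exact (mul_eq_zero.mp h3).resolve_left (sub_ne_zero.mpr hne)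

lemma upper_zero : upper 0 0 0 0 0 = 0 := by
  ext i j; fin_cases i <;> fin_cases j <;> simp [upper, toM]

lemma torus_e (i : Fin 3) : upper 0 0 0 5 4 * e i - e i * upper 0 0 0 5 4 =
    (![-9, -6, -3] i : ℝ) • e i := by
  fin_cases i
  · simp only [Fin.zero_eta, e_zero, upper, bracket_toM, ← toM_smul]
    congr 1; ext i; rw [mulVec_eight]
    fin_cases i <;> simp [adMat]; norm_num
  · have := bracket_upper_e_one 0 0 0 5 4
    norm_num at this
    simp only [Fin.mk_one, this]
    simp [upper_zero]
  · have := bracket_upper_e_two 0 0 0 5 4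
    norm_num at this
    simp only [Fin.reduceFinMk, this]
    simp [upper_zero]

-- By invariance χ(e₀), χ(e₁), χ(e₂) have torus weights -9, -6, -3. Coordinates of nonnegative
-- weight vanish for this reason, coordinates of negative filtration degree vanish by `Leading`, and
-- the only one left is the coefficient of R_{-1,1}, of weight -3.
set_option maxHeartbeats 1000000 in
lemma eq_smul_xiR (h : AlgData H χ) (hT : ad (upper 0 0 0 5 4) ∈ H) :
    χ (lowerPart (e 0)) = 0 ∧ χ (lowerPart (e 1)) = 0 ∧
    ∃ ρ : ℝ, χ (lowerPart (e 2)) = ρ • Rm11 := by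
  obtain ⟨x0, y0, x1, y1, x2, y2, h0, h1, h2, hl, -⟩ := h.exists_leading
  have k0 := fun a b => h.weight_eq_zero hT (torus_e 0) a b
  have k1 := fun a b => h.weight_eq_zero hT (torus_e 1) a b
  have k2 := fun a b => h.weight_eq_zero hT (torus_e 2) a b
  rw [h0] at k0
  rw [h1] at k1
  rw [h2] at k2
  have c0 := gpMat_coord_of_weight (by simp) k0
  have c1 := gpMat_coord_of_weight (by simp) k1
  have c2 := gpMat_coord_of_weight (by simp) k2
  have d0 := c0.2 (by simp)
  have d1 := c1.2 (by simp)
  obtain ⟨⟩ := hl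
  refine ⟨?_, ?_, x2 6 / 6, ?_⟩
  · rw [h0]
    apply gpMat_eq_zero <;> intro i <;> fin_cases i <;> simp [*]
  · rw [h1]
    apply gpMat_eq_zero <;> intro i <;> fin_cases i <;> simp [*]
  · have hx : x2 = ![0, 0, 0, 0, 0, 0, x2 6, 0, 0, 0] := by
      ext i; fin_cases i <;> simp [*]
    have hy : y2 = 0 := by
      ext i; fin_cases i <;> simp [*]
    rw [h2, hy, hx]
    refine ext_mulVec fun v => ?_
    rw [Matrix.smul_mulVec, Rm11_mulVec]
    ext i; rw [mulVec_eight]; fin_cases i <;> simp [gpMat] <;> ring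

/-- Subtracting a multiple of the torus removes the H₁-component; the remainder is an isotropy
element to which `isotropy_nilpotent` applies. -/
lemma isotropy_eq (h : AlgData H χ) (hα : χ (lowerPart (e 2)) 2 1 ≠ 0)
    (hT : ad (upper 0 0 0 5 4) ∈ H) {Y : M3} (hY : Y ∈ gZero) (hYH : ad Y ∈ H) :
    ∃ r : ℝ, Y = r • upper 0 0 0 5 4 := by
  refine ⟨Y 0 0 / 5, ?_⟩
  have h1 : ad (Y - (Y 0 0 / 5) • upper 0 0 0 5 4) ∈ H := by
    rw [ad_sub, ad_smul]; exact sub_mem hYH (H.smul_mem _ hT)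
  have hYu := sub_mem hY (gZero.smul_mem (Y 0 0 / 5) (upper_mem 0 0 0 5 4))
  have h2 := eq_upper hYu
  rw [h2] at h1
  have h3 := h.isotropy_nilpotent hα h1 (by simp [upper, toM])
  rw [← sub_eq_zero, h2, h3.1, h3.2.1, h3.2.2.1, h3.2.2.2]
  convert upper_zero using 2
  simp [upper, toM]

/-- Let T be the torus element, w < 0 the weight of eᵢ, and Z the correction of a lift. Comparing
the bracket of T with the lift and w times the lift puts wZ - [T, Z] in the isotropy, that is, in
the line of T. Since ad T has only the eigenvalues 9, 6, 3, 0 on 𝔤⁰, Z itself is a multiple of T and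
can be removed. -/
lemma lift_mem (h : AlgData H χ) (hα : χ (lowerPart (e 2)) 2 1 ≠ 0)
    (hT : ad (upper 0 0 0 5 4) ∈ H) (i : Fin 3) : ad (e i) + χ (lowerPart (e i)) ∈ H := by
  obtain ⟨Z, hZ, hZH⟩ := h.exists_lift i
  set w : ℝ := ![-9, -6, -3] i with hw
  set T := upper 0 0 0 5 4 with hTdef
  have h1 := (h.invariant (upper_mem _ _ _ _ _) hT hZ hZH).2
  rw [torus_e i, map_smul, map_smul, ← hw] at h1
  have h2 : ad (w • Z - (T * Z - Z * T)) ∈ H := by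
    have := sub_mem h1 (H.smul_mem w hZH)
    convert this using 1
    rw [show T * (e i - Z) - (e i - Z) * T = (T * e i - e i * T) - (T * Z - Z * T) by noncomm_ring,
      torus_e i, ← hw]
    simp only [ad_sub, ad_smul, smul_add, smul_sub]
    abel
  have hZu := eq_upper hZ
  have e1 : w • Z - (T * Z - Z * T) = upper ((w - 9) * Z 0 2) ((w - 6) * Z 0 1)
      ((w - 3) * Z 1 2) (w * Z 0 0) (w * -Z 2 2) := by
    conv_lhs => rw [hZu]
    rw [hTdef, upper, upper, bracket_toM, ← toM_smul, sub_eq_add_neg, ← neg_one_smul ℝ (toM _),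
      ← toM_smul, ← toM_add, upper]
    congr 1; ext i; simp only [Pi.add_apply, Pi.smul_apply, mulVec_eight]
    fin_cases i <;> simp [adMat] <;> ring
  rw [e1] at h2
  obtain ⟨r, hr⟩ := h.isotropy_eq hα hT (upper_mem _ _ _ _ _) h2
  have hneg : w < 0 := by rw [hw]; fin_cases i <;> simp
  have hr' : upper ((w - 9) * Z 0 2) ((w - 6) * Z 0 1) ((w - 3) * Z 1 2) (w * Z 0 0)
      (w * -Z 2 2) = upper 0 0 0 (r * 5) (r * 4) := by
    rw [hr, upper, ← toM_smul, upper]; simp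
  have hc := toM_injective hr'
  have c0 := congrFun hc 0
  have c1 := congrFun hc 1
  have c2 := congrFun hc 2
  have c3 := congrFun hc 3
  have c4 := congrFun hc 4
  simp at c0 c1 c2 c3 c4
  have z0 := c0.resolve_left (by linarith)
  have z1 := c1.resolve_left (by linarith)
  have z2 := c2.resolve_left (by linarith)
  have hZe : Z = (r / w) • T := by
    rw [hZu, z0, z1, z2, hTdef, upper, upper, ← toM_smul]
    have hw0 : w ≠ 0 := hneg.ne
    congr 1; ext i; fin_cases i <;> simp
    · field_simp; linarith
    · field_simp; linarith
  have h3 := add_mem hZH (H.smul_mem (r / w) hT)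
  convert h3 using 1
  rw [ad_sub, hZe, ad_smul]
  abel

/-- The symmetry algebra, once the isotropy is diagonal. -/
lemma eq_span (h : AlgData H χ) (hα : χ (lowerPart (e 2)) 2 1 ≠ 0)
    (hT : ad (upper 0 0 0 5 4) ∈ H) : ∃ ρ : ℝ, ρ ≠ 0 ∧
    H = Submodule.span ℝ {ad (e 0), ad (e 1), ad (e 2) + ρ • Rm11, ad (upper 0 0 0 5 4)} := by
  obtain ⟨h0, h1, ρ, h2⟩ := h.eq_smul_xiR hT
  refine ⟨ρ, ?_, le_antisymm (fun w hw => ?_) ?_⟩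
  · rintro rfl
    rw [h2] at hα
    simp at hα
  · have l0 := h.lift_mem hα hT 0
    have l1 := h.lift_mem hα hT 1
    have l2 := h.lift_mem hα hT 2
    obtain ⟨Y, hY, rfl⟩ := h.graph w hw
    have hY' : Y - (Y 2 0 • e 0 + Y 1 0 • e 1 + Y 2 1 • e 2) ∈ gZero := by
      refine ⟨sub_mem hY (add_mem (add_mem ?_ ?_) ?_), fun i j hij => ?_⟩
      · exact sl3.smul_mem _ (e_mem_sl3 0)
      · exact sl3.smul_mem _ (e_mem_sl3 1)
      · exact sl3.smul_mem _ (e_mem_sl3 2)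
      · fin_cases i <;> fin_cases j <;> simp at hij <;> simp [e, E]
    have hsub : ad (Y - (Y 2 0 • e 0 + Y 1 0 • e 1 + Y 2 1 • e 2)) ∈ H := by
      have := sub_mem hw (add_mem (add_mem (H.smul_mem (Y 2 0) l0) (H.smul_mem (Y 1 0) l1))
        (H.smul_mem (Y 2 1) l2))
      convert this using 1
      rw [map_lowerPart χ Y]
      simp only [ad_sub, ad_add, ad_smul, smul_add]
      abel
    obtain ⟨r, hr⟩ := h.isotropy_eq hα hT hY' hsub
    have e1 : Y = r • upper 0 0 0 5 4 + (Y 2 0 • e 0 + Y 1 0 • e 1 + Y 2 1 • e 2) :=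
      sub_eq_iff_eq_add.mp hr
    have e2 : ad Y + χ (lowerPart Y) = r • ad (upper 0 0 0 5 4) + Y 2 0 • ad (e 0) +
        Y 1 0 • ad (e 1) + Y 2 1 • (ad (e 2) + ρ • Rm11) := by
      rw [map_lowerPart, h0, h1, h2]
      conv_lhs => rw [e1]
      simp only [ad_add, ad_smul, smul_add, smul_zero]
      simp [upper, toM, e, E]
      abel
    rw [e2]
    refine add_mem (add_mem (add_mem ?_ ?_) ?_) ?_ <;>
      exact Submodule.smul_mem _ _ (Submodule.subset_span (by simp))
  · rw [Submodule.span_le]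
    rintro w (rfl | rfl | rfl | rfl)
    · simpa [h0] using h.lift_mem hα hT 0
    · simpa [h1] using h.lift_mem hα hT 1
    · simpa [h2] using h.lift_mem hα hT 2
    · exact hT

end AlgData

/-- Rescaling of the normal form. -/
lemma exists_conj_cayleyR {ρ : ℝ} (hρ : ρ ≠ 0) : ∃ b ∈ GZero,
    (Submodule.span ℝ {ad (e 0), ad (e 1), ad (e 2) + ρ • Rm11, ad (upper 0 0 0 5 4)}).map
      (conjInv (Ad b)) = cayleyR := by
  -- Conjugation by this matrix commutes with R_{-1,1}, whose two entries connect coordinates of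
  -- equal scaling, and multiplies ad e₂ by ρ; so e₂ + ρR becomes ρ(e₂ + R).
  set b : M3 := !![ρ, 0, 0; 0, 1, 0; 0, 0, ρ⁻¹] with hb
  set c : M3 := !![ρ⁻¹, 0, 0; 0, 1, 0; 0, 0, ρ] with hc
  have hbc : b * c = 1 := by
    ext i j; fin_cases i <;> fin_cases j <;> simp [hb, hc, hρ]
  have hbG : b ∈ GZero := by
    refine ⟨by simp [hb, Matrix.det_fin_three, hρ], fun i j hij => ?_⟩
    fin_cases i <;> fin_cases j <;> simp at hij <;> simp [hb]
  have hbi : b⁻¹ = c := Matrix.inv_eq_right_inv hbc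
  have hbu := isUnit_of_GZero hbG
  refine ⟨b, hbG, ?_⟩
  have k0 : conjInv (Ad b) (ad (e 0)) = (ρ ^ 2) • ad (e 0) := by
    rw [conjInv_ad hbu, ← ad_smul, hbi]
    congr 1; ext i j; fin_cases i <;> fin_cases j <;> simp [hb, hc, e_zero, toM]; ring
  have k1 : conjInv (Ad b) (ad (e 1)) = ρ • ad (e 1) := by
    rw [conjInv_ad hbu, ← ad_smul, hbi]
    congr 1; ext i j; fin_cases i <;> fin_cases j <;> simp [hb, hc, e_one, toM]
  have k2 : conjInv (Ad b) (ad (e 2)) = ρ • ad (e 2) := by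
    rw [conjInv_ad hbu, ← ad_smul, hbi]
    congr 1; ext i j; fin_cases i <;> fin_cases j <;> simp [hb, hc, e_two, toM]
  have k3 : conjInv (Ad b) (ad (upper 0 0 0 5 4)) = ad (upper 0 0 0 5 4) := by
    rw [conjInv_ad hbu, hbi]
    congr 1; ext i j; fin_cases i <;> fin_cases j <;> simp [hb, hc, upper, toM, hρ] <;> field_simp
  have k4 : conjInv (Ad b) Rm11 = Rm11 := by
    have hA : Ad b = Matrix.diagonal ![ρ ^ 2, ρ, ρ, 1, 1, ρ⁻¹, ρ⁻¹, (ρ ^ 2)⁻¹] := by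
      refine ext_mulVec fun v => ?_
      rw [Ad_mulVec, hbi]
      ext i; rw [Matrix.mulVec_diagonal]
      fin_cases i <;> simp [hb, hc, toM, coord, hρ] <;> field_simp
    have hcomm : Rm11 * Ad b = Ad b * Rm11 := by
      refine ext_mulVec fun v => ?_
      simp only [hA, ← Matrix.mulVec_mulVec, Rm11_mulVec]
      ext i
      rw [Matrix.mulVec_diagonal]
      fin_cases i <;> simp [Matrix.mulVec_diagonal] <;> ring
    change (Ad b)⁻¹ * Rm11 * Ad b = Rm11
    rw [mul_assoc, hcomm, ← mul_assoc, L_inv_mul (Ad_mem_L hbu), one_mul]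
  rw [Submodule.map_span, cayleyR, torus_eq]
  have k5 : conjInv (Ad b) (ad (e 2) + ρ • Rm11) = ρ • (ad (e 2) + Rm11) := by
    rw [map_add, map_smul, k2, k4, smul_add]
  simp only [Set.image_insert_eq, Set.image_singleton, k0, k1, k3, k5]
  refine le_antisymm ?_ ?_ <;> rw [Submodule.span_le]
  · rintro w (rfl | rfl | rfl | rfl)
    · exact Submodule.smul_mem _ _ (Submodule.subset_span (by simp))
    · exact Submodule.smul_mem _ _ (Submodule.subset_span (by simp))
    · exact Submodule.smul_mem _ _ (Submodule.subset_span (by simp))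
    · exact Submodule.subset_span (by simp)
  · rintro w (rfl | rfl | rfl | rfl)
    · exact (Submodule.smul_mem_iff _ (pow_ne_zero 2 hρ)).mp (Submodule.subset_span (by simp))
    · exact (Submodule.smul_mem_iff _ hρ).mp (Submodule.subset_span (by simp))
    · exact (Submodule.smul_mem_iff _ hρ).mp (Submodule.subset_span (by simp))
    · exact Submodule.subset_span (by simp)

/-- An isotropy element with nonzero semisimple part is diagonalizable. -/
lemma exists_conj_torus {c p q s t : ℝ} (h : 5 * t = 4 * s) (hs : s ≠ 0) : ∃ b ∈ GZero,
    b⁻¹ * upper c p q s t * b = (s / 5) • upper 0 0 0 5 4 := by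
  set r := s / 5 with hr
  have hr0 : r ≠ 0 := by positivity
  have hs5 : s = 5 * r := by rw [hr]; ring
  have ht : t = 4 * r := by linarith
  -- The entries solve Y b = b (r T) from the diagonal outwards. The denominators are differences of
  -- the eigenvalues 5r, -r, -4r of r T.
  obtain ⟨b1, hb1⟩ : ∃ x, x = -p / (6 * r) := ⟨_, rfl⟩
  obtain ⟨b2, hb2⟩ : ∃ x, x = -q / (3 * r) := ⟨_, rfl⟩
  obtain ⟨b3, hb3⟩ : ∃ x, x = -(p * b2 + c) / (9 * r) := ⟨_, rfl⟩
  set b : M3 := !![1, b1, b3; 0, 1, b2; 0, 0, 1] with hb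
  have hbG : b ∈ GZero := by
    refine ⟨by simp [hb, Matrix.det_fin_three], fun i j hij => ?_⟩
    fin_cases i <;> fin_cases j <;> simp at hij <;> simp [hb]
  refine ⟨b, hbG, ?_⟩
  have h1 : p = -6 * r * b1 := by rw [hb1]; field_simp
  have h2 : q = -3 * r * b2 := by rw [hb2]; field_simp
  have h3 : c = -9 * r * b3 - p * b2 := by rw [hb3]; field_simp; ring
  have key : upper c p q s t * b = b * (r • upper 0 0 0 5 4) := by
    rw [hs5, ht]
    ext i j; fin_cases i <;> fin_cases j <;> simp [upper, toM, hb] <;>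
      linarith
  rw [mul_assoc, key, ← mul_assoc, Matrix.nonsing_inv_mul _ (isUnit_of_GZero hbG), one_mul]


/-! ### The mirror symmetry -/

/-- The automorphism `X ↦ -J Xᵀ J` of `sl(3,ℝ)`, where `J` is the antidiagonal matrix. -/
def mir : M3 →ₗ[ℝ] M3 where
  toFun X := Matrix.of fun i j => -X j.rev i.rev
  map_add' X Y := by ext i j; simp; ring
  map_smul' c X := by ext i j; simp

lemma mir_apply (X : M3) (i j : Fin 3) : mir X i j = -X j.rev i.rev := rfl

lemma mir_mir (X : M3) : mir (mir X) = X := by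
  ext i j; simp [mir_apply]

lemma mir_bracket (X Y : M3) : mir (X * Y - Y * X) = mir X * mir Y - mir Y * mir X := by
  ext i j
  fin_cases i <;> fin_cases j <;>
    simp [mir_apply, Matrix.mul_apply, Fin.sum_univ_three, Fin.rev] <;> ring

lemma mir_mem_sl3 {X : M3} (hX : X ∈ sl3) : mir X ∈ sl3 := by
  rw [mem_sl3_iff] at *
  simp [mir_apply, Fin.rev]; linarith

lemma mir_mem_gr {p : ℤ} {X : M3} (hX : X ∈ gr p) : mir X ∈ gr p := by
  refine ⟨mir_mem_sl3 hX.1, fun i j h => ?_⟩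
  rw [mir_apply, hX.2 _ _ (by fin_cases i <;> fin_cases j <;> simpa [Fin.rev] using h), neg_zero]

lemma mir_mem_gZero {X : M3} (hX : X ∈ gZero) : mir X ∈ gZero := by
  refine ⟨mir_mem_sl3 hX.1, fun i j h => ?_⟩
  rw [mir_apply, hX.2 _ _ (Fin.rev_lt_rev.mpr h), neg_zero]

lemma mir_toM (v : Fin 8 → ℝ) :
    mir (toM v) = toM ![-v 0, -v 2, -v 1, v 4, v 3, -v 6, -v 5, -v 7] := by
  ext i j; fin_cases i <;> fin_cases j <;> simp [mir_apply, toM, Fin.rev]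

/-- The mirror symmetry as an element of `L`. -/
def S8 : M8 := !![-1, 0, 0, 0, 0, 0, 0, 0; 0, 0, -1, 0, 0, 0, 0, 0; 0, -1, 0, 0, 0, 0, 0, 0;
  0, 0, 0, 0, 1, 0, 0, 0; 0, 0, 0, 1, 0, 0, 0, 0; 0, 0, 0, 0, 0, 0, -1, 0;
  0, 0, 0, 0, 0, -1, 0, 0; 0, 0, 0, 0, 0, 0, 0, -1]

lemma S8_mulVec (v : Fin 8 → ℝ) :
    S8 *ᵥ v = ![-v 0, -v 2, -v 1, v 4, v 3, -v 6, -v 5, -v 7] := by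
  ext i; rw [mulVec_eight]; fin_cases i <;> simp [S8]

lemma toM_S8_mulVec (v : Fin 8 → ℝ) : toM (S8 *ᵥ v) = mir (toM v) := by
  rw [S8_mulVec, mir_toM]

lemma S8_mul_self : S8 * S8 = 1 := by
  refine ext_mulVec fun v => toM_injective ?_
  rw [← Matrix.mulVec_mulVec, toM_S8_mulVec, toM_S8_mulVec, mir_mir, Matrix.one_mulVec]

lemma S8_inv : S8⁻¹ = S8 := Matrix.inv_eq_left_inv S8_mul_self

lemma S8_mem_L : S8 ∈ L := by
  rw [mem_L_iff]
  intro v w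
  simp only [S8_mulVec, Matrix.trace, Matrix.diag, Matrix.mul_apply, Fin.sum_univ_three]
  simp [toM]; ring

lemma S8_mul_apply (B : M8) (i j : Fin 8) : (S8 * B) i j =
    ![-B 0 j, -B 2 j, -B 1 j, B 4 j, B 3 j, -B 6 j, -B 5 j, -B 7 j] i := by
  have := congrFun (S8_mulVec fun k => B k j) i
  rw [← this]; rfl

lemma mul_S8_apply (B : M8) (i j : Fin 8) : (B * S8) i j =
    ![-B i 0, -B i 2, -B i 1, B i 4, B i 3, -B i 6, -B i 5, -B i 7] j := by
  rw [Matrix.mul_apply, Fin.sum_univ_eight]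
  fin_cases j <;> simp [S8]

lemma conjInv_S8 (B : M8) : conjInv S8 B = S8 * B * S8 := by
  change S8⁻¹ * B * S8 = _
  rw [S8_inv]

lemma conjInv_S8_ad (X : M3) : conjInv S8 (ad X) = ad (mir X) := by
  rw [conjInv_S8]
  refine ext_mulVec fun v => toM_injective ?_
  rw [← Matrix.mulVec_mulVec, ← Matrix.mulVec_mulVec, toM_S8_mulVec, toM_ad_mulVec, toM_S8_mulVec,
    mir_bracket, mir_mir, toM_ad_mulVec]

lemma conjInv_bracket {a : M8} (ha : a ∈ L) (B C : M8) :
    conjInv a (B * C - C * B) = conjInv a B * conjInv a C - conjInv a C * conjInv a B := by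
  change a⁻¹ * (B * C - C * B) * a = a⁻¹ * B * a * (a⁻¹ * C * a) - a⁻¹ * C * a * (a⁻¹ * B * a)
  rw [show a⁻¹ * B * a * (a⁻¹ * C * a) = a⁻¹ * B * (a * a⁻¹) * C * a by noncomm_ring,
    show a⁻¹ * C * a * (a⁻¹ * B * a) = a⁻¹ * C * (a * a⁻¹) * B * a by noncomm_ring, L_mul_inv ha]
  noncomm_ring

lemma conjInv_S8_mem_glFil {p : ℤ} {B : M8} (hB : B ∈ glFil p) : conjInv S8 B ∈ glFil p := by
  intro i j h
  rw [conjInv_S8, mul_S8_apply]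
  fin_cases i <;> fin_cases j <;> simp [S8_mul_apply] <;> exact hB _ _ h

lemma conjInv_S8_mem_gPerp {B : M8} (hB : B ∈ gPerp) : conjInv S8 B ∈ gPerp := by
  refine ⟨?_, fun X hX => ?_⟩
  · have := conj_mem_lAlg S8_mem_L hB.1
    rwa [S8_inv, ← conjInv_S8] at this
  · have h := hB.2 _ (mir_mem_sl3 hX)
    rw [← conjInv_S8_ad, conjInv_S8] at h
    rw [conjInv_S8, ← h, show S8 * B * S8 * ad X = S8 * (B * S8 * ad X) by noncomm_ring,
      Matrix.trace_mul_comm]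
    congr 1; noncomm_ring

lemma mir_eCheck : mir (eCheck 0) = -eCheck 0 ∧ mir (eCheck 1) = -eCheck 2 ∧
    mir (eCheck 2) = -eCheck 1 := by
  refine ⟨?_, ?_, ?_⟩ <;> ext i j <;> fin_cases i <;> fin_cases j <;>
    simp [mir_apply, eCheck, E, Fin.rev]

lemma mir_e : mir (e 0) = -e 0 ∧ mir (e 1) = -e 2 ∧ mir (e 2) = -e 1 := by
  refine ⟨?_, ?_, ?_⟩ <;> ext i j <;> fin_cases i <;> fin_cases j <;>
    simp [mir_apply, e, E, Fin.rev]

/-- The mirror image of a structure function. -/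
def mirχ (χ : gMinus →ₗ[ℝ] M8) : gMinus →ₗ[ℝ] M8 :=
  conjInv S8 ∘ₗ χ ∘ₗ lowerPart ∘ₗ mir ∘ₗ gMinus.subtype

lemma mirχ_lowerPart (χ : gMinus →ₗ[ℝ] M8) (X : M3) :
    mirχ χ (lowerPart X) = conjInv S8 (χ (lowerPart (mir X))) := by
  have : lowerPart (mir (lowerPart X).1) = lowerPart (mir X) := by
    ext i j
    by_cases h : j < i
    · simp [lowerPart, h, mir_apply]
    · simp [lowerPart, h]
  simp [mirχ, this]

lemma IsNormal.mirror {χ : gMinus →ₗ[ℝ] M8} (h : IsNormal χ) : IsNormal (mirχ χ) := by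
  refine ⟨fun p hp X hX => ?_, ?_⟩
  · rw [mirχ_lowerPart]
    exact conjInv_S8_mem_glFil (h.1 p hp _ (mir_mem_gr hX))
  · have h2 := congrArg (conjInv S8) h.2
    rw [codiff, map_sum, map_zero, Fin.sum_univ_three] at h2
    rw [codiff, Fin.sum_univ_three]
    simp only [Ring.lie_def, conjInv_bracket S8_mem_L, conjInv_S8_ad, mir_eCheck, mirχ_lowerPart,
      mir_e, ad_neg, map_neg] at h2 ⊢
    rw [← h2]; noncomm_ring

/-- Allows the case of a nonzero coefficient of ξ₁^S to be deduced from that of ξ₁^R. -/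
lemma AlgData.mirror {H : Submodule ℝ M8} {χ : gMinus →ₗ[ℝ] M8} (h : AlgData H χ) :
    AlgData (H.map (conjInv S8)) (mirχ χ) where
  perp X := conjInv_S8_mem_gPerp (h.perp _)
  normal := h.normal.mirror
  graph := by
    rintro _ ⟨w, hw, rfl⟩
    obtain ⟨Y, hY, rfl⟩ := h.graph w hw
    exact ⟨mir Y, mir_mem_sl3 hY, by rw [map_add, conjInv_S8_ad, mirχ_lowerPart, mir_mir]⟩
  trans Y hY := by
    obtain ⟨Z, hZ, hZH⟩ := h.trans _ (mir_mem_sl3 hY)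
    refine ⟨mir Z, mir_mem_gZero hZ, _, hZH, ?_⟩
    rw [map_add, conjInv_S8_ad, mirχ_lowerPart, map_sub, mir_mir]
  lie := by
    rintro _ ⟨B, hB, rfl⟩ _ ⟨C, hC, rfl⟩
    exact ⟨_, h.lie B hB C hC, conjInv_bracket S8_mem_L B C⟩

/-- The mirror image of an upper triangular matrix of determinant one. -/
def mirG (b : M3) : M3 := Matrix.of fun i j => b⁻¹ j.rev i.rev

lemma mirG_mul {b : M3} (hb : IsUnit b.det) :
    (Matrix.of fun i j => b j.rev i.rev) * mirG b = 1 := by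
  have h := congrArg Matrix.transpose (Matrix.nonsing_inv_mul b hb)
  rw [Matrix.transpose_mul, Matrix.transpose_one] at h
  ext i j
  have := congrFun (congrFun h i.rev) j.rev
  rw [Matrix.mul_apply] at this ⊢
  simp only [Matrix.transpose_apply, Fin.sum_univ_three] at this
  have h2 : (1 : M3) i j = (1 : M3) i.rev j.rev := by simp [Matrix.one_apply]
  rw [h2, ← this, Fin.sum_univ_three]
  change b 2 i.rev * b⁻¹ j.rev 2 + b 1 i.rev * b⁻¹ j.rev 1 + b 0 i.rev * b⁻¹ j.rev 0 = _
  ring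

/-- The automorphism X ↦ -J Xᵀ J of 𝔤 integrates to b ↦ J b^{-T} J on the group, so `S8` normalizes
Ad G⁰ and changes of frame can be carried across the mirror. -/
lemma Ad_mirG {b : M3} (hb : IsUnit b.det) : Ad b * S8 = S8 * Ad (mirG b) := by
  have h1 := mirG_mul hb
  have hu : IsUnit (mirG b).det := by
    have := congrArg Matrix.det h1
    rw [Matrix.det_mul, Matrix.det_one] at this
    exact IsUnit.of_mul_eq_one_right _ this
  have hi : (mirG b)⁻¹ = Matrix.of fun i j => b j.rev i.rev := Matrix.inv_eq_left_inv h1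
  refine ext_mulVec fun v => toM_injective ?_
  rw [← Matrix.mulVec_mulVec, ← Matrix.mulVec_mulVec, toM_S8_mulVec, toM_Ad_mulVec hb,
    toM_Ad_mulVec hu, toM_S8_mulVec, hi]
  generalize toM v = X
  ext i j
  simp only [mir_apply, mirG, Matrix.mul_apply, Fin.sum_univ_three, Matrix.of_apply]
  fin_cases i <;> fin_cases j <;> simp [Fin.rev] <;> ring

lemma mirG_mem {b : M3} (hb : b ∈ GZero) : mirG b ∈ GZero := by
  have hb0 := hb.1
  have h1 := hb.2 1 0 (by simp)
  have h2 := hb.2 2 0 (by simp)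
  have h3 := hb.2 2 1 (by simp)
  have h := congrArg Matrix.det (mirG_mul (isUnit_of_GZero hb))
  rw [Matrix.det_mul, Matrix.det_one] at h
  have hd : (Matrix.of fun i j : Fin 3 => b j.rev i.rev).det = 1 := by
    rw [← hb0, Matrix.det_fin_three, Matrix.det_fin_three b]
    simp [Fin.rev]; ring
  refine ⟨by rwa [hd, one_mul] at h, fun i j hij => ?_⟩
  have hinv : b⁻¹ = b.adjugate := by rw [Matrix.inv_def, hb0]; simp
  rw [mirG, Matrix.of_apply, hinv, Matrix.adjugate_fin_three]
  fin_cases i <;> fin_cases j <;> simp at hij <;> simp [Fin.rev, h1, h2, h3]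

lemma GZero_mul {b c : M3} (hb : b ∈ GZero) (hc : c ∈ GZero) : b * c ∈ GZero := by
  refine ⟨by rw [Matrix.det_mul, hb.1, hc.1, one_mul], fun i j h => ?_⟩
  rw [Matrix.mul_apply]
  refine Finset.sum_eq_zero fun k _ => ?_
  rcases lt_or_ge k i with hk | hk
  · rw [hb.2 i k hk, zero_mul]
  · rw [hc.2 k j (h.trans_le hk), mul_zero]

lemma mir_torus : mir (upper 0 0 0 5 4) = (4 : ℝ) • H1 + (5 : ℝ) • H2 := by
  rw [upper, mir_toM]
  ext i j; fin_cases i <;> fin_cases j <;> simp [H1, H2, E, upper, toM]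
  norm_num

lemma conjInv_S8_R21 : conjInv S8 R21 = S12 := by
  rw [conjInv_S8]
  refine ext_mulVec fun v => ?_
  rw [← Matrix.mulVec_mulVec, ← Matrix.mulVec_mulVec, S8_mulVec, S8_mulVec]
  ext i; fin_cases i <;> simp [R21, S12, mulVec_eight, Matrix.sub_mulVec, Matrix.single_mulVec]

lemma conjInv_S8_Rm11 : conjInv S8 Rm11 = -S1m1 := by
  rw [Rm11, S1m1]
  simp only [Ring.lie_def, conjInv_bracket S8_mem_L, conjInv_S8_ad, mir_e, ad_neg, conjInv_S8_R21]
  noncomm_ring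

lemma map_S8_cayleyR : cayleyR.map (conjInv S8) = cayleyS := by
  rw [cayleyR, Submodule.map_span, cayleyS, torus_eq]
  simp only [Set.image_insert_eq, Set.image_singleton, map_add, conjInv_S8_ad, mir_e,
    conjInv_S8_Rm11, ad_neg, mir_torus, ← neg_add]
  refine le_antisymm ?_ ?_ <;> rw [Submodule.span_le]
  · rintro w (rfl | rfl | rfl | rfl)
    · exact neg_mem (Submodule.subset_span (by simp))
    · exact neg_mem (Submodule.subset_span (by simp))
    · exact neg_mem (Submodule.subset_span (by simp))
    · exact Submodule.subset_span (by simp)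
  · rintro w (rfl | rfl | rfl | rfl)
    · exact neg_mem_iff.mp (Submodule.subset_span (by simp))
    · exact neg_mem_iff.mp (Submodule.subset_span (by simp))
    · exact neg_mem_iff.mp (Submodule.subset_span (by simp))
    · exact Submodule.subset_span (by simp)

lemma map_S8_map_S8 (H : Submodule ℝ M8) : (H.map (conjInv S8)).map (conjInv S8) = H := by
  rw [← map_conjInv_mul, S8_mul_self, conjInv_one, Submodule.map_id]

/-! ### Classification of the symmetry algebras -/

variable {H : Submodule ℝ M8} {χ : gMinus →ₗ[ℝ] M8}

/-- Dimension count: the traces against ě₀, ě₁, ě₂ read off the 𝔤₋-part of an element of H, giving a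
map to ℝ³ that must have a kernel. On the kernel χ does not contribute, so what remains is ad of an
element of 𝔤⁰. -/
lemma AlgData.isotropy_ne_zero (h : AlgData H χ) (h4 : 4 ≤ Module.finrank ℝ H) :
    ∃ Y ∈ gZero, Y ≠ 0 ∧ ad Y ∈ H := by
  let π : M8 →ₗ[ℝ] (Fin 3 → ℝ) := LinearMap.pi fun i =>
    (Matrix.traceLinearMap (Fin 8) ℝ ℝ) ∘ₗ (LinearMap.mulRight ℝ (ad (eCheck i)))
  have hπ : ∀ w i, π w i = (w * ad (eCheck i)).trace := fun w i => rfl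
  have hk : LinearMap.ker (π.domRestrict H) ≠ ⊥ :=
    LinearMap.ker_ne_bot_of_finrank_lt (by rw [Module.finrank_fin_fun]; omega)
  obtain ⟨w, hw, hw0⟩ := Submodule.exists_mem_ne_zero_of_ne_bot hk
  obtain ⟨Y, hY, hwY⟩ := h.graph w.1 w.2
  have hc : ∀ i, eCheck i ∈ sl3 := fun i => by
    rw [mem_sl3_iff]; fin_cases i <;> simp [eCheck, E]
  have key : ∀ i, (Y * eCheck i).trace = 0 := fun i => by
    have h1 : π w.1 i = 0 := congrFun (LinearMap.mem_ker.mp hw) i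
    rw [hπ, hwY, add_mul, Matrix.trace_add, (h.perp _).2 _ (hc i), trace_ad_mul_ad hY (hc i)] at h1
    linarith
  have k0 : Y 2 0 = 0 := (trace_mul_E Y 2 0).symm.trans (key 0)
  have k1 : Y 1 0 = 0 := (trace_mul_E Y 1 0).symm.trans (key 1)
  have k2 : Y 2 1 = 0 := (trace_mul_E Y 2 1).symm.trans (key 2)
  have hχ : χ (lowerPart Y) = 0 := by rw [map_lowerPart, k0, k1, k2]; simp
  rw [hχ, add_zero] at hwY
  refine ⟨Y, ⟨hY, fun i j hij => ?_⟩, ?_, hwY ▸ w.2⟩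
  · fin_cases i <;> fin_cases j <;> simp at hij <;> assumption
  · rintro rfl
    exact hw0 (Subtype.ext (by rw [hwY, ad_zero]; rfl))

/-- A lift of eᵢ lying in ad 𝔤 has no 𝔤^⊥-part, and that part is χ(eᵢ). -/
lemma AlgData.eq_zero_of_flat (h : AlgData H χ) (hf : ∀ w ∈ H, ∃ X ∈ sl3, w = ad X) (i : Fin 3) :
    χ (lowerPart (e i)) = 0 := by
  obtain ⟨Z, hZ, hZH⟩ := h.exists_lift i
  obtain ⟨X, hX, he⟩ := hf _ hZH
  exact (graph_unique (h.perp _) (zero_mem _) (sub_mem (e_mem_sl3 i) hZ.1) hX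
    (by rw [he, add_zero])).2

/-- A nonzero isotropy element cannot be nilpotent, so it can be conjugated into the torus; there
the algebra is rigid up to the scale of R. The family hypothesis supplies a normal structure
function in the conjugated frame without computing how χ transforms. -/
lemma AlgData.exists_conj_eq_cayleyR (h : AlgData H χ)
    (hfam : ∀ b ∈ GZero, ∃ χ', AlgData (H.map (conjInv (Ad b))) χ')
    (h4 : 4 ≤ Module.finrank ℝ H) (hα : χ (lowerPart (e 2)) 2 1 ≠ 0) :
    ∃ b ∈ GZero, H.map (conjInv (Ad b)) = cayleyR := by
  obtain ⟨Y, hY, hY0, hYH⟩ := h.isotropy_ne_zero h4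
  have hYu := eq_upper hY
  rw [hYu] at hYH
  have hw := (h.isotropy_weight hYH).1
  have hs : Y 0 0 ≠ 0 := fun hs => by
    have := h.isotropy_nilpotent hα hYH hs
    rw [this.1, this.2.1, this.2.2.1, this.2.2.2, hs, upper_zero] at hYu
    exact hY0 hYu
  obtain ⟨b, hb, hbY⟩ := exists_conj_torus (c := Y 0 2) (p := Y 0 1) (q := Y 1 2)
    (s := Y 0 0) (t := -Y 2 2)
    (by have := (mul_eq_zero.mp hw).resolve_right hα; linarith) hs
  have hbu := isUnit_of_GZero hb
  obtain ⟨χ', h'⟩ := hfam b hb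
  have hT : ad (upper 0 0 0 5 4) ∈ H.map (conjInv (Ad b)) := by
    have h1 := Submodule.mem_map_of_mem (f := conjInv (Ad b)) hYH
    rw [conjInv_ad hbu, hbY, ad_smul] at h1
    exact (Submodule.smul_mem_iff _ (by positivity)).mp h1
  -- The new structure function is not expressed through the old one, so non-vanishing is rechecked.
  -- The torus always kills the ξ₁^S-coefficient, as 5·5 - 4·4 ≠ 0; if the ξ₁^R-coefficient vanished
  -- as well, then χ' = 0, so H would lie in ad 𝔤, which contradicts χ(e₂) ≠ 0.
  have hα' : χ' (lowerPart (e 2)) 2 1 ≠ 0 := fun hα' => by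
    obtain ⟨x0, y0, x1, y1, x2, y2, h0, h1, h2, hl, hz⟩ := h'.exists_leading
    have hβ := (h'.isotropy_weight hT).2.1
    rw [h1] at hβ
    rw [h2] at hα'
    simp [gpMat] at hα' hβ
    have hχ := hz hα' (hβ.resolve_left (by norm_num))
    refine hα ?_
    rw [h.eq_zero_of_flat (fun w hw => ?_) 2]; rfl
    obtain ⟨X, hX, hwX⟩ := h'.graph _ (Submodule.mem_map_of_mem (f := conjInv (Ad b)) hw)
    refine ⟨_, conj_mem_sl3 hbu hX, ?_⟩
    rw [hχ, LinearMap.zero_apply, add_zero] at hwX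
    rw [← Ad_ad hbu, ← hwX]
    have hbL := Ad_mem_L hbu
    change w = Ad b * ((Ad b)⁻¹ * w * Ad b) * (Ad b)⁻¹
    rw [show Ad b * ((Ad b)⁻¹ * w * Ad b) * (Ad b)⁻¹ = (Ad b * (Ad b)⁻¹) * w * (Ad b * (Ad b)⁻¹) by
      noncomm_ring, L_mul_inv hbL, one_mul, mul_one]
  obtain ⟨ρ, hρ, hspan⟩ := h'.eq_span hα' hT
  obtain ⟨c, hc, hcR⟩ := exists_conj_cayleyR hρ
  refine ⟨b * c, GZero_mul hb hc, ?_⟩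
  rw [Ad_mul (isUnit_of_GZero hc), map_conjInv_mul, hspan, hcR]

/-- The symmetry algebra of a submaximal embedding in a given frame. -/
theorem AlgData.classification (h : AlgData H χ)
    (hfam : ∀ b ∈ GZero, ∃ χ', AlgData (H.map (conjInv (Ad b))) χ')
    (h4 : 4 ≤ Module.finrank ℝ H) : χ = 0 ∨
    (∃ b ∈ GZero, H.map (conjInv (Ad b)) = cayleyR) ∨
    ∃ b ∈ GZero, H.map (conjInv (Ad b)) = cayleyS := by
  obtain ⟨x0, y0, x1, y1, x2, y2, h0, h1, h2, hl, hz⟩ := h.exists_leading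
  by_cases hα : x2 6 = 0
  · by_cases hβ : y1 6 = 0
    · exact Or.inl (hz hα hβ)
    · right; right
      -- Conjugating the mirrored algebra by b is the same as mirroring the algebra conjugated by
      -- `mirG b`; this carries the family hypothesis to the mirror image.
      have hmul : ∀ b ∈ GZero, (H.map (conjInv S8)).map (conjInv (Ad b)) =
          (H.map (conjInv (Ad (mirG b)))).map (conjInv S8) := fun b hb => by
        rw [← map_conjInv_mul, ← map_conjInv_mul, ← mul_one (S8 * Ad b), ← S8_mul_self,
          show S8 * Ad b * (S8 * S8) = S8 * (Ad b * S8) * S8 by noncomm_ring,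
          Ad_mirG (isUnit_of_GZero hb),
          show S8 * (S8 * Ad (mirG b)) * S8 = (S8 * S8) * Ad (mirG b) * S8 by noncomm_ring,
          S8_mul_self, one_mul]
      obtain ⟨b, hb, hbR⟩ := h.mirror.exists_conj_eq_cayleyR (fun b hb => by
          obtain ⟨χ', h'⟩ := hfam _ (mirG_mem hb)
          exact ⟨_, hmul b hb ▸ h'.mirror⟩) (by
          have : H = (H.map (conjInv S8)).map (conjInv S8) := (map_S8_map_S8 H).symm
          rw [this] at h4
          exact h4.trans (Submodule.finrank_map_le _ _)) (by
          rw [mirχ_lowerPart, mir_e.2.2, map_neg, map_neg, h1, conjInv_S8, mul_S8_apply]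
          simp [S8_mul_apply, gpMat, hβ])
      refine ⟨mirG b, mirG_mem hb, ?_⟩
      rw [hmul b hb] at hbR
      rw [← map_S8_cayleyR, ← hbR, map_S8_map_S8]
  · right; left
    exact h.exists_conj_eq_cayleyR hfam h4 (by rw [h2]; simpa [gpMat] using hα)


/-! ### Invariants of the normal forms -/

lemma ad_e_two_mulVec (v : Fin 8 → ℝ) :
    ad (e 2) *ᵥ v = ![0, -v 0, 0, 0, -v 2, -v 3 + 2 * v 4, 0, v 6] := by
  rw [e_two, ad_toM]
  ext i; rw [mulVec_eight]; fin_cases i <;> simp [adMat]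

/-- Cayley–Hamilton with tr X = tr X² = 0 gives X³ = d·1. For N = ad X this yields N³Y = -3 X N(Y)
X, hence N⁵Y = 9 X² N(Y) X² and N⁷ = -27 d² N. If d ≠ 0, then N = 0; if d = 0, then X³ = 0 and X²
N(Y) X² = X³YX² - X²YX³ = 0. -/
lemma ad_nilpotent {X : M3} (hX : X ∈ sl3) (h2 : (X * X).trace = 0) (h7 : ad X ^ 7 = 0) :
    ad X ^ 5 = 0 := by
  obtain ⟨d, hd⟩ : ∃ d : ℝ, X * X * X = d • (1 : M3) := by
    refine ⟨X.det, ?_⟩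
    have h1 := hX
    rw [mem_sl3_iff] at h1
    have e1 : X 2 2 = - X 0 0 - X 1 1 := by linarith
    have key : X * X * X = X.det • 1 + ((X * X).trace / 2) • X := by
      rw [Matrix.det_fin_three]
      ext i j
      simp only [Matrix.add_apply, Matrix.trace, Matrix.diag, Matrix.mul_apply,
        Fin.sum_univ_three, Matrix.smul_apply, smul_eq_mul]
      fin_cases i <;> fin_cases j <;> simp [e1] <;> ring
    rw [key, h2]; simp
  set N := LinearMap.mulLeft ℝ X - LinearMap.mulRight ℝ X with hN
  have hpow : ∀ n v, toM (ad X ^ n *ᵥ v) = (N ^ n) (toM v) := fun n => by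
    induction n with
    | zero => intro v; simp
    | succ n ih =>
      intro v
      rw [pow_succ, ← Matrix.mulVec_mulVec, ih, toM_ad_mulVec, pow_succ]; rfl
  have h3 : ∀ Y, (N ^ 3) Y = -(3 : ℝ) • (X * N Y * X) := fun Y => by
    have : (N ^ 3) Y = X * X * X * Y - Y * (X * X * X) - (3 : ℝ) • (X * N Y * X) := by
      simp [pow_succ, hN, mul_sub, sub_mul, mul_assoc]
      module
    rw [this, hd]; simp
  have hc : ∀ Y, N (X * Y * X) = X * N Y * X := fun Y => by
    simp [hN]; noncomm_ring
  have h5 : ∀ Y, (N ^ 5) Y = (9 : ℝ) • (X * X * N Y * (X * X)) := fun Y => by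
    rw [show (N ^ 5) Y = (N ^ 3) (N (N Y)) by simp [pow_succ], h3, 
      show N (N (N Y)) = (N ^ 3) Y by simp [pow_succ], h3]
    simp [mul_assoc, smul_smul]; norm_num
  have h7' : ∀ Y, (N ^ 7) Y = (-27 * d ^ 2) • N Y := fun Y => by
    rw [show (N ^ 7) Y = (N ^ 5) (N (N Y)) by simp [pow_succ], h5,
      show N (N (N Y)) = (N ^ 3) Y by simp [pow_succ], h3,
      show X * X * (-(3 : ℝ) • (X * N Y * X)) * (X * X) =
        -(3 : ℝ) • ((X * X * X) * N Y * (X * X * X)) by simp [mul_assoc], hd]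
    simp [smul_smul]; ring_nf
  refine ext_mulVec fun v => toM_injective ?_
  rw [hpow, Matrix.zero_mulVec]
  have hv := hpow 7 v
  rw [h7, Matrix.zero_mulVec, h7'] at hv
  have hz : toM 0 = 0 := by ext i j; fin_cases i <;> fin_cases j <;> simp [toM]
  rw [hz] at hv ⊢
  by_cases hd0 : d = 0
  · rw [hd0, zero_smul] at hd
    rw [h5]
    have : X * X * N (toM v) * (X * X) = X * X * X * toM v * (X * X) - X * X * toM v *
      (X * X * X) := by simp [hN]; noncomm_ring
    rw [this, hd]; simp
  · have h0 : N (toM v) = 0 := (smul_eq_zero.mp hv.symm).resolve_left (by simpa using hd0)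
    rw [h5, h0]; simp

/-- No conjugate of the symmetry algebra `cayleyR` lies in `ad sl(3,ℝ)`. -/
lemma not_flat_of_cayleyR {g : M8} (hg : g ∈ L)
    (h : ∀ w ∈ cayleyR, ∃ X ∈ sl3, g * w * g⁻¹ = ad X) : False := by
  set w := ad (e 2) + Rm11 with hw
  obtain ⟨X, hX, hgX⟩ := h w (Submodule.subset_span (by simp [hw]))
  have hf : ∀ v, w *ᵥ v = ![0, -v 0, -6 * v 1, 0, -v 2, -v 3 + 2 * v 4, 6 * v 5, v 6] := fun v => by
    rw [hw, Matrix.add_mulVec, Rm11_mulVec, ad_e_two_mulVec]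
    ext i; fin_cases i <;> simp
  have hpow : ∀ n, ad X ^ n = g * w ^ n * g⁻¹ := fun n => by
    induction n with
    | zero => simp [L_mul_inv hg]
    | succ n ih =>
      rw [pow_succ, ih, ← hgX, pow_succ, show g * w ^ n * g⁻¹ * (g * w * g⁻¹) =
        g * w ^ n * (g⁻¹ * g) * w * g⁻¹ by noncomm_ring, L_inv_mul hg]
      noncomm_ring
  -- The operator ad e₂ + R_{-1,1} has vanishing seventh power and trace of square zero, but its
  -- fifth power is nonzero. For an operator ad X this is excluded by `ad_nilpotent`, and all three
  -- properties are invariant under conjugation.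
  have hw7 : w ^ 7 = 0 := by
    refine ext_mulVec fun v => ?_
    simp only [pow_succ, pow_zero, one_mul, ← Matrix.mulVec_mulVec, hf]
    ext i; fin_cases i <;> simp
  have htr : (ad X * ad X).trace = 0 := by
    rw [← pow_two, hpow, Matrix.trace_mul_comm, ← mul_assoc, L_inv_mul hg, one_mul, Matrix.trace]
    refine Finset.sum_eq_zero fun i _ => ?_
    have := congrFun (Matrix.mulVec_single_one (w ^ 2) i) i
    rw [Matrix.diag_apply, ← Matrix.col_apply (w ^ 2), ← this, pow_two, ← Matrix.mulVec_mulVec, hf, hf]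
    fin_cases i <;> simp
  rw [trace_ad_mul_ad hX hX] at htr
  have h5 := ad_nilpotent hX (by linarith) (by rw [hpow, hw7]; simp)
  rw [hpow] at h5
  have hw5 : w ^ 5 = 0 := by
    have := congrArg (fun B => g⁻¹ * B * g) h5
    simp only [mul_zero, zero_mul] at this
    rw [← this, show g⁻¹ * (g * w ^ 5 * g⁻¹) * g = (g⁻¹ * g) * w ^ 5 * (g⁻¹ * g) by noncomm_ring,
      L_inv_mul hg, one_mul, mul_one]
  have h1 : (w ^ 5) *ᵥ ![1, 0, 0, 0, 0, 0, 0, 0] = 0 := by rw [hw5, Matrix.zero_mulVec]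
  simp only [pow_succ, pow_zero, one_mul, ← Matrix.mulVec_mulVec, hf] at h1
  have h2 := congrFun h1 6
  simp at h2

/-- A closed condition, invariant under `SL(3,ℝ)`, that separates the two normal forms. -/
def typeR : Set M8 := {B | ∀ l m u : Fin 3 → ℝ, l ⬝ᵥ u = 0 → m ⬝ᵥ u = 0 →
  l ⬝ᵥ (toM (B *ᵥ coord (Matrix.vecMulVec u m)) *ᵥ u) = 0}

lemma vecMulVec_mem_sl3 {u m : Fin 3 → ℝ} (h : m ⬝ᵥ u = 0) : Matrix.vecMulVec u m ∈ sl3 := by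
  rw [mem_sl3_iff]
  simp only [dotProduct, Fin.sum_univ_three] at h
  simp only [Matrix.vecMulVec_apply]
  linarith

lemma typeR_conj {b : M3} (hb : IsUnit b.det) {B : M8} (h : B ∈ typeR) :
    conjInv (Ad b) B ∈ typeR := by
  intro l m u hl hm
  have hbb := Matrix.nonsing_inv_mul b hb
  have key := h (l ᵥ* b⁻¹) (m ᵥ* b⁻¹) (b *ᵥ u)
    (by rw [← Matrix.dotProduct_mulVec, Matrix.mulVec_mulVec, hbb, Matrix.one_mulVec, hl])
    (by rw [← Matrix.dotProduct_mulVec, Matrix.mulVec_mulVec, hbb, Matrix.one_mulVec, hm])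
  rw [← Matrix.dotProduct_mulVec] at key
  rw [← key]
  congr 1
  change toM (((Ad b)⁻¹ * B * Ad b) *ᵥ _) *ᵥ u = _
  rw [← Matrix.mulVec_mulVec, ← Matrix.mulVec_mulVec, Ad_inv hb, toM_Ad_mulVec (isUnit_det_inv hb),
    Matrix.nonsing_inv_nonsing_inv _ hb, ← Matrix.mulVec_mulVec, ← Matrix.mulVec_mulVec, Ad_mulVec,
    toM_coord (vecMulVec_mem_sl3 hm)]
  congr 6
  rw [Matrix.mul_vecMulVec, Matrix.vecMulVec_mul]

lemma isClosed_typeR : IsClosed typeR := by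
  simp only [typeR, Set.setOf_forall]
  refine isClosed_iInter fun l => isClosed_iInter fun m => isClosed_iInter fun u =>
    isClosed_iInter fun _ => isClosed_iInter fun _ => isClosed_eq ?_ continuous_const
  have h : Continuous fun B : M8 => toM (B *ᵥ coord (Matrix.vecMulVec u m)) := by
    have h1 : Continuous toM := by
      refine continuous_matrix fun i j => ?_
      fin_cases i <;> fin_cases j <;> simp [toM] <;> fun_prop
    exact h1.comp (Continuous.matrix_mulVec continuous_id continuous_const)
  exact Continuous.dotProduct continuous_const (h.matrix_mulVec continuous_const)

/-- For ad X the expression is (l·Xu)(m·u) - (l·u)(m·Xu), and both products vanish. For R_{-1,1} it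
reduces to two cancelling copies of 6 l₁m₁u₀u₂, indices starting at 0. The condition is linear in B,
so it passes to the span. -/
lemma cayleyR_subset_typeR : (cayleyR : Set M8) ⊆ typeR := by
  intro B hB l m u hl hm
  have hv : l ⬝ᵥ (Matrix.vecMulVec u m *ᵥ u) = 0 := by
    rw [Matrix.vecMulVec_mulVec, hm]; simp
  have had : ∀ X, l ⬝ᵥ (toM (ad X *ᵥ coord (Matrix.vecMulVec u m)) *ᵥ u) = 0 := fun X => by
    rw [toM_ad_mulVec, toM_coord (vecMulVec_mem_sl3 hm), Matrix.mul_vecMulVec,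
      Matrix.vecMulVec_mul, Matrix.sub_mulVec, Matrix.vecMulVec_mulVec, Matrix.vecMulVec_mulVec, hm]
    simp [hl]
  have hR : l ⬝ᵥ (toM (Rm11 *ᵥ coord (Matrix.vecMulVec u m)) *ᵥ u) = 0 := by
    rw [Rm11_mulVec]
    simp [dotProduct, Matrix.mulVec, Fin.sum_univ_three, coord, toM, Matrix.vecMulVec]
    right; ring
  have hadd : ∀ B C : M8, l ⬝ᵥ (toM ((B + C) *ᵥ coord (Matrix.vecMulVec u m)) *ᵥ u) =
      l ⬝ᵥ (toM (B *ᵥ coord (Matrix.vecMulVec u m)) *ᵥ u) +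
      l ⬝ᵥ (toM (C *ᵥ coord (Matrix.vecMulVec u m)) *ᵥ u) := fun B C => by
    rw [Matrix.add_mulVec, toM_add, Matrix.add_mulVec, dotProduct_add]
  induction hB using Submodule.span_induction with
  | mem x hx =>
    obtain rfl | rfl | rfl | rfl := hx
    · exact had _
    · exact had _
    · rw [hadd, had, hR, add_zero]
    · exact had _
  | zero => rw [← ad_zero]; exact had 0
  | add x y _ _ hx hy => rw [hadd, hx, hy, add_zero]
  | smul c x _ hx =>
    rw [Matrix.smul_mulVec, toM_smul, Matrix.smul_mulVec, dotProduct_smul, hx, smul_zero]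

lemma S1m1_mulVec (v : Fin 8 → ℝ) : S1m1 *ᵥ v = ![0, 6 * v 2, 0, 0, 0, -6 * v 6, 0, 0] := by
  have h : S1m1 = -(S8 * Rm11 * S8) := by rw [← conjInv_S8, conjInv_S8_Rm11, neg_neg]
  rw [h, Matrix.neg_mulVec, ← Matrix.mulVec_mulVec, ← Matrix.mulVec_mulVec, S8_mulVec, Rm11_mulVec,
    S8_mulVec]
  ext i; fin_cases i <;> simp

lemma cayleyS_not_subset_typeR : ¬ (cayleyS : Set M8) ⊆ typeR := by
  intro h
  have h1 := h (show ad (e 1) + S1m1 ∈ cayleyS from Submodule.subset_span (by simp))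
  -- With this choice u mᵀ is E₂₃, which S_{1,-1} sends to 6 E₁₂, and l picks up exactly that entry.
  have h2 := h1 ![1, 0, 0] ![0, 0, 1] ![0, 1, 0] (by simp [dotProduct, Fin.sum_univ_three])
    (by simp [dotProduct, Fin.sum_univ_three])
  rw [Matrix.add_mulVec, S1m1_mulVec, e_one, ad_toM] at h2
  simp [dotProduct, Matrix.mulVec, Fin.sum_univ_three, Fin.sum_univ_eight, coord, toM,
    Matrix.vecMulVec, adMat] at h2

lemma finrank_cayleyR_le : Module.finrank ℝ cayleyR ≤ 4 := by
  classical
  have h := finrank_span_finset_le_card (R := ℝ)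
    ({ad (e 0), ad (e 1), ad (e 2) + Rm11, ad ((5 : ℝ) • H1 + (4 : ℝ) • H2)} : Finset M8)
  simp only [Finset.coe_insert, Finset.coe_singleton] at h
  exact h.trans Finset.card_le_four


/-! ### Matrix valued functions on `ℝ³` -/

/-- The derivative of a matrix valued function. -/
def dE (σ : E3 → M8) (p v : E3) : M8 := Matrix.of fun i j => fderiv ℝ (fun q => σ q i j) p v

/-- Differentiability of a matrix valued function. -/
def DiffM (σ : E3 → M8) (p : E3) : Prop := ∀ i j, DifferentiableAt ℝ (fun q => σ q i j) p

/-- Smoothness of a matrix valued function. -/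
def SmoothE (σ : E3 → M8) (W : Set E3) : Prop := ∀ i j, ContDiffOn ℝ ∞ (fun q => σ q i j) W

lemma SmoothE.contDiffAt {σ : E3 → M8} {W : Set E3} (h : SmoothE σ W) (hW : IsOpen W) {p : E3}
    (hp : p ∈ W) (i j : Fin 8) : ContDiffAt ℝ ∞ (fun q => σ q i j) p :=
  (h i j).contDiffAt (hW.mem_nhds hp)

lemma SmoothE.diffM {σ : E3 → M8} {W : Set E3} (h : SmoothE σ W) (hW : IsOpen W) {p : E3}
    (hp : p ∈ W) : DiffM σ p := fun i j =>
  (h.contDiffAt hW hp i j).differentiableAt (by simp)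

lemma DiffM.mul {σ τ : E3 → M8} {p : E3} (hσ : DiffM σ p) (hτ : DiffM τ p) :
    DiffM (fun q => σ q * τ q) p := fun i j => by
  simp only [Matrix.mul_apply]
  exact DifferentiableAt.fun_sum fun k _ => (hσ i k).mul (hτ k j)

lemma DiffM.sub {σ τ : E3 → M8} {p : E3} (hσ : DiffM σ p) (hτ : DiffM τ p) :
    DiffM (fun q => σ q - τ q) p := fun i j => (hσ i j).sub (hτ i j)

lemma DiffM.const (B : M8) (p : E3) : DiffM (fun _ => B) p := fun i j =>
  differentiableAt_const _

lemma SmoothE.mul {σ τ : E3 → M8} {W : Set E3} (hσ : SmoothE σ W) (hτ : SmoothE τ W) :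
    SmoothE (fun q => σ q * τ q) W := fun i j => by
  simp only [Matrix.mul_apply]
  exact ContDiffOn.sum fun k _ => (hσ i k).mul (hτ k j)

lemma SmoothE.const (B : M8) (W : Set E3) : SmoothE (fun _ => B) W := fun i j => contDiffOn_const

/-- On L the inverse is the Killing adjoint K⁻¹aᵀK, linear in a, so no determinant has to be
differentiated. -/
lemma SmoothE.inv {σ : E3 → M8} {W : Set E3} (hσ : SmoothE σ W) (h : ∀ q ∈ W, σ q ∈ L) :
    SmoothE (fun q => (σ q)⁻¹) W := by
  have h1 : SmoothE (fun q => K⁻¹ * (σ q)ᵀ * K) W :=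
    ((SmoothE.const _ _).mul (fun i j => hσ j i)).mul (SmoothE.const _ _)
  exact fun i j => (h1 i j).congr fun q hq => by simp only [L_inv_eq (h q hq)]

lemma dE_mul {σ τ : E3 → M8} {p : E3} (hσ : DiffM σ p) (hτ : DiffM τ p) (v : E3) :
    dE (fun q => σ q * τ q) p v = dE σ p v * τ p + σ p * dE τ p v := by
  ext i j
  simp only [dE, Matrix.of_apply, Matrix.mul_apply, Matrix.add_apply]
  rw [fderiv_fun_sum fun k _ => (hσ i k).fun_mul (hτ k j), ContinuousLinearMap.sum_apply,
    ← Finset.sum_add_distrib]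
  refine Finset.sum_congr rfl fun k _ => ?_
  rw [fderiv_fun_mul (hσ i k) (hτ k j)]
  simp; ring

lemma dE_sub {σ τ : E3 → M8} {p : E3} (hσ : DiffM σ p) (hτ : DiffM τ p) (v : E3) :
    dE (fun q => σ q - τ q) p v = dE σ p v - dE τ p v := by
  ext i j
  simp only [dE, Matrix.of_apply, Matrix.sub_apply]
  rw [fderiv_fun_sub (hσ i j) (hτ i j)]; rfl

lemma dE_const (B : M8) (p v : E3) : dE (fun _ => B) p v = 0 := by
  ext i j; simp [dE]

lemma dE_congr {σ τ : E3 → M8} {p : E3} (h : ∀ᶠ q in nhds p, σ q = τ q) (v : E3) :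
    dE σ p v = dE τ p v := by
  ext i j
  simp only [dE, Matrix.of_apply]
  rw [Filter.EventuallyEq.fderiv_eq (h.mono fun q hq => by rw [hq])]

/-- The derivative as a linear map. -/
def dEₗ (σ : E3 → M8) (p : E3) : E3 →ₗ[ℝ] M8 where
  toFun v := dE σ p v
  map_add' v w := by ext i j; simp [dE]
  map_smul' c v := by ext i j; simp [dE]

lemma dEₗ_apply (σ : E3 → M8) (p v : E3) : dEₗ σ p v = dE σ p v := rfl

lemma linear_eq_sum (f : M8 →ₗ[ℝ] ℝ) (B : M8) :
    f B = ∑ i, ∑ j, B i j * f (Matrix.single i j 1) := by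
  conv_lhs => rw [Matrix.matrix_eq_sum_single B]
  simp only [map_sum]
  refine Finset.sum_congr rfl fun i _ => Finset.sum_congr rfl fun j _ => ?_
  rw [← mul_one (B i j), ← smul_eq_mul, ← Matrix.smul_single, map_smul]; simp

lemma DiffM.linear {σ : E3 → M8} {p : E3} (h : DiffM σ p) (f : M8 →ₗ[ℝ] ℝ) :
    DifferentiableAt ℝ (fun q => f (σ q)) p := by
  simp only [linear_eq_sum f (σ _)]
  exact DifferentiableAt.fun_sum fun i _ => DifferentiableAt.fun_sum fun j _ =>
    (h i j).mul (differentiableAt_const _)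

lemma SmoothE.linear {σ : E3 → M8} {W : Set E3} (h : SmoothE σ W) (f : M8 →ₗ[ℝ] ℝ) :
    ContDiffOn ℝ ∞ (fun q => f (σ q)) W := by
  simp only [linear_eq_sum f (σ _)]
  exact ContDiffOn.sum fun i _ => ContDiffOn.sum fun j _ => (h i j).mul contDiffOn_const

lemma fderiv_linear {σ : E3 → M8} {p : E3} (h : DiffM σ p) (f : M8 →ₗ[ℝ] ℝ) (v : E3) :
    fderiv ℝ (fun q => f (σ q)) p v = f (dE σ p v) := by
  rw [linear_eq_sum f (dE σ p v)]
  simp only [linear_eq_sum f (σ _)]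
  rw [fderiv_fun_sum fun i _ => DifferentiableAt.fun_sum fun j _ =>
    (h i j).fun_mul (differentiableAt_const _), ContinuousLinearMap.sum_apply]
  refine Finset.sum_congr rfl fun i _ => ?_
  rw [fderiv_fun_sum fun j _ => (h i j).fun_mul (differentiableAt_const _),
    ContinuousLinearMap.sum_apply]
  refine Finset.sum_congr rfl fun j _ => ?_
  rw [fderiv_mul_const (h i j)]
  simp [dE, mul_comm]

/-- The derivative of a function with values in a subspace. -/
lemma dE_mem {σ : E3 → M8} {p : E3} (h : DiffM σ p) {N : Submodule ℝ M8}
    (hN : ∀ᶠ q in nhds p, σ q ∈ N) (v : E3) : dE σ p v ∈ N := by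
  by_contra hv
  -- A linear form vanishing on the subspace but not on the derivative would be identically zero
  -- along σ near p.
  obtain ⟨f, hf, hfN⟩ := Submodule.exists_le_ker_of_notMem hv
  apply hf
  rw [← fderiv_linear h]
  have : (fun q => f (σ q)) =ᶠ[nhds p] fun _ => 0 := hN.mono fun q hq => hfN hq
  rw [this.fderiv_eq]; simp

/-- The second derivative. -/
def d2E (σ : E3 → M8) (p v w : E3) : M8 :=
  Matrix.of fun i j => fderiv ℝ (fderiv ℝ (fun q => σ q i j)) p v w

lemma differentiableAt_fderiv {f : E3 → ℝ} {p : E3} (h : ContDiffAt ℝ ∞ f p) :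
    DifferentiableAt ℝ (fderiv ℝ f) p :=
  (h.fderiv_right (m := ∞) (by simp)).differentiableAt (by simp)

lemma d2E_comm {σ : E3 → M8} {p : E3} (h : ∀ i j, ContDiffAt ℝ ∞ (fun q => σ q i j) p)
    (v w : E3) : d2E σ p v w = d2E σ p w v := by
  ext i j
  exact ((h i j).isSymmSndFDerivAt (by simp; exact ENat.LEInfty.out)).eq v w

lemma DiffM.dE {σ : E3 → M8} {p : E3} (h : ∀ i j, ContDiffAt ℝ ∞ (fun q => σ q i j) p)
    {v : E3 → E3} (hv : DifferentiableAt ℝ v p) : DiffM (fun q => dE σ q (v q)) p := fun i j =>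
  (differentiableAt_fderiv (h i j)).clm_apply hv

lemma dE_dE {σ : E3 → M8} {p : E3} (h : ∀ i j, ContDiffAt ℝ ∞ (fun q => σ q i j) p)
    {v : E3 → E3} (hv : DifferentiableAt ℝ v p) (w : E3) :
    dE (fun q => dE σ q (v q)) p w = d2E σ p w (v p) + dE σ p (fderiv ℝ v p w) := by
  ext i j
  simp only [dE, d2E, Matrix.of_apply, Matrix.add_apply]
  rw [fderiv_clm_apply (differentiableAt_fderiv (h i j)) hv]
  simp [add_comm]

lemma SmoothE.dE {σ : E3 → M8} {W : Set E3} (hW : IsOpen W) (h : SmoothE σ W) (v : E3) :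
    SmoothE (fun q => dE σ q v) W := fun i j =>
  ((h i j).fderiv_of_isOpen hW (m := ∞) (by simp)).clm_apply contDiffOn_const

/-! ### The lower triangular part of the Maurer–Cartan form -/

/-- The vertical space `ad 𝔤⁰`. -/
def gB : Submodule ℝ M8 := gZero.map adₗ

lemma gB_bracket {B C : M8} (hB : B ∈ gB) (hC : C ∈ gB) : B * C - C * B ∈ gB := by
  obtain ⟨X, hX, rfl⟩ := hB
  obtain ⟨Y, hY, rfl⟩ := hC
  refine ⟨X * Y - Y * X, ?_, ad_bracket X Y⟩
  rw [SetLike.mem_coe, mem_gZero_iff] at *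
  exact ⟨bracket_mem_sl3 _ _, by simpa using mFil_bracket hX.2 hY.2⟩

/-- The component in `𝔤_-` of an element of `𝔩`. -/
def piM : M8 →ₗ[ℝ] (Fin 3 → ℝ) := LinearMap.pi fun i =>
  (6⁻¹ : ℝ) • ((Matrix.traceLinearMap (Fin 8) ℝ ℝ) ∘ₗ (LinearMap.mulRight ℝ (ad (eCheck i))))

lemma eCheck_mem_sl3 (i : Fin 3) : eCheck i ∈ sl3 := by
  rw [mem_sl3_iff]; fin_cases i <;> simp [eCheck, E]

lemma piM_apply {Y : M3} (hY : Y ∈ sl3) {Q : M8} (hQ : Q ∈ gPerp) :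
    piM (ad Y + Q) = ![Y 2 0, Y 1 0, Y 2 1] := by
  have h : ∀ i, piM (ad Y + Q) i = (Y * eCheck i).trace := fun i => by
    change 6⁻¹ * ((ad Y + Q) * ad (eCheck i)).trace = _
    rw [add_mul, Matrix.trace_add, hQ.2 _ (eCheck_mem_sl3 i), trace_ad_mul_ad hY (eCheck_mem_sl3 i)]
    ring
  ext i
  rw [h]
  fin_cases i
  · exact trace_mul_E Y 2 0
  · exact trace_mul_E Y 1 0
  · exact trace_mul_E Y 2 1

lemma piM_of_mem_gB {w : M8} (h : w ∈ gB) : piM w = 0 := by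
  obtain ⟨Y, hY, rfl⟩ := h
  have := piM_apply hY.1 (zero_mem gPerp)
  rw [add_zero] at this
  rw [show adₗ Y = ad Y from rfl, this]
  ext i; fin_cases i <;> simp <;> exact hY.2 _ _ (by simp)

/-! ### Inverse matrices depending on parameters -/

lemma contDiffAt_inv_apply {f : E3 → Matrix (Fin 3) (Fin 3) ℝ} {p : E3}
    (h : ∀ i j, ContDiffAt ℝ ∞ (fun q => f q i j) p) (hd : (f p).det ≠ 0) (i j : Fin 3) :
    ContDiffAt ℝ ∞ (fun q => (f q)⁻¹ i j) p := by
  have hdet : ContDiffAt ℝ ∞ (fun q => (f q).det) p := by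
    simp only [Matrix.det_fin_three]
    fun_prop
  have hadj : ContDiffAt ℝ ∞ (fun q => (f q).adjugate i j) p := by
    simp only [Matrix.adjugate_fin_three]
    fin_cases i <;> fin_cases j <;> simp <;> fun_prop
  simp only [Matrix.inv_def, Matrix.smul_apply, Ring.inverse_eq_inv', smul_eq_mul]
  exact (hdet.inv hd).mul hadj

/-- Frames on an open subset of `ℝ³` that are moved along all directions by the infinitesimal
symmetries in `S`, and whose Maurer–Cartan form maps tangent spaces isomorphically onto `𝔤_-`. -/
structure FrameField (S : Submodule ℝ M8) (W : Set E3) (σ : E3 → M8) : Prop where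
  isOpen : IsOpen W
  smooth : SmoothE σ W
  mem_L : ∀ p ∈ W, σ p ∈ L
  immersion : ∀ p ∈ W, ∀ v, piM ((σ p)⁻¹ * dE σ p v) = 0 → v = 0
  trans : ∀ p ∈ W, ∀ v, ∃ B ∈ S, ∃ η ∈ gB, (σ p)⁻¹ * dE σ p v = (σ p)⁻¹ * B * σ p + η
  sym : ∀ p ∈ W, ∀ B ∈ S, ∃ v, ∃ η ∈ gB, (σ p)⁻¹ * B * σ p = (σ p)⁻¹ * dE σ p v + η

namespace FrameField

variable {S : Submodule ℝ M8} {W : Set E3} {σ : E3 → M8}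

/-- The matrix of the `𝔤_-` component of the Maurer–Cartan form. -/
def solder (σ : E3 → M8) (q : E3) : Matrix (Fin 3) (Fin 3) ℝ :=
  Matrix.of fun i k => piM ((σ q)⁻¹ * dE σ q (EuclideanSpace.single k 1)) i

lemma solder_mulVec (σ : E3 → M8) (q v : E3) :
    solder σ q *ᵥ (fun i => v i) = piM ((σ q)⁻¹ * dE σ q v) := by
  have hv : v = ∑ k, v k • EuclideanSpace.single k (1 : ℝ) := by
    ext i; simp [Finset.sum_apply, Pi.single_apply]
  have h : piM ((σ q)⁻¹ * dE σ q v) =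
      ∑ k, v k • piM ((σ q)⁻¹ * dE σ q (EuclideanSpace.single k 1)) := by
    conv_lhs => rw [hv]
    rw [← dEₗ_apply, map_sum, Finset.mul_sum, map_sum]
    refine Finset.sum_congr rfl fun k _ => ?_
    rw [map_smul, mul_smul_comm, map_smul, dEₗ_apply]
  rw [h]
  ext i
  simp [Matrix.mulVec, dotProduct, solder, mul_comm]

lemma isUnit_solder (h : FrameField S W σ) {p : E3} (hp : p ∈ W) : IsUnit (solder σ p).det := by
  rw [← Matrix.isUnit_iff_isUnit_det, ← Matrix.mulVec_injective_iff_isUnit]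
  rw [← Matrix.coe_mulVecLin, ← LinearMap.ker_eq_bot, LinearMap.ker_eq_bot']
  intro v hv
  have h1 := h.immersion p hp (WithLp.toLp 2 v) (by
    rw [← solder_mulVec]; exact hv)
  simpa using h1

lemma contDiffAt_piM (h : SmoothE σ W) (hW : IsOpen W) {p : E3} (hp : p ∈ W) (i : Fin 3) :
    ContDiffAt ℝ ∞ (fun q => piM (σ q) i) p :=
  (h.linear (LinearMap.proj i ∘ₗ piM)).contDiffAt (hW.mem_nhds hp)

/-- The vector field on the base induced by an infinitesimal symmetry. -/
def field (σ : E3 → M8) (B : M8) (q : E3) : E3 :=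
  WithLp.toLp 2 ((solder σ q)⁻¹ *ᵥ piM ((σ q)⁻¹ * B * σ q))

lemma differentiableAt_field (h : FrameField S W σ) (B : M8) {p : E3} (hp : p ∈ W) :
    DifferentiableAt ℝ (field σ B) p := by
  have hi := h.smooth.inv h.mem_L
  rw [differentiableAt_euclidean]
  intro i
  simp only [field, Matrix.mulVec, dotProduct]
  refine DifferentiableAt.fun_sum fun k _ => DifferentiableAt.mul ?_ ?_
  · refine (contDiffAt_inv_apply (fun i j => ?_) (h.isUnit_solder hp).ne_zero i k).differentiableAt
      (by simp)
    exact contDiffAt_piM (hi.mul (h.smooth.dE h.isOpen _)) h.isOpen hp i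
  · exact (contDiffAt_piM ((hi.mul (SmoothE.const B W)).mul h.smooth) h.isOpen hp k).differentiableAt
      (by simp)

/-- The base vector moved by a symmetry is determined by its 𝔤₋-component, because vertical terms
have none. Inverting the solder matrix thus recovers the vector given by `sym`, and the formula
makes it depend differentiably on the point. -/
lemma field_spec (h : FrameField S W σ) {B : M8} (hB : B ∈ S) {p : E3} (hp : p ∈ W) :
    (σ p)⁻¹ * B * σ p - (σ p)⁻¹ * dE σ p (field σ B p) ∈ gB := by
  obtain ⟨v, η, hη, he⟩ := h.sym p hp B hB
  have hv : field σ B p = v := by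
    have h1 : piM ((σ p)⁻¹ * B * σ p) = solder σ p *ᵥ (fun i => v i) := by
      rw [he, map_add, piM_of_mem_gB hη, add_zero, solder_mulVec]
    rw [field, h1, Matrix.mulVec_mulVec, Matrix.nonsing_inv_mul _ (h.isUnit_solder hp),
      Matrix.one_mulVec]
  rw [hv, he]; simpa using hη

/-- The infinitesimal symmetries form a Lie algebra. -/
theorem bracket (h : FrameField S W σ) {B C : M8} (hB : B ∈ S) (hC : C ∈ S) {p : E3}
    (hp : p ∈ W) : ∃ v, ∃ η ∈ gB,
      (σ p)⁻¹ * (B * C - C * B) * σ p = (σ p)⁻¹ * dE σ p v + η := by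
  set Y : M8 → E3 → M8 := fun B q => (σ q)⁻¹ * B * σ q - (σ q)⁻¹ * dE σ q (field σ B q) with hYdef
  have hc := h.smooth.contDiffAt h.isOpen hp
  have hσ := h.smooth.diffM h.isOpen hp
  have hi := (h.smooth.inv h.mem_L).diffM h.isOpen hp
  have hW := h.isOpen.mem_nhds hp
  have hYd : ∀ B, DiffM (Y B) p := fun B =>
    ((hi.mul (DiffM.const B p)).mul hσ).sub (hi.mul (DiffM.dE hc (h.differentiableAt_field B hp)))
  -- Tangency of left translation by B as a first order equation for σ, with vertical correction Y
  -- B; it will be differentiated once more.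
  have hid : ∀ B, ∀ q ∈ W, B * σ q - σ q * Y B q = dE σ q (field σ B q) := fun B q hq => by
    rw [hYdef]
    simp only [mul_sub, ← mul_assoc, L_mul_inv (h.mem_L q hq), one_mul]
    abel
  have hder : ∀ B w, B * dE σ p w - (dE σ p w * Y B p + σ p * dE (Y B) p w) =
      d2E σ p w (field σ B p) + dE σ p (fderiv ℝ (field σ B) p w) := fun B w => by
    rw [← dE_dE hc (h.differentiableAt_field B hp),
      ← dE_congr (Filter.eventually_of_mem hW (hid B)), dE_sub ((DiffM.const B p).mul hσ)
      (hσ.mul (hYd B)), dE_mul (DiffM.const B p) hσ, dE_const, dE_mul hσ (hYd B)]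
    simp
  have hBC := hder B (field σ C p)
  have hCB := hder C (field σ B p)
  -- Symmetry of the second derivative makes the second order terms cancel in the difference of the
  -- two equations.
  rw [d2E_comm hc] at hCB
  rw [← hid C p hp] at hBC
  rw [← hid B p hp] at hCB
  have hmem : ∀ B ∈ S, ∀ᶠ q in nhds p, Y B q ∈ gB := fun B hB =>
    Filter.eventually_of_mem hW fun q hq => h.field_spec hB hq
  -- The base vector is the Lie bracket of the induced fields of C and B, in this order. The
  -- vertical term is the bracket of the corrections plus their derivatives, and these derivatives
  -- stay in the linear space ad 𝔤⁰.
  refine ⟨fderiv ℝ (field σ B) p (field σ C p) - fderiv ℝ (field σ C) p (field σ B p),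
    (Y B p * Y C p - Y C p * Y B p) + (dE (Y B) p (field σ C p) - dE (Y C) p (field σ B p)),
    add_mem (gB_bracket (h.field_spec hB hp) (h.field_spec hC hp))
      (sub_mem (dE_mem (hYd B) (hmem B hB) _) (dE_mem (hYd C) (hmem C hC) _)), ?_⟩
  have key : (B * C - C * B) * σ p = dE σ p (fderiv ℝ (field σ B) p (field σ C p) -
      fderiv ℝ (field σ C) p (field σ B p)) + σ p * ((Y B p * Y C p - Y C p * Y B p) +
      (dE (Y B) p (field σ C p) - dE (Y C) p (field σ B p))) := by
    rw [← dEₗ_apply, map_sub, dEₗ_apply, dEₗ_apply]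
    have h1 := congrArg₂ (· - ·) hBC hCB
    simp only [add_sub_add_left_eq_sub] at h1
    rw [← h1]
    noncomm_ring
  rw [mul_assoc, key, mul_add, ← mul_assoc _ (σ p), L_inv_mul (h.mem_L p hp), one_mul]

end FrameField

/-! ### Cartan bundles in charts -/

lemma inv_mem_mFil {b : M3} (hb : b ∈ GZero) : b⁻¹ ∈ mFil 0 := by
  have h1 := hb.2 1 0 (by simp)
  have h2 := hb.2 2 0 (by simp)
  have h3 := hb.2 2 1 (by simp)
  have hinv : b⁻¹ = b.adjugate := by rw [Matrix.inv_def, hb.1]; simp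
  rw [hinv, Matrix.adjugate_fin_three]
  intro i j hij
  fin_cases i <;> fin_cases j <;> simp at hij <;> simp [h1, h2, h3]

lemma mem_mFil_of_GZero {b : M3} (hb : b ∈ GZero) : b ∈ mFil 0 := by
  intro i j hij
  refine hb.2 i j ?_
  rw [← Fin.val_fin_lt]; omega

lemma Ad_mem_glFil {b : M3} (hb : b ∈ GZero) : Ad b ∈ glFil 0 := by
  intro i j h
  have h1 := mFil_mul (mFil_mul (mem_mFil_of_GZero hb) (A_mem_mFil j)) (inv_mem_mFil hb)
  exact coord_of_mFil h1 i (by omega)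

/-- In the graph of χ, filtration degree at least 0 forces the 𝔤-part into 𝔤⁰, where χ no longer
contributes. Vertical vectors can thus be recognized by a linear condition. -/
lemma mem_gB_of_graph {χ : gMinus →ₗ[ℝ] M8} (hχ : ∀ X, χ X ∈ gPerp) {Y : M3} (hY : Y ∈ sl3)
    (h : ad Y + χ (lowerPart Y) ∈ glFil 0) : ad Y + χ (lowerPart Y) ∈ gB := by
  have hY0 := mFil_of_add_mem (hχ _) hY (add_comm (ad Y) _ ▸ h)
  rw [lowerPart_of_mem hY0, map_zero, add_zero]
  exact ⟨Y, mem_gZero_iff.mpr ⟨hY, hY0⟩, rfl⟩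

lemma one_mem_GZero : (1 : M3) ∈ GZero :=
  ⟨Matrix.det_one, fun i j h => Matrix.one_apply_ne h.ne'⟩

variable {M : Type*} [TopologicalSpace M] [ChartedSpace E3 M] [IsManifold (𝓡 3) ∞ M]

lemma isManifold_one : IsManifold (𝓡 3) 1 M :=
  IsManifold.of_le (n := ∞) (by exact_mod_cast le_top)

/-- The derivative of a function on a manifold, computed in a chart. -/
lemma mfderiv_eq_chart (x : M) {F : M → ℝ} {y : M} (hy : y ∈ (chartAt E3 x).source)
    (hF : MDifferentiableAt (𝓡 3) 𝓘(ℝ, ℝ) F y) (X : TangentSpace (𝓡 3) y) :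
    (mfderiv (𝓡 3) 𝓘(ℝ, ℝ) F y X : ℝ) = fderiv ℝ (F ∘ (chartAt E3 x).symm) (chartAt E3 x y)
      (mfderiv (𝓡 3) (𝓡 3) (chartAt E3 x) y X) := by
  haveI : IsManifold (𝓡 3) 1 M := isManifold_one
  set c := chartAt E3 x with hc
  have hd := mdifferentiable_chart (I := 𝓡 3) x
  have h1 : F =ᶠ[nhds y] (F ∘ c.symm) ∘ c := by
    filter_upwards [c.open_source.mem_nhds hy] with z hz
    simp [c.left_inv hz]
  have hs : MDifferentiableAt (𝓡 3) (𝓡 3) c.symm (c y) := hd.mdifferentiableAt_symm (c.map_source hy)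
  have h2 : MDifferentiableAt (𝓡 3) 𝓘(ℝ, ℝ) (F ∘ c.symm) (c y) := by
    refine MDifferentiableAt.comp _ ?_ hs
    rwa [c.left_inv hy]
  rw [h1.mfderiv_eq, mfderiv_comp y h2 (hd.mdifferentiableAt hy), mfderiv_eq_fderiv]
  rfl

/-- The domain in a chart of a function defined on an open subset of a manifold. -/
def chartDom (x : M) (U : Set M) : Set E3 :=
  (chartAt E3 x).target ∩ (chartAt E3 x).symm ⁻¹' U

lemma isOpen_chartDom (x : M) {U : Set M} (hU : IsOpen U) : IsOpen (chartDom x U) :=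
  (chartAt E3 x).isOpen_inter_preimage_symm hU

lemma contDiffOn_chart {x : M} {U : Set M} {F : M → ℝ}
    (hF : ContMDiffOn (𝓡 3) 𝓘(ℝ, ℝ) ∞ F U) :
    ContDiffOn ℝ ∞ (F ∘ (chartAt E3 x).symm) (chartDom x U) := by
  rw [← contMDiffOn_iff_contDiffOn]
  exact hF.comp ((contMDiffOn_chart_symm (x := x)).mono Set.inter_subset_left)
    (fun q hq => hq.2)

lemma smoothE_chart {x : M} {U : Set M} {s : M → M8} (hs : SmoothMat s U) :
    SmoothE (s ∘ (chartAt E3 x).symm) (chartDom x U) := fun i j => contDiffOn_chart (hs i j)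

lemma dMat_eq_chart {x : M} {U : Set M} (hU : IsOpen U) {s : M → M8} (hs : SmoothMat s U) {y : M}
    (hy : y ∈ (chartAt E3 x).source) (hyU : y ∈ U) (X : TangentSpace (𝓡 3) y) :
    dMat s y X = dE (s ∘ (chartAt E3 x).symm) (chartAt E3 x y)
      (mfderiv (𝓡 3) (𝓡 3) (chartAt E3 x) y X) := by
  ext i j
  refine mfderiv_eq_chart x hy ?_ X
  exact ((hs i j).contMDiffAt (hU.mem_nhds hyU)).mdifferentiableAt (by simp)

lemma chart_mfderiv_surjective {x y : M} (hy : y ∈ (chartAt E3 x).source) (v : E3) :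
    ∃ X : TangentSpace (𝓡 3) y, mfderiv (𝓡 3) (𝓡 3) (chartAt E3 x) y X = v := by
  haveI : IsManifold (𝓡 3) 1 M := isManifold_one
  exact ((mdifferentiable_chart (I := 𝓡 3) x).mfderiv_bijective hy).2 v

namespace IsCartanBundle

variable {φ : M → ℤ → Submodule ℝ (Fin 8 → ℝ)} {P : Set (M × M8)}

lemma mem_L (h : IsCartanBundle φ P) {x : M} {a : M8} (ha : (x, a) ∈ P) : a ∈ L := (h.frame x a ha).1

/-- The image of the Maurer–Cartan form in terms of a local frame. -/
lemma mem_omegaImage_iff (h : IsCartanBundle φ P) {U : Set M} {s : M → M8}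
    (hs : IsLocalFrame P U s) (x : M) {p : E3} (hp : p ∈ chartDom x U) (w : M8) :
    w ∈ omegaImage P ((chartAt E3 x).symm p) (s ((chartAt E3 x).symm p)) ↔
      ∃ v, ∃ η ∈ gB, w = (s ((chartAt E3 x).symm p))⁻¹ * dE (s ∘ (chartAt E3 x).symm) p v + η := by
  set c := chartAt E3 x with hc
  set y := c.symm p with hy
  set σ := s ∘ c.symm with hσ
  have hyc : y ∈ c.source := c.map_target hp.1
  have hcy : c y = p := c.right_inv hp.1
  have hyU : y ∈ U := hp.2
  have hyP := hs.2.2 y hyU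
  obtain ⟨χ, ⟨hχp, hχ⟩, -⟩ := h.normal y _ hyP
  have hgB : ∀ η ∈ gB, η ∈ omegaImage P y (s y) := by
    rintro _ ⟨Y, hY, rfl⟩
    exact Submodule.subset_span (Or.inr ⟨Y, hY, rfl⟩)
  have hθ : ∀ X : TangentSpace (𝓡 3) y, (s y)⁻¹ * dMat s y X ∈ omegaImage P y (s y) := fun X =>
    Submodule.subset_span (Or.inl ⟨U, s, X, hs, hyU, rfl, rfl⟩)
  have hd : ∀ X : TangentSpace (𝓡 3) y, dMat s y X =
      dE σ p (mfderiv (𝓡 3) (𝓡 3) c y X) := fun X => by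
    rw [dMat_eq_chart hs.1 hs.2.1 hyc hyU, hcy]
  constructor
  · intro hw
    let O : Submodule ℝ M8 := LinearMap.range
      (LinearMap.mulLeft ℝ (s y)⁻¹ ∘ₗ dEₗ σ p) ⊔ gB
    suffices omegaImage P y (s y) ≤ O by
      obtain ⟨_, ⟨v, rfl⟩, η, hη, he⟩ := Submodule.mem_sup.mp (this hw)
      exact ⟨v, η, hη, he.symm⟩
    refine Submodule.span_le.mpr ?_
    rintro w (⟨U', s', X, hs', hyU', he, rfl⟩ | ⟨Y, hY, rfl⟩)
    · set σ' := s' ∘ c.symm with hσ'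
      have hp' : p ∈ chartDom x U' := ⟨hp.1, hyU'⟩
      have hd' : dMat s' y X = dE σ' p (mfderiv (𝓡 3) (𝓡 3) c y X) := by
        rw [dMat_eq_chart hs'.1 hs'.2.1 hyc hyU', hcy]
      set v : E3 := mfderiv (𝓡 3) (𝓡 3) c y X with hv
      have hWo := isOpen_chartDom x hs.1
      have hWo' := isOpen_chartDom x hs'.1
      have hσs := smoothE_chart (x := x) hs.2.1
      have hσs' := smoothE_chart (x := x) hs'.2.1
      have hσL : ∀ q ∈ chartDom x U, σ q ∈ L := fun q hq => h.mem_L (hs.2.2 _ hq.2)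
      have hci := (hσs.inv hσL).diffM hWo hp
      have hcd : DiffM (fun q => (σ q)⁻¹ * σ' q) p := hci.mul (hσs'.diffM hWo' hp')
      have hev : ∀ᶠ q in nhds p, q ∈ chartDom x U ∧ q ∈ chartDom x U' :=
        (hWo.eventually_mem hp).and (hWo'.eventually_mem hp')
      -- The transition map takes values in Ad G⁰, inside the linear space of operators of degree at
      -- least 0, so its derivative lies there too. Being also in the image of ω, it is vertical; no
      -- differentiable choice of b is needed.
      have hC : dE (fun q => (σ q)⁻¹ * σ' q) p v ∈ glFil 0 := by
        refine dE_mem hcd (hev.mono ?_) v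
        rintro q ⟨hq, hq'⟩
        obtain ⟨b, hb, hbe⟩ := (h.torsor _ _ (hs.2.2 _ hq.2) _).mp (hs'.2.2 _ hq'.2)
        change (s (c.symm q))⁻¹ * s' (c.symm q) ∈ glFil 0
        have hL : s (c.symm q) ∈ L := hσL q hq
        rw [hbe, ← mul_assoc, L_inv_mul hL, one_mul]
        exact Ad_mem_glFil hb
      have hprod : dE σ' p v = dE σ p v + s y * dE (fun q => (σ q)⁻¹ * σ' q) p v := by
        have : dE σ' p v = dE (fun q => σ q * ((σ q)⁻¹ * σ' q)) p v := by
          refine dE_congr (hev.mono ?_) v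
          rintro q ⟨hq, -⟩
          rw [← mul_assoc, L_mul_inv (hσL q hq), one_mul]
        rw [this, dE_mul (hσs.diffM hWo hp) hcd]
        change _ * ((s y)⁻¹ * s' y) + s y * _ = _
        rw [he, L_inv_mul (h.mem_L hyP), mul_one]
      have hsum : (s y)⁻¹ * dMat s' y X = (s y)⁻¹ * dE σ p v +
          dE (fun q => (σ q)⁻¹ * σ' q) p v := by
        rw [hd', hprod, mul_add, ← mul_assoc, L_inv_mul (h.mem_L hyP), one_mul]
      have hCO : dE (fun q => (σ q)⁻¹ * σ' q) p v ∈ omegaImage P y (s y) := by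
        have h1 : (s y)⁻¹ * dMat s' y X ∈ omegaImage P y (s y) :=
          Submodule.subset_span (Or.inl ⟨U', s', X, hs', hyU', he, rfl⟩)
        have h2 := hθ X
        rw [hd] at h2
        have := sub_mem h1 h2
        rwa [hsum, add_sub_cancel_left] at this
      rw [SetLike.mem_coe, hsum]
      refine add_mem (Submodule.mem_sup_left ⟨v, rfl⟩) (Submodule.mem_sup_right ?_)
      obtain ⟨Y, hY, hYe⟩ := (hχ _).mp hCO
      rw [hYe] at hC ⊢
      exact mem_gB_of_graph hχp hY hC
    · exact Submodule.mem_sup_right ⟨Y, hY, rfl⟩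
  · rintro ⟨v, η, hη, rfl⟩
    refine add_mem ?_ (hgB η hη)
    obtain ⟨X, hX⟩ := chart_mfderiv_surjective hyc v
    rw [← hX, ← hd]
    exact hθ X

/-- A local frame of a transitive Cartan bundle, read in a chart. -/
theorem frameField (h : IsCartanBundle φ P) (ht : IsTransitive P) {U : Set M} {s : M → M8}
    (hs : IsLocalFrame P U s) (x : M) :
    FrameField (symAlg P) (chartDom x U) (s ∘ (chartAt E3 x).symm) where
  isOpen := isOpen_chartDom x hs.1
  smooth := smoothE_chart hs.2.1
  mem_L p hp := h.mem_L (hs.2.2 _ hp.2)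
  immersion p hp := by
    set y := (chartAt E3 x).symm p with hy
    set σ := s ∘ (chartAt E3 x).symm with hσ
    have hyP := hs.2.2 _ hp.2
    obtain ⟨χ, ⟨hχp, hχ⟩, -⟩ := h.normal _ _ hyP
    let f : E3 →ₗ[ℝ] (Fin 3 → ℝ) := piM ∘ₗ LinearMap.mulLeft ℝ (σ p)⁻¹ ∘ₗ dEₗ σ p
    -- The structure function provides a vector in the image of ω for each element of 𝔤₋, so the
    -- 𝔤₋-part of the form is onto; injectivity follows as both sides have dimension 3.
    have hsurj : Function.Surjective f := by
      intro t
      have hY : t 0 • e 0 + t 1 • e 1 + t 2 • e 2 ∈ sl3 :=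
        add_mem (add_mem (sl3.smul_mem _ (e_mem_sl3 0)) (sl3.smul_mem _ (e_mem_sl3 1)))
          (sl3.smul_mem _ (e_mem_sl3 2))
      obtain ⟨v, η, hη, hv⟩ := (h.mem_omegaImage_iff hs x hp _).mp ((hχ _).mpr ⟨_, hY, rfl⟩)
      refine ⟨v, ?_⟩
      have := congrArg piM hv
      rw [piM_apply hY (hχp _), map_add, piM_of_mem_gB hη, add_zero] at this
      change piM ((σ p)⁻¹ * dE σ p v) = t
      rw [hσ, Function.comp_apply, ← this]
      ext i; fin_cases i <;> simp [e, E]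
    have hinj : Function.Injective f :=
      (LinearMap.injective_iff_surjective_of_finrank_eq_finrank (by simp)).mpr hsurj
    intro v hv
    exact hinj (hv.trans (map_zero f).symm)
  trans p hp v := by
    have hw := (h.mem_omegaImage_iff hs x hp _).mpr ⟨v, 0, zero_mem _, rfl⟩
    obtain ⟨_, ⟨B, hB, rfl⟩, Y, hY, he⟩ := ht _ _ (hs.2.2 _ hp.2) _ hw
    rw [add_zero] at he
    exact ⟨B, hB, ad Y, ⟨Y, hY, rfl⟩, he⟩
  sym p hp B hB := (h.mem_omegaImage_iff hs x hp _).mp (hB.2 _ _ (hs.2.2 _ hp.2))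

/-- Tangency is checked frame by frame along a local section through the frame, where it is
`FrameField.bracket` read in a chart. -/
lemma symAlg_bracket (h : IsCartanBundle φ P) (ht : IsTransitive P) {B C : M8}
    (hB : B ∈ symAlg P) (hC : C ∈ symAlg P) : B * C - C * B ∈ symAlg P := by
  refine ⟨lAlg_bracket hB.1 hC.1, fun x a ha => ?_⟩
  obtain ⟨U, s, hs, hxU, rfl⟩ := h.local_section x a ha
  have hxc := mem_chart_source E3 x
  have hp : chartAt E3 x x ∈ chartDom x U :=
    ⟨(chartAt E3 x).map_source hxc, by
      rw [Set.mem_preimage, (chartAt E3 x).left_inv hxc]; exact hxU⟩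
  have := (h.mem_omegaImage_iff hs x hp _).mpr ((h.frameField ht hs x).bracket hB hC hp)
  simp only [Function.comp_apply, (chartAt E3 x).left_inv hxc] at this
  exact this

/-- The symmetry algebra in a frame satisfies the hypotheses of the classification. -/
theorem algData (h : IsCartanBundle φ P) (ht : IsTransitive P) {x : M} {a : M8}
    (ha : (x, a) ∈ P) {χ : gMinus →ₗ[ℝ] M8} (hχ : IsStructureFunctionAt P x a χ)
    (hn : IsNormal χ) : AlgData (symAlgAt P a) χ where
  perp := hχ.1
  normal := hn
  graph := by
    rintro _ ⟨B, hB, rfl⟩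
    exact (hχ.2 _).mp (hB.2 x a ha)
  trans Y hY := by
    obtain ⟨B, hB, Z, hZ, he⟩ := ht x a ha _ ((hχ.2 _).mpr ⟨Y, hY, rfl⟩)
    refine ⟨Z, hZ, ?_⟩
    rw [ad_sub, show ad Y - ad Z + χ (lowerPart Y) = (ad Y + χ (lowerPart Y)) - ad Z by abel, he,
      add_sub_cancel_right]
    exact hB
  lie := by
    rintro _ ⟨B, hB, rfl⟩ _ ⟨C, hC, rfl⟩
    exact ⟨_, h.symAlg_bracket ht hB hC, conjInv_bracket (h.mem_L ha) B C⟩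

end IsCartanBundle

/-! ### The normal form of the structure function -/

lemma Rm11_eq_single : Rm11 = Matrix.single 2 1 (-6) + Matrix.single 6 5 6 := by
  refine ext_mulVec fun v => ?_
  rw [Rm11_mulVec]
  ext i; fin_cases i <;> simp [Matrix.add_mulVec, Matrix.single_mulVec]

lemma Rm11_mem_gPerp : Rm11 ∈ gPerp := by
  refine ⟨?_, fun X hX => ?_⟩
  · rw [mem_lAlg_iff]
    intro v w
    rw [Rm11_mulVec, Rm11_mulVec]
    simp [Matrix.trace, Matrix.mul_apply, Fin.sum_univ_three, toM]
    ring
  · rw [Rm11_eq_single, ad_eq_adMat hX, add_mul, Matrix.trace_add, Matrix.trace_single_mul,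
      Matrix.trace_single_mul]
    simp [adMat]

lemma S1m1_mem_gPerp : S1m1 ∈ gPerp := by
  rw [← neg_neg S1m1, ← conjInv_S8_Rm11]
  exact neg_mem (conjInv_S8_mem_gPerp Rm11_mem_gPerp)

/-- The algebra H lies in the graph of χ, so it determines χ: the normal form of H yields that of
the structure function. -/
lemma AlgData.map_e_eq {H : Submodule ℝ M8} {χ : gMinus →ₗ[ℝ] M8} (h : AlgData H χ) {i : Fin 3}
    {Q : M8} (hQ : Q ∈ gPerp) (hH : ad (e i) + Q ∈ H) : χ (lowerPart (e i)) = Q := by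
  obtain ⟨Y, hY, he⟩ := h.graph _ hH
  have h1 := graph_unique hQ (h.perp _) (e_mem_sl3 i) hY he
  rw [h1.1, ← h1.2]

lemma ext_gMinus {χ χ' : gMinus →ₗ[ℝ] M8}
    (h : ∀ i, χ (lowerPart (e i)) = χ' (lowerPart (e i))) : χ = χ' := by
  ext1 X
  rw [← lowerPart_coe X, map_lowerPart, map_lowerPart χ', h, h, h]

lemma AlgData.eq_xiR {χ : gMinus →ₗ[ℝ] M8} (h : AlgData cayleyR χ) : χ = xiR := by
  have hx : ∀ i, xiR (lowerPart (e i)) = (e i 2 1) • Rm11 := fun i => rfl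
  refine ext_gMinus fun i => ?_
  rw [hx]
  fin_cases i
  · exact (h.map_e_eq (Q := 0) (zero_mem _) (by
      rw [add_zero]; exact Submodule.subset_span (by simp))).trans (by simp [e, E])
  · exact (h.map_e_eq (Q := 0) (zero_mem _) (by
      rw [add_zero]; exact Submodule.subset_span (by simp))).trans (by simp [e, E])
  · exact (h.map_e_eq Rm11_mem_gPerp (Submodule.subset_span (by simp))).trans (by simp [e, E])

lemma AlgData.eq_xiS {χ : gMinus →ₗ[ℝ] M8} (h : AlgData cayleyS χ) : χ = xiS := by
  have hx : ∀ i, xiS (lowerPart (e i)) = (e i 1 0) • S1m1 := fun i => rfl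
  refine ext_gMinus fun i => ?_
  rw [hx]
  fin_cases i
  · exact (h.map_e_eq (Q := 0) (zero_mem _) (by
      rw [add_zero]; exact Submodule.subset_span (by simp))).trans (by simp [e, E])
  · exact (h.map_e_eq S1m1_mem_gPerp (Submodule.subset_span (by simp))).trans (by simp [e, E])
  · exact (h.map_e_eq (Q := 0) (zero_mem _) (by
      rw [add_zero]; exact Submodule.subset_span (by simp))).trans (by simp [e, E])

lemma map_S8_cayleyS : cayleyS.map (conjInv S8) = cayleyR := by
  rw [← map_S8_cayleyR, map_S8_map_S8]

/-! ### Constancy of the type along the base -/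

section

variable {M : Type*} [TopologicalSpace M] [ChartedSpace E3 M]
  {φ : M → ℤ → Submodule ℝ (Fin 8 → ℝ)} {P : Set (M × M8)}

lemma symAlgAt_mul (P : Set (M × M8)) (a c : M8) :
    symAlgAt P (a * c) = (symAlgAt P a).map (conjInv c) := map_conjInv_mul a c _

lemma finrank_symAlg_le (P : Set (M × M8)) {a : M8} (ha : a ∈ L) :
    Module.finrank ℝ (symAlg P) ≤ Module.finrank ℝ (symAlgAt P a) := by
  have h : (symAlgAt P a).map (conjInv a⁻¹) = symAlg P := by
    rw [← symAlgAt_mul, L_mul_inv ha, symAlgAt, conjInv_one, Submodule.map_id]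
  rw [← h]
  exact Submodule.finrank_map_le _ _

/-- Failure at x is witnessed by one fixed symmetry B in one frame. Read along a local section
through that frame, B varies continuously and stays outside the closed set `typeR` nearby, so
failure is an open condition. The matrix J is 1 for type R and `S8` for type S. -/
lemma IsCartanBundle.isClosed_setOf_typeR (h : IsCartanBundle φ P) (J : M8) :
    IsClosed {x : M | ∀ a, (x, a) ∈ P → (symAlgAt P (a * J) : Set M8) ⊆ typeR} := by
  rw [← isOpen_compl_iff, isOpen_iff_mem_nhds]
  intro x hx
  simp only [Set.mem_compl_iff, Set.mem_setOf_eq, not_forall] at hx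
  obtain ⟨a, ha, hsub⟩ := hx
  obtain ⟨_, ⟨B, hB, rfl⟩, hBR⟩ := Set.not_subset.mp hsub
  obtain ⟨U, s, hs, hxU, rfl⟩ := h.local_section x a ha
  let F : M8 → M8 := fun m => J⁻¹ * (K⁻¹ * mᵀ * K) * B * (m * J)
  have hF : Continuous F := by fun_prop
  have hsc : ContinuousOn s U :=
    continuousOn_pi.mpr fun i => continuousOn_pi.mpr fun j => (hs.2.1 i j).continuousOn
  have hFs : ∀ y ∈ U, F (s y) = conjInv (s y * J) B := fun y hy => by
    change _ = (s y * J)⁻¹ * B * (s y * J)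
    rw [Matrix.mul_inv_rev, L_inv_eq (h.frame _ _ (hs.2.2 y hy)).1]
  have hc := (hF.comp_continuousOn hsc).continuousAt (hs.1.mem_nhds hxU)
  have hn : typeRᶜ ∈ nhds ((F ∘ s) x) := by
    refine isClosed_typeR.isOpen_compl.mem_nhds ?_
    rw [Function.comp_apply, hFs x hxU]
    exact hBR
  filter_upwards [hc hn, hs.1.mem_nhds hxU] with y hy hyU
  intro hmem
  apply hy
  rw [Function.comp_apply, hFs y hyU]
  exact hmem _ (hs.2.2 y hyU) ⟨B, hB, rfl⟩

end

variable {M : Type*} [TopologicalSpace M] [ChartedSpace E3 M] [IsManifold (𝓡 3) ∞ M]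
  {D : ∀ x : M, Submodule ℝ (TangentSpace (𝓡 3) x)}
  {φ : M → ℤ → Submodule ℝ (Fin 8 → ℝ)} {P : Set (M × M8)}

namespace IsSubmaximal

lemma mul_mem (h : IsSubmaximal D φ P) {x : M} {a : M8} (ha : (x, a) ∈ P) {b : M3}
    (hb : b ∈ GZero) : (x, a * Ad b) ∈ P := (h.cartan.torsor x a ha _).mpr ⟨b, hb, rfl⟩

/-- Passage from the pointwise algebra to the bundle: moving along the fibre by b conjugates the
symmetry algebra by Ad b, and the Cartan bundle supplies a normal structure function in each of
these frames. -/
lemma trichotomy (h : IsSubmaximal D φ P) {x : M} {a : M8} (ha : (x, a) ∈ P) :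
    IsStructureFunctionAt P x a 0 ∨
    (∃ b ∈ GZero, symAlgAt P (a * Ad b) = cayleyR) ∨
    ∃ b ∈ GZero, symAlgAt P (a * Ad b) = cayleyS := by
  obtain ⟨χ, hχ, hn⟩ := h.cartan.normal x a ha
  have hA := h.cartan.algData h.transitive ha hχ hn
  simp only [symAlgAt_mul]
  rcases hA.classification (fun b hb => by
    obtain ⟨χ', hχ', hn'⟩ := h.cartan.normal _ _ (h.mul_mem ha hb)
    exact ⟨χ', symAlgAt_mul P a _ ▸ h.cartan.algData h.transitive (h.mul_mem ha hb) hχ' hn'⟩)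
    (h.four_le.trans (finrank_symAlg_le P (h.cartan.mem_L ha))) with h0 | h1
  · exact Or.inl (h0 ▸ hχ)
  · exact Or.inr h1

/-- A single non-flat frame suffices, and in type S the extra factor `S8` leads to the same algebra.
The element g need not belong to the bundle; it only fixes the conjugacy class under L. -/
lemma exists_cayleyR (h : IsSubmaximal D φ P) : ∃ g ∈ L, symAlgAt P g = cayleyR := by
  have hf := h.not_flat
  simp only [IsFlat, not_forall] at hf
  obtain ⟨x, a, ha, h0⟩ := hf
  rcases h.trichotomy ha with h1 | ⟨b, hb, h1⟩ | ⟨b, hb, h1⟩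
  · exact absurd h1 h0
  · exact ⟨_, h.cartan.mem_L (h.mul_mem ha hb), h1⟩
  · refine ⟨_, L_mul (h.cartan.mem_L (h.mul_mem ha hb)) S8_mem_L, ?_⟩
    rw [symAlgAt_mul, h1, map_S8_cayleyS]

/-- If the structure function vanished in one frame, all symmetries read there would lie in ad 𝔤.
They are conjugate in L to the normal form, and `not_flat_of_cayleyR` rules this out. -/
lemma dichotomy (h : IsSubmaximal D φ P) {x : M} {a : M8} (ha : (x, a) ∈ P) :
    (∃ b ∈ GZero, symAlgAt P (a * Ad b) = cayleyR) ∨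
    ∃ b ∈ GZero, symAlgAt P (a * Ad b) = cayleyS := by
  refine (h.trichotomy ha).resolve_left fun h0 => ?_
  obtain ⟨g, hg, hgR⟩ := h.exists_cayleyR
  have haL := h.cartan.mem_L ha
  refine not_flat_of_cayleyR (L_mul (L_inv haL) hg) fun w hw => ?_
  rw [← hgR] at hw
  obtain ⟨B, hB, rfl⟩ := hw
  obtain ⟨Y, hY, he⟩ := (h0.2 _).mp (hB.2 x a ha)
  rw [LinearMap.zero_apply, add_zero] at he
  refine ⟨Y, hY, ?_⟩
  rw [← he, Matrix.mul_inv_rev, Matrix.nonsing_inv_nonsing_inv _ (det_sq_of_mem_L haL)]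
  change a⁻¹ * g * (g⁻¹ * B * g) * (g⁻¹ * a) = _
  rw [show a⁻¹ * g * (g⁻¹ * B * g) * (g⁻¹ * a) = a⁻¹ * (g * g⁻¹) * B * (g * g⁻¹) * a by
    noncomm_ring, L_mul_inv hg, mul_one, mul_one]

/-- Invariance of `typeR` under Ad carries the condition from one frame over x to the whole fibre;
this makes it a condition on the base point. The next lemma does the same for type S. -/
lemma typeR_of_cayleyR (h : IsSubmaximal D φ P) {x : M} {a : M8} (ha : (x, a) ∈ P)
    (hR : symAlgAt P a = cayleyR) {a' : M8} (ha' : (x, a') ∈ P) :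
    (symAlgAt P (a' * 1) : Set M8) ⊆ typeR := by
  obtain ⟨c, hc, rfl⟩ := (h.cartan.torsor x a ha _).mp ha'
  rw [mul_one, symAlgAt_mul, hR]
  rintro _ ⟨B, hB, rfl⟩
  exact typeR_conj (isUnit_of_GZero hc) (cayleyR_subset_typeR hB)

lemma typeR_of_cayleyS (h : IsSubmaximal D φ P) {x : M} {a : M8} (ha : (x, a) ∈ P)
    (hS : symAlgAt P a = cayleyS) {a' : M8} (ha' : (x, a') ∈ P) :
    (symAlgAt P (a' * S8) : Set M8) ⊆ typeR := by
  obtain ⟨c, hc, rfl⟩ := (h.cartan.torsor x a ha _).mp ha'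
  rw [mul_assoc, Ad_mirG (isUnit_of_GZero hc), ← mul_assoc, symAlgAt_mul, symAlgAt_mul, hS,
    map_S8_cayleyS]
  rintro _ ⟨B, hB, rfl⟩
  exact typeR_conj (isUnit_of_GZero (mirG_mem hc)) (cayleyR_subset_typeR hB)

/-- The type of the normal form does not depend on the point. -/
lemma constant_type [ConnectedSpace M] (h : IsSubmaximal D φ P) :
    (∀ x a, (x, a) ∈ P → ∃ b ∈ GZero, symAlgAt P (a * Ad b) = cayleyR) ∨
    (∀ x a, (x, a) ∈ P → ∃ b ∈ GZero, symAlgAt P (a * Ad b) = cayleyS) := by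
  set MR := {x : M | ∀ a, (x, a) ∈ P → (symAlgAt P (a * 1) : Set M8) ⊆ typeR} with hMR
  set MS := {x : M | ∀ a, (x, a) ∈ P → (symAlgAt P (a * S8) : Set M8) ⊆ typeR} with hMS
  have hR : ∀ x a, (x, a) ∈ P → ∀ b ∈ GZero, symAlgAt P (a * Ad b) = cayleyR →
      x ∈ MR ∧ x ∉ MS := fun x a ha b hb hR => by
    refine ⟨fun a' ha' => h.typeR_of_cayleyR (h.mul_mem ha hb) hR ha', fun hx => ?_⟩
    have := hx _ (h.mul_mem ha hb)
    rw [symAlgAt_mul, hR, map_S8_cayleyR] at this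
    exact cayleyS_not_subset_typeR this
  have hS : ∀ x a, (x, a) ∈ P → ∀ b ∈ GZero, symAlgAt P (a * Ad b) = cayleyS →
      x ∈ MS ∧ x ∉ MR := fun x a ha b hb hS => by
    refine ⟨fun a' ha' => h.typeR_of_cayleyS (h.mul_mem ha hb) hS ha', fun hx => ?_⟩
    have := hx _ (h.mul_mem ha hb)
    rw [mul_one, hS] at this
    exact cayleyS_not_subset_typeR this
  -- The two types cover M and exclude each other, so two closed sets are complementary and hence
  -- clopen.
  have hcompl : MRᶜ = MS := by
    ext x
    obtain ⟨a, ha⟩ := h.cartan.nonempty_fibre x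
    rcases h.dichotomy ha with ⟨b, hb, h1⟩ | ⟨b, hb, h1⟩
    · have := hR x a ha b hb h1
      simp [this]
    · have := hS x a ha b hb h1
      simp [this]
  have hclopen : IsClopen MR :=
    ⟨h.cartan.isClosed_setOf_typeR 1, by
      rw [← isClosed_compl_iff, hcompl]; exact h.cartan.isClosed_setOf_typeR S8⟩
  rcases isClopen_iff.mp hclopen with h0 | h0
  · right
    intro x a ha
    refine (h.dichotomy ha).resolve_left ?_
    rintro ⟨b, hb, h1⟩
    have := (hR x a ha b hb h1).1
    rw [h0] at this
    exact this
  · left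
    intro x a ha
    refine (h.dichotomy ha).resolve_right ?_
    rintro ⟨b, hb, h1⟩
    exact (hS x a ha b hb h1).2 (h0 ▸ Set.mem_univ x)

/-- The normal form of the structure function and of the symmetry algebra. -/
theorem normal_form [ConnectedSpace M] (h : IsSubmaximal D φ P) :
    (∀ x a, (x, a) ∈ P → ∃ b ∈ GZero, IsStructureFunctionAt P x (a * Ad b) xiR ∧
      symAlgAt P (a * Ad b) = cayleyR) ∨
    (∀ x a, (x, a) ∈ P → ∃ b ∈ GZero, IsStructureFunctionAt P x (a * Ad b) xiS ∧
      symAlgAt P (a * Ad b) = cayleyS) := by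
  refine h.constant_type.imp (fun hR x a ha => ?_) (fun hS x a ha => ?_)
  · obtain ⟨b, hb, h1⟩ := hR x a ha
    obtain ⟨χ, hχ, hn⟩ := h.cartan.normal _ _ (h.mul_mem ha hb)
    have hA := h.cartan.algData h.transitive (h.mul_mem ha hb) hχ hn
    rw [h1] at hA
    exact ⟨b, hb, hA.eq_xiR ▸ hχ, h1⟩
  · obtain ⟨b, hb, h1⟩ := hS x a ha
    obtain ⟨χ, hχ, hn⟩ := h.cartan.normal _ _ (h.mul_mem ha hb)
    have hA := h.cartan.algData h.transitive (h.mul_mem ha hb) hχ hn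
    rw [h1] at hA
    exact ⟨b, hb, hA.eq_xiS ▸ hχ, h1⟩

end IsSubmaximal

/-! ### The homogeneous model -/

/-- The exponential of `t • X`, if `X ^ 7 = 0`. -/
def expNil (X : M8) (t : ℝ) : M8 :=
  1 + t • X + (t ^ 2 / 2) • X ^ 2 + (t ^ 3 / 6) • X ^ 3 + (t ^ 4 / 24) • X ^ 4 +
    (t ^ 5 / 120) • X ^ 5 + (t ^ 6 / 720) • X ^ 6

lemma expNil_zero (X : M8) : expNil X 0 = 1 := by simp [expNil]

lemma expNil_mul_self (X : M8) (t : ℝ) : expNil X t * X = X * expNil X t := by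
  simp only [expNil, add_mul, mul_add, one_mul, mul_one, smul_mul_assoc, mul_smul_comm,
    ← pow_succ, ← pow_succ']

lemma hasDerivAt_expNil {X : M8} (hX : X ^ 7 = 0) (i j : Fin 8) (t : ℝ) :
    HasDerivAt (fun t => expNil X t i j) ((expNil X t * X) i j) t := by
  have h : (expNil X t * X) i j = X i j + t * (X ^ 2) i j + (t ^ 2 / 2) * (X ^ 3) i j +
      (t ^ 3 / 6) * (X ^ 4) i j + (t ^ 4 / 24) * (X ^ 5) i j + (t ^ 5 / 120) * (X ^ 6) i j := by
    simp only [expNil, add_mul, one_mul, smul_mul_assoc, ← pow_succ, hX, ← pow_two,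
      Matrix.add_apply, Matrix.smul_apply, smul_eq_mul, smul_zero, add_zero, Matrix.zero_apply,
      Nat.reduceAdd]
  have h2 : ∀ n : ℕ, HasDerivAt (fun t : ℝ => t ^ n) (n * t ^ (n - 1)) t := fun n => hasDerivAt_pow n t
  rw [h]
  simp only [expNil, Matrix.add_apply, Matrix.smul_apply, smul_eq_mul]
  have := ((((((hasDerivAt_const t ((1 : M8) i j)).add ((hasDerivAt_id t).mul_const (X i j))).add
    (((h2 2).div_const 2).mul_const ((X ^ 2) i j))).add
    (((h2 3).div_const 6).mul_const ((X ^ 3) i j))).add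
    (((h2 4).div_const 24).mul_const ((X ^ 4) i j))).add
    (((h2 5).div_const 120).mul_const ((X ^ 5) i j))).add
    (((h2 6).div_const 720).mul_const ((X ^ 6) i j))
  refine HasDerivAt.congr_deriv this ?_
  simp only [Nat.cast_ofNat, Nat.reduceSub]
  ring

/-- The generators of the nilpotent part of the symmetry algebra. -/
def X1 : M8 := ad (e 1)

/-- The generator depending on the structure function. -/
def X2 (α : ℝ) : M8 := ad (e 2) + α • Rm11

/-- The central generator. -/
def X3 : M8 := -ad (e 0)

lemma X1_mulVec (v : Fin 8 → ℝ) :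
    X1 *ᵥ v = ![0, 0, v 0, -v 1, 0, 0, 2 * v 3 - v 4, -v 5] := ad_e_one_mulVec v

lemma X2_mulVec (α : ℝ) (v : Fin 8 → ℝ) : X2 α *ᵥ v =
    ![0, -v 0, -6 * α * v 1, 0, -v 2, -v 3 + 2 * v 4, 6 * α * v 5, v 6] := by
  rw [X2, Matrix.add_mulVec, Matrix.smul_mulVec, Rm11_mulVec, ad_e_two_mulVec]
  ext i; fin_cases i <;> simp <;> ring

lemma X3_mulVec (v : Fin 8 → ℝ) :
    X3 *ᵥ v = ![0, 0, 0, v 0, v 0, -v 1, v 2, -v 3 - v 4] := by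
  rw [X3, e_zero, ad_toM, Matrix.neg_mulVec]
  ext i; rw [Pi.neg_apply, mulVec_eight]; fin_cases i <;> simp [adMat]
  ring

lemma X1_pow : X1 ^ 7 = 0 := by
  refine ext_mulVec fun v => ?_
  simp only [pow_succ, pow_zero, one_mul, ← Matrix.mulVec_mulVec, X1_mulVec]
  ext i; fin_cases i <;> simp

lemma X2_pow (α : ℝ) : X2 α ^ 7 = 0 := by
  refine ext_mulVec fun v => ?_
  simp only [pow_succ, pow_zero, one_mul, ← Matrix.mulVec_mulVec, X2_mulVec]
  ext i; fin_cases i <;> simp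

lemma X3_pow : X3 ^ 7 = 0 := by
  refine ext_mulVec fun v => ?_
  simp only [pow_succ, pow_zero, one_mul, ← Matrix.mulVec_mulVec, X3_mulVec]
  ext i; fin_cases i <;> simp

/-- `exp (x X₁)`. -/
def G1 (x : ℝ) : M8 := expNil X1 x
/-- `exp (y X₂)`. -/
def G2 (α y : ℝ) : M8 := expNil (X2 α) y
/-- `exp (r X₃)`. -/
def G3 (r : ℝ) : M8 := expNil X3 r

lemma G1_mulVec (x : ℝ) (v : Fin 8 → ℝ) : G1 x *ᵥ v = ![v 0, v 1, v 2 + x * v 0, v 3 - x * v 1,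
    v 4, v 5, v 6 + x * (2 * v 3 - v 4) - x ^ 2 * v 1, v 7 - x * v 5] := by
  simp only [G1, expNil, Matrix.add_mulVec, Matrix.smul_mulVec, pow_succ X1, pow_zero, one_mul,
    ← Matrix.mulVec_mulVec, X1_mulVec, Matrix.one_mulVec]
  ext i; simp only [Pi.add_apply, Pi.smul_apply, smul_eq_mul]
  fin_cases i <;> simp <;> ring

lemma G3_mulVec (r : ℝ) (v : Fin 8 → ℝ) : G3 r *ᵥ v = ![v 0, v 1, v 2, v 3 + r * v 0,
    v 4 + r * v 0, v 5 - r * v 1, v 6 + r * v 2, v 7 - r * (v 3 + v 4) - r ^ 2 * v 0] := by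
  simp only [G3, expNil, Matrix.add_mulVec, Matrix.smul_mulVec, pow_succ X3, pow_zero, one_mul,
    ← Matrix.mulVec_mulVec, X3_mulVec, Matrix.one_mulVec]
  ext i; simp only [Pi.add_apply, Pi.smul_apply, smul_eq_mul]
  fin_cases i <;> simp <;> ring

lemma G2_mulVec (α y : ℝ) (v : Fin 8 → ℝ) : G2 α y *ᵥ v = ![v 0, v 1 - y * v 0,
    v 2 - 6 * α * y * v 1 + 3 * α * y ^ 2 * v 0, v 3,
    v 4 - y * v 2 + 3 * α * y ^ 2 * v 1 - α * y ^ 3 * v 0,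
    v 5 + y * (2 * v 4 - v 3) - y ^ 2 * v 2 + 2 * α * y ^ 3 * v 1 - α / 2 * y ^ 4 * v 0,
    v 6 + 6 * α * y * v 5 + 3 * α * y ^ 2 * (2 * v 4 - v 3) - 2 * α * y ^ 3 * v 2 +
      3 * α ^ 2 * y ^ 4 * v 1 - 3 / 5 * α ^ 2 * y ^ 5 * v 0,
    v 7 + y * v 6 + 3 * α * y ^ 2 * v 5 + α * y ^ 3 * (2 * v 4 - v 3) - α / 2 * y ^ 4 * v 2 +
      3 / 5 * α ^ 2 * y ^ 5 * v 1 - α ^ 2 / 10 * y ^ 6 * v 0] := by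
  simp only [G2, expNil, Matrix.add_mulVec, Matrix.smul_mulVec, pow_succ (X2 α), pow_zero, one_mul,
    ← Matrix.mulVec_mulVec, X2_mulVec, Matrix.one_mulVec]
  ext i; simp only [Pi.add_apply, Pi.smul_apply, smul_eq_mul]
  fin_cases i <;> simp <;> ring

lemma trace_toM_mul (v w : Fin 8 → ℝ) : (toM v * toM w).trace = v 0 * w 7 + v 7 * w 0 +
    v 1 * w 6 + v 6 * w 1 + v 2 * w 5 + v 5 * w 2 + 2 * v 3 * w 3 + 2 * v 4 * w 4 -
    v 3 * w 4 - v 4 * w 3 := by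
  simp [Matrix.trace, Matrix.mul_apply, Fin.sum_univ_three, toM]
  ring

lemma G1_mem_L (x : ℝ) : G1 x ∈ L := by
  rw [mem_L_iff]; intro v w
  rw [trace_toM_mul, trace_toM_mul, G1_mulVec, G1_mulVec]
  simp; ring

lemma G2_mem_L (α y : ℝ) : G2 α y ∈ L := by
  rw [mem_L_iff]; intro v w
  rw [trace_toM_mul, trace_toM_mul, G2_mulVec, G2_mulVec]
  simp; ring

lemma G3_mem_L (r : ℝ) : G3 r ∈ L := by
  rw [mem_L_iff]; intro v w
  rw [trace_toM_mul, trace_toM_mul, G3_mulVec, G3_mulVec]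
  simp; ring

lemma X3_mul_G1 (x : ℝ) : X3 * G1 x = G1 x * X3 := by
  refine ext_mulVec fun v => ?_
  simp only [← Matrix.mulVec_mulVec, G1_mulVec, X3_mulVec]
  ext i; fin_cases i <;> simp
  all_goals first | ring1 | exact Or.inl (by ring1)

lemma X3_mul_G2 (α y : ℝ) : X3 * G2 α y = G2 α y * X3 := by
  refine ext_mulVec fun v => ?_
  simp only [← Matrix.mulVec_mulVec, G2_mulVec, X3_mulVec]
  ext i; fin_cases i <;> simp
  all_goals first | ring1 | exact Or.inl (by ring1)

lemma X1_mul_G3 (r : ℝ) : X1 * G3 r = G3 r * X1 := by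
  refine ext_mulVec fun v => ?_
  simp only [← Matrix.mulVec_mulVec, G3_mulVec, X1_mulVec]
  ext i; fin_cases i <;> simp
  all_goals first | ring1 | exact Or.inl (by ring1)

lemma X2_mul_G3 (α r : ℝ) : X2 α * G3 r = G3 r * X2 α := by
  refine ext_mulVec fun v => ?_
  simp only [← Matrix.mulVec_mulVec, G3_mulVec, X2_mulVec]
  ext i; fin_cases i <;> simp
  all_goals first | ring1 | exact Or.inl (by ring1)

/-- The element R_{-1,1} commutes with ad e₁, so X₁, X₂, X₃ span a Heisenberg algebra with [X₁, X₂]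
= X₃ central, and the exponential series of -x ad X₁ on X₂ stops after the linear term. -/
lemma X2_mul_G1 (α x : ℝ) : X2 α * G1 x = G1 x * (X2 α - x • X3) := by
  refine ext_mulVec fun v => ?_
  simp only [← Matrix.mulVec_mulVec, Matrix.sub_mulVec, Matrix.smul_mulVec, G1_mulVec, X2_mulVec,
    X3_mulVec]
  ext i; fin_cases i <;> simp
  all_goals first | ring1 | exact Or.inl (by ring1)

lemma X1_mul_G2 (α y : ℝ) : X1 * G2 α y = G2 α y * (X1 + y • X3) := by
  refine ext_mulVec fun v => ?_
  simp only [← Matrix.mulVec_mulVec, Matrix.add_mulVec, Matrix.smul_mulVec, G2_mulVec, X1_mulVec,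
    X3_mulVec]
  ext i; fin_cases i <;> simp
  all_goals first | ring1 | exact Or.inl (by ring1)

/-- The frame of the homogeneous model. -/
def model (α x y r : ℝ) : M8 := G3 r * G2 α y * G1 x

lemma model_mem_L (α x y r : ℝ) : model α x y r ∈ L :=
  L_mul (L_mul (G3_mem_L r) (G2_mem_L α y)) (G1_mem_L x)

lemma model_zero (α : ℝ) : model α 0 0 0 = 1 := by
  simp [model, G1, G2, G3, expNil_zero]

/-- Elements of the nilpotent part of the symmetry algebra. -/
def nil (α : ℝ) (c : Fin 3 → ℝ) : M8 := c 0 • X1 + c 1 • X2 α + c 2 • X3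

lemma nil_mulVec (α : ℝ) (c : Fin 3 → ℝ) (v : Fin 8 → ℝ) : nil α c *ᵥ v =
    ![0, -c 1 * v 0, c 0 * v 0 - 6 * α * c 1 * v 1, -c 0 * v 1 + c 2 * v 0,
      -c 1 * v 2 + c 2 * v 0, c 1 * (-v 3 + 2 * v 4) - c 2 * v 1,
      c 0 * (2 * v 3 - v 4) + 6 * α * c 1 * v 5 + c 2 * v 2,
      -c 0 * v 5 + c 1 * v 6 - c 2 * (v 3 + v 4)] := by
  simp only [nil, Matrix.add_mulVec, Matrix.smul_mulVec, X1_mulVec, X2_mulVec, X3_mulVec]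
  ext i; fin_cases i <;> simp <;> ring

/-- Conjugating the Heisenberg algebra by an element of its own group changes only the central
coefficient. -/
lemma nil_mul_model (α : ℝ) (c : Fin 3 → ℝ) (x y r : ℝ) : nil α c * model α x y r =
    model α x y r * nil α ![c 0, c 1, c 2 + c 0 * y - c 1 * x] := by
  have h1 : X1 * model α x y r = model α x y r * (X1 + y • X3) := by
    rw [model, ← mul_assoc, ← mul_assoc, X1_mul_G3, mul_assoc (G3 r), X1_mul_G2,
      mul_assoc, mul_assoc, add_mul, smul_mul_assoc, X3_mul_G1, ← mul_smul_comm,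
      show X1 * G1 x = G1 x * X1 from (expNil_mul_self _ _).symm, ← mul_add]
    simp only [mul_assoc]
  have h2 : X2 α * model α x y r = model α x y r * (X2 α - x • X3) := by
    rw [model, ← mul_assoc, ← mul_assoc, X2_mul_G3, mul_assoc (G3 r),
      show X2 α * G2 α y = G2 α y * X2 α from (expNil_mul_self _ _).symm,
      mul_assoc, mul_assoc, X2_mul_G1]
    simp only [mul_assoc]
  have h3 : X3 * model α x y r = model α x y r * X3 := by
    rw [model, ← mul_assoc, ← mul_assoc, show X3 * G3 r = G3 r * X3 from
      (expNil_mul_self _ _).symm, mul_assoc (G3 r), X3_mul_G2, mul_assoc, mul_assoc, X3_mul_G1]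
    simp only [mul_assoc]
  rw [nil, add_mul, add_mul, smul_mul_assoc, smul_mul_assoc, smul_mul_assoc, h1, h2, h3, nil]
  simp only [← mul_smul_comm, ← mul_add]
  congr 1
  simp
  module

/-- The first components of a vector in the moving frame. -/
lemma model_mulVec (α x y r : ℝ) (v : Fin 8 → ℝ) :
    (model α x y r *ᵥ v) 0 = v 0 ∧ (model α x y r *ᵥ v) 1 = v 1 - y * v 0 ∧
    (model α x y r *ᵥ v) 2 = v 2 + x * v 0 - 6 * α * y * v 1 + 3 * α * y ^ 2 * v 0 ∧
    (model α x y r *ᵥ v) 3 = v 3 - x * v 1 + r * v 0 := by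
  simp only [model, ← Matrix.mulVec_mulVec, G1_mulVec, G2_mulVec, G3_mulVec]
  simp

lemma dE_expNil {X : M8} (hX : X ^ 7 = 0) {c : E3 → ℝ} {q : E3} (hc : DifferentiableAt ℝ c q)
    (w : E3) : DiffM (fun q => expNil X (c q)) q ∧
    dE (fun q => expNil X (c q)) q w = fderiv ℝ c q w • (expNil X (c q) * X) := by
  have h := fun i j => (hasDerivAt_expNil hX i j (c q)).comp_hasFDerivAt q hc.hasFDerivAt
  refine ⟨fun i j => (h i j).differentiableAt, ?_⟩
  ext i j
  have := (h i j).fderiv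
  simp only [Function.comp_def] at this
  simp only [dE, Matrix.of_apply, this]
  simp [mul_comm]

lemma contDiff_expNil (X : M8) (i j : Fin 8) : ContDiff ℝ ∞ (fun t => expNil X t i j) := by
  simp only [expNil, Matrix.add_apply, Matrix.smul_apply, smul_eq_mul]
  fun_prop

lemma smoothE_model (α : ℝ) {x y r : E3 → ℝ} {W : Set E3} (hx : ContDiffOn ℝ ∞ x W)
    (hy : ContDiffOn ℝ ∞ y W) (hr : ContDiffOn ℝ ∞ r W) :
    SmoothE (fun q => model α (x q) (y q) (r q)) W :=
  (SmoothE.mul (fun i j => (contDiff_expNil X3 i j).comp_contDiffOn hr)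
    (fun i j => (contDiff_expNil (X2 α) i j).comp_contDiffOn hy)).mul
    (fun i j => (contDiff_expNil X1 i j).comp_contDiffOn hx)

/-- The derivative of the moving frame. -/
lemma dE_model (α : ℝ) {x y r : E3 → ℝ} {q : E3} (hx : DifferentiableAt ℝ x q)
    (hy : DifferentiableAt ℝ y q) (hr : DifferentiableAt ℝ r q) (w : E3) :
    DiffM (fun q => model α (x q) (y q) (r q)) q ∧
    dE (fun q => model α (x q) (y q) (r q)) q w = model α (x q) (y q) (r q) *
      nil α ![fderiv ℝ x q w, fderiv ℝ y q w, fderiv ℝ r q w - x q * fderiv ℝ y q w] := by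
  obtain ⟨d1, e1⟩ := dE_expNil X1_pow hx w
  obtain ⟨d2, e2⟩ := dE_expNil (X2_pow α) hy w
  obtain ⟨d3, e3⟩ := dE_expNil X3_pow hr w
  refine ⟨(d3.mul d2).mul d1, ?_⟩
  simp only [model, G1, G2, G3]
  rw [dE_mul (d3.mul d2) d1, dE_mul d3 d2, e1, e2, e3]
  have c1 : X3 * expNil X1 (x q) = expNil X1 (x q) * X3 := X3_mul_G1 _
  have c2 : X3 * expNil (X2 α) (y q) = expNil (X2 α) (y q) * X3 := X3_mul_G2 _ _
  have c3 : X2 α * expNil X1 (x q) = expNil X1 (x q) * (X2 α - x q • X3) := X2_mul_G1 _ _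
  generalize expNil X1 (x q) = a1 at *
  generalize expNil (X2 α) (y q) = a2 at *
  generalize expNil X3 (r q) = a3 at *
  have t3 : a3 * X3 * a2 * a1 = a3 * a2 * a1 * X3 := by
    rw [mul_assoc a3, c2, mul_assoc, mul_assoc, c1]; simp only [mul_assoc]
  have t2 : a3 * (a2 * X2 α) * a1 = a3 * a2 * a1 * (X2 α - x q • X3) := by
    rw [mul_assoc a3, mul_assoc a2, c3]; simp only [mul_assoc]
  simp only [add_mul, smul_mul_assoc, mul_smul_comm, t3, t2, nil, mul_add, mul_sub]
  simp [mul_assoc]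
  module


/-! ### Normal coordinates -/

lemma nil_mem_cayleyR (c : Fin 3 → ℝ) : nil 1 c ∈ cayleyR := by
  refine add_mem (add_mem (cayleyR.smul_mem _ ?_) (cayleyR.smul_mem _ ?_)) (cayleyR.smul_mem _ ?_)
  · exact Submodule.subset_span (by simp [X1])
  · exact Submodule.subset_span (by simp [X2])
  · exact neg_mem (Submodule.subset_span (by simp))

lemma glFil_zero_col {B : M8} (hB : B ∈ glFil 0) {i : Fin 8} (hi : i ≠ 0) : B i 0 = 0 :=
  hB i 0 (by fin_cases i <;> simp [vdeg] at hi ⊢)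

lemma gB_le_glFil {w : M8} (h : w ∈ gB) : w ∈ glFil 0 := by
  obtain ⟨Y, hY, rfl⟩ := h
  exact ad_mem_glFil (mem_gZero_iff.mp hY).2

/-- An element of `L` that respects the filtration is an automorphism of it. -/
lemma map_stdFlag {d : M8} (hd : d ∈ L) (hF : d ∈ glFil 0) (q : ℤ) :
    (stdFlag q).map d.mulVecLin = stdFlag q := by
  refine Submodule.eq_of_le_of_finrank_eq ?_ ?_
  · rintro _ ⟨v, hv, rfl⟩
    simpa using glFil_mulVec hF hv
  · have hinj : Function.Injective d.mulVecLin := fun v w hvw => by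
      have := congrArg (fun u => d⁻¹ *ᵥ u) hvw
      simpa [Matrix.mulVec_mulVec, L_inv_mul hd] using this
    exact (LinearEquiv.finrank_eq (Submodule.equivMapOfInjective _ hinj (stdFlag q))).symm

/-- A linear differential inequality with zero initial value. -/
lemma eq_zero_of_linear_ode {ι : Type*} [Fintype ι] {y y' : ℝ → ι → ℝ} {C : ℝ}
    (hy : ∀ t ∈ Set.Icc (0 : ℝ) 1, ∀ i, HasDerivAt (fun t => y t i) (y' t i) t)
    (h0 : y 0 = 0) (hC : ∀ t ∈ Set.Icc (0 : ℝ) 1, ∀ i, |y' t i| ≤ C * ‖y t‖) : y 1 = 0 := by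
  have hd : ∀ t ∈ Set.Icc (0 : ℝ) 1, HasDerivAt y (y' t) t := fun t ht =>
    hasDerivAt_pi.mpr (hy t ht)
  have hC' : ∀ t ∈ Set.Icc (0 : ℝ) 1, ‖y' t‖ ≤ |C| * ‖y t‖ := fun t ht => by
    refine (pi_norm_le_iff_of_nonneg (by positivity)).mpr fun i => (hC t ht i).trans ?_
    exact mul_le_mul_of_nonneg_right (le_abs_self C) (norm_nonneg _)
  have := norm_le_gronwallBound_of_norm_deriv_right_le (δ := 0) (K := |C|) (ε := 0)
    (fun t ht => (hd t ht).continuousAt.continuousWithinAt)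
    (fun t ht => (hd t (Set.Ico_subset_Icc_self ht)).hasDerivWithinAt) (by simp [h0])
    (fun t ht => by simpa using hC' t (Set.Ico_subset_Icc_self ht)) 1 (by simp)
  rw [gronwallBound_ε0_δ0] at this
  exact norm_le_zero_iff.mp this

namespace FrameField

variable {W : Set E3} {σ : E3 → M8}

/-- The `𝔤_-` components of the nilpotent symmetries. -/
def nilSolder (σ : E3 → M8) (q : E3) : Matrix (Fin 3) (Fin 3) ℝ :=
  Matrix.of fun i k => piM ((σ q)⁻¹ * nil 1 (Pi.single k 1) * σ q) i

lemma nil_linear (c : Fin 3 → ℝ) : nil 1 c = ∑ k, c k • nil 1 (Pi.single k 1) := by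
  simp [Fin.sum_univ_three, nil]

lemma nilSolder_mulVec (σ : E3 → M8) (q : E3) (c : Fin 3 → ℝ) :
    nilSolder σ q *ᵥ c = piM ((σ q)⁻¹ * nil 1 c * σ q) := by
  rw [nil_linear c, Finset.mul_sum, Finset.sum_mul, map_sum]
  ext i
  simp [Matrix.mulVec, dotProduct, nilSolder, mul_comm]

/-- The coefficients of the nilpotent symmetry that moves the frame in a given direction. -/
def coef (σ : E3 → M8) (q v : E3) : Fin 3 → ℝ :=
  (nilSolder σ q)⁻¹ *ᵥ piM ((σ q)⁻¹ * dE σ q v)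

/-- The vertical correction. -/
def vert (σ : E3 → M8) (q v : E3) : M8 :=
  (σ q)⁻¹ * nil 1 (coef σ q v) * σ q - (σ q)⁻¹ * dE σ q v

lemma piM_coef {q : E3} (hN : (nilSolder σ q).det ≠ 0) (v : E3) :
    piM ((σ q)⁻¹ * nil 1 (coef σ q v) * σ q) = piM ((σ q)⁻¹ * dE σ q v) := by
  rw [← nilSolder_mulVec, coef, Matrix.mulVec_mulVec,
    Matrix.mul_nonsing_inv _ (Ne.isUnit hN), Matrix.one_mulVec]

/-- The symmetry with these coefficients moves the frame along some v' up to a vertical term. Its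
𝔤₋-part equals that of v by the choice of the coefficients, so v' = v by immersion and only the
vertical term is left. -/
lemma vert_mem (h : FrameField cayleyR W σ) {q : E3} (hq : q ∈ W)
    (hN : (nilSolder σ q).det ≠ 0) (v : E3) : vert σ q v ∈ gB := by
  obtain ⟨v', η, hη, he⟩ := h.sym q hq _ (nil_mem_cayleyR (coef σ q v))
  have h1 := piM_coef hN v
  rw [he, map_add, piM_of_mem_gB hη, add_zero] at h1
  have h2 : v' - v = 0 := h.immersion q hq _ (by
    rw [← dEₗ_apply, map_sub, mul_sub, map_sub, dEₗ_apply, dEₗ_apply, h1, sub_self])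
  rw [sub_eq_zero] at h2
  rw [vert, he, h2, add_sub_cancel_left]
  exact hη

lemma dE_eq (h : FrameField cayleyR W σ) {q : E3} (hq : q ∈ W) (v : E3) :
    dE σ q v = nil 1 (coef σ q v) * σ q - σ q * vert σ q v := by
  rw [vert, mul_sub, ← mul_assoc, ← mul_assoc, ← mul_assoc, L_mul_inv (h.mem_L q hq), one_mul,
    one_mul]
  abel

lemma contDiffAt_nilSolder (h : FrameField cayleyR W σ) {q : E3} (hq : q ∈ W) (i k : Fin 3) :
    ContDiffAt ℝ ∞ (fun q => nilSolder σ q i k) q :=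
  contDiffAt_piM (((h.smooth.inv h.mem_L).mul (SmoothE.const _ _)).mul h.smooth) h.isOpen hq i

lemma continuousAt_vert (h : FrameField cayleyR W σ) {q : E3} (hq : q ∈ W)
    (hN : (nilSolder σ q).det ≠ 0) (v : E3) (i j : Fin 8) :
    ContinuousAt (fun q => vert σ q v i j) q := by
  have hi := h.smooth.inv h.mem_L
  have hc : ∀ k, ContDiffAt ℝ ∞ (fun q => coef σ q v k) q := fun k => by
    simp only [coef, Matrix.mulVec, dotProduct]
    refine ContDiffAt.sum fun l _ => ContDiffAt.mul ?_ ?_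
    · exact contDiffAt_inv_apply (fun i k => h.contDiffAt_nilSolder hq i k) hN k l
    · exact contDiffAt_piM (hi.mul (h.smooth.dE h.isOpen v)) h.isOpen hq l
  have hcD : ∀ a b, ContDiffAt ℝ ∞ (fun q => nil 1 (coef σ q v) a b) q := fun a b => by
    simp only [nil, Matrix.add_apply, Matrix.smul_apply, smul_eq_mul]
    exact (((hc 0).mul contDiffAt_const).add ((hc 1).mul contDiffAt_const)).add
      ((hc 2).mul contDiffAt_const)
  have hσ := h.smooth.contDiffAt h.isOpen hq
  have hσi := hi.contDiffAt h.isOpen hq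
  have hd := (hi.mul (h.smooth.dE h.isOpen v)).contDiffAt h.isOpen hq i j
  refine ContDiffAt.continuousAt (𝕜 := ℝ) (n := ∞) (ContDiffAt.sub ?_ hd)
  simp only [Matrix.mul_apply]
  exact ContDiffAt.sum fun a _ => (ContDiffAt.sum fun b _ => (hσi i b).mul (hcD b a)).mul (hσ a j)

/-- The normal coordinates. -/
def cy (σ : E3 → M8) (q : E3) : ℝ := -(σ q 1 0 / σ q 0 0)
/-- The normal coordinates. -/
def cx (σ : E3 → M8) (q : E3) : ℝ := σ q 2 0 / σ q 0 0 - 3 * cy σ q ^ 2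
/-- The normal coordinates. -/
def cr (σ : E3 → M8) (q : E3) : ℝ := σ q 3 0 / σ q 0 0

lemma mulVec_single_zero (B : M8) (i : Fin 8) : (B *ᵥ Pi.single 0 1) i = B i 0 := by
  simp

/-- The deviation of a frame from the model. -/
def dev (σ : E3 → M8) (q : E3) : M8 := (model 1 (cx σ q) (cy σ q) (cr σ q))⁻¹ * σ q

lemma model_mul_dev (σ : E3 → M8) (q : E3) : model 1 (cx σ q) (cy σ q) (cr σ q) * dev σ q = σ q := by
  rw [dev, ← mul_assoc, L_mul_inv (model_mem_L _ _ _ _), one_mul]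

/-- For α = 1 the model sends a multiple d of the first basis vector to (d, -y d, (x + 3y²) d, r d,
…), and the first four components of an image depend only on the first four components of the
argument. The formulas for `cy`, `cx`, `cr` solve these equations for the first column of σ. -/
lemma dev_col {q : E3} (h : σ q 0 0 ≠ 0) : dev σ q 0 0 = σ q 0 0 ∧ dev σ q 1 0 = 0 ∧
    dev σ q 2 0 = 0 ∧ dev σ q 3 0 = 0 := by
  have h1 := model_mulVec 1 (cx σ q) (cy σ q) (cr σ q) (dev σ q *ᵥ Pi.single 0 1)
  rw [Matrix.mulVec_mulVec, model_mul_dev] at h1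
  simp only [mulVec_single_zero] at h1
  obtain ⟨a0, a1, a2, a3⟩ := h1
  rw [← a0] at a1 a2 a3
  have b1 : dev σ q 1 0 = 0 := by
    rw [cy] at a1; field_simp at a1; linarith
  rw [b1] at a2 a3
  refine ⟨a0.symm, b1, ?_, ?_⟩
  · rw [cx] at a2; field_simp at a2; linarith
  · rw [cr] at a3; field_simp at a3; linarith

lemma fderiv_eq_zero {f : E3 → ℝ} {q : E3} (h : ∀ᶠ p in nhds q, f p = 0) (v : E3) :
    fderiv ℝ f q v = 0 := by
  have : f =ᶠ[nhds q] fun _ => 0 := h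
  rw [this.fderiv_eq]; simp

/-- The locus where the normal coordinates are defined. -/
def goodLocus (W : Set E3) (σ : E3 → M8) : Set E3 :=
  {q | q ∈ W ∧ (nilSolder σ q).det ≠ 0 ∧ σ q 0 0 ≠ 0}

lemma isOpen_goodLocus (h : FrameField cayleyR W σ) : IsOpen (goodLocus W σ) := by
  rw [isOpen_iff_mem_nhds]
  rintro q ⟨hq, hN, h0⟩
  have hc : ContinuousAt (fun q => (nilSolder σ q).det) q := by
    have := fun i k => (h.contDiffAt_nilSolder hq i k).continuousAt
    simp only [Matrix.det_fin_three]
    fun_prop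
  have hc0 := (h.smooth.contDiffAt h.isOpen hq 0 0).continuousAt
  filter_upwards [h.isOpen.mem_nhds hq, hc.eventually_ne hN, hc0.eventually_ne h0] with p h1 h2 h3
  exact ⟨h1, h2, h3⟩

lemma contDiffOn_coords (h : FrameField cayleyR W σ) : ContDiffOn ℝ ∞ (cx σ) (goodLocus W σ) ∧
    ContDiffOn ℝ ∞ (cy σ) (goodLocus W σ) ∧ ContDiffOn ℝ ∞ (cr σ) (goodLocus W σ) := by
  have hs : ∀ i, ContDiffOn ℝ ∞ (fun q => σ q i 0 / σ q 0 0) (goodLocus W σ) := fun i =>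
    ((h.smooth i 0).mono fun q hq => hq.1).div ((h.smooth 0 0).mono fun q hq => hq.1)
      fun q hq => hq.2.2
  have hy : ContDiffOn ℝ ∞ (cy σ) (goodLocus W σ) := (hs 1).neg
  exact ⟨(hs 2).sub (contDiffOn_const.mul (hy.pow 2)), hy, hs 3⟩

lemma nil_sub (c c' : Fin 3 → ℝ) : nil 1 c - nil 1 c' = nil 1 (c - c') := by
  simp [nil, sub_smul]; abel

lemma diffM_dev (h : FrameField cayleyR W σ) {q : E3} (hq : q ∈ goodLocus W σ) :
    DiffM (dev σ) q := by
  obtain ⟨hx, hy, hr⟩ := h.contDiffOn_coords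
  have hm := (smoothE_model 1 hx hy hr).inv fun q _ => model_mem_L _ _ _ _
  exact (hm.mul fun i j => (h.smooth i j).mono fun q hq => hq.1).diffM h.isOpen_goodLocus hq

/-- Both σ and the model move by elements of the Heisenberg algebra. The difference of the two
motions acts on the first column of the deviation, where three entries vanish identically; this
forces the motions to coincide, and only the vertical correction acts on the deviation. In
particular the coordinates detect the coefficients of the motion. -/
lemma dE_dev (h : FrameField cayleyR W σ) {q : E3} (hq : q ∈ goodLocus W σ) (v : E3) :
    dE (dev σ) q v = -(dev σ q * vert σ q v) ∧
    (fderiv ℝ (cx σ) q v = 0 → fderiv ℝ (cy σ) q v = 0 → fderiv ℝ (cr σ) q v = 0 →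
      coef σ q v = 0) := by
  obtain ⟨hx, hy, hr⟩ := h.contDiffOn_coords
  have hV := h.isOpen_goodLocus
  have hdiff : ∀ {f : E3 → ℝ}, ContDiffOn ℝ ∞ f (goodLocus W σ) → DifferentiableAt ℝ f q :=
    fun hf => (hf.contDiffAt (hV.mem_nhds hq)).differentiableAt (by simp)
  obtain ⟨dm, em⟩ := dE_model 1 (hdiff hx) (hdiff hy) (hdiff hr) v
  have hd := h.diffM_dev hq
  set c := coef σ q v with hc
  set m := model 1 (cx σ q) (cy σ q) (cr σ q) with hm
  set κ : Fin 3 → ℝ := ![fderiv ℝ (cx σ) q v, fderiv ℝ (cy σ) q v,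
    fderiv ℝ (cr σ) q v - cx σ q * fderiv ℝ (cy σ) q v] with hκ
  set c' : Fin 3 → ℝ := ![c 0, c 1, c 2 + c 0 * cy σ q - c 1 * cx σ q] with hc'
  have hmL : m ∈ L := model_mem_L _ _ _ _
  have hσ : σ q = m * dev σ q := (model_mul_dev σ q).symm
  have h1 : dE σ q v = m * nil 1 κ * dev σ q + m * dE (dev σ) q v := by
    have : dE σ q v =
        dE (fun q => model 1 (cx σ q) (cy σ q) (cr σ q) * dev σ q) q v :=
      dE_congr (Filter.Eventually.of_forall fun q => (model_mul_dev σ q).symm) v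
    rw [this, dE_mul dm hd, em]
  have h2 : dE σ q v = m * nil 1 c' * dev σ q - m * (dev σ q * vert σ q v) := by
    rw [h.dE_eq hq.1, hσ, ← mul_assoc, nil_mul_model, ← mul_assoc]
  -- Moving the symmetry across the model with `nil_mul_model` turns its coefficients c into c', to
  -- be compared with those of the model, κ.
  have h3 : dE (dev σ) q v = nil 1 (c' - κ) * dev σ q - dev σ q * vert σ q v := by
    have h4 : m * dE (dev σ) q v = m * (nil 1 (c' - κ) * dev σ q - dev σ q * vert σ q v) := by
      rw [← nil_sub, sub_mul, mul_sub, mul_sub, ← mul_assoc m, ← mul_assoc m, ← mul_assoc m]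
      rw [h1] at h2
      rw [eq_sub_of_add_eq' h2]
      simp only [mul_assoc]
      abel
    have := congrArg (fun B => m⁻¹ * B) h4
    simpa only [← mul_assoc, L_inv_mul hmL, one_mul] using this
  have hcol := dev_col hq.2.2
  have hvert : vert σ q v ∈ glFil 0 := gB_le_glFil (h.vert_mem hq.1 hq.2.1 v)
  -- The vertical part preserves the filtration, so it maps the first basis vector to a multiple of
  -- itself and does not disturb a vanishing entry of the first column.
  have hrow : ∀ i : Fin 8, (∀ q ∈ goodLocus W σ, dev σ q i 0 = 0) →
      (nil 1 (c' - κ) *ᵥ fun k => dev σ q k 0) i = 0 := fun i hi => by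
    have e1 : dE (dev σ) q v i 0 = 0 := fderiv_eq_zero (Filter.eventually_of_mem
      (hV.mem_nhds hq) hi) v
    have e2 : (dev σ q * vert σ q v) i 0 = 0 := by
      rw [Matrix.mul_apply]
      refine Finset.sum_eq_zero fun k _ => ?_
      by_cases hk : k = 0
      · rw [hk, hi q hq, zero_mul]
      · rw [glFil_zero_col hvert hk, mul_zero]
    rw [h3, Matrix.sub_apply, e2, sub_zero] at e1
    rw [← e1]; rfl
  have r1 := hrow 1 fun q hq => (dev_col hq.2.2).2.1
  have r2 := hrow 2 fun q hq => (dev_col hq.2.2).2.2.1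
  have r3 := hrow 3 fun q hq => (dev_col hq.2.2).2.2.2
  rw [nil_mulVec] at r1 r2 r3
  have hne : dev σ q 0 0 ≠ 0 := by rw [hcol.1]; exact hq.2.2
  simp only [Matrix.cons_val, hcol.2.1] at r1 r2 r3
  have b1 : (c' - κ) 1 = 0 := by
    have : (c' - κ) 1 * dev σ q 0 0 = 0 := by linarith
    exact (mul_eq_zero.mp this).resolve_right hne
  have b0 : (c' - κ) 0 = 0 := by
    have : (c' - κ) 0 * dev σ q 0 0 = 0 := by linarith
    exact (mul_eq_zero.mp this).resolve_right hne
  have b2 : (c' - κ) 2 = 0 := by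
    have : (c' - κ) 2 * dev σ q 0 0 = 0 := by linarith
    exact (mul_eq_zero.mp this).resolve_right hne
  refine ⟨?_, fun k0 k1 k2 => ?_⟩
  · have hb : c' - κ = 0 := by ext i; fin_cases i <;> assumption
    rw [h3, hb]
    simp [nil]
  · rw [hc', hκ] at b0 b1 b2
    simp [k0, k1, k2] at b0 b1 b2
    simp [b0, b1] at b2
    ext i; fin_cases i <;> assumption

/-- The entries of the deviation that violate the filtration satisfy a closed homogeneous linear
system along the segment: right multiplication by a filtration-preserving matrix does not feed the
other entries into them. They vanish at the start, hence at the end by Grönwall. -/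
lemma dev_mem_glFil (h : FrameField cayleyR W σ) {p v : E3}
    (hs : ∀ t ∈ Set.Icc (0 : ℝ) 1, p + t • v ∈ goodLocus W σ) (h0 : dev σ p ∈ glFil 0) :
    dev σ (p + v) ∈ glFil 0 := by
  have hγ : ∀ t : ℝ, HasDerivAt (fun t : ℝ => p + t • v) v t := fun t => by
    simpa using ((hasDerivAt_id t).smul_const v).const_add p
  obtain ⟨C, hC⟩ := (isCompact_Icc (a := (0 : ℝ)) (b := 1)).exists_bound_of_continuousOn
    (f := fun t => fun ij : Fin 8 × Fin 8 => vert σ (p + t • v) v ij.1 ij.2) (by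
      refine continuousOn_pi.mpr fun ij t ht => ContinuousAt.continuousWithinAt ?_
      exact ContinuousAt.comp (f := fun t : ℝ => p + t • v)
        (h.continuousAt_vert (hs t ht).1 (hs t ht).2.1 v ij.1 ij.2) (hγ t).continuousAt)
  have hC0 : 0 ≤ C := (norm_nonneg _).trans (hC 0 (by simp))
  let y : ℝ → (Fin 8 × Fin 8 → ℝ) := fun t ij =>
    if vdeg ij.1 < vdeg ij.2 then dev σ (p + t • v) ij.1 ij.2 else 0
  let y' : ℝ → (Fin 8 × Fin 8 → ℝ) := fun t ij =>
    if vdeg ij.1 < vdeg ij.2 then dE (dev σ) (p + t • v) v ij.1 ij.2 else 0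
  have hy1 : y 1 = 0 := by
    refine eq_zero_of_linear_ode (y' := y') (C := 8 * C) (fun t ht ij => ?_) ?_ (fun t ht ij => ?_)
    · by_cases hij : vdeg ij.1 < vdeg ij.2
      · simp only [y, y', hij, if_true]
        exact (h.diffM_dev (hs t ht) ij.1 ij.2).hasFDerivAt.comp_hasDerivAt t (hγ t)
      · simp only [y, y', hij, if_false]
        exact hasDerivAt_const t 0
    · ext ij
      by_cases hij : vdeg ij.1 < vdeg ij.2
      · simp only [y, hij, if_true, zero_smul, add_zero]
        exact h0 _ _ (by omega)
      · simp [y, hij]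
    · by_cases hij : vdeg ij.1 < vdeg ij.2
      · simp only [y', hij, if_true, (h.dE_dev (hs t ht) v).1, Matrix.neg_apply, abs_neg,
          Matrix.mul_apply]
        -- Either the entry (i, k) is itself a violating one and is bounded by ‖y t‖, or deg k ≤ deg
        -- i < deg j and the vertical factor vanishes. Eight such summands give the constant 8C.
        have hk : ∀ k, |dev σ (p + t • v) ij.1 k * vert σ (p + t • v) v k ij.2| ≤ C * ‖y t‖ :=
          fun k => by
          by_cases hik : vdeg ij.1 < vdeg k
          · rw [abs_mul, mul_comm]
            have h1 := (norm_le_pi_norm (fun ij : Fin 8 × Fin 8 =>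
              vert σ (p + t • v) v ij.1 ij.2) (k, ij.2)).trans (hC t ht)
            have h2 := norm_le_pi_norm (y t) (ij.1, k)
            simp only [y, hik, if_true] at h2
            exact mul_le_mul h1 h2 (abs_nonneg _) hC0
          · rw [gB_le_glFil (h.vert_mem (hs t ht).1 (hs t ht).2.1 v) k ij.2 (by omega), mul_zero,
              abs_zero]
            positivity
        calc _ ≤ ∑ k, |dev σ (p + t • v) ij.1 k * vert σ (p + t • v) v k ij.2| :=
              Finset.abs_sum_le_sum_abs _ _
          _ ≤ ∑ _k : Fin 8, C * ‖y t‖ := Finset.sum_le_sum fun k _ => hk k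
          _ = 8 * C * ‖y t‖ := by simp; ring
      · simp only [y', hij, if_false, abs_zero]
        positivity
  intro i j hij
  have := congrFun hy1 (i, j)
  simpa [y, show vdeg i < vdeg j by omega] using this

/-- A frame of the first type is, up to a change of coordinates and of frames, that of the
homogeneous model. -/
theorem exists_normal_coordinates (h : FrameField cayleyR W σ) {p : E3} (hp : p ∈ W)
    (h0 : σ p ∈ glFil 0) (hN : (nilSolder σ p).det ≠ 0) :
    ∃ (V : Set E3) (f : E3 → E3), IsOpen V ∧ p ∈ V ∧ V ⊆ W ∧ ContDiffOn ℝ ∞ f V ∧ f p = 0 ∧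
      (∀ q ∈ V, ∀ v, fderiv ℝ f q v = 0 → v = 0) ∧
      ∀ q ∈ V, ∀ k, (stdFlag k).map (σ q).mulVecLin =
        (stdFlag k).map (model 1 (f q 0) (f q 1) (f q 2)).mulVecLin := by
  have hσ0 : σ p 0 0 ≠ 0 := fun hz => by
    have h1 : σ p *ᵥ Pi.single 0 1 = 0 := by
      ext i
      rw [mulVec_single_zero]
      by_cases hi : i = 0
      · rw [hi, hz]; rfl
      · exact glFil_zero_col h0 hi
    have h2 := congrArg (fun u => (σ p)⁻¹ *ᵥ u) h1
    simp only [Matrix.mulVec_mulVec, L_inv_mul (h.mem_L p hp), Matrix.one_mulVec,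
      Matrix.mulVec_zero] at h2
    simpa using congrFun h2 0
  have hpV : p ∈ goodLocus W σ := ⟨hp, hN, hσ0⟩
  have hV := h.isOpen_goodLocus
  -- A ball is star-shaped about p, so the segments along which the deviation is propagated stay in
  -- the good locus.
  obtain ⟨ε, hε, hball⟩ := Metric.isOpen_iff.mp hV p hpV
  obtain ⟨hx, hy, hr⟩ := h.contDiffOn_coords
  have z1 := glFil_zero_col h0 (i := 1) (by simp)
  have z2 := glFil_zero_col h0 (i := 2) (by simp)
  have z3 := glFil_zero_col h0 (i := 3) (by simp)
  have cy0 : cy σ p = 0 := by simp [cy, z1]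
  have cx0 : cx σ p = 0 := by simp [cx, cy0, z2]
  have cr0 : cr σ p = 0 := by simp [cr, z3]
  have hdev0 : dev σ p ∈ glFil 0 := by
    rw [dev, cx0, cy0, cr0, model_zero]; simpa using h0
  refine ⟨Metric.ball p ε, fun q => WithLp.toLp 2 ![cx σ q, cy σ q, cr σ q], Metric.isOpen_ball,
    Metric.mem_ball_self hε, fun q hq => (hball hq).1, ?_, ?_, fun q hq v hv => ?_,
    fun q hq k => ?_⟩
  · rw [contDiffOn_euclidean]
    intro i
    fin_cases i
    · exact hx.mono hball
    · exact hy.mono hball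
    · exact hr.mono hball
  · ext i; fin_cases i <;> simp [cx0, cy0, cr0]
  · have hqV := hball hq
    have hd : ∀ i : Fin 3, ∀ {g : E3 → ℝ}, ContDiffOn ℝ ∞ g (goodLocus W σ) →
        (∀ q, (WithLp.toLp 2 ![cx σ q, cy σ q, cr σ q] : E3) i = g q) → fderiv ℝ g q v = 0 := by
      intro i g hg hgi
      have hF : DifferentiableAt ℝ (fun q => (WithLp.toLp 2 ![cx σ q, cy σ q, cr σ q] : E3)) q := by
        rw [differentiableAt_euclidean]
        have hdiff : ∀ {f : E3 → ℝ}, ContDiffOn ℝ ∞ f (goodLocus W σ) → DifferentiableAt ℝ f q :=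
          fun hf => (hf.contDiffAt (hV.mem_nhds hqV)).differentiableAt (by simp)
        intro i
        fin_cases i
        · exact hdiff hx
        · exact hdiff hy
        · exact hdiff hr
      have h1 := ((EuclideanSpace.proj (𝕜 := ℝ) i).hasFDerivAt.comp q hF.hasFDerivAt).fderiv
      have h2 : (fun q => EuclideanSpace.proj (𝕜 := ℝ) i
          (WithLp.toLp 2 ![cx σ q, cy σ q, cr σ q] : E3)) = g := funext hgi
      rw [Function.comp_def, h2] at h1
      rw [h1, ContinuousLinearMap.comp_apply, hv, map_zero]
    -- A direction in which all three coordinates are stationary has vanishing motion coefficients,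
    -- so the 𝔤₋-part of the Maurer–Cartan form vanishes there and immersion applies.
    have hc := (h.dE_dev hqV v).2 (hd 0 hx fun _ => rfl) (hd 1 hy fun _ => rfl)
      (hd 2 hr fun _ => rfl)
    refine h.immersion q hqV.1 v ?_
    rw [← piM_coef hqV.2.1, hc]
    simp [nil]
  · have hdev : dev σ q ∈ glFil 0 := by
      have := h.dev_mem_glFil (p := p) (v := q - p) (fun t ht => hball ?_) hdev0
      · simpa using this
      · rw [Metric.mem_ball, dist_eq_norm, add_sub_cancel_left, norm_smul, Real.norm_eq_abs,
          abs_of_nonneg ht.1]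
        rw [Metric.mem_ball, dist_eq_norm] at hq
        exact (mul_le_of_le_one_left (norm_nonneg _) ht.2).trans_lt hq
    have hL : dev σ q ∈ L := L_mul (L_inv (model_mem_L _ _ _ _)) (h.mem_L q (hball hq).1)
    conv_lhs => rw [← model_mul_dev σ q, Matrix.mulVecLin_mul, Submodule.map_comp,
      map_stdFlag hL hdev]
    rfl

end FrameField

/-! ### Uniqueness -/

/-- Left translation by a constant leaves the Maurer–Cartan form unchanged and only conjugates the
symmetries; it brings the symmetry algebra to its normal form. -/
lemma FrameField.conj {S : Submodule ℝ M8} {W : Set E3} {σ : E3 → M8} (h : FrameField S W σ)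
    {a : M8} (ha : a ∈ L) : FrameField (S.map (conjInv a)) W (fun q => a⁻¹ * σ q) := by
  have hθ : ∀ p ∈ W, ∀ v, (a⁻¹ * σ p)⁻¹ * dE (fun q => a⁻¹ * σ q) p v = (σ p)⁻¹ * dE σ p v :=
    fun p hp v => by
    rw [dE_mul (DiffM.const _ _) (h.smooth.diffM h.isOpen hp), dE_const, zero_mul, zero_add,
      Matrix.mul_inv_rev, Matrix.nonsing_inv_nonsing_inv _ (det_sq_of_mem_L ha), ← mul_assoc,
      mul_assoc _ a, L_mul_inv ha, mul_one]
  have hB : ∀ p B, (a⁻¹ * σ p)⁻¹ * conjInv a B * (a⁻¹ * σ p) = (σ p)⁻¹ * B * σ p := fun p B => by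
    rw [Matrix.mul_inv_rev, Matrix.nonsing_inv_nonsing_inv _ (det_sq_of_mem_L ha)]
    change (σ p)⁻¹ * a * (a⁻¹ * B * a) * (a⁻¹ * σ p) = _
    rw [show (σ p)⁻¹ * a * (a⁻¹ * B * a) * (a⁻¹ * σ p) =
      (σ p)⁻¹ * (a * a⁻¹) * B * (a * a⁻¹) * σ p by noncomm_ring, L_mul_inv ha, mul_one, mul_one]
  refine ⟨h.isOpen, (SmoothE.const _ _).mul h.smooth, fun p hp => L_mul (L_inv ha) (h.mem_L p hp),
    fun p hp v hv => ?_, fun p hp v => ?_, fun p hp => ?_⟩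
  · rw [hθ p hp] at hv
    exact h.immersion p hp v hv
  · obtain ⟨B, hBS, η, hη, he⟩ := h.trans p hp v
    exact ⟨conjInv a B, ⟨B, hBS, rfl⟩, η, hη, by rw [hθ p hp, hB, he]⟩
  · rintro _ ⟨B, hBS, rfl⟩
    obtain ⟨v, η, hη, he⟩ := h.sym p hp B hBS
    exact ⟨v, η, hη, by rw [hθ p hp, hB, he]⟩

lemma nil_eq (α : ℝ) (c : Fin 3 → ℝ) : nil α c =
    ad (c 0 • e 1 + c 1 • e 2 - c 2 • e 0) + (α * c 1) • Rm11 := by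
  simp only [nil, X1, X2, X3, ad_sub, ad_add, ad_smul]
  module

lemma nil_base_mem (c : Fin 3 → ℝ) : c 0 • e 1 + c 1 • e 2 - c 2 • e 0 ∈ sl3 :=
  sub_mem (add_mem (sl3.smul_mem _ (e_mem_sl3 1)) (sl3.smul_mem _ (e_mem_sl3 2)))
    (sl3.smul_mem _ (e_mem_sl3 0))

lemma det_ne_zero_of_mulVec {N : Matrix (Fin 3) (Fin 3) ℝ} (h : ∀ c, N *ᵥ c = 0 → c = 0) :
    N.det ≠ 0 := by
  rw [← isUnit_iff_ne_zero, ← Matrix.isUnit_iff_isUnit_det, ← Matrix.mulVec_injective_iff_isUnit,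
    ← Matrix.coe_mulVecLin, ← LinearMap.ker_eq_bot, LinearMap.ker_eq_bot']
  exact h

lemma det_nilSolder_of_one {σ : E3 → M8} {p : E3} (h : σ p = 1) :
    (FrameField.nilSolder σ p).det ≠ 0 := by
  refine det_ne_zero_of_mulVec fun c hc => ?_
  rw [FrameField.nilSolder_mulVec, h, inv_one, one_mul, mul_one, nil_eq,
    piM_apply (nil_base_mem c) (gPerp.smul_mem _ Rm11_mem_gPerp)] at hc
  have h0 := congrFun hc 0
  have h1 := congrFun hc 1
  have h2 := congrFun hc 2
  simp [e, E] at h0 h1 h2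
  ext i; fin_cases i <;> assumption

lemma det_nilSolder_of_S8 {σ : E3 → M8} {p : E3} (h : σ p = S8) :
    (FrameField.nilSolder σ p).det ≠ 0 := by
  refine det_ne_zero_of_mulVec fun c hc => ?_
  have hc' : piM (conjInv S8 (nil 1 c)) = 0 := by
    rw [FrameField.nilSolder_mulVec, h] at hc
    exact hc
  rw [nil_eq, map_add, conjInv_S8_ad, piM_apply (mir_mem_sl3 (nil_base_mem c))
    (conjInv_S8_mem_gPerp (gPerp.smul_mem _ Rm11_mem_gPerp))] at hc'
  have h0 := congrFun hc' 0
  have h1 := congrFun hc' 1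
  have h2 := congrFun hc' 2
  simp [mir_apply, e, E, Fin.rev] at h0 h1 h2
  ext i; fin_cases i <;> assumption

lemma S8_mem_glFil : S8 ∈ glFil 0 := by
  intro i j h
  fin_cases i <;> fin_cases j <;> simp [vdeg] at h <;> simp [S8]

lemma one_mem_glFil : (1 : M8) ∈ glFil 0 := by
  intro i j h
  exact Matrix.one_apply_ne (by rintro rfl; simp at h)

lemma fderiv_mulVec_apply {w : E3 → Fin 8 → ℝ} {p : E3}
    (hw : ∀ i, DifferentiableAt ℝ (fun q => w q i) p) (B : M8) (i : Fin 8) (v : E3) :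
    fderiv ℝ (fun q => (B *ᵥ w q) i) p v = ∑ j, B i j * fderiv ℝ (fun q => w q j) p v := by
  change fderiv ℝ (fun q => ∑ j, B i j * w q j) p v = _
  rw [fderiv_fun_sum fun j _ => (hw j).const_mul (B i j), ContinuousLinearMap.sum_apply]
  refine Finset.sum_congr rfl fun j _ => ?_
  rw [fderiv_const_mul (hw j)]
  rfl

section

variable {M : Type*} [TopologicalSpace M] [ChartedSpace E3 M] [IsManifold (𝓡 3) ∞ M]
  {D : ∀ x : M, Submodule ℝ (TangentSpace (𝓡 3) x)}
  {φ : M → ℤ → Submodule ℝ (Fin 8 → ℝ)} {P : Set (M × M8)}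

/-- Every submaximal embedding is locally the homogeneous model. -/
theorem IsSubmaximal.exists_local_model [ConnectedSpace M] (h : IsSubmaximal D φ P) (x : M) :
    ∃ a ∈ L, ∃ (V : Set E3) (f : E3 → E3), IsOpen V ∧ chartAt E3 x x ∈ V ∧
      V ⊆ (chartAt E3 x).target ∧ ContDiffOn ℝ ∞ f V ∧ f (chartAt E3 x x) = 0 ∧
      (∀ q ∈ V, ∀ v, fderiv ℝ f q v = 0 → v = 0) ∧
      ∀ q ∈ V, ∀ k, φ ((chartAt E3 x).symm q) k =
        (stdFlag k).map (a * model 1 (f q 0) (f q 1) (f q 2)).mulVecLin := by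
  -- Since `S8` lies in L and respects the filtration, type S is turned into type R by J = `S8`, and
  -- one model serves both types. The translated frame then starts at J⁻¹ instead of 1, which is
  -- enough for normal coordinates.
  have key : ∃ a₀ J, (x, a₀) ∈ P ∧ J ∈ L ∧ J⁻¹ ∈ glFil 0 ∧
      (∀ {σ : E3 → M8} {p}, σ p = J⁻¹ → (FrameField.nilSolder σ p).det ≠ 0) ∧
      symAlgAt P (a₀ * J) = cayleyR := by
    obtain ⟨a, ha⟩ := h.cartan.nonempty_fibre x
    rcases h.constant_type with hR | hS
    · obtain ⟨b, hb, h1⟩ := hR x a ha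
      refine ⟨a * Ad b, 1, h.mul_mem ha hb, one_mem_L, ?_, fun hσ => ?_, by rwa [mul_one]⟩
      · rw [inv_one]; exact one_mem_glFil
      · rw [inv_one] at hσ; exact det_nilSolder_of_one hσ
    · obtain ⟨b, hb, h1⟩ := hS x a ha
      refine ⟨a * Ad b, S8, h.mul_mem ha hb, S8_mem_L, ?_, fun hσ => ?_, ?_⟩
      · rw [S8_inv]; exact S8_mem_glFil
      · rw [S8_inv] at hσ; exact det_nilSolder_of_S8 hσ
      · rw [symAlgAt_mul, h1, map_S8_cayleyS]
  obtain ⟨a₀, J, ha₀, hJ, hJF, hJN, hsym⟩ := key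
  have hx := mem_chart_source E3 x
  set c := chartAt E3 x with hc
  obtain ⟨U, s, hs, hxU, hsx⟩ := h.cartan.local_section x a₀ ha₀
  have haL : a₀ * J ∈ L := L_mul (h.cartan.mem_L ha₀) hJ
  have hF := (h.cartan.frameField h.transitive hs x).conj haL
  rw [show (symAlg P).map (conjInv (a₀ * J)) = cayleyR from hsym] at hF
  have hp : c x ∈ chartDom x U := ⟨c.map_source hx, by
    rw [Set.mem_preimage, c.left_inv hx]; exact hxU⟩
  have hσp : (a₀ * J)⁻¹ * (s ∘ c.symm) (c x) = J⁻¹ := by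
    rw [Function.comp_apply, c.left_inv hx, hsx, Matrix.mul_inv_rev, mul_assoc,
      L_inv_mul (h.cartan.mem_L ha₀), mul_one]
  obtain ⟨V, f, hVo, hpV, hVW, hf, hf0, hfi, hfm⟩ := hF.exists_normal_coordinates hp
    (hσp ▸ hJF) (hJN hσp)
  refine ⟨a₀ * J, haL, V, f, hVo, hpV, fun q hq => (hVW hq).1, hf, hf0, hfi, fun q hq k => ?_⟩
  rw [Matrix.mulVecLin_mul, Submodule.map_comp, ← hfm q hq k, ← Submodule.map_comp,
    ← Matrix.mulVecLin_mul, ← mul_assoc, L_mul_inv haL, one_mul]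
  exact (h.cartan.frame _ _ (hs.2.2 _ (hVW hq).2)).2 k

/-- The derivative of a vector valued function transformed by a constant matrix. -/
lemma dVec_mulVec {y : M} {w : M → Fin 8 → ℝ}
    (hw : ∀ i, ContMDiffAt (𝓡 3) 𝓘(ℝ, ℝ) ∞ (fun z => w z i) y) (B : M8)
    (X : TangentSpace (𝓡 3) y) : dVec (fun z => B *ᵥ w z) y X = B *ᵥ dVec w y X := by
  haveI : IsManifold (𝓡 3) 1 M := isManifold_one
  have hy := mem_chart_source E3 y
  have hB : ∀ i, MDifferentiableAt (𝓡 3) 𝓘(ℝ, ℝ) (fun z => (B *ᵥ w z) i) y := fun i => by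
    have : ContDiff ℝ ∞ (fun u : Fin 8 → ℝ => (B *ᵥ u) i) := by
      simp only [Matrix.mulVec, dotProduct]; fun_prop
    exact (this.contDiffAt.contMDiffAt.comp (f := w) y
      (contMDiffAt_pi_space.mpr hw)).mdifferentiableAt (by simp)
  have hw' := fun i => (hw i).mdifferentiableAt (n := ∞) (by simp)
  have hs : ∀ i, DifferentiableAt ℝ ((fun z => w z i) ∘ (chartAt E3 y).symm) (chartAt E3 y y) :=
    fun i => by
    rw [← mdifferentiableAt_iff_differentiableAt]
    refine MDifferentiableAt.comp _ ?_
      ((mdifferentiable_chart (I := 𝓡 3) y).mdifferentiableAt_symm ((chartAt E3 y).map_source hy))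
    rw [(chartAt E3 y).left_inv hy]
    exact hw' i
  ext i
  have h1 := mfderiv_eq_chart y hy (hB i) X
  have h2 : ∀ j, dVec w y X j = fderiv ℝ ((fun z => w z j) ∘ (chartAt E3 y).symm)
      (chartAt E3 y y) (mfderiv (𝓡 3) (𝓡 3) (chartAt E3 y) y X) :=
    fun j => mfderiv_eq_chart y hy (hw' j) X
  change (mfderiv (𝓡 3) 𝓘(ℝ, ℝ) (fun z => (B *ᵥ w z) i) y X : ℝ) =
    ∑ j, B i j * dVec w y X j
  rw [h1]
  simp only [h2]
  exact fderiv_mulVec_apply (w := fun q => w ((chartAt E3 y).symm q)) hs B i _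

/-- The distribution is determined by the filtration. -/
lemma IsOsculatingMap.mem_D_iff (h : IsOsculatingMap D φ) {y : M} (X : TangentSpace (𝓡 3) y) :
    X ∈ D y ↔ ∀ (U : Set M) (v : M → Fin 8 → ℝ), IsSection φ U 4 v → y ∈ U →
      dVec v y X ∈ φ y 3 := by
  constructor
  · intro hX U v hv hy
    exact (h.osculating U 4 v hv y hy).1 X hX
  · intro hX
    obtain ⟨U, F, hU, hyU, hF, hFf⟩ := h.smooth y
    obtain ⟨a, ha, σ₁, σ₂, -, -, hker, hsym⟩ := h.symbol y
    have hA : (Pi.single 0 1 : Fin 8 → ℝ) ∈ stdFlag 4 := by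
      intro i hi
      fin_cases i <;> simp [vdeg] at hi ⊢
    have hv : IsSection φ U 4 (fun z => F z *ᵥ Pi.single 0 1) := by
      refine ⟨hU, fun i => ?_, fun z hz => ?_⟩
      · simp only [Matrix.mulVec_single_one]
        exact hF i 0
      · rw [(hFf z hz).2 4]
        exact ⟨_, hA, rfl⟩
    have h1 := hX U _ hv hyU
    have h2 := (hsym U 4 _ hyU hv).2 X
    -- Modulo φ³ the derivative of a section of the line φ⁴ in the direction X is given by ad of the
    -- symbol σ₂(X), a multiple of e₀. On a generator of the line its H₁-component is nonzero unless
    -- that multiple is 0, so σ₂(X) = 0 and X lies in D.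
    have h3 := sub_mem h1 h2
    rw [sub_sub_cancel, ha.2 3] at h3
    have hvy : F y *ᵥ Pi.single 0 1 ∈ φ y 4 := hv.2.2 y hyU
    rw [ha.2 4] at hvy
    obtain ⟨t, ht, hte⟩ := hvy
    obtain ⟨u, hu, hue⟩ := h3
    simp only [Matrix.mulVecLin_apply] at hte hue
    rw [← hte, Matrix.mulVec_mulVec, mul_assoc, L_inv_mul ha.1, mul_one, ← Matrix.mulVec_mulVec]
      at hue
    have h4 : ad (σ₂ X).1 *ᵥ t = u := by
      have := congrArg (fun u => a⁻¹ *ᵥ u) hue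
      simpa [Matrix.mulVec_mulVec, ← mul_assoc, L_inv_mul ha.1] using this.symm
    have ht0 : t 0 ≠ 0 := fun h0 => by
      have htz : t = 0 := by
        ext i
        by_cases hi : i = 0
        · rw [hi, h0]; rfl
        · exact ht i (by fin_cases i <;> simp [vdeg] at hi ⊢)
      rw [htz, Matrix.mulVec_zero] at hte
      have := congrArg (fun u => (F y)⁻¹ *ᵥ u) hte
      simp only [Matrix.mulVec_mulVec, L_inv_mul (hFf y hyU).1, Matrix.one_mulVec,
        Matrix.mulVec_zero] at this
      simpa using congrFun this 0
    obtain ⟨hs, hg⟩ := (σ₂ X).2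
    have h5 := hu 3 (by simp [vdeg])
    rw [← h4, ad_eq_adMat hs, mulVec_eight] at h5
    have ht1 : ∀ i : Fin 8, i ≠ 0 → t i = 0 := fun i hi =>
      ht i (by fin_cases i <;> simp [vdeg] at hi ⊢)
    rw [ht1 1 (by simp), ht1 2 (by simp), ht1 3 (by simp), ht1 4 (by simp), ht1 5 (by simp),
      ht1 6 (by simp), ht1 7 (by simp)] at h5
    simp [adMat, coord, ht0] at h5
    have h6 : σ₂ X = 0 := by
      ext i j
      by_cases hij : ((j : ℕ) : ℤ) - ((i : ℕ) : ℤ) = -2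
      · fin_cases i <;> fin_cases j <;> simp at hij
        exact h5
      · exact hg i j hij
    rw [← hker]
    exact LinearMap.mem_ker.mpr h6

end

/-- Smooth maps with smooth inverse from the inverse function theorem. -/
lemma exists_local_diffeo {V : Set E3} {f : E3 → E3} (hV : IsOpen V) (hf : ContDiffOn ℝ ∞ f V)
    (hi : ∀ q ∈ V, ∀ v, fderiv ℝ f q v = 0 → v = 0) {p : E3} (hp : p ∈ V) :
    ∃ g : OpenPartialHomeomorph E3 E3, p ∈ g.source ∧ g.source ⊆ V ∧ (∀ q, g q = f q) ∧
      ContDiffOn ℝ ∞ g g.source ∧ ContDiffOn ℝ ∞ g.symm g.target := by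
  have hequiv : ∀ q ∈ V, ∃ f' : E3 ≃L[ℝ] E3, HasFDerivAt f (f' : E3 →L[ℝ] E3) q := fun q hq => by
    have hinj : Function.Injective (fderiv ℝ f q).toLinearMap :=
      (injective_iff_map_eq_zero _).mpr fun v hv => hi q hq v hv
    refine ⟨(LinearEquiv.ofInjectiveEndo _ hinj).toContinuousLinearEquiv, ?_⟩
    have hd := ((hf.contDiffAt (hV.mem_nhds hq)).differentiableAt (by simp)).hasFDerivAt
    have he : ((LinearEquiv.ofInjectiveEndo _ hinj).toContinuousLinearEquiv : E3 →L[ℝ] E3) =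
        fderiv ℝ f q := by
      ext v; rfl
    rw [he]
    exact hd
  obtain ⟨f', hf'⟩ := hequiv p hp
  have hc := hf.contDiffAt (hV.mem_nhds hp)
  let g₀ := hc.toOpenPartialHomeomorph f hf' (by simp)
  have hg₀ : ∀ q, g₀ q = f q := fun q => by
    rw [show (g₀ : E3 → E3) = f from hc.toOpenPartialHomeomorph_coe hf' (by simp)]
  -- Restricting to V keeps the derivative invertible on the whole source, so the inverse is smooth
  -- on the whole target and not only near the image of p.
  refine ⟨g₀.restrOpen V hV, ?_, ?_, ?_, ?_, ?_⟩
  · exact ⟨hc.mem_toOpenPartialHomeomorph_source hf' (by simp), hp⟩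
  · exact fun q hq => hq.2
  · exact fun q => hg₀ q
  · exact (hf.mono fun q hq => hq.2).congr fun q _ => hg₀ q
  · intro q hq
    set g := g₀.restrOpen V hV
    have hq' := g.map_target hq
    obtain ⟨f'', hf''⟩ := hequiv _ hq'.2
    have hgf : (g : E3 → E3) = f := funext hg₀
    refine (g.contDiffAt_symm hq (f₀' := f'') ?_ ?_).contDiffWithinAt
    · rw [hgf]; exact hf''
    · rw [hgf]; exact hf.contDiffAt (hV.mem_nhds hq'.2)

/-! ### Equivalences assembled from the local models -/

section

variable {M : Type*} [TopologicalSpace M] [ChartedSpace E3 M] [IsManifold (𝓡 3) ∞ M]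
  {M' : Type*} [TopologicalSpace M'] [ChartedSpace E3 M'] [IsManifold (𝓡 3) ∞ M']
  {D : ∀ x : M, Submodule ℝ (TangentSpace (𝓡 3) x)}
  {φ : M → ℤ → Submodule ℝ (Fin 8 → ℝ)} {P : Set (M × M8)}
  {D' : ∀ x : M', Submodule ℝ (TangentSpace (𝓡 3) x)}
  {φ' : M' → ℤ → Submodule ℝ (Fin 8 → ℝ)} {P' : Set (M' × M8)}

/-- A local diffeomorphism matching the filtrations of `V` preserves the distributions. -/
lemma mfderiv_mem_D (hD : IsOsculatingMap D φ) (hD' : IsOsculatingMap D' φ')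
    (h : OpenPartialHomeomorph M M') (hs : ContMDiffOn (𝓡 3) (𝓡 3) ∞ h h.source)
    {a : M8} (ha : a ∈ L)
    (hφ : ∀ y ∈ h.source, ∀ q, φ' (h y) q = (φ y q).map a.mulVecLin) {y : M} (hy : y ∈ h.source)
    {X : TangentSpace (𝓡 3) y} (hX : X ∈ D y) : mfderiv (𝓡 3) (𝓡 3) h y X ∈ D' (h y) := by
  rw [hD'.mem_D_iff]
  intro U v hv hyU
  have hopen : IsOpen (h.source ∩ h ⁻¹' U) := h.isOpen_inter_preimage hv.1
  have hmem : y ∈ h.source ∩ h ⁻¹' U := ⟨hy, hyU⟩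
  have hsm : SmoothVec (fun z => v (h z)) (h.source ∩ h ⁻¹' U) := fun i =>
    (hv.2.1 i).comp (hs.mono Set.inter_subset_left) fun z hz => hz.2
  have hsec : IsSection φ (h.source ∩ h ⁻¹' U) 4 (fun z => a⁻¹ *ᵥ v (h z)) := by
    refine ⟨hopen, fun i => ?_, fun z hz => ?_⟩
    · have : ContDiff ℝ ∞ (fun u : Fin 8 → ℝ => (a⁻¹ *ᵥ u) i) := by
        simp only [Matrix.mulVec, dotProduct]; fun_prop
      exact this.contMDiff.comp_contMDiffOn (f := fun z => v (h z)) (contMDiffOn_pi_space.mpr hsm)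
    · have := hv.2.2 (h z) hz.2
      rw [hφ z hz.1] at this
      obtain ⟨u, hu, hue⟩ := this
      change a⁻¹ *ᵥ v (h z) ∈ φ z 4
      rw [← hue, Matrix.mulVecLin_apply, Matrix.mulVec_mulVec, L_inv_mul ha, Matrix.one_mulVec]
      exact hu
  have h1 := (hD.mem_D_iff X).mp hX _ _ hsec hmem
  have hd : ∀ i, ContMDiffAt (𝓡 3) 𝓘(ℝ, ℝ) ∞ (fun z => v (h z) i) y := fun i =>
    (hsm i).contMDiffAt (hopen.mem_nhds hmem)
  rw [dVec_mulVec hd a⁻¹ X] at h1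
  have h2 : dVec (fun z => v (h z)) y X = dVec v (h y) (mfderiv (𝓡 3) (𝓡 3) h y X) := by
    ext i
    have hv1 : MDifferentiableAt (𝓡 3) 𝓘(ℝ, ℝ) (fun z => v z i) (h y) :=
      ((hv.2.1 i).contMDiffAt (hv.1.mem_nhds hyU)).mdifferentiableAt (by simp)
    have hh : MDifferentiableAt (𝓡 3) (𝓡 3) h y :=
      (hs.contMDiffAt (h.open_source.mem_nhds hy)).mdifferentiableAt (by simp)
    have := mfderiv_comp y hv1 hh
    simp only [dVec]
    rw [show (fun z => v (h z) i) = (fun z => v z i) ∘ h from rfl, this]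
    rfl
  rw [h2] at h1
  rw [hφ y hy]
  refine ⟨_, h1, ?_⟩
  rw [Matrix.mulVecLin_apply, Matrix.mulVec_mulVec, L_mul_inv ha, Matrix.one_mulVec]

/-- Submaximal embeddings are locally equivalent. -/
theorem IsSubmaximal.locallyEquivalent [ConnectedSpace M] [ConnectedSpace M']
    (h : IsSubmaximal D φ P) (h' : IsSubmaximal D' φ' P') (x : M) (x' : M') :
    LocallyEquivalent D φ x D' φ' x' := by
  obtain ⟨a, ha, V, f, hV, hp, hVt, hf, hf0, hfi, hφ⟩ := h.exists_local_model x
  obtain ⟨a', ha', V', f', hV', hp', hVt', hf', hf0', hfi', hφ'⟩ := h'.exists_local_model x'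
  obtain ⟨g, hgp, hgV, hgf, hg, hgs⟩ := exists_local_diffeo hV hf hfi hp
  obtain ⟨g', hgp', hgV', hgf', hg', hgs'⟩ := exists_local_diffeo hV' hf' hfi' hp'
  set c := chartAt E3 x with hc
  set c' := chartAt E3 x' with hc'
  have hx := mem_chart_source E3 x
  have hx' := mem_chart_source E3 x'
  have hg0 : g (c x) = 0 := by rw [hgf, hf0]
  have hg0' : g' (c' x') = 0 := by rw [hgf', hf0']
  have hsym0 : g'.symm 0 = c' x' := by rw [← hg0', g'.left_inv hgp']
  -- Both embeddings are the same model in their normal coordinates, each centred at 0, so composing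
  -- one coordinate system with the inverse of the other matches the flags up to a constant of L.
  let H : OpenPartialHomeomorph M M' := ((c.trans g).trans g'.symm).trans c'.symm
  have hsrc : ∀ y, y ∈ H.source ↔ ((y ∈ c.source ∧ c y ∈ g.source) ∧ g (c y) ∈ g'.target) ∧
      g'.symm (g (c y)) ∈ c'.target := fun y => by
    simp [H, OpenPartialHomeomorph.trans_source]
  have htgt : ∀ y, y ∈ H.target ↔ ((y ∈ c'.source ∧ c' y ∈ g'.source) ∧ g' (c' y) ∈ g.target) ∧
      g.symm (g' (c' y)) ∈ c.target := fun y => by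
    simp [H, OpenPartialHomeomorph.trans_target, and_assoc]
  have hH : ∀ y, H y = c'.symm (g'.symm (g (c y))) := fun y => rfl
  have hHs : ∀ y, H.symm y = c.symm (g.symm (g' (c' y))) := fun y => rfl
  have hxH : x ∈ H.source := by
    rw [hsrc]
    refine ⟨⟨⟨hx, hgp⟩, ?_⟩, ?_⟩
    · rw [hg0, ← hg0']; exact g'.map_source hgp'
    · rw [hg0, hsym0]; exact c'.map_source hx'
  have hsm : ContMDiffOn (𝓡 3) (𝓡 3) ∞ H H.source := fun y hy => by
    obtain ⟨⟨⟨h1, h2⟩, h3⟩, h4⟩ := (hsrc y).mp hy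
    have e1 := contMDiffAt_of_mem_maximalAtlas (I := 𝓡 3) (n := ∞)
      (IsManifold.chart_mem_maximalAtlas x) h1
    have e2 := (hg.contDiffAt (g.open_source.mem_nhds h2)).contMDiffAt
    have e3 := (hgs'.contDiffAt (g'.open_target.mem_nhds h3)).contMDiffAt
    have e4 := contMDiffAt_symm_of_mem_maximalAtlas (I := 𝓡 3) (n := ∞)
      (IsManifold.chart_mem_maximalAtlas x') h4
    exact (e4.comp y (e3.comp y (e2.comp y e1))).contMDiffWithinAt
  have hsms : ContMDiffOn (𝓡 3) (𝓡 3) ∞ H.symm H.target := fun y hy => by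
    obtain ⟨⟨⟨h1, h2⟩, h3⟩, h4⟩ := (htgt y).mp hy
    have e1 := contMDiffAt_of_mem_maximalAtlas (I := 𝓡 3) (n := ∞)
      (IsManifold.chart_mem_maximalAtlas x') h1
    have e2 := (hg'.contDiffAt (g'.open_source.mem_nhds h2)).contMDiffAt
    have e3 := (hgs.contDiffAt (g.open_target.mem_nhds h3)).contMDiffAt
    have e4 := contMDiffAt_symm_of_mem_maximalAtlas (I := 𝓡 3) (n := ∞)
      (IsManifold.chart_mem_maximalAtlas x) h4
    exact (e4.comp y (e3.comp y (e2.comp y e1))).contMDiffWithinAt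
  have haa : a' * a⁻¹ ∈ L := L_mul ha' (L_inv ha)
  have hflag : ∀ y ∈ H.source, ∀ k, φ' (H y) k = (φ y k).map (a' * a⁻¹).mulVecLin := by
    intro y hy k
    obtain ⟨⟨⟨h1, h2⟩, h3⟩, h4⟩ := (hsrc y).mp hy
    have e1 := hφ (c y) (hgV h2) k
    have e2 := hφ' (g'.symm (g (c y))) (hgV' (g'.map_target h3)) k
    rw [← hgf', g'.right_inv h3] at e2
    rw [c.left_inv h1, ← hgf] at e1
    rw [hH, e2, e1, ← Submodule.map_comp, ← Matrix.mulVecLin_mul, ← mul_assoc, mul_assoc a',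
      L_inv_mul ha, mul_one]
  have hflags : ∀ y ∈ H.symm.source, ∀ k,
      φ (H.symm y) k = (φ' y k).map (a' * a⁻¹)⁻¹.mulVecLin := by
    intro y hy k
    have := hflag (H.symm y) (H.map_target hy) k
    rw [H.right_inv hy] at this
    rw [this, ← Submodule.map_comp, ← Matrix.mulVecLin_mul, L_inv_mul haa, Matrix.mulVecLin_one,
      Submodule.map_id]
  refine ⟨H, hxH, ?_, hsm, hsms, fun y hy => ?_, a' * a⁻¹, haa, hflag⟩
  · rw [hH, hg0, hsym0, c'.left_inv hx']
  · haveI : IsManifold (𝓡 3) 1 M := isManifold_one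
    haveI : IsManifold (𝓡 3) 1 M' := isManifold_one
    have hmd : H.MDifferentiable (𝓡 3) (𝓡 3) :=
      ⟨hsm.mdifferentiableOn (by simp), hsms.mdifferentiableOn (by simp)⟩
    refine le_antisymm ?_ fun X' hX' => ?_
    · rintro _ ⟨X, hX, rfl⟩
      exact mfderiv_mem_D h.osculating h'.osculating H hsm haa hflag hy hX
    · have h1 := mfderiv_mem_D h'.osculating h.osculating H.symm hsms (L_inv haa) hflags
        (H.map_source hy) hX'
      -- The inverse map lands in the space D at H⁻¹(H y), equal to y only propositionally; this
      -- moves membership to D at y.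
      have h2 : ∀ (z : M) (Y : E3), z = y → Y ∈ (show Submodule ℝ E3 from D z) →
        Y ∈ (show Submodule ℝ E3 from D y) := by
        rintro z Y rfl hz; exact hz
      have h3 := congrArg (ContinuousLinearMap.toLinearMap) (hmd.symm_comp_deriv hy)
      let T : E3 →ₗ[ℝ] E3 := (mfderiv (𝓡 3) (𝓡 3) H y).toLinearMap
      let T' : E3 →ₗ[ℝ] E3 := (mfderiv (𝓡 3) (𝓡 3) H.symm (H y)).toLinearMap
      have h4 : T' * T = 1 := h3
      have h5 : T * T' = 1 := mul_eq_one_comm.mp h4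
      exact ⟨T' X', h2 _ _ (H.left_inv hy) h1, LinearMap.congr_fun h5 X'⟩

end

/-! ### Existence: the osculating map -/

/-- The frame of the homogeneous model. -/
def frame (α : ℝ) (p : E3) : M8 := model α (p 0) (p 1) (p 0 * p 1 / 2 - p 2)

lemma frame_mem_L (α : ℝ) (p : E3) : frame α p ∈ L := model_mem_L _ _ _ _

/-- The coordinates of a tangent vector in the coframe dual to `Z₁`, `Z₂`, `-∂/∂z`. -/
def coframe (p : E3) : E3 →ₗ[ℝ] (Fin 3 → ℝ) where
  toFun w := ![w 0, w 1, (p 1 * w 0 - p 0 * w 1) / 2 - w 2]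
  map_add' w w' := by ext i; fin_cases i <;> simp; ring
  map_smul' c w := by ext i; fin_cases i <;> simp; ring

lemma coframe_apply (p w : E3) :
    coframe p w = ![w 0, w 1, (p 1 * w 0 - p 0 * w 1) / 2 - w 2] := rfl

lemma contDiff_coord (i : Fin 3) : ContDiff ℝ ∞ (fun q : E3 => q i) := by fun_prop

lemma contDiff_frame_coord : ContDiff ℝ ∞ (fun q : E3 => q 0 * q 1 / 2 - q 2) := by fun_prop

lemma smoothE_frame (α : ℝ) (W : Set E3) : SmoothE (frame α) W :=
  smoothE_model α (contDiff_coord 0).contDiffOn (contDiff_coord 1).contDiffOn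
    contDiff_frame_coord.contDiffOn

lemma fderiv_coord (i : Fin 3) (p w : E3) : fderiv ℝ (fun q : E3 => q i) p w = w i := by
  rw [show (fun q : E3 => q i) = EuclideanSpace.proj (𝕜 := ℝ) i from rfl,
    ContinuousLinearMap.fderiv]
  rfl

lemma diffM_frame (α : ℝ) (p : E3) : DiffM (frame α) p :=
  (smoothE_frame α Set.univ).diffM isOpen_univ (Set.mem_univ p)

/-- The choice r = xy/2 - z turns the central coefficient dr - x dy of the model into the contact
form (y dx - x dy)/2 - dz, which annihilates Z₁ and Z₂. -/
lemma dE_frame (α : ℝ) (p w : E3) : dE (frame α) p w = frame α p * nil α (coframe p w) := by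
  have h0 := (contDiff_coord 0).differentiable (by simp) p
  have h1 := (contDiff_coord 1).differentiable (by simp) p
  have h2 := (contDiff_coord 2).differentiable (by simp) p
  have hr := contDiff_frame_coord.differentiable (by simp) p
  have h := (dE_model α h0 h1 hr w).2
  have e : fderiv ℝ (fun q : E3 => q 0 * q 1 / 2 - q 2) p w =
      (p 0 * w 1 + p 1 * w 0) / 2 - w 2 := by
    have h3 : HasFDerivAt (fun q : E3 => q 0 * q 1 / 2 - q 2) _ p :=
      (((h0.hasFDerivAt.mul h1.hasFDerivAt).mul_const (2 : ℝ)⁻¹).congr_of_eventuallyEq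
        (Filter.Eventually.of_forall fun q => div_eq_mul_inv _ _)).sub h2.hasFDerivAt
    rw [h3.fderiv]
    simp only [ContinuousLinearMap.sub_apply, ContinuousLinearMap.smul_apply,
      ContinuousLinearMap.add_apply, fderiv_coord, smul_eq_mul]
    ring
  refine h.trans ?_
  rw [e, fderiv_coord, fderiv_coord, coframe_apply]
  rw [show (p 0 * w 1 + p 1 * w 0) / 2 - w 2 - p 0 * w 1 =
    (p 1 * w 0 - p 0 * w 1) / 2 - w 2 by ring]
  rfl

/-- The flags of the homogeneous model. -/
def flag (α : ℝ) (p : E3) (q : ℤ) : Submodule ℝ (Fin 8 → ℝ) :=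
  (stdFlag q).map (frame α p).mulVecLin

/-- The contact distribution of the homogeneous model. -/
def dist (p : E3) : Submodule ℝ E3 := Submodule.span ℝ {Z1 p, Z2 p}

lemma mem_dist {p w : E3} : w ∈ dist p ↔ coframe p w 2 = 0 := by
  rw [dist, Submodule.mem_span_pair]
  constructor
  · rintro ⟨s, t, rfl⟩
    simp [coframe, Z1, Z2]
    ring
  · intro h
    simp only [coframe_apply, Matrix.cons_val] at h
    refine ⟨w 0, w 1, ?_⟩
    ext i
    fin_cases i <;> simp [Z1, Z2]
    linarith

lemma fderiv_mulVec {σ : E3 → M8} {w : E3 → Fin 8 → ℝ} {p : E3} (hσ : DiffM σ p)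
    (hw : ∀ i, DifferentiableAt ℝ (fun q => w q i) p) (v : E3) (i : Fin 8) :
    fderiv ℝ (fun q => (σ q *ᵥ w q) i) p v =
      (dE σ p v *ᵥ w p + σ p *ᵥ fun j => fderiv ℝ (fun q => w q j) p v) i := by
  change fderiv ℝ (fun q => ∑ j, σ q i j * w q j) p v = _
  rw [fderiv_fun_sum fun j _ => (hσ i j).fun_mul (hw j), ContinuousLinearMap.sum_apply]
  simp only [Pi.add_apply, Matrix.mulVec, dotProduct, dE, Matrix.of_apply]
  rw [← Finset.sum_add_distrib]
  refine Finset.sum_congr rfl fun j _ => ?_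
  rw [fderiv_fun_mul (hσ i j) (hw j)]
  simp
  ring

lemma mem_stdFlag_of_eventually {w : E3 → Fin 8 → ℝ} {p : E3} {q : ℤ}
    (h : ∀ᶠ y in nhds p, w y ∈ stdFlag q) (v : E3) :
    (fun j => fderiv ℝ (fun y => w y j) p v) ∈ stdFlag q := fun i hi =>
  FrameField.fderiv_eq_zero (h.mono fun _ hy => hy i hi) v

/-- Derivatives of sections in the moving frame. -/
lemma IsSection.exists_deriv {α : ℝ} {U : Set E3} {q : ℤ} {v : E3 → Fin 8 → ℝ}
    (hv : IsSection (flag α) U q v) {x : E3} (hx : x ∈ U) : ∃ u ∈ stdFlag q,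
      v x = frame α x *ᵥ u ∧ ∀ X : E3, ∃ u' ∈ stdFlag q,
      dVec v x X = frame α x *ᵥ (nil α (coframe x X) *ᵥ u + u') := by
  obtain ⟨hU, hs, hm⟩ := hv
  have hd : ∀ i, DifferentiableAt ℝ (fun q => v q i) x := fun i =>
    ((contMDiffOn_iff_contDiffOn.mp (hs i)).contDiffAt (hU.mem_nhds hx)).differentiableAt (by simp)
  have hF : DiffM (fun y => (frame α y)⁻¹) x :=
    ((smoothE_frame α U).inv fun q _ => frame_mem_L α q).diffM hU hx
  have hw : ∀ y ∈ U, (frame α y)⁻¹ *ᵥ v y ∈ stdFlag q := fun y hy => by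
    obtain ⟨u, hu, hue⟩ := hm y hy
    rw [← hue, Matrix.mulVecLin_apply, Matrix.mulVec_mulVec, L_inv_mul (frame_mem_L α y),
      Matrix.one_mulVec]
    exact hu
  have hv : ∀ y, v y = frame α y *ᵥ ((frame α y)⁻¹ *ᵥ v y) := fun y => by
    rw [Matrix.mulVec_mulVec, L_mul_inv (frame_mem_L α y), Matrix.one_mulVec]
  have hwd : ∀ i, DifferentiableAt ℝ (fun y => ((frame α y)⁻¹ *ᵥ v y) i) x := fun i => by
    change DifferentiableAt ℝ (fun y => ∑ j, (frame α y)⁻¹ i j * v y j) x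
    exact DifferentiableAt.fun_sum fun j _ => (hF i j).mul (hd j)
  refine ⟨_, hw x hx, hv x, fun X => ⟨_, mem_stdFlag_of_eventually
    (Filter.eventually_of_mem (hU.mem_nhds hx) hw) X, ?_⟩⟩
  ext i
  have h1 : dVec v x X i = fderiv ℝ (fun y => v y i) x X := by
    simp only [dVec, mfderiv_eq_fderiv]
    rfl
  have h2 : (fun y => v y i) = fun y => (frame α y *ᵥ ((frame α y)⁻¹ *ᵥ v y)) i :=
    funext fun y => congrFun (hv y) i
  rw [h1, h2, fderiv_mulVec (diffM_frame α x) hwd, dE_frame, Matrix.mulVec_add,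
    ← Matrix.mulVec_mulVec]

lemma e_one_add_e_two_mem (s t : ℝ) : s • e 1 + t • e 2 ∈ gr (-1) :=
  add_mem ((gr (-1)).smul_mem _ (e_mem_gr 1)) ((gr (-1)).smul_mem _ (e_mem_gr 2))

/-- Degree 0 is one higher than that of e₂, so the term αR in X₂ is invisible to the symbol, which
is the same for all α. -/
lemma Rm11_mem_glFil : Rm11 ∈ glFil 0 := by
  rw [Rm11_eq]
  exact gpMat_mem_glFil (by simp) (by simp) (by simp) (by simp) (by simp) (by simp) (by simp)

lemma nil_mem_glFil_neg_two (α : ℝ) (c : Fin 3 → ℝ) : nil α c ∈ glFil (-2) := by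
  rw [nil_eq]
  refine add_mem (ad_mem_glFil (sub_mem (mFil_mono (by norm_num : (-2 : ℤ) ≤ -1)
    (gr_le_mFil (e_one_add_e_two_mem _ _))) ((mFil (-2)).smul_mem _ (gr_le_mFil (e_mem_gr 0))))) ?_
  exact (glFil (-2)).smul_mem _ (glFil_mono (by norm_num) Rm11_mem_glFil)

lemma nil_mem_glFil_neg_one (α : ℝ) {c : Fin 3 → ℝ} (h : c 2 = 0) : nil α c ∈ glFil (-1) := by
  rw [nil_eq, h, zero_smul, sub_zero]
  exact add_mem (ad_mem_glFil (gr_le_mFil (e_one_add_e_two_mem _ _)))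
    ((glFil (-1)).smul_mem _ (glFil_mono (by norm_num) Rm11_mem_glFil))

/-- The symbol in degree `-1`. -/
def symbolOne : E3 →ₗ[ℝ] gr (-1) where
  toFun w := ⟨w 0 • e 1 + w 1 • e 2, e_one_add_e_two_mem _ _⟩
  map_add' w w' := by ext1; simp; module
  map_smul' c w := by ext1; simp; module

/-- The symbol in degree `-2`. -/
def symbolTwo (p : E3) : E3 →ₗ[ℝ] gr (-2) where
  toFun w := ⟨(-(coframe p w 2)) • e 0, (gr (-2)).smul_mem _ (e_mem_gr 0)⟩
  map_add' w w' := by ext1; simp only [map_add, Pi.add_apply, Submodule.coe_add]; module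
  map_smul' c w := by
    ext1; simp only [map_smul, Pi.smul_apply, smul_eq_mul, Submodule.coe_smul, RingHom.id_apply]
    module

lemma isFrameOf_frame (α : ℝ) (p : E3) : IsFrameOf (frame α p) (flag α p) :=
  ⟨frame_mem_L α p, fun _ => rfl⟩

lemma symbolOne_bijective (x : E3) :
    Function.Bijective (symbolOne.domRestrict (dist x)) := by
  refine ⟨(injective_iff_map_eq_zero _).mpr ?_, ?_⟩
  · rintro ⟨w, hw⟩ h
    have hw' := mem_dist.mp hw
    have h1 : (w 0 • e 1 + w 1 • e 2 : M3) = 0 := congrArg Subtype.val h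
    have h2 := congrFun (congrFun h1 1) 0
    have h3 := congrFun (congrFun h1 2) 1
    simp [e, E] at h2 h3
    simp only [coframe_apply, Matrix.cons_val, h2, h3] at hw'
    ext i
    fin_cases i
    · exact h2
    · exact h3
    · simpa using hw'
  · rintro ⟨Y, hY⟩
    refine ⟨⟨!₂[Y 1 0, Y 2 1, (x 1 * Y 1 0 - x 0 * Y 2 1) / 2], mem_dist.mpr ?_⟩, ?_⟩
    · simp [coframe]
    · ext i j
      change (Y 1 0 • e 1 + Y 2 1 • e 2 : M3) i j = Y i j
      by_cases hij : ((j : ℕ) : ℤ) - ((i : ℕ) : ℤ) = -1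
      · fin_cases i <;> fin_cases j <;> simp at hij <;> simp [e, E]
      · rw [hY.2 i j hij]
        exact (e_one_add_e_two_mem _ _).2 i j hij

lemma symbolTwo_surjective (x : E3) : Function.Surjective (symbolTwo x) := by
  rintro ⟨Y, hY⟩
  refine ⟨!₂[0, 0, Y 2 0], ?_⟩
  ext i j
  change ((-(coframe x !₂[0, 0, Y 2 0] 2)) • e 0 : M3) i j = Y i j
  by_cases hij : ((j : ℕ) : ℤ) - ((i : ℕ) : ℤ) = -2
  · fin_cases i <;> fin_cases j <;> simp at hij
    simp [coframe, e, E]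
  · rw [hY.2 i j hij]
    exact ((gr (-2)).smul_mem _ (e_mem_gr 0)).2 i j hij

lemma ker_symbolTwo (x : E3) : LinearMap.ker (symbolTwo x) = dist x := by
  ext w
  rw [LinearMap.mem_ker, mem_dist]
  constructor
  · intro h
    have h1 : ((-(coframe x w 2)) • e 0 : M3) = 0 := congrArg Subtype.val h
    have h2 := congrFun (congrFun h1 2) 0
    simpa [e, E] using h2
  · intro h
    ext1
    change (-(coframe x w 2)) • e 0 = 0
    rw [h, neg_zero, zero_smul]

section

variable {α : ℝ} {U : Set E3} {q : ℤ} {v : E3 → Fin 8 → ℝ}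

lemma IsSection.dVec_mem_one (hv : IsSection (flag α) U q v) {x : E3} (hx : x ∈ U) {X : E3}
    (hX : X ∈ dist x) : dVec v x X ∈ flag α x (q - 1) := by
  obtain ⟨u, hu, -, h⟩ := hv.exists_deriv hx
  obtain ⟨u', hu', h'⟩ := h X
  rw [h']
  refine ⟨_, add_mem ?_ (stdFlag_anti (by lia) hu'), rfl⟩
  have := glFil_mulVec (nil_mem_glFil_neg_one α (mem_dist.mp hX)) hu
  rwa [neg_add_eq_sub] at this

lemma IsSection.dVec_mem_two (hv : IsSection (flag α) U q v) {x : E3} (hx : x ∈ U) (X : E3) :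
    dVec v x X ∈ flag α x (q - 2) := by
  obtain ⟨u, hu, -, h⟩ := hv.exists_deriv hx
  obtain ⟨u', hu', h'⟩ := h X
  rw [h']
  refine ⟨_, add_mem ?_ (stdFlag_anti (by lia) hu'), rfl⟩
  have := glFil_mulVec (nil_mem_glFil_neg_two α (coframe x X)) hu
  rwa [neg_add_eq_sub] at this

/-- Both symbol conditions are instances: k = 0 along the contact directions, k = -1 along all
directions. -/
lemma IsSection.dVec_sub_mem (hv : IsSection (flag α) U q v) {x : E3} (hx : x ∈ U) {X : E3}
    {S : M3} {k : ℤ} (hk : k ≤ 0) (hS : nil α (coframe x X) - ad S ∈ glFil k) :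
    dVec v x X - (frame α x * ad S * (frame α x)⁻¹) *ᵥ v x ∈ flag α x (k + q) := by
  obtain ⟨u, hu, hvx, h⟩ := hv.exists_deriv hx
  obtain ⟨u', hu', h'⟩ := h X
  refine ⟨(nil α (coframe x X) - ad S) *ᵥ u + u',
    add_mem (glFil_mulVec hS hu) (stdFlag_anti (by lia) hu'), ?_⟩
  rw [h', hvx, Matrix.mulVecLin_apply, Matrix.mulVec_mulVec, mul_assoc,
    L_inv_mul (frame_mem_L α x), mul_one, ← Matrix.mulVec_mulVec, ← Matrix.mulVec_sub,
    Matrix.sub_mulVec]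
  congr 1; abel

lemma IsSection.symbolOne (hv : IsSection (flag α) U q v) {x : E3} (hx : x ∈ U) {X : E3}
    (hX : X ∈ dist x) :
    dVec v x X - (frame α x * ad (symbolOne X).1 * (frame α x)⁻¹) *ᵥ v x ∈ flag α x q := by
  have h := hv.dVec_sub_mem hx (X := X) (S := (ContactSl3.symbolOne X).1) le_rfl ?_
  · rwa [zero_add] at h
  · rw [nil_eq, mem_dist.mp hX, zero_smul, sub_zero]
    refine (congrArg (· ∈ glFil 0) (add_sub_cancel_left _ _)).mpr ?_
    exact (glFil 0).smul_mem _ Rm11_mem_glFil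

lemma IsSection.symbolTwo (hv : IsSection (flag α) U q v) {x : E3} (hx : x ∈ U) (X : E3) :
    dVec v x X - (frame α x * ad (symbolTwo x X).1 * (frame α x)⁻¹) *ᵥ v x ∈
      flag α x (q - 1) := by
  have h := hv.dVec_sub_mem hx (X := X) (S := (ContactSl3.symbolTwo x X).1) (k := -1)
    (by norm_num) ?_
  · rwa [neg_add_eq_sub] at h
  · have hS : nil α (coframe x X) - ad (ContactSl3.symbolTwo x X).1 =
        nil α ![coframe x X 0, coframe x X 1, 0] := by
      rw [nil_eq, nil_eq]
      change _ - ad ((-(coframe x X 2)) • e 0) = _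
      simp only [ad_sub, ad_add, ad_smul, Matrix.cons_val]
      module
    rw [hS]
    exact nil_mem_glFil_neg_one α rfl

end

/-- The model is an osculating map. -/
lemma isOsculatingMap_flag (α : ℝ) : IsOsculatingMap (M := E3) dist (flag α) where
  smooth x₀ := ⟨Set.univ, frame α, isOpen_univ, Set.mem_univ _,
    fun i j => contMDiffOn_iff_contDiffOn.mpr (smoothE_frame α Set.univ i j),
    fun x _ => isFrameOf_frame α x⟩
  osculating U q v hv x hx := ⟨fun X hX => hv.dVec_mem_one hx hX, fun X => hv.dVec_mem_two hx X⟩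
  symbol x := ⟨frame α x, isFrameOf_frame α x, symbolOne.domRestrict (dist x), symbolTwo x,
    symbolOne_bijective x, symbolTwo_surjective x, ker_symbolTwo x, fun U q v hx hv =>
      ⟨fun X => hv.symbolOne hx X.2, fun X => hv.symbolTwo hx X⟩⟩


/-! ### Existence: the Cartan bundle -/

/-- The Cartan bundle of the homogeneous model. -/
def bundle (α : ℝ) : Set (E3 × M8) := {z | ∃ b ∈ GZero, z.2 = frame α z.1 * Ad b}

lemma mem_bundle {α : ℝ} {x : E3} {a : M8} :
    (x, a) ∈ bundle α ↔ ∃ b ∈ GZero, a = frame α x * Ad b := Iff.rfl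

lemma GZero_inv {b : M3} (hb : b ∈ GZero) : b⁻¹ ∈ GZero := by
  refine ⟨by rw [Matrix.det_nonsing_inv, hb.1, Ring.inverse_one], fun i j hij => ?_⟩
  exact inv_mem_mFil hb i j (by have : (j : ℕ) < i := hij; omega)

lemma mul_inv_of_GZero {b : M3} (hb : b ∈ GZero) : b * b⁻¹ = 1 :=
  Matrix.mul_nonsing_inv _ (isUnit_of_GZero hb)

lemma inv_mul_of_GZero {b : M3} (hb : b ∈ GZero) : b⁻¹ * b = 1 :=
  Matrix.nonsing_inv_mul _ (isUnit_of_GZero hb)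

lemma conj_mem_gZero {b : M3} (hb : b ∈ GZero) {Y : M3} (hY : Y ∈ gZero) :
    b⁻¹ * Y * b ∈ gZero := by
  rw [mem_gZero_iff] at hY ⊢
  have h1 := conj_mem_sl3 (isUnit_of_GZero (GZero_inv hb)) hY.1
  rw [Matrix.nonsing_inv_nonsing_inv _ (isUnit_of_GZero hb)] at h1
  refine ⟨h1, ?_⟩
  have := mFil_mul (mFil_mul (inv_mem_mFil hb) hY.2) (mem_mFil_of_GZero hb)
  rwa [add_zero, add_zero] at this

/-- The image of the form `ω` along the frame of the model. -/
def theta (α : ℝ) : M3 →ₗ[ℝ] M8 where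
  toFun Y := ad Y + (α * Y 2 1) • Rm11
  map_add' Y Y' := by rw [ad_add, Matrix.add_apply]; module
  map_smul' c Y := by
    rw [ad_smul, Matrix.smul_apply, smul_eq_mul, RingHom.id_apply]; module

lemma theta_apply (α : ℝ) (Y : M3) : theta α Y = ad Y + (α * Y 2 1) • Rm11 := rfl

lemma theta_of_gZero (α : ℝ) {Y : M3} (hY : Y ∈ gZero) : theta α Y = ad Y := by
  rw [theta_apply, hY.2 2 1 (by decide), mul_zero, zero_smul, add_zero]

lemma nil_eq_theta (α : ℝ) (c : Fin 3 → ℝ) :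
    nil α c = theta α (c 0 • e 1 + c 1 • e 2 - c 2 • e 0) := by
  rw [nil_eq, theta_apply]
  simp [e, E]

lemma theta_eq_nil_add (α : ℝ) {Y : M3} (hY : Y ∈ sl3) : ∃ Z ∈ gZero,
    theta α Y = nil α ![Y 1 0, Y 2 1, -Y 2 0] + ad Z := by
  have hZ : Y - (Y 1 0 • e 1 + Y 2 1 • e 2 - (-Y 2 0) • e 0) ∈ gZero := by
    refine ⟨sub_mem hY (nil_base_mem ![Y 1 0, Y 2 1, -Y 2 0]), fun i j hij => ?_⟩
    fin_cases i <;> fin_cases j <;> simp at hij <;> simp [e, E]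
  refine ⟨_, hZ, ?_⟩
  rw [nil_eq_theta, ← theta_of_gZero α hZ, ← map_add]
  congr 1
  simp

lemma dE_linear {c : E3 → M8} {p : E3} (h : DiffM c p) (f : M8 →ₗ[ℝ] M8) (v : E3) :
    DiffM (fun q => f (c q)) p ∧ dE (fun q => f (c q)) p v = f (dE c p v) := by
  have hf : ∀ i j, ∃ g : M8 →ₗ[ℝ] ℝ, ∀ B, g B = f B i j := fun i j =>
    ⟨Matrix.entryLinearMap ℝ ℝ i j ∘ₗ f, fun B => rfl⟩
  refine ⟨fun i j => ?_, ?_⟩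
  · obtain ⟨g, hg⟩ := hf i j
    simpa only [hg] using h.linear g
  · ext i j
    obtain ⟨g, hg⟩ := hf i j
    have := fderiv_linear h g v
    simp only [hg] at this
    exact this

/-- The logarithmic derivative of a curve in `Ad G⁰` lies in `ad 𝔤⁰`. -/
lemma inv_mul_dE_mem_gB {c : E3 → M8} {p : E3} (hc : DiffM c p)
    (h : ∀ᶠ q in nhds p, ∃ b ∈ GZero, c q = Ad b) (v : E3) : (c p)⁻¹ * dE c p v ∈ gB := by
  obtain ⟨b, hb, hcb⟩ := h.self_of_nhds
  have hbu := isUnit_of_GZero hb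
  have hL : c p ∈ L := hcb ▸ Ad_mem_L hbu
  obtain ⟨N, hN⟩ : ∃ N, N = (c p)⁻¹ * dE c p v := ⟨_, rfl⟩
  have hC : dE c p v = c p * N := by rw [hN, ← mul_assoc, L_mul_inv hL, one_mul]
  rw [← hN]
  have hNl : N ∈ lAlg := by
    have h1 : dE (fun q => (c q)ᵀ * (K * c q)) p v = 0 := by
      rw [dE_congr (τ := fun _ => K) (h.mono ?_) v, dE_const]
      rintro q ⟨b, hb, hq⟩
      have : c q ∈ L := hq ▸ Ad_mem_L (isUnit_of_GZero hb)
      rw [← mul_assoc]; exact this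
    have hct : DiffM (fun q => (c q)ᵀ) p := fun i j => hc j i
    have h2 : dE (fun q => (c q)ᵀ) p v = (dE c p v)ᵀ := rfl
    rw [dE_mul hct ((DiffM.const K p).mul hc), dE_mul (DiffM.const K p) hc, dE_const, zero_mul,
      zero_add, h2, hC, Matrix.transpose_mul] at h1
    have h3 : (c p)ᵀ * K * c p = K := hL
    change Nᵀ * K + K * N = 0
    rw [← h1]
    nth_rewrite 1 [← h3]
    nth_rewrite 2 [← h3]
    simp only [mul_assoc]
  have hNF : N ∈ glFil 0 := by
    have h1 : dE c p v ∈ glFil 0 := dE_mem hc (h.mono fun q ⟨b, hb, hq⟩ => hq ▸ Ad_mem_glFil hb) v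
    have h2 : (c p)⁻¹ ∈ glFil 0 := by
      rw [hcb, Ad_inv hbu]; exact Ad_mem_glFil (GZero_inv hb)
    have := glFil_mul h2 h1
    rwa [add_zero, ← hN] at this
  -- Differentiating Ad b ∘ ad u = ad(Ad b u) ∘ Ad b shows that N is a derivation of the Lie
  -- algebra. Only the curve c is differentiated, never a choice of b.
  have hder : ∀ u, N * ad (toM u) = ad (toM (N *ᵥ u)) + ad (toM u) * N := fun u => by
    let f : M8 →ₗ[ℝ] M8 :=
      { toFun B := ad (toM (B *ᵥ u))
        map_add' B C := by rw [Matrix.add_mulVec, toM_add, ad_add]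
        map_smul' r B := by rw [Matrix.smul_mulVec, toM_smul, ad_smul]; rfl }
    obtain ⟨hfd, hfe⟩ := dE_linear hc f v
    have h1 : ∀ {q}, (∃ b ∈ GZero, c q = Ad b) → c q * ad (toM u) = f (c q) * c q := by
      rintro q ⟨b, hb, hq⟩
      have hbu := isUnit_of_GZero hb
      change _ = ad (toM (c q *ᵥ u)) * c q
      rw [hq, toM_Ad_mulVec hbu, ← Ad_ad hbu, mul_assoc _ _ (Ad b), L_inv_mul (Ad_mem_L hbu),
        mul_one]
    have h2 := dE_congr (h.mono fun q hq => h1 hq) v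
    rw [dE_mul hc (DiffM.const _ p), dE_const, mul_zero, add_zero, dE_mul hfd hc, hfe, hC] at h2
    have h3 : f (c p * N) * c p = c p * ad (toM (N *ᵥ u)) := by
      change ad (toM ((c p * N) *ᵥ u)) * c p = _
      rw [← Matrix.mulVec_mulVec, hcb, toM_Ad_mulVec hbu, ← Ad_ad hbu, mul_assoc _ _ (Ad b),
        L_inv_mul (Ad_mem_L hbu), mul_one]
    rw [h3, ← mul_assoc, ← h1 ⟨b, hb, hcb⟩, mul_assoc, mul_assoc, ← mul_add] at h2
    have h4 := congrArg ((c p)⁻¹ * ·) h2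
    simpa only [← mul_assoc, L_inv_mul hL, one_mul] using h4
  obtain ⟨Z, hZ, hQ⟩ := exists_gPerp_add hNl
  obtain ⟨Q, hQe⟩ : ∃ Q, Q = N - ad Z := ⟨_, rfl⟩
  rw [← hQe] at hQ
  have hNQ : N = ad Z + Q := by rw [hQe]; abel
  -- Derivations are inner: for the 𝔤^⊥-part Q the derivation rule says [ad u, Q] + ad(Qu) = 0 with
  -- summands in complementary spaces, so Qu = 0 for all u.
  have hQ0 : Q = 0 := ext_mulVec fun u => by
    have h1 := hder u
    have h2 := ad_bracket Z (toM u)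
    rw [← toM_ad_mulVec] at h2
    rw [hNQ, Matrix.add_mulVec, toM_add, ad_add, h2, add_mul, mul_add] at h1
    have h3 : ad (toM u) * Q - Q * ad (toM u) + ad (toM (Q *ᵥ u)) = 0 := by
      rw [← sub_eq_zero] at h1
      rw [← neg_eq_zero, ← h1]
      abel
    have h4 := (gPerp_inter (gPerp_bracket hQ (toM u)) (toM_mem _) h3).2
    rw [Matrix.zero_mulVec]
    refine toM_injective (h4.trans ?_)
    have := toM_smul 0 0
    rwa [zero_smul, zero_smul, eq_comm] at this
  rw [hNQ, hQ0, add_zero] at hNF ⊢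
  refine ⟨Z, mem_gZero_iff.mpr ⟨hZ, mFil_of_add_mem gPerp.zero_mem hZ ?_⟩, rfl⟩
  rwa [zero_add]

lemma isLocalFrame_bundle (α : ℝ) {b : M3} (hb : b ∈ GZero) :
    IsLocalFrame (bundle α) Set.univ (fun x => frame α x * Ad b) :=
  ⟨isOpen_univ, fun i j => contMDiffOn_iff_contDiffOn.mpr
    (((smoothE_frame α Set.univ).mul (SmoothE.const (Ad b) Set.univ)) i j),
    fun _ _ => ⟨b, hb, rfl⟩⟩

lemma dMat_eq_dE (s : E3 → M8) (x X : E3) : dMat (M := E3) s x X = dE s x X := by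
  ext i j
  simp only [dMat, dE, Matrix.of_apply, mfderiv_eq_fderiv]
  rfl

lemma frame_mul_Ad_mem_L (α : ℝ) (x : E3) {b : M3} (hb : b ∈ GZero) : frame α x * Ad b ∈ L :=
  L_mul (frame_mem_L α x) (Ad_mem_L (isUnit_of_GZero hb))

lemma conjInv_mul_eq {a B C : M8} (h : B * a = a * C) (ha : a ∈ L) : conjInv a B = C := by
  change a⁻¹ * B * a = C
  rw [mul_assoc, h, ← mul_assoc, L_inv_mul ha, one_mul]

lemma theta_conj_add_mem (α : ℝ) {b : M3} (hb : b ∈ GZero) {Y : M3} (hY : Y ∈ sl3) {w : M8}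
    (hw : w ∈ gB) : ∃ Y' ∈ sl3, conjInv (Ad b) (theta α Y) + w = conjInv (Ad b) (theta α Y') := by
  obtain ⟨Z, hZ, rfl⟩ := hw
  have hbu := isUnit_of_GZero hb
  have hZ' := conj_mem_gZero (GZero_inv hb) hZ
  rw [Matrix.nonsing_inv_nonsing_inv _ hbu] at hZ'
  refine ⟨Y + b * Z * b⁻¹, add_mem hY hZ'.1, ?_⟩
  rw [map_add, map_add, theta_of_gZero α hZ', conjInv_ad hbu]
  rw [show b⁻¹ * (b * Z * b⁻¹) * b = (b⁻¹ * b) * Z * (b⁻¹ * b) by noncomm_ring,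
    inv_mul_of_GZero hb, one_mul, mul_one]
  rfl

/-- Relative to the model frame a local section is an Ad G⁰-valued map, whose logarithmic derivative
is vertical by `inv_mul_dE_mem_gB`. The image is therefore that of the constant sections together
with the vertical directions. -/
lemma mem_omegaImage_bundle {α : ℝ} {x : E3} {b : M3} (hb : b ∈ GZero) {w : M8} :
    w ∈ omegaImage (bundle α) x (frame α x * Ad b) ↔
      ∃ Y ∈ sl3, w = conjInv (Ad b) (theta α Y) := by
  have hbu := isUnit_of_GZero hb
  have hbL := Ad_mem_L hbu
  have hconst : ∀ X : E3, (frame α x * Ad b)⁻¹ * dMat (fun y => frame α y * Ad b) x X =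
      conjInv (Ad b) (nil α (coframe x X)) := fun X => by
    rw [dMat_eq_dE, dE_mul (diffM_frame α x) (DiffM.const _ x), dE_const, mul_zero, add_zero,
      dE_frame, Matrix.mul_inv_rev]
    change _ = (Ad b)⁻¹ * _ * Ad b
    rw [show (Ad b)⁻¹ * (frame α x)⁻¹ * (frame α x * nil α (coframe x X) * Ad b) =
      (Ad b)⁻¹ * ((frame α x)⁻¹ * frame α x) * nil α (coframe x X) * Ad b by noncomm_ring,
      L_inv_mul (frame_mem_L α x), mul_one]
  constructor
  · intro hw
    let O : Submodule ℝ M8 := (sl3.map (theta α)).map (conjInv (Ad b))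
    suffices omegaImage (bundle α) x (frame α x * Ad b) ≤ O by
      obtain ⟨_, ⟨Y, hY, rfl⟩, he⟩ := this hw
      exact ⟨Y, hY, he.symm⟩
    refine Submodule.span_le.mpr ?_
    rintro w (⟨U, s, X, hs, hxU, he, rfl⟩ | ⟨Y, hY, rfl⟩)
    · suffices h : ∀ X : E3, (frame α x * Ad b)⁻¹ * dMat s x X ∈ O from h X
      intro X
      have hsE : SmoothE s U := fun i j => contMDiffOn_iff_contDiffOn.mp (hs.2.1 i j)
      have hsd := hsE.diffM hs.1 hxU
      have hF := ((smoothE_frame α U).inv fun q _ => frame_mem_L α q).diffM hs.1 hxU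
      have hcd := hF.mul hsd
      have hsF : ∀ q, s q = frame α q * ((frame α q)⁻¹ * s q) := fun q => by
        rw [← mul_assoc, L_mul_inv (frame_mem_L α q), one_mul]
      have hc0 : (frame α x)⁻¹ * s x = Ad b := by
        rw [he, ← mul_assoc, L_inv_mul (frame_mem_L α x), one_mul]
      have hgB := inv_mul_dE_mem_gB hcd ?_ X
      · rw [hc0] at hgB
        have h1 : dE s x X = frame α x * nil α (coframe x X) * Ad b +
            frame α x * dE (fun q => (frame α q)⁻¹ * s q) x X := by
          rw [dE_congr (Filter.Eventually.of_forall hsF), dE_mul (diffM_frame α x) hcd, dE_frame,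
            hc0]
        have h2 : (frame α x * Ad b)⁻¹ * dE s x X = conjInv (Ad b) (nil α (coframe x X)) +
            (Ad b)⁻¹ * dE (fun q => (frame α q)⁻¹ * s q) x X := by
          rw [← hconst, dMat_eq_dE, dE_mul (diffM_frame α x) (DiffM.const _ x), dE_const, mul_zero,
            add_zero, dE_frame, h1, mul_add]
          congr 1
          rw [Matrix.mul_inv_rev, mul_assoc, ← mul_assoc (frame α x)⁻¹,
            L_inv_mul (frame_mem_L α x), one_mul]
        obtain ⟨Y', hY', h3⟩ := theta_conj_add_mem α hb (nil_base_mem (coframe x X)) hgB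
        refine ⟨_, ⟨Y', hY', rfl⟩, ?_⟩
        rw [dMat_eq_dE, h2, nil_eq_theta, h3]
      · filter_upwards [hs.1.mem_nhds hxU] with q hq
        obtain ⟨b', hb', hq'⟩ := hs.2.2 q hq
        refine ⟨b', hb', ?_⟩
        change s q = _ at hq'
        rw [hq', ← mul_assoc, L_inv_mul (frame_mem_L α q), one_mul]
    · obtain ⟨Y', hY', h⟩ := theta_conj_add_mem α hb sl3.zero_mem (w := ad Y) ⟨Y, hY, rfl⟩
      rw [map_zero, map_zero, zero_add] at h
      exact ⟨_, ⟨Y', hY', rfl⟩, h.symm⟩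
  · rintro ⟨Y, hY, rfl⟩
    obtain ⟨Z, hZ, hYZ⟩ := theta_eq_nil_add α hY
    rw [hYZ, map_add, conjInv_ad hbu]
    refine add_mem ?_ (Submodule.subset_span (Or.inr ⟨_, conj_mem_gZero hb hZ, rfl⟩))
    have h1 : ∀ c : Fin 3 → ℝ, ∃ X : E3, coframe x X = c := fun c => by
      refine ⟨!₂[c 0, c 1, (x 1 * c 0 - x 0 * c 1) / 2 - c 2], ?_⟩
      ext i; fin_cases i <;> simp [coframe]
    obtain ⟨X, hX⟩ := h1 ![Y 1 0, Y 2 1, -Y 2 0]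
    rw [← hX, ← hconst]
    exact Submodule.subset_span (Or.inl ⟨_, _, X, isLocalFrame_bundle α hb, Set.mem_univ _, rfl, rfl⟩)

/-- The structure function of the model. -/
def chi (α : ℝ) (b : M3) : gMinus →ₗ[ℝ] M8 where
  toFun X := (α * (b * X.1 * b⁻¹) 2 1) • conjInv (Ad b) Rm11
  map_add' X X' := by
    rw [Submodule.coe_add, mul_add, add_mul, Matrix.add_apply]; module
  map_smul' c X := by
    rw [Submodule.coe_smul, mul_smul_comm, smul_mul_assoc, Matrix.smul_apply, smul_eq_mul,
      RingHom.id_apply]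
    module

/-- Changing the frame by b conjugates the graph, and the entry of bYb⁻¹ that multiplies R depends
only on the strictly lower part of Y because b is upper triangular. -/
lemma conjInv_theta (α : ℝ) {b : M3} (hb : b ∈ GZero) {Y : M3} (hY : Y ∈ sl3) :
    conjInv (Ad b) (theta α (b * Y * b⁻¹)) = ad Y + chi α b (lowerPart Y) := by
  have hbu := isUnit_of_GZero hb
  have hlow : (b * Y * b⁻¹) 2 1 = (b * (lowerPart Y).1 * b⁻¹) 2 1 := by
    have h1 : Y - (lowerPart Y).1 ∈ mFil 0 := by
      intro i j hij
      have : j < i := by have : (j : ℤ) - i < 0 := hij; omega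
      simp [lowerPart, this]
    have h2 := mFil_mul (mFil_mul (mem_mFil_of_GZero hb) h1) (inv_mem_mFil hb)
    rw [add_zero, add_zero, mul_sub, sub_mul] at h2
    have := h2 2 1 (by simp)
    rwa [Matrix.sub_apply, sub_eq_zero] at this
  rw [theta_apply, map_add, map_smul, conjInv_ad hbu, hlow]
  congr 2
  rw [show b⁻¹ * (b * Y * b⁻¹) * b = (b⁻¹ * b) * Y * (b⁻¹ * b) by noncomm_ring,
    inv_mul_of_GZero hb, one_mul, mul_one]

lemma isStructureFunctionAt_bundle (α : ℝ) (x : E3) {b : M3} (hb : b ∈ GZero) :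
    IsStructureFunctionAt (bundle α) x (frame α x * Ad b) (chi α b) := by
  have hbu := isUnit_of_GZero hb
  refine ⟨fun X => gPerp.smul_mem _ ?_, fun w => ?_⟩
  · have := gPerp_conj (isUnit_det_inv hbu) Rm11_mem_gPerp
    rwa [← Ad_inv hbu, Matrix.nonsing_inv_nonsing_inv _ (det_sq_of_mem_L (Ad_mem_L hbu))] at this
  · rw [mem_omegaImage_bundle hb]
    constructor
    · rintro ⟨Y, hY, rfl⟩
      have hY' := conj_mem_sl3 (isUnit_det_inv hbu) hY
      rw [Matrix.nonsing_inv_nonsing_inv _ hbu] at hY'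
      refine ⟨_, hY', ?_⟩
      rw [← conjInv_theta α hb hY', show b * (b⁻¹ * Y * b) * b⁻¹ = (b * b⁻¹) * Y * (b * b⁻¹) by
        noncomm_ring, mul_inv_of_GZero hb, one_mul, mul_one]
    · rintro ⟨Y, hY, rfl⟩
      exact ⟨_, conj_mem_sl3 hbu hY, (conjInv_theta α hb hY).symm⟩

lemma bracket_eCheck_two_Rm11 : ad (eCheck 2) * Rm11 - Rm11 * ad (eCheck 2) = 0 := by
  have h : ∀ v, ad (eCheck 2) *ᵥ v = ![-v 1, 0, v 3 - 2 * v 4, 0, v 5, 0, v 7, 0] := fun v => by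
    rw [ad_eCheck_two]
    ext i; rw [mulVec_eight]; fin_cases i <;> simp [adMat]
    ring
  rw [sub_eq_zero]
  refine ext_mulVec fun v => ?_
  simp only [← Matrix.mulVec_mulVec, h, Rm11_mulVec]
  ext i; fin_cases i <;> simp

/-- Equivariance of ∂* under G⁰ reduces coclosedness to the frame b = 1, where it says that ě₂
commutes with R_{-1,1}. The degree condition holds because R has degree 0 and Ad b preserves the
filtration. -/
lemma isNormal_chi (α : ℝ) {b : M3} (hb : b ∈ GZero) : IsNormal (chi α b) := by
  have hbu := isUnit_of_GZero hb
  have hbL := Ad_mem_L hbu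
  have hF : conjInv (Ad b) Rm11 ∈ glFil 0 := by
    have := glFil_mul (glFil_mul (Ad_mem_glFil (GZero_inv hb)) Rm11_mem_glFil) (Ad_mem_glFil hb)
    rwa [add_zero, add_zero, ← Ad_inv hbu] at this
  refine ⟨fun p hp X _ => (glFil (p + 1)).smul_mem _ (glFil_mono (by omega) hF), ?_⟩
  -- The ěᵢ are dual to the eᵢ for the trace form, so the linear form X ↦ (bXb⁻¹)₂₁ (written with
  -- entry `2 1`) on 𝔤₋ is represented by b⁻¹ě₂b.
  have hsum : ∑ i, (b * (lowerPart (e i)).1 * b⁻¹) 2 1 • eCheck i = b⁻¹ * eCheck 2 * b := by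
    have hb0 : b 2 0 = 0 := hb.2 2 0 (by decide)
    have hb1 : b 2 1 = 0 := hb.2 2 1 (by decide)
    have hi : b⁻¹ 2 1 = 0 := (GZero_inv hb).2 2 1 (by decide)
    ext i j
    fin_cases i <;> fin_cases j <;>
      simp [Fin.sum_univ_three, Matrix.mul_apply, e, eCheck, E, lowerPart, hb0, hb1, hi, Matrix.single_apply] <;> ring
  have h1 : ∀ i, ⁅ad (eCheck i), chi α b (lowerPart (e i))⁆ =
      ad ((b * (lowerPart (e i)).1 * b⁻¹) 2 1 • eCheck i) * (α • conjInv (Ad b) Rm11) -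
      (α • conjInv (Ad b) Rm11) * ad ((b * (lowerPart (e i)).1 * b⁻¹) 2 1 • eCheck i) := fun i => by
    change _ * ((α * (b * (lowerPart (e i)).1 * b⁻¹) 2 1) • conjInv (Ad b) Rm11) -
      ((α * (b * (lowerPart (e i)).1 * b⁻¹) 2 1) • conjInv (Ad b) Rm11) * _ = _
    simp only [ad_smul, smul_mul_assoc, mul_smul_comm, smul_smul, mul_comm α]
  rw [codiff, Finset.sum_congr rfl fun i _ => h1 i, Finset.sum_sub_distrib, ← Finset.sum_mul,
    ← Finset.mul_sum]
  have h2 : ∑ i, ad ((b * (lowerPart (e i)).1 * b⁻¹) 2 1 • eCheck i) =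
      conjInv (Ad b) (ad (eCheck 2)) := by
    rw [conjInv_ad hbu, ← hsum]
    exact (map_sum adₗ _ _).symm
  rw [h2, mul_smul_comm, smul_mul_assoc, ← smul_sub]
  have h3 : ∀ B C : M8, conjInv (Ad b) B * conjInv (Ad b) C = conjInv (Ad b) (B * C) := fun B C => by
    change (Ad b)⁻¹ * B * Ad b * ((Ad b)⁻¹ * C * Ad b) = (Ad b)⁻¹ * (B * C) * Ad b
    rw [show (Ad b)⁻¹ * B * Ad b * ((Ad b)⁻¹ * C * Ad b) =
      (Ad b)⁻¹ * B * (Ad b * (Ad b)⁻¹) * C * Ad b by noncomm_ring, L_mul_inv hbL, mul_one]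
    simp only [mul_assoc]
  rw [h3, h3, ← map_sub, bracket_eCheck_two_Rm11, map_zero, smul_zero]

lemma isCartanBundle_bundle (α : ℝ) : IsCartanBundle (flag α) (bundle α) where
  frame := by
    intro x a h
    obtain ⟨b, hb, rfl⟩ := mem_bundle.mp h
    refine ⟨frame_mul_Ad_mem_L α x hb, fun q => ?_⟩
    rw [Matrix.mulVecLin_mul, Submodule.map_comp,
      map_stdFlag (Ad_mem_L (isUnit_of_GZero hb)) (Ad_mem_glFil hb)]
    rfl
  nonempty_fibre x := ⟨frame α x * Ad 1, 1, one_mem_GZero, rfl⟩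
  torsor := by
    intro x a h a'
    obtain ⟨b, hb, rfl⟩ := mem_bundle.mp h
    constructor
    · rintro ⟨b', hb', h'⟩
      refine ⟨b⁻¹ * b', GZero_mul (GZero_inv hb) hb', ?_⟩
      change a' = _ at h'
      rw [h', mul_assoc, ← Ad_mul (isUnit_of_GZero (GZero_mul (GZero_inv hb) hb')), ← mul_assoc,
        mul_inv_of_GZero hb, one_mul]
    · rintro ⟨b', hb', rfl⟩
      exact ⟨b * b', GZero_mul hb hb', by rw [Ad_mul (isUnit_of_GZero hb'), mul_assoc]⟩
  local_section := by
    rintro x a ⟨b, hb, h⟩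
    exact ⟨_, _, isLocalFrame_bundle α hb, Set.mem_univ _, h.symm⟩
  normal := by
    intro x a h
    obtain ⟨b, hb, rfl⟩ := mem_bundle.mp h
    exact ⟨_, isStructureFunctionAt_bundle α x hb, isNormal_chi α hb⟩

/-- The generator of the grading that is preserved by the model. -/
def torus : M8 := ad ((5 : ℝ) • H1 + (4 : ℝ) • H2)

lemma torus_mulVec (v : Fin 8 → ℝ) :
    torus *ᵥ v = ![9 * v 0, 6 * v 1, 3 * v 2, 0, 0, -3 * v 5, -6 * v 6, -9 * v 7] := by
  rw [torus, torus_eq, upper, ad_toM, adMat_torus]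
  ext i
  rw [Matrix.mulVec_diagonal]
  fin_cases i <;> simp

/-- The torus has weights -6, -3, -9 on X₁, X₂, X₃, so it crosses each exponential at the cost of a
multiple of its generator. The weight of αR equals that of e₂, hence this works for all α. -/
lemma torus_mul_frame (α : ℝ) (p : E3) : ∃ c, torus * frame α p = frame α p * (nil α c + torus) := by
  have h1 : ∀ x, torus * G1 x = G1 x * (torus - (6 * x) • X1) := fun x => by
    refine ext_mulVec fun v => ?_
    simp only [← Matrix.mulVec_mulVec, Matrix.sub_mulVec, Matrix.smul_mulVec, G1_mulVec, X1_mulVec,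
      torus_mulVec]
    ext i; fin_cases i <;> simp
    all_goals ring1
  have h2 : ∀ y, torus * G2 α y = G2 α y * (torus - (3 * y) • X2 α) := fun y => by
    refine ext_mulVec fun v => ?_
    simp only [← Matrix.mulVec_mulVec, Matrix.sub_mulVec, Matrix.smul_mulVec, G2_mulVec, X2_mulVec,
      torus_mulVec]
    ext i; fin_cases i <;> simp
    all_goals ring1
  have h3 : ∀ r, torus * G3 r = G3 r * (torus - (9 * r) • X3) := fun r => by
    refine ext_mulVec fun v => ?_
    simp only [← Matrix.mulVec_mulVec, Matrix.sub_mulVec, Matrix.smul_mulVec, G3_mulVec, X3_mulVec,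
      torus_mulVec]
    ext i; fin_cases i <;> simp
    all_goals ring1
  -- The central entry collects -9r from the factor G3 and 3xy from carrying -3y X₂ across G1.
  refine ⟨![-6 * p 0, -3 * p 1, 3 * p 0 * p 1 - 9 * (p 0 * p 1 / 2 - p 2)], ?_⟩
  obtain ⟨x, hx⟩ : ∃ x, x = p 0 := ⟨_, rfl⟩
  obtain ⟨y, hy⟩ : ∃ y, y = p 1 := ⟨_, rfl⟩
  obtain ⟨r, hr⟩ : ∃ r, r = p 0 * p 1 / 2 - p 2 := ⟨_, rfl⟩
  rw [frame, ← hr, ← hx, ← hy, model, ← mul_assoc, ← mul_assoc, h3, mul_assoc (G3 r), sub_mul, h2,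
    smul_mul_assoc, X3_mul_G2, ← mul_smul_comm, ← mul_sub, ← mul_assoc, mul_assoc _ _ (G1 x),
    sub_mul, sub_mul, h1, smul_mul_assoc, smul_mul_assoc, X2_mul_G1, X3_mul_G1]
  simp only [← mul_smul_comm, ← mul_sub, ← mul_assoc]
  congr 1
  simp only [nil, Matrix.cons_val]
  module

lemma nil_mem_lAlg (α : ℝ) (c : Fin 3 → ℝ) : nil α c ∈ lAlg := by
  rw [nil_eq]
  exact add_mem (ad_mem_lAlg _) (lAlg.smul_mem _ Rm11_mem_gPerp.1)

lemma conjInv_frame_nil (α : ℝ) (x : E3) (c : Fin 3 → ℝ) :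
    conjInv (frame α x) (nil α c) = nil α ![c 0, c 1, c 2 + c 0 * x 1 - c 1 * x 0] :=
  conjInv_mul_eq (nil_mul_model _ _ _ _ _) (frame_mem_L α x)

lemma nil_mem_symAlg (α : ℝ) (c : Fin 3 → ℝ) : nil α c ∈ symAlg (bundle α) := by
  refine ⟨nil_mem_lAlg α c, ?_⟩
  intro x a h
  obtain ⟨b, hb, rfl⟩ := mem_bundle.mp h
  rw [mem_omegaImage_bundle hb]
  refine ⟨_, nil_base_mem ![c 0, c 1, c 2 + c 0 * x 1 - c 1 * x 0], ?_⟩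
  rw [← nil_eq_theta, ← conjInv_frame_nil, ← conjInv_mul]
  rfl

lemma torus_mem_symAlg (α : ℝ) : torus ∈ symAlg (bundle α) := by
  refine ⟨ad_mem_lAlg _, ?_⟩
  intro x a h
  obtain ⟨b, hb, rfl⟩ := mem_bundle.mp h
  rw [mem_omegaImage_bundle hb]
  obtain ⟨c, hc⟩ := torus_mul_frame α x
  have hT : (5 : ℝ) • H1 + (4 : ℝ) • H2 ∈ gZero := by
    rw [torus_eq]; exact upper_mem _ _ _ _ _
  refine ⟨_, add_mem (nil_base_mem c) hT.1, ?_⟩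
  rw [map_add, ← nil_eq_theta, theta_of_gZero α hT]
  change _ = conjInv _ (nil α c + torus)
  rw [← conjInv_mul_eq hc (frame_mem_L α x), ← conjInv_mul]
  rfl

lemma isTransitive_bundle (α : ℝ) : IsTransitive (bundle α) := by
  rintro x a h w hw
  obtain ⟨b, hb, rfl⟩ := mem_bundle.mp h
  obtain ⟨Y, hY, rfl⟩ := (mem_omegaImage_bundle hb).mp hw
  obtain ⟨Z, hZ, hYZ⟩ := theta_eq_nil_add α hY
  -- The third coefficient is shifted in advance so that conjugation by the model frame, through
  -- `conjInv_frame_nil`, returns the prescribed element at x.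
  refine ⟨conjInv (Ad b) (nil α ![Y 1 0, Y 2 1, -Y 2 0]), ⟨_, nil_mem_symAlg α
    ![Y 1 0, Y 2 1, -Y 2 0 - Y 1 0 * x 1 + Y 2 1 * x 0], ?_⟩, _, conj_mem_gZero hb hZ, ?_⟩
  · rw [conjInv_mul, conjInv_frame_nil]
    simp only [Matrix.cons_val]
    rw [show -Y 2 0 - Y 1 0 * x 1 + Y 2 1 * x 0 + Y 1 0 * x 1 - Y 2 1 * x 0 = -Y 2 0 by ring]
  · rw [hYZ, map_add, conjInv_ad (isUnit_of_GZero hb)]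

/-- Applied to E₁₃, the torus and the three Heisenberg generators can be told apart by the first
four coordinates of the result. -/
lemma four_le_finrank (α : ℝ) : 4 ≤ Module.finrank ℝ (symAlg (bundle α)) := by
  let f : (Fin 3 → ℝ) × ℝ →ₗ[ℝ] symAlg (bundle α) :=
    { toFun z := ⟨nil α z.1 + z.2 • torus, add_mem (nil_mem_symAlg α z.1)
        ((symAlg (bundle α)).smul_mem _ (torus_mem_symAlg α))⟩
      map_add' z z' := by
        ext1
        simp only [nil, Prod.fst_add, Prod.snd_add, Pi.add_apply, Submodule.coe_add]
        module
      map_smul' r z := by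
        ext1
        simp only [nil, Prod.smul_fst, Prod.smul_snd, Pi.smul_apply, Submodule.coe_smul,
          smul_eq_mul, RingHom.id_apply]
        module }
  have hf : Function.Injective f := (injective_iff_map_eq_zero f).mpr fun z hz => by
    have h1 : nil α z.1 + z.2 • torus = 0 := congrArg Subtype.val hz
    have h2 : ∀ i, (nil α z.1 *ᵥ Pi.single 0 1 + z.2 • torus *ᵥ Pi.single 0 1) i = 0 := fun i => by
      rw [← Matrix.smul_mulVec, ← Matrix.add_mulVec, h1, Matrix.zero_mulVec]; rfl
    simp only [nil_mulVec, torus_mulVec, Pi.add_apply, Pi.smul_apply, smul_eq_mul] at h2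
    have k0 := h2 0
    have k1 := h2 1
    have k2 := h2 2
    have k3 := h2 3
    simp at k0 k1 k2 k3
    refine Prod.ext (funext fun i => ?_) k0
    fin_cases i <;> assumption
  have := LinearMap.finrank_le_finrank_of_injective hf
  simpa using this

lemma not_isFlat_bundle {α : ℝ} (hα : α ≠ 0) : ¬ IsFlat (bundle α) := fun h => by
  have h1 := h 0 (frame α 0 * Ad 1) ⟨1, one_mem_GZero, rfl⟩
  have h2 : theta α (e 2) ∈ omegaImage (bundle α) 0 (frame α 0 * Ad 1) := by
    rw [mem_omegaImage_bundle one_mem_GZero, Ad_one]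
    exact ⟨_, e_mem_sl3 2, by rw [conjInv_one]; rfl⟩
  obtain ⟨Y, hY, he⟩ := (h1.2 _).mp h2
  rw [theta_apply, LinearMap.zero_apply] at he
  have h3 := (graph_unique (gPerp.smul_mem _ Rm11_mem_gPerp) gPerp.zero_mem (e_mem_sl3 2) hY he).2
  have h4 := congrFun (congrArg (fun B : M8 => B *ᵥ Pi.single 1 1) h3) 2
  simp only [Matrix.smul_mulVec, Rm11_mulVec] at h4
  simp [e, E] at h4
  exact hα h4

lemma isSubmaximal_bundle {α : ℝ} (hα : α ≠ 0) :
    IsSubmaximal (M := E3) dist (flag α) (bundle α) where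
  osculating := isOsculatingMap_flag α
  cartan := isCartanBundle_bundle α
  transitive := isTransitive_bundle α
  not_flat := not_isFlat_bundle hα
  four_le := four_le_finrank α

/-- The upper bound comes from the classification itself: the algebra is conjugate to one spanned by
four elements. -/
lemma finrank_symAlg_bundle {α : ℝ} (hα : α ≠ 0) :
    Module.finrank ℝ (symAlg (bundle α)) = 4 := by
  have h := isSubmaximal_bundle hα
  obtain ⟨g, hg, hgR⟩ := h.exists_cayleyR
  have h1 := finrank_symAlg_le (bundle α) hg
  rw [hgR] at h1
  exact le_antisymm (h1.trans finrank_cayleyR_le) h.four_le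


/-! ### The system of differential equations -/

/-- The smooth functions on `ℝ³`. -/
def smoothFun : Submodule ℝ (E3 → ℝ) where
  carrier := {f | ContDiff ℝ ∞ f}
  add_mem' {f g} hf hg := by
    have hf : ContDiff ℝ ∞ f := hf
    have hg : ContDiff ℝ ∞ g := hg
    exact hf.add hg
  zero_mem' := by
    change ContDiff ℝ ∞ fun _ : E3 => (0 : ℝ)
    exact contDiff_const
  smul_mem' c f hf := by
    have hf : ContDiff ℝ ∞ f := hf
    exact hf.const_smul c

lemma contDiff_of_smoothFun (u : smoothFun) : ContDiff ℝ ∞ u.1 := u.2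

lemma differentiable_of_smoothFun (u : smoothFun) : Differentiable ℝ u.1 :=
  (contDiff_of_smoothFun u).differentiable (by simp)

lemma contDiff_along {Z : E3 → E3} (hZ : ContDiff ℝ ∞ Z) {u : E3 → ℝ} (hu : ContDiff ℝ ∞ u) :
    ContDiff ℝ ∞ (along Z u) :=
  (hu.fderiv_right (m := ∞) (by simp)).clm_apply hZ

/-- The derivation of the algebra of smooth functions given by a vector field. -/
def derivation (Z : E3 → E3) (hZ : ContDiff ℝ ∞ Z) : smoothFun →ₗ[ℝ] smoothFun where
  toFun u := ⟨along Z u.1, contDiff_along hZ u.2⟩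
  map_add' u v := by
    ext p
    exact congrArg (· (Z p)) (fderiv_add (differentiable_of_smoothFun u p)
      (differentiable_of_smoothFun v p))
  map_smul' c u := by
    ext p
    exact congrArg (· (Z p)) (fderiv_const_smul (differentiable_of_smoothFun u p) c)

lemma derivation_apply {Z : E3 → E3} (hZ : ContDiff ℝ ∞ Z) (u : smoothFun) (p : E3) :
    (derivation Z hZ u).1 p = fderiv ℝ u.1 p (Z p) := rfl

/-- The second derivatives of u cancel by symmetry, leaving the derivative along the Lie bracket of
the fields. -/
lemma derivation_comp_sub {Y Z W : E3 → E3} (hY : ContDiff ℝ ∞ Y) (hZ : ContDiff ℝ ∞ Z)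
    (hW : ContDiff ℝ ∞ W) (h : ∀ p, fderiv ℝ Z p (Y p) - fderiv ℝ Y p (Z p) = W p)
    (u : smoothFun) : derivation Y hY (derivation Z hZ u) - derivation Z hZ (derivation Y hY u) =
      derivation W hW u := by
  obtain ⟨u, hu⟩ := u
  have hu : ContDiff ℝ ∞ u := hu
  have key : ∀ {Y Z : E3 → E3}, ContDiff ℝ ∞ Z → ∀ p, fderiv ℝ (along Z u) p (Y p) =
      fderiv ℝ (fderiv ℝ u) p (Y p) (Z p) + fderiv ℝ u p (fderiv ℝ Z p (Y p)) := by
    intro Y Z hZ p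
    have h1 : HasFDerivAt (along Z u) _ p :=
      ((hu.fderiv_right (m := ∞) (by simp)).differentiable (by simp) p).hasFDerivAt.clm_apply
        (hZ.differentiable (by simp) p).hasFDerivAt
    rw [h1.fderiv]
    simp [add_comm]
  ext p
  change fderiv ℝ (along Z u) p (Y p) - fderiv ℝ (along Y u) p (Z p) = fderiv ℝ u p (W p)
  have hsym := (hu.contDiffAt (x := p)).isSymmSndFDerivAt (by simp [minSmoothness, ENat.LEInfty.out]) (Y p) (Z p)
  rw [key hZ, key hY, hsym, ← h p, map_sub]
  ring

/-- The vector field `-∂/∂z`. -/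
def Z3 (_ : E3) : E3 := !₂[0, 0, -1]

lemma contDiff_Z1 : ContDiff ℝ ∞ Z1 := by
  refine contDiff_euclidean.mpr fun i => ?_
  fin_cases i <;> simp [Z1] <;> fun_prop

lemma contDiff_Z2 : ContDiff ℝ ∞ Z2 := by
  refine contDiff_euclidean.mpr fun i => ?_
  fin_cases i <;> simp [Z2] <;> fun_prop

lemma contDiff_Z3 : ContDiff ℝ ∞ Z3 := contDiff_const

lemma fderiv_field_apply {Z : E3 → E3} (hZ : ContDiff ℝ ∞ Z) (p v : E3) (i : Fin 3) :
    fderiv ℝ Z p v i = fderiv ℝ (fun q => Z q i) p v := by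
  have h := (EuclideanSpace.proj (𝕜 := ℝ) i).hasFDerivAt.comp p
    (hZ.differentiable (by simp) p).hasFDerivAt
  have h' : HasFDerivAt (fun q => Z q i) _ p := h
  rw [h'.fderiv]
  rfl

lemma fderiv_Z1 (p v : E3) : fderiv ℝ Z1 p v = !₂[0, 0, v 1 / 2] := by
  ext i
  rw [fderiv_field_apply contDiff_Z1]
  have h1 := (contDiff_coord 1).differentiable (by simp) p
  fin_cases i
  · simp [Z1]
  · simp [Z1]
  · have : (fun q => Z1 q 2) = fun q => (1 / 2 : ℝ) * q 1 := by ext q; simp [Z1]; ring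
    simp only [Fin.reduceFinMk, this]
    rw [fderiv_const_mul h1]
    simp [fderiv_coord]
    ring

lemma fderiv_Z2 (p v : E3) : fderiv ℝ Z2 p v = !₂[0, 0, -(v 0 / 2)] := by
  ext i
  rw [fderiv_field_apply contDiff_Z2]
  have h1 := (contDiff_coord 0).differentiable (by simp) p
  fin_cases i
  · simp [Z2]
  · simp [Z2]
  · have : (fun q => Z2 q 2) = fun q => (-1 / 2 : ℝ) * q 0 := by ext q; simp [Z2]; ring
    simp only [Fin.reduceFinMk, this]
    rw [fderiv_const_mul h1]
    simp [fderiv_coord]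
    ring

lemma fderiv_Z3 (p v : E3) : fderiv ℝ Z3 p v = 0 := by
  rw [show Z3 = fun _ => !₂[0, 0, -1] from rfl]
  simp

/-- `Z₁`, as a derivation. -/
abbrev D1 := derivation Z1 contDiff_Z1
/-- `Z₂`, as a derivation. -/
abbrev D2 := derivation Z2 contDiff_Z2
/-- `[Z₁, Z₂]`, as a derivation. -/
abbrev D3 := derivation Z3 contDiff_Z3

lemma D1_D2 (u : smoothFun) : D1 (D2 u) = D2 (D1 u) + D3 u := by
  rw [← sub_eq_iff_eq_add']
  refine derivation_comp_sub _ _ _ (fun p => ?_) u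
  rw [fderiv_Z2, fderiv_Z1]
  ext i; fin_cases i <;> simp [Z1, Z2, Z3]
  norm_num

lemma D1_D3 (u : smoothFun) : D1 (D3 u) = D3 (D1 u) := by
  have h0 : ContDiff ℝ ∞ (fun _ : E3 => (0 : E3)) := contDiff_const
  rw [← sub_eq_zero, derivation_comp_sub _ _ h0 (fun p => ?_) u]
  · ext p; simp [derivation_apply]
  · rw [fderiv_Z3, fderiv_Z1]
    ext i; fin_cases i <;> simp [Z3]

lemma D2_D3 (u : smoothFun) : D2 (D3 u) = D3 (D2 u) := by
  have h0 : ContDiff ℝ ∞ (fun _ : E3 => (0 : E3)) := contDiff_const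
  rw [← sub_eq_zero, derivation_comp_sub _ _ h0 (fun p => ?_) u]
  · ext p; simp [derivation_apply]
  · rw [fderiv_Z3, fderiv_Z2]
    ext i; fin_cases i <;> simp [Z3]

/-- The derivatives of a solution, in the order of the basis of `V`. -/
def jet (u : smoothFun) : Fin 8 → smoothFun :=
  ![u, -D2 u, D1 u, D1 (D2 u), -D2 (D1 u), D3 (D2 u), D3 (D1 u), D3 (D2 (D1 u))]

/-- The linear combinations of the derivatives of a solution. -/
def jetMap (u : smoothFun) (v : Fin 8 → ℝ) : smoothFun := ∑ i, v i • jet u i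

lemma jetMap_eq (u : smoothFun) (v : Fin 8 → ℝ) : jetMap u v =
    v 0 • u + v 1 • -D2 u + v 2 • D1 u + v 3 • D1 (D2 u) + v 4 • -D2 (D1 u) + v 5 • D3 (D2 u) +
      v 6 • D3 (D1 u) + v 7 • D3 (D2 (D1 u)) := by
  rw [jetMap, Fin.sum_univ_eight]
  rfl

lemma jetMap_apply (u : smoothFun) (v : Fin 8 → ℝ) (p : E3) :
    (jetMap u v).1 p = ∑ i, v i * (jet u i).1 p := by
  simp [jetMap, Finset.sum_apply]

/-! ### Prolongation of the system to a closed linear system -/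

section

variable {u : smoothFun} {α : ℝ}

/-- The consequences of the system for the derivatives of higher order. -/
lemma prolongation (h1 : D1 (D1 u) = 0) (h2 : D2 (D2 u) = (6 * α) • D1 u) :
    D1 (D1 (D2 u)) = (2 : ℝ) • D3 (D1 u) ∧ D1 (D2 (D1 u)) = D3 (D1 u) ∧
    D2 (D1 (D2 u)) = -D3 (D2 u) ∧ D2 (D2 (D1 u)) = (-2 : ℝ) • D3 (D2 u) ∧
    D3 (D1 (D2 u)) = -D3 (D2 (D1 u)) ∧ D3 (D3 (D1 u)) = 0 ∧ D3 (D3 (D2 u)) = 0 := by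
  have a1 : D1 (D2 (D1 u)) = D3 (D1 u) := by rw [D1_D2, h1, map_zero, zero_add]
  have a2 : D1 (D1 (D2 u)) = (2 : ℝ) • D3 (D1 u) := by
    rw [D1_D2 u, map_add, a1, D1_D3]; module
  have a3 : D2 (D1 (D2 u)) = -D3 (D2 u) := by
    have := D1_D2 (D2 u)
    rw [h2, map_smul, h1, smul_zero] at this
    exact eq_neg_of_add_eq_zero_left this.symm
  have a4 : D2 (D2 (D1 u)) = (-2 : ℝ) • D3 (D2 u) := by
    have := congrArg D2 (D1_D2 u)
    rw [a3, map_add, D2_D3] at this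
    have h := eq_sub_of_add_eq this.symm
    rw [h]; module
  -- Compatibility: D₁D₂D₁D₂u is computed once from the value of D₂D₁D₂u and once by commuting D₁
  -- with D₂.
  have a5 : D3 (D1 (D2 u)) = -D3 (D2 (D1 u)) := by
    have := D1_D2 (D1 (D2 u))
    rw [a3, map_neg, D1_D3, a2, map_smul, D2_D3] at this
    have h : (2 : ℝ) • D3 (D1 (D2 u)) = (2 : ℝ) • -D3 (D2 (D1 u)) := by
      linear_combination (norm := module) (-1 : ℝ) • this
    exact smul_right_injective _ (two_ne_zero) h
  -- Differentiating the previous relation by D₁ gives 2 D₃²D₁u = -D₃²D₁u. Applying D₂ treats D₃²D₂u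
  -- in the same way.
  have a6 : D3 (D3 (D1 u)) = 0 := by
    have h := congrArg D1 a5
    rw [D1_D3, a2, map_neg, D1_D3, a1, map_smul] at h
    have h' : (3 : ℝ) • D3 (D3 (D1 u)) = 0 := by linear_combination (norm := module) (1 : ℝ) • h
    exact (smul_eq_zero.mp h').resolve_left (by norm_num)
  have a7 : D3 (D3 (D2 u)) = 0 := by
    have h := congrArg D2 a5
    rw [D2_D3, a3, map_neg, map_neg, D2_D3, a4, map_smul] at h
    have h' : (3 : ℝ) • D3 (D3 (D2 u)) = 0 := by linear_combination (norm := module) (-1 : ℝ) • h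
    exact (smul_eq_zero.mp h').resolve_left (by norm_num)
  exact ⟨a2, a1, a3, a4, a5, a6, a7⟩

/-- The eight chosen derivatives are closed under D₁, D₂, D₃ by the prolongation, with signs and
order arranged so that the coefficient matrices are those of the Heisenberg algebra. -/
lemma jetMap_X (h1 : D1 (D1 u) = 0) (h2 : D2 (D2 u) = (6 * α) • D1 u) (v : Fin 8 → ℝ) :
    D1 (jetMap u v) = jetMap u (X1 *ᵥ v) ∧ D2 (jetMap u v) = jetMap u (X2 α *ᵥ v) ∧
    D3 (jetMap u v) = jetMap u (X3 *ᵥ v) := by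
  obtain ⟨a2, a1, a3, a4, a5, a6, a7⟩ := prolongation h1 h2
  have b1 : D3 u = D1 (D2 u) - D2 (D1 u) := by rw [D1_D2]; abel
  have b2 : D3 (D3 (D2 (D1 u))) = 0 := by
    rw [← D2_D3, ← D2_D3, a6, map_zero]
  refine ⟨?_, ?_, ?_⟩
  · rw [X1_mulVec, jetMap_eq, jetMap_eq]
    simp only [map_add, map_smul, map_neg, D1_D3, a1, a2, a5, a6, h1, map_zero, Matrix.cons_val]
    module
  · rw [X2_mulVec, jetMap_eq, jetMap_eq]
    simp only [map_add, map_smul, map_neg, D2_D3, a3, a4, h2, a7, map_zero, Matrix.cons_val]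
    module
  · rw [X3_mulVec, jetMap_eq, jetMap_eq]
    simp only [map_add, map_smul, map_neg, a5, a6, a7, b1, b2, Matrix.cons_val]
    module

lemma tangent_eq (p w : E3) : w = coframe p w 0 • Z1 p + coframe p w 1 • Z2 p +
    coframe p w 2 • Z3 p := by
  ext i; fin_cases i <;> simp [coframe, Z1, Z2, Z3]
  ring

lemma jetMap_add (u : smoothFun) (v w : Fin 8 → ℝ) :
    jetMap u (v + w) = jetMap u v + jetMap u w := by
  simp only [jetMap, Pi.add_apply, add_smul, Finset.sum_add_distrib]

lemma jetMap_smul (u : smoothFun) (c : ℝ) (v : Fin 8 → ℝ) :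
    jetMap u (c • v) = c • jetMap u v := by
  simp only [jetMap, Pi.smul_apply, smul_eq_mul, mul_smul, Finset.smul_sum]

lemma fderiv_jetMap (h1 : D1 (D1 u) = 0) (h2 : D2 (D2 u) = (6 * α) • D1 u) (v : Fin 8 → ℝ)
    (p w : E3) : fderiv ℝ (jetMap u v).1 p w = (jetMap u (nil α (coframe p w) *ᵥ v)).1 p := by
  obtain ⟨k1, k2, k3⟩ := jetMap_X h1 h2 v
  conv_lhs => rw [tangent_eq p w]
  simp only [map_add, map_smul, ← derivation_apply contDiff_Z1, ← derivation_apply contDiff_Z2,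
    ← derivation_apply contDiff_Z3]
  rw [k1, k2, k3]
  simp only [nil, Matrix.add_mulVec, Matrix.smul_mulVec, jetMap_add, jetMap_smul]
  rfl

lemma dE_inv_frame (α : ℝ) (p w : E3) : DiffM (fun q => (frame α q)⁻¹) p ∧
    dE (fun q => (frame α q)⁻¹) p w = -(nil α (coframe p w) * (frame α p)⁻¹) := by
  have hF := ((smoothE_frame α Set.univ).inv fun q _ => frame_mem_L α q).diffM isOpen_univ
    (Set.mem_univ p)
  refine ⟨hF, ?_⟩
  have h := dE_mul hF (diffM_frame α p) w
  simp only [L_inv_mul (frame_mem_L α _)] at h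
  rw [dE_const, dE_frame, ← mul_assoc, L_inv_mul (frame_mem_L α p), one_mul] at h
  have h2 := congrArg (· * (frame α p)⁻¹) (eq_neg_of_add_eq_zero_left h.symm)
  simpa only [mul_assoc, L_mul_inv (frame_mem_L α p), mul_one, neg_mul] using h2

/-- The derivatives of a solution are constant in the moving frame. -/
lemma jetMap_inv_frame_eq (h1 : D1 (D1 u) = 0) (h2 : D2 (D2 u) = (6 * α) • D1 u)
    (v : Fin 8 → ℝ) (p q : E3) :
    (jetMap u ((frame α p)⁻¹ *ᵥ v)).1 p = (jetMap u ((frame α q)⁻¹ *ᵥ v)).1 q := by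
  have hj : ∀ i, Differentiable ℝ (jet u i).1 := fun i =>
    differentiable_of_smoothFun (jet u i)
  have hg : ∀ i, Differentiable ℝ (fun p => ((frame α p)⁻¹ *ᵥ v) i) := fun i p => by
    change DifferentiableAt ℝ (fun p => ∑ j, (frame α p)⁻¹ i j * v j) p
    exact DifferentiableAt.fun_sum fun j _ =>
      ((dE_inv_frame α p 0).1 i j).mul (differentiableAt_const _)
  have hfun : (fun p => (jetMap u ((frame α p)⁻¹ *ᵥ v)).1 p) =
      fun p => ∑ i, ((frame α p)⁻¹ *ᵥ v) i * (jet u i).1 p := by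
    funext p; exact jetMap_apply _ _ _
  have hd : Differentiable ℝ (fun p => (jetMap u ((frame α p)⁻¹ *ᵥ v)).1 p) := by
    rw [hfun]
    exact Differentiable.fun_sum fun i _ => (hg i).mul (hj i)
  refine is_const_of_fderiv_eq_zero hd (fun p => ?_) p q
  ext w
  have hjet : ∀ y : Fin 8 → ℝ, ∑ i, y i * fderiv ℝ (jet u i).1 p w =
      (jetMap u (nil α (coframe p w) *ᵥ y)).1 p := fun y => by
    rw [← fderiv_jetMap h1 h2]
    have : (jetMap u y).1 = fun q => ∑ i, y i * (jet u i).1 q := by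
      funext q; exact jetMap_apply _ _ _
    rw [this, fderiv_fun_sum fun i _ => (hj i p).const_mul (y i), ContinuousLinearMap.sum_apply]
    refine Finset.sum_congr rfl fun i _ => ?_
    rw [fderiv_const_mul (hj i p)]
    rfl
  have hfr : ∀ i, fderiv ℝ (fun p => ((frame α p)⁻¹ *ᵥ v) i) p w =
      (-(nil α (coframe p w) * (frame α p)⁻¹) *ᵥ v) i := fun i => by
    rw [fderiv_mulVec (dE_inv_frame α p w).1 (fun j => differentiableAt_const (v j)),
      (dE_inv_frame α p w).2]
    simp [Matrix.mulVec_zero, ← Pi.zero_def]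
  rw [hfun, fderiv_fun_sum fun i _ => (hg i p).fun_mul (hj i p), ContinuousLinearMap.sum_apply]
  have hterm : ∀ i, fderiv ℝ (fun p => ((frame α p)⁻¹ *ᵥ v) i * (jet u i).1 p) p w =
      ((frame α p)⁻¹ *ᵥ v) i * fderiv ℝ (jet u i).1 p w +
        (-(nil α (coframe p w) * (frame α p)⁻¹) *ᵥ v) i * (jet u i).1 p := fun i => by
    rw [fderiv_fun_mul (hg i p) (hj i p)]
    simp only [ContinuousLinearMap.add_apply, ContinuousLinearMap.smul_apply, smul_eq_mul, hfr]
    ring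
  rw [Finset.sum_congr rfl fun i _ => hterm i, Finset.sum_add_distrib, hjet, ← jetMap_apply,
    Matrix.neg_mulVec, ← Matrix.mulVec_mulVec, ← neg_one_smul ℝ, jetMap_smul]
  simp

end

/-! ### Solutions as linear forms on the curve -/

/-- The vector function spanning the lines of the model. -/
def curve (α : ℝ) (p : E3) : Fin 8 → ℝ := frame α p *ᵥ Pi.single 0 1

lemma flag_four (α : ℝ) (p : E3) : flag α p 4 = Submodule.span ℝ {curve α p} := by
  have h : stdFlag 4 = Submodule.span ℝ {(Pi.single 0 1 : Fin 8 → ℝ)} := by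
    ext v
    rw [Submodule.mem_span_singleton]
    constructor
    · intro hv
      refine ⟨v 0, funext fun i => ?_⟩
      by_cases hi : i = 0
      · subst hi; simp
      · rw [hv i (by fin_cases i <;> simp [vdeg] at hi ⊢)]
        simp [hi]
    · rintro ⟨c, rfl⟩ i hi
      fin_cases i <;> simp [vdeg] at hi ⊢
  rw [flag, h, Submodule.map_span, Set.image_singleton]
  rfl

lemma contDiff_dotProduct_frame (α : ℝ) (c v : Fin 8 → ℝ) :
    ContDiff ℝ ∞ (fun p => c ⬝ᵥ frame α p *ᵥ v) := by
  have h := fun i j => contDiffOn_univ.mp (smoothE_frame α Set.univ i j)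
  simp only [dotProduct, Matrix.mulVec]
  exact ContDiff.sum fun i _ => contDiff_const.mul
    (ContDiff.sum fun j _ => (h i j).mul contDiff_const)

lemma along_dotProduct_frame (α : ℝ) (c v : Fin 8 → ℝ) {Z : E3 → E3} {k : Fin 3 → ℝ}
    (hZ : ∀ p, coframe p (Z p) = k) : along Z (fun p => c ⬝ᵥ frame α p *ᵥ v) =
      fun p => c ⬝ᵥ frame α p *ᵥ (nil α k *ᵥ v) := by
  funext p
  have hd : ∀ i, DifferentiableAt ℝ (fun p => (frame α p *ᵥ v) i) p := fun i => by
    change DifferentiableAt ℝ (fun p => ∑ j, frame α p i j * v j) p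
    exact DifferentiableAt.fun_sum fun j _ => (diffM_frame α p i j).mul (differentiableAt_const _)
  change fderiv ℝ (fun p => ∑ i, c i * (frame α p *ᵥ v) i) p (Z p) = ∑ i, c i * _
  rw [fderiv_fun_sum fun i _ => (hd i).const_mul (c i), ContinuousLinearMap.sum_apply]
  refine Finset.sum_congr rfl fun i _ => ?_
  rw [fderiv_const_mul (hd i)]
  refine congrArg (c i * ·) ?_
  refine (fderiv_mulVec (diffM_frame α p) (fun j => differentiableAt_const (v j)) (Z p) i).trans ?_
  rw [dE_frame, hZ]
  simp [← Pi.zero_def]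

lemma coframe_Z1 (p : E3) : coframe p (Z1 p) = ![1, 0, 0] := by
  ext i; fin_cases i <;> simp [coframe, Z1]

lemma coframe_Z2 (p : E3) : coframe p (Z2 p) = ![0, 1, 0] := by
  ext i; fin_cases i <;> simp [coframe, Z2]
  ring

lemma nil_X1 (α : ℝ) : nil α ![1, 0, 0] = X1 := by simp [nil]

lemma nil_X2 (α : ℝ) : nil α ![0, 1, 0] = X2 α := by simp [nil]

lemma along_Z1 (α : ℝ) (c v : Fin 8 → ℝ) : along Z1 (fun p => c ⬝ᵥ frame α p *ᵥ v) =
    fun p => c ⬝ᵥ frame α p *ᵥ (X1 *ᵥ v) := by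
  rw [along_dotProduct_frame α c v coframe_Z1, nil_X1]

lemma along_Z2 (α : ℝ) (c v : Fin 8 → ℝ) : along Z2 (fun p => c ⬝ᵥ frame α p *ᵥ v) =
    fun p => c ⬝ᵥ frame α p *ᵥ (X2 α *ᵥ v) := by
  rw [along_dotProduct_frame α c v coframe_Z2, nil_X2]

/-- Differentiating along Z₁ and Z₂ amounts to applying X₁ and X₂ to the vector in the moving frame.
On E₁₃ one has X₁² = 0 and X₂² = 6α X₁, which is where a = 6α comes from. -/
lemma isSolution_curve (α : ℝ) (c : Fin 8 → ℝ) :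
    IsSolution (6 * α) (fun p => c ⬝ᵥ curve α p) := by
  refine ⟨contDiff_dotProduct_frame α c _, ?_, ?_⟩
  · unfold curve
    rw [along_Z1, along_Z1]
    have : X1 *ᵥ (X1 *ᵥ Pi.single 0 1) = 0 := by
      simp only [X1_mulVec]; ext i; fin_cases i <;> simp
    funext p
    rw [this, Matrix.mulVec_zero, dotProduct_zero]
    rfl
  · unfold curve
    rw [along_Z2, along_Z2, along_Z1]
    have : X2 α *ᵥ (X2 α *ᵥ Pi.single 0 1) = (6 * α) • (X1 *ᵥ Pi.single 0 1) := by
      simp only [X2_mulVec, X1_mulVec]; ext i; fin_cases i <;> simp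
    funext p
    rw [this, Matrix.mulVec_smul, dotProduct_smul]
    rfl

/-- The linear form is the constant of `jetMap_inv_frame_eq`, evaluated at the origin. On the curve
at p it can be evaluated at p instead, where the inverse frame returns the first basis vector and
hence u(p). -/
lemma exists_of_isSolution {α : ℝ} {u : E3 → ℝ} (h : IsSolution (6 * α) u) :
    ∃ c : Fin 8 → ℝ, u = fun p => c ⬝ᵥ curve α p := by
  let w : smoothFun := ⟨u, h.1⟩
  have h1 : D1 (D1 w) = 0 := Subtype.ext h.2.1
  have h2 : D2 (D2 w) = (6 * α) • D1 w := Subtype.ext h.2.2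
  let f : (Fin 8 → ℝ) →ₗ[ℝ] ℝ :=
    { toFun v := (jetMap w ((frame α 0)⁻¹ *ᵥ v)).1 0
      map_add' v v' := by rw [Matrix.mulVec_add, jetMap_add]; rfl
      map_smul' r v := by rw [Matrix.mulVec_smul, jetMap_smul]; rfl }
  refine ⟨fun i => f (Pi.single i 1), funext fun p => ?_⟩
  have h3 : f (curve α p) = u p := by
    change (jetMap w ((frame α 0)⁻¹ *ᵥ curve α p)).1 0 = u p
    rw [jetMap_inv_frame_eq h1 h2 _ 0 p, curve, Matrix.mulVec_mulVec, L_inv_mul (frame_mem_L α p),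
      Matrix.one_mulVec, jetMap_eq]
    simp [w]
  rw [← h3]
  conv_lhs => rw [pi_eq_sum_univ' (curve α p), map_sum]
  refine Finset.sum_congr rfl fun i _ => ?_
  rw [map_smul, smul_eq_mul, mul_comm]

/-- Repeated differentiation along Z₁ and Z₂, followed by evaluation at the origin where the frame
is 1, shows that d annihilates the words in X₁, X₂ applied to E₁₃. The eight words used span V. -/
lemma eq_zero_of_curve {α : ℝ} {d : Fin 8 → ℝ} (h : ∀ p, d ⬝ᵥ curve α p = 0) : d = 0 := by
  have k1 : ∀ {v}, (∀ p, d ⬝ᵥ frame α p *ᵥ v = 0) → ∀ p, d ⬝ᵥ frame α p *ᵥ (X1 *ᵥ v) = 0 :=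
    fun {v} hv p => by
    rw [← congrFun (along_Z1 α d v) p, funext hv]
    simp [along]
  have k2 : ∀ {v}, (∀ p, d ⬝ᵥ frame α p *ᵥ v = 0) → ∀ p, d ⬝ᵥ frame α p *ᵥ (X2 α *ᵥ v) = 0 :=
    fun {v} hv p => by
    rw [← congrFun (along_Z2 α d v) p, funext hv]
    simp [along]
  have h0 : frame α 0 = 1 := by simp [frame, model_zero]
  have z : ∀ {v}, (∀ p, d ⬝ᵥ frame α p *ᵥ v = 0) → d ⬝ᵥ v = 0 := fun {v} hv => by
    have := hv 0
    rwa [h0, Matrix.one_mulVec] at this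
  have c0 := h
  unfold curve at c0
  have e0 := z c0
  have e1 := z (k2 c0)
  have e2 := z (k1 c0)
  have e3 := z (k1 (k2 c0))
  have e4 := z (k2 (k1 c0))
  have e5 := z (k2 (k1 (k2 c0)))
  have e6 := z (k1 (k1 (k2 c0)))
  have e7 := z (k1 (k2 (k1 (k2 c0))))
  simp only [X1_mulVec, X2_mulVec] at e1 e2 e3 e4 e5 e6 e7
  simp [dotProduct, Fin.sum_univ_eight] at e0 e1 e2 e3 e4 e5 e6 e7
  ext i
  fin_cases i <;> assumption

/-- The model corresponds to the system of differential equations. -/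
lemma correspondsToSystem (α : ℝ) : CorrespondsToSystem (6 * α) dist (flag α) := by
  refine ⟨fun p => rfl, curve α, flag_four α, fun u => ⟨exists_of_isSolution, ?_⟩, fun c c' h => ?_⟩
  · rintro ⟨c, rfl⟩
    exact isSolution_curve α c
  · rw [← sub_eq_zero]
    exact eq_zero_of_curve fun p => by rw [sub_dotProduct, h p, sub_self]

end ContactSl3

end

theorem propositionp :
    -- the normal form of the structure function and of the symmetry algebra
    (∀ (M : Type*) [TopologicalSpace M] [ChartedSpace ContactSl3.E3 M] [IsManifold (𝓡 3) ∞ M]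
        [ConnectedSpace M]
        (D : ∀ x : M, Submodule ℝ (TangentSpace (𝓡 3) x))
        (φ : M → ℤ → Submodule ℝ (Fin 8 → ℝ)) (P : Set (M × ContactSl3.M8)),
        ContactSl3.IsSubmaximal D φ P →
        (∀ x a, (x, a) ∈ P → ∃ b ∈ ContactSl3.GZero,
          ContactSl3.IsStructureFunctionAt P x (a * ContactSl3.Ad b) ContactSl3.xiR ∧
          ContactSl3.symAlgAt P (a * ContactSl3.Ad b) = ContactSl3.cayleyR) ∨
        (∀ x a, (x, a) ∈ P → ∃ b ∈ ContactSl3.GZero,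
          ContactSl3.IsStructureFunctionAt P x (a * ContactSl3.Ad b) ContactSl3.xiS ∧
          ContactSl3.symAlgAt P (a * ContactSl3.Ad b) = ContactSl3.cayleyS)) ∧
    -- uniqueness up to local equivalence
    (∀ (M : Type*) [TopologicalSpace M] [ChartedSpace ContactSl3.E3 M] [IsManifold (𝓡 3) ∞ M]
        [ConnectedSpace M]
        (M' : Type*) [TopologicalSpace M'] [ChartedSpace ContactSl3.E3 M']
        [IsManifold (𝓡 3) ∞ M'] [ConnectedSpace M']
        (D : ∀ x : M, Submodule ℝ (TangentSpace (𝓡 3) x))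
        (φ : M → ℤ → Submodule ℝ (Fin 8 → ℝ)) (P : Set (M × ContactSl3.M8))
        (D' : ∀ x : M', Submodule ℝ (TangentSpace (𝓡 3) x))
        (φ' : M' → ℤ → Submodule ℝ (Fin 8 → ℝ)) (P' : Set (M' × ContactSl3.M8)),
        ContactSl3.IsSubmaximal D φ P → ContactSl3.IsSubmaximal D' φ' P' →
        ∀ x x', ContactSl3.LocallyEquivalent D φ x D' φ' x') ∧
    -- existence, and the corresponding systems of differential equations
    (∀ a : ℝ, a ≠ 0 →
      ∃ (D : ∀ p : ContactSl3.E3, Submodule ℝ (TangentSpace (𝓡 3) p))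
        (φ : ContactSl3.E3 → ℤ → Submodule ℝ (Fin 8 → ℝ))
        (P : Set (ContactSl3.E3 × ContactSl3.M8)),
        ContactSl3.IsSubmaximal D φ P ∧ Module.finrank ℝ (ContactSl3.symAlg P) = 4 ∧
        ContactSl3.CorrespondsToSystem a D φ) := by
  refine ⟨fun M _ _ _ _ D φ P h => h.normal_form,
    fun M _ _ _ _ M' _ _ _ _ D φ P D' φ' P' h h' x x' => h.locallyEquivalent h' x x',
    fun a ha => ?_⟩
  -- The model with parameter α corresponds to the system with constant 6α.
  have hα : a / 6 ≠ 0 := div_ne_zero ha (by norm_num)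
  refine ⟨ContactSl3.dist, ContactSl3.flag (a / 6), ContactSl3.bundle (a / 6),
    ContactSl3.isSubmaximal_bundle hα, ContactSl3.finrank_symAlg_bundle hα, ?_⟩
  have h := ContactSl3.correspondsToSystem (a / 6)
  rwa [mul_div_cancel₀ a (by norm_num : (6 : ℝ) ≠ 0)] at h
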